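/- **Setting.** Let $\mathbb L$ be a finite set, $N\in\mathbb N$, $\Xi=\mathbb R^N$ with the euclidean norm. Let $C$ be a complex symmetric and normal matrix on $\mathbb L\times\{1,\dots,N\}$ such that $\mathrm{Re}\,C^{-1}=\tfrac12(C^{-1}+(C^{-1})^*)$ is positive definite, and let $d\mu_C(\phi)=\det(2\pi C)^{-1/2}e^{-\frac12\langle\phi,C^{-1}\phi\rangle}d\phi$ on $\Xi^{\mathbb L}$ ($\det(M)^{-1/2}$ is the product of the principal values $\lambda^{-1/2}$ over the eigenvalues $\lambda$ of $M$, with multiplicity). Write $\mathsf P(X)$ for the set of pairs $\{x,y\}\subset X$, $x\ne y$; for $s\in[0,1]^{\mathsf P(X)}$ put $s(\{x,x\})=1$ and $C_s(x,y)=C(x,y)s(\{x,y\})$, and let $\mathcal P(s)$ be the finest partition of $X$ with $s(\{x,y\})=0$ whenever $x,y$ lie in different parts. For a forest $F$ and $s\in[0,1]^F$, $s^F(\{x,y\})$ is the minimum of $s(\ell)$ over the edges $\ell$ of the $F$-path from $x$ to $y$ ($0$ if there is none). $\mathfrak T(X)$ is the set of trees with vertex set $X$. Let $0<r<\infty$,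 $r\le R\le\infty$, and fix a source $J\in\Xi^{\mathbb L}$. Let $V_1(\phi;s;J),V_2(\phi;s;J)\in\mathbb C$ be functions, smooth in $(\phi,s)$ on $\{|\phi(x)|\le R\ \forall x\}\times[0,1]^{\mathsf P(\mathbb L)}$, such that there $$V_1(\phi;s;J)=\sum_{X\in\mathcal P(s)}V_1(\phi|_X;s|_X;J|_X),\qquad V_2(\phi;s;J)=\sum_{X\in\mathcal P(s)}\sum_{x\in X}V_2(x;\phi|_X;s|_X;J|_X)$$ with local functions on the right-hand sides. If $R=\infty$, assume also that for every $k$ and every $\varepsilon>0$ the $k$-th $s$-derivative of $e^{V_1+V_2}$ is $O(e^{\varepsilon\|\phi\|^2})$, uniformly in $\phi$ and in $s=s^F$, $F$ a forest on $\mathbb L$. Put $V(\phi;J)=(V_1+V_2)(\phi;s;J)|_{s=1}$ and $$\mathcal Z(J)=\int d\mu_C(\phi)\,\chi_R(\phi)\,e^{V(\phi;J)},\qquad \chi_R(\phi)=\prod_{x}\chi(|\phi(x)|\le R).$$ **Activities.** For $Q\subset X\subset\mathbb L$, $X\neq\emptyset$ and $T\in\mathfrak T(X)$ define the operator $$\int\limits_{T,Q}d\phi|_X\,ds|_X=\sum_{F_C\sqcup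 F_V=T}\int_0^1\prod_{\ell\in T}ds(\ell)\int d\mu_{C_{s^T}}(\phi|_X)\prod_{\ell\in F_C}C(\ell)\partial_\ell\;\chi_{Q^c}(\phi|_{Q^c})\,\chi^c_Q(\phi|_Q)\prod_{\ell\in F_V}\partial_{s(\ell)},$$ $\chi_{Q^c}=\prod_{x\in X\setminus Q}\chi(|\phi(x)|\le r)$, $\chi^c_Q=\prod_{x\in Q}\chi(r<|\phi(x)|\le R)$, $C(\{x,y\})\partial_{\{x,y\}}=\sum_{m,n}C((x,m),(y,n))\partial_{\phi(x,m)}\partial_{\phi(y,n)}$, where $F_C,F_V$ may be empty and the $\phi$-derivatives are weak, that is, they are transposed onto the Gaussian density. With $A'(X;\phi;s;J)=\exp\big(V_1(\phi|_X;s;J|_X)+\sum_{x\in X}V_2(x;\phi|_X;s;J|_X)\big)$ let $$A_s(Z;J)=\sum_{T\in\mathfrak T(Z)}\int\limits_{T,\emptyset}d\phi\,ds\,A'(Z;\phi;s^T;J),\qquad B(X,Q;J)=\sum_{T\in\mathfrak T(X)}\int\limits_{T,Q}d\phi\,ds\,A'(X;\phi;s^T;J)\quad(Q\ne\emptyset).$$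 **Mayer series.** Given activities $A(Z)$, $B(X,Q)$ ($Z\ne\emptyset$, $\emptyset\ne Q\subset X$) with $A(\{x\})\ne0$, let $\dot A(X)=A(X)\prod_{x\in X}A(\{x\})^{-1}$, let $\rho(X_1,\dots,X_n)=\sum_g(-1)^{|g|}$ over the connected spanning subgraphs $g$ of the incidence graph of $X_1,\dots,X_n$, and $$\mathcal V(\{x\})=\log A(\{x\}),\qquad \mathcal V(X)=\sum_{n}\frac1{n!}\sum_{\substack{(X_1,\dots,X_n),\,|X_m|\ge2\\ \cup X_m=X}}\rho(X_1,\dots,X_n)\prod_m\dot A(X_m)\quad(|X|\ge2).$$ Let $\tilde2^{\mathbb L}$ be the set of $(Z,X,Q)$ with $\emptyset\ne Q\subset X\subset\mathbb L$, $Z\subset\mathbb L$, and $Z\cap X\neq\emptyset$ or $Z=\emptyset$. For $(Z,X,Q)\in\tilde2^{\mathbb L}$ let $$\dot B(Z,X,Q)=\sum_{n'}\frac1{n'!}\sum\prod_{m'=1}^{n'}\big(-\mathcal V(Z_{m'})\big)\prod_{m}B(X_m,Q_m),$$ the inner sum being over sequences $(Z_{m'})_1^{n'}$ of sets with $Z_{m'}\cap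 X\ne\emptyset$ or $Z_{m'}=\emptyset$, and over sets $\{(X_m,Q_m)\}$ with $\emptyset\neq Q_m\subset X_m$ such that the $X_m$ partition $X$, $\bigcup Q_m=Q$, $\bigcup Z_{m'}=Z$ and the incidence graph of all the $Z_{m'},X_m$ is connected; and let $$\mathcal L(Z,X,Q)=\sum_n\frac1{n!}\sum_{\substack{(Z_m,X_m,Q_m)_1^n\in(\tilde 2^{\mathbb L})^n\\ \cup Z_m=Z,\ \cup X_m=X,\ \cup Q_m=Q}}\rho(Z_1\cup X_1,\dots,Z_n\cup X_n)\prod_{m}\dot B(Z_m,X_m,Q_m).$$ Let $\mathfrak S(A,B)=\sum_{\emptyset\ne Z\subset\mathbb L}\mathcal V(Z)+\sum_{(Z,X,Q)\in\tilde2^{\mathbb L}}\mathcal L(Z,X,Q)$, and say that it converges absolutely if the series over $n$, $n'$ defining the $\mathcal V(X)$, $\dot B$, $\mathcal L$ do so term by term. Let $$\Phi(A,B)=\sum_{\Omega\subset\mathbb L}\ \sum_{\{Z_m\}\text{ partition of }\Omega}\ \prod_mA(Z_m)\sum_{\substack{\{(X_m,Q_m)\},\ \emptyset\ne Q_m\subset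 X_m\\ \{X_m\}\text{ partition of }\Omega^c}}\ \prod_mB(X_m,Q_m).$$ **Theorem.** Under these assumptions all the integrals above converge absolutely (those for $A_s$ and $B$ jointly in $(s,\phi)$), and $\mathcal Z(J)=\Phi(A_s,B)$. If moreover $A_s(\{x\};J)\neq0$ for all $x\in\mathbb L$, then $\log\mathcal Z(J)$ is given by the modified Mayer series $$\log\mathcal Z(J)=\sum_{\emptyset\ne Z\subset\mathbb L}\mathcal V(Z;J)+\sum_{(Z,X,Q)\in\tilde2^{\mathbb L}}\mathcal L(Z,X,Q;J)$$ formed from $A_s(\cdot\,;J)$ and $B(\cdot\,;J)$, in the following sense: 1. if the series converges absolutely, then $e^{\mathfrak S(A_s,B)}=\mathcal Z(J)$; 2. as an expansion in the activities, always: if $A_s(Z)$, $|Z|\ge2$, and all $B(X,Q)$ are multiplied by $t\in\mathbb C$ (with result $A_s^{(t)},B^{(t)}$), then for all $t$ in a neighbourhood of $0$ the series converges absolutely and $e^{\mathfrak S(A_s^{(t)},B^{(t)})}=\Phi(A_s^{(t)},B^{(t)})$, a polynomial in $t$ whose value at $t=1$ is $\mathcal Z(J)$. -/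

import Mathlib

open scoped ContDiff Topology ComplexOrder
open MeasureTheory

noncomputable section

open scoped Classical

/-! ## Fields, pairs, couplings -/

/-- The state space `Ξ = ℝ^N` of one spin, with its euclidean norm. -/
abbrev Spin (N : ℕ) := EuclideanSpace ℝ (Fin N)

/-- The set of unordered pairs `{x, y}` with `x ≠ y` (the full graph on `ι`). -/
abbrev Pairs (ι : Type*) := {e : Sym2 ι // ¬ e.IsDiag}

/-- A pair of points of `X`, seen as a pair of points of `L`. -/
def Pairs.incl {L : Type*} (X : Finset L) (ℓ : Pairs X) : Pairs L :=
  ⟨ℓ.1.map Subtype.val, by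
    rw [Sym2.isDiag_map Subtype.val_injective]; exact ℓ.2⟩

/-- The restriction `φ|_X` of a field. -/
def restrictField {L : Type*} {N : ℕ} (X : Finset L) (φ : L → Spin N) : X → Spin N :=
  fun x => φ x

/-- The restriction `s|_X` of the coupling parameters to pairs in `X`. -/
def restrictCoupling {L : Type*} (X : Finset L) (s : Pairs L → ℝ) : Pairs X → ℝ :=
  fun ℓ => s (Pairs.incl X ℓ)

/-- The number `s({x, y})`, with the convention `s({x, x}) = 1`. -/
def coupling {ι : Type*} (s : Pairs ι → ℝ) (x y : ι) : ℝ :=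
  if h : x = y then 1 else s ⟨s(x, y), by simpa using h⟩

/-- The partition `P(s)`: the finest partition such that `s({x, y}) = 0` whenever `x` and `y` lie in
different parts. Its parts are the connected components of the graph of all pairs with `s ≠ 0`. -/
def couplingParts {ι : Type*} [Fintype ι] [DecidableEq ι] (s : Pairs ι → ℝ) :
    Finset (Finset ι) :=
  (Finpartition.ofSetoid
    (SimpleGraph.fromEdgeSet {e : Sym2 ι | ∃ ℓ : Pairs ι, ℓ.1 = e ∧ s ℓ ≠ 0}).reachableSetoid).parts

/-! ## Trees, forests and tree interpolation -/

/-- The graph with a given set of edges. -/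
def edgeGraph {ι : Type*} (T : Finset (Pairs ι)) : SimpleGraph ι :=
  SimpleGraph.fromEdgeSet {e | ∃ ℓ ∈ T, ℓ.1 = e}

/-- The (edge sets of) spanning trees on the vertex set `ι`. -/
def spanningTrees (ι : Type*) [Fintype ι] [DecidableEq ι] : Finset (Finset (Pairs ι)) :=
  Finset.univ.filter fun T => (edgeGraph T).IsTree

/-- `s^F({x, y})` is the minimum of `s(ℓ)` over the edges `ℓ` of the `F`-path linking `x` and `y`, and
it is `0` if there is no such path. (The path is unique, as `F` is a forest; the infimum of the empty
set is `0`.) -/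
def forestInterp {ι : Type*} (F : Finset (Pairs ι)) (u : F → ℝ) (ℓ : Pairs ι) : ℝ :=
  sInf {t | ∃ (x y : ι) (p : (edgeGraph F).Walk x y), p.IsPath ∧ s(x, y) = ℓ.1 ∧
    ∃ e : F, e.1.1 ∈ p.edges ∧ t = u e}

/-! ## Complex Gaussian densities -/

/-- `det(M)^{-1/2}` for a matrix whose eigenvalues have positive real part: the product, over the
eigenvalues with algebraic multiplicity, of the principal values of `z^{-1/2}`. -/
def detInvSqrt {κ : Type*} [Fintype κ] [DecidableEq κ] (M : Matrix κ κ ℂ) : ℂ :=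
  (M.charpoly.roots.map fun z : ℂ => z ^ (-(1 / 2) : ℂ)).prod

/-- The density, with respect to Lebesgue measure on `Ξ^ι`, of the Gaussian measure `dμ_C(φ)`. -/
def gaussDensity {ι : Type*} [Fintype ι] [DecidableEq ι] {N : ℕ}
    (C : Matrix (ι × Fin N) (ι × Fin N) ℂ) (φ : ι → Spin N) : ℂ :=
  detInvSqrt ((2 * (Real.pi : ℂ)) • C) *
    Complex.exp (-(1 / 2) * ∑ a : ι × Fin N, ∑ b : ι × Fin N,
      (φ a.1 a.2 : ℂ) * C⁻¹ a b * (φ b.1 b.2 : ℂ))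

/-- The interpolated covariance `C_s(x, y) = C(x, y) s({x, y})`. -/
def interpCov {ι : Type*} {N : ℕ} (C : Matrix (ι × Fin N) (ι × Fin N) ℂ) (s : Pairs ι → ℝ) :
    Matrix (ι × Fin N) (ι × Fin N) ℂ :=
  Matrix.of fun a b => C a b * (coupling s a.1 b.1 : ℂ)

/-- The block of the covariance that belongs to the points of `X`. -/
def restrictCov {L : Type*} {N : ℕ} (C : Matrix (L × Fin N) (L × Fin N) ℂ) (X : Finset L) :
    Matrix (X × Fin N) (X × Fin N) ℂ :=
  C.submatrix (fun a => ((a.1 : L), a.2)) (fun a => ((a.1 : L), a.2))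

/-! ## Differential operators -/

/-- The partial derivative `∂_{φ(x, m)}`. -/
def fieldDeriv {ι : Type*} [Fintype ι] [DecidableEq ι] {N : ℕ} (x : ι) (m : Fin N)
    (f : (ι → Spin N) → ℂ) : (ι → Spin N) → ℂ :=
  fun φ => fderiv ℝ f φ (Pi.single x (EuclideanSpace.single m 1))

/-- The operator `C(ℓ)∂_ℓ = ∑_{m,n} C((x,m),(y,n)) ∂_{φ(x,m)} ∂_{φ(y,n)}` for `ℓ = {x, y}`. The sum runs
over both orderings `(x, y)` of the pair, whence the factor `1/2` (`C` is symmetric). -/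
def edgeOp {ι : Type*} [Fintype ι] [DecidableEq ι] {N : ℕ}
    (C : Matrix (ι × Fin N) (ι × Fin N) ℂ) (ℓ : Pairs ι) (f : (ι → Spin N) → ℂ) :
    (ι → Spin N) → ℂ :=
  fun φ => (1 / 2) * ∑ x : ι, ∑ y : ι, if s(x, y) = ℓ.1 then
    ∑ m : Fin N, ∑ n : Fin N, C (x, m) (y, n) * fieldDeriv x m (fieldDeriv y n f) φ else 0

/-- The product `∏_{ℓ ∈ F} C(ℓ)∂_ℓ` (the factors commute on smooth functions). -/
def edgeOps {ι : Type*} [Fintype ι] [DecidableEq ι] {N : ℕ}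
    (C : Matrix (ι × Fin N) (ι × Fin N) ℂ) (F : Finset (Pairs ι)) (f : (ι → Spin N) → ℂ) :
    (ι → Spin N) → ℂ :=
  F.toList.foldr (edgeOp C) f

/-- The partial derivative `∂_{s(ℓ)}`. -/
def couplingDeriv {ι : Type*} [DecidableEq ι] (ℓ : Pairs ι) (f : (Pairs ι → ℝ) → ℂ) :
    (Pairs ι → ℝ) → ℂ :=
  fun s => deriv (fun t : ℝ => f (Function.update s ℓ t)) (s ℓ)

/-- The product `∏_{ℓ ∈ F} ∂_{s(ℓ)}` (the factors commute on smooth functions). -/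
def couplingDerivs {ι : Type*} [DecidableEq ι] (F : Finset (Pairs ι))
    (f : (Pairs ι → ℝ) → ℂ) : (Pairs ι → ℝ) → ℂ :=
  F.toList.foldr couplingDeriv f

/-! ## The cluster expansion with large and small fields -/

/-- `χ_R(φ) = ∏_x χ(|φ(x)| ≤ R)`. The value `R = ∞` is allowed. -/
def chiR {ι : Type*} [Fintype ι] {N : ℕ} (R : EReal) (φ : ι → Spin N) : ℂ :=
  ∏ x : ι, if ((‖φ x‖ : ℝ) : EReal) ≤ R then 1 else 0

/-- The partition function `Z(J) = ∫ dμ_C(φ) χ_R(φ) exp V(φ; J)`, for `V(φ; J) = V(φ)`. -/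
def partitionFunction {ι : Type*} [Fintype ι] [DecidableEq ι] {N : ℕ}
    (C : Matrix (ι × Fin N) (ι × Fin N) ℂ) (R : EReal) (V : (ι → Spin N) → ℂ) : ℂ :=
  ∫ φ : ι → Spin N, gaussDensity C φ * (chiR R φ * Complex.exp (V φ))

/-- `χ_{Q^c}(φ|_{Q^c}) χ_Q^c(φ|_Q) = ∏_{x ∉ Q} χ(|φ(x)| ≤ r) ∏_{x ∈ Q} χ(r < |φ(x)| ≤ R)`. -/
def chiQ {ι : Type*} [Fintype ι] {N : ℕ} (r : ℝ) (R : EReal) (Q : Set ι) (φ : ι → Spin N) : ℂ :=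
  ∏ x : ι, if x ∈ Q then
      (if r < ‖φ x‖ ∧ ((‖φ x‖ : ℝ) : EReal) ≤ R then 1 else 0)
    else (if ‖φ x‖ ≤ r then 1 else 0)

/-- The integrand of the operator `∫_{T,Q} dφ ds`, applied to `A'(φ; s)`, for the splitting
`T = F_C ∪ F_V` with `F_C = F` and `F_V = T \ F`, at `s = s^T`.

The integral `∫ dμ_{C_s}(φ) ∏_{ℓ ∈ F} C(ℓ)∂_ℓ [χ ⋯]` contains derivatives of characteristic functions
and is meant in the weak sense: `∫ ρ D g := ∫ (D ρ) g` for the smooth Gaussian density `ρ` and the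
operator `D = ∏ C(ℓ)∂_ℓ`, which is its own formal transpose because each factor is of second order with
constant coefficients. -/
def clusterIntegrand {ι : Type*} [Fintype ι] [DecidableEq ι] {N : ℕ}
    (C : Matrix (ι × Fin N) (ι × Fin N) ℂ) (r : ℝ) (R : EReal) (Q : Set ι)
    (A' : (ι → Spin N) → (Pairs ι → ℝ) → ℂ) (T F : Finset (Pairs ι)) (u : T → ℝ)
    (φ : ι → Spin N) : ℂ :=
  edgeOps C F (gaussDensity (interpCov C (forestInterp T u))) φ *
    (chiQ r R Q φ * couplingDerivs (T \ F) (A' φ) (forestInterp T u))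

/-- `∫_{T,Q} dφ ds A'(φ; s)`. -/
def treeIntegral {ι : Type*} [Fintype ι] [DecidableEq ι] {N : ℕ}
    (C : Matrix (ι × Fin N) (ι × Fin N) ℂ) (r : ℝ) (R : EReal) (Q : Set ι)
    (A' : (ι → Spin N) → (Pairs ι → ℝ) → ℂ) (T : Finset (Pairs ι)) : ℂ :=
  ∑ F ∈ T.powerset, ∫ u in Set.Icc (0 : T → ℝ) 1, ∫ φ : ι → Spin N,
    clusterIntegrand C r R Q A' T F u φ

/-- `A'(X; φ; s; J) = exp (V₁(φ; s; J) + ∑_{x ∈ X} V₂(x; φ; s; J))`, for fields, couplings and sources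
on `X`. -/
def boltzmann {L : Type*} {N : ℕ}
    (V₁ : (X : Finset L) → (X → Spin N) → (Pairs X → ℝ) → (X → Spin N) → ℂ)
    (V₂ : (X : Finset L) → X → (X → Spin N) → (Pairs X → ℝ) → (X → Spin N) → ℂ)
    (J : L → Spin N) (X : Finset L) (φ : X → Spin N) (s : Pairs X → ℝ) : ℂ :=
  Complex.exp (V₁ X φ s (restrictField X J) + ∑ x : X, V₂ X x φ s (restrictField X J))

/-- The large field activity `B(X, Q; J)`. -/
def largeActivity {L : Type*} [DecidableEq L] {N : ℕ}
    (C : Matrix (L × Fin N) (L × Fin N) ℂ) (r : ℝ) (R : EReal)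
    (V₁ : (X : Finset L) → (X → Spin N) → (Pairs X → ℝ) → (X → Spin N) → ℂ)
    (V₂ : (X : Finset L) → X → (X → Spin N) → (Pairs X → ℝ) → (X → Spin N) → ℂ)
    (J : L → Spin N) (X Q : Finset L) : ℂ :=
  ∑ T ∈ spanningTrees X,
    treeIntegral (restrictCov C X) r R {x : X | (x : L) ∈ Q} (boltzmann V₁ V₂ J X) T

/-- The small field activity `A_s(Z; J)`: the same expression with `Q = ∅`. -/
def smallActivity {L : Type*} [DecidableEq L] {N : ℕ}
    (C : Matrix (L × Fin N) (L × Fin N) ℂ) (r : ℝ) (R : EReal)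
    (V₁ : (X : Finset L) → (X → Spin N) → (Pairs X → ℝ) → (X → Spin N) → ℂ)
    (V₂ : (X : Finset L) → X → (X → Spin N) → (Pairs X → ℝ) → (X → Spin N) → ℂ)
    (J : L → Spin N) (Z : Finset L) : ℂ :=
  ∑ T ∈ spanningTrees Z,
    treeIntegral (restrictCov C Z) r R (∅ : Set Z) (boltzmann V₁ V₂ J Z) T

/-! ## Polymer gases and Mayer expansions -/

section Mayer

variable {L : Type*} [Fintype L] [DecidableEq L]

/-- The incidence graph of a family of sets. -/
def incidence {κ : Type*} (Y : κ → Finset L) : SimpleGraph κ :=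
  SimpleGraph.fromRel fun i j => (Y i ∩ Y j).Nonempty

/-- The Ursell function: the sum of `(-1)^{|g|}` over connected subgraphs `g` of the incidence graph. -/
def ursell {n : ℕ} (Y : Fin n → Finset L) : ℂ :=
  ∑ g ∈ Finset.univ.filter (fun g : SimpleGraph (Fin n) => g ≤ incidence Y ∧ g.Connected),
    (-1) ^ g.edgeFinset.card

/-- The set `P(Ω)` of partitions of `Ω` into nonempty sets. -/
def partitions (Ω : Finset L) : Finset (Finset (Finset L)) :=
  Finset.univ.filter fun S =>
    (∀ X ∈ S, X.Nonempty) ∧ (S : Set (Finset L)).PairwiseDisjoint id ∧ S.sup id = Ω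

/-- The set `P'(Ω)` of sets of pairs `(X, Q)`, `∅ ≠ Q ⊆ X`, whose first components partition `Ω`. -/
def markedPartitions (Ω : Finset L) : Finset (Finset (Finset L × Finset L)) :=
  Finset.univ.filter fun S =>
    (∀ p ∈ S, p.2.Nonempty ∧ p.2 ⊆ p.1) ∧
    (S : Set (Finset L × Finset L)).PairwiseDisjoint Prod.fst ∧ S.sup Prod.fst = Ω

/-- The partition function of the polymer gas with small field activities `A` and large field
activities `B`. -/
def polymerZ (A : Finset L → ℂ) (B : Finset L → Finset L → ℂ) : ℂ :=
  ∑ Ω : Finset L, (∑ S ∈ partitions Ω, ∏ Z ∈ S, A Z) *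
    ∑ S ∈ markedPartitions Ωᶜ, ∏ p ∈ S, B p.1 p.2

/-- Normalized activities `Ȧ(X) = A(X) ∏_{x ∈ X} A({x})⁻¹`. -/
def normAct (A : Finset L → ℂ) (X : Finset L) : ℂ := A X * ∏ x ∈ X, (A {x})⁻¹

/-- Sequences `X₁, …, X_n` of sets with at least two elements and union `X`. -/
def mayerSeqs (X : Finset L) (n : ℕ) : Finset (Fin n → Finset L) :=
  Finset.univ.filter fun Y => Finset.univ.sup Y = X ∧ ∀ m, 2 ≤ (Y m).card

/-- The exponentiated activities: `V({x}) = log A({x})`, and for `|X| ≥ 2` the Mayer series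
`V(X) = ∑_n 1/n! ∑_{(X₁, …, X_n)} ρ(X₁, …, X_n) ∏ Ȧ(X_m)`. -/
def mayerV (A : Finset L → ℂ) (X : Finset L) : ℂ :=
  if X.card = 1 then Complex.log (A X) else
    ∑' n : ℕ, ((n.factorial : ℂ))⁻¹ *
      ∑ Y ∈ mayerSeqs X n, ursell Y * ∏ m, normAct A (Y m)

/-- The triples `(Z, X, Q)` with `∅ ≠ Q ⊆ X` and (`Z ∩ X ≠ ∅` or `Z = ∅`). -/
def tripleSet (L : Type*) [Fintype L] [DecidableEq L] :
    Finset (Finset L × Finset L × Finset L) :=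
  Finset.univ.filter fun M =>
    M.2.2.Nonempty ∧ M.2.2 ⊆ M.2.1 ∧ (M.1 = ∅ ∨ (M.1 ∩ M.2.1).Nonempty)

/-- The set `C(Z, X, Q)`, with the sets `Z_{m'}` arranged in a sequence of length `n'`. -/
def clusterConfs (M : Finset L × Finset L × Finset L) (n' : ℕ) :
    Finset ((Fin n' → Finset L) × Finset (Finset L × Finset L)) :=
  Finset.univ.filter fun c =>
    c.2 ∈ markedPartitions M.2.1 ∧
    (∀ m, c.1 m = ∅ ∨ (c.1 m ∩ M.2.1).Nonempty) ∧
    (incidence (Sum.elim c.1 fun p : c.2 => p.1.1)).Connected ∧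
    Finset.univ.sup c.1 = M.1 ∧ c.2.sup Prod.snd = M.2.2

/-- `Ḃ(Z, X, Q) = ∑_{C(Z, X, Q)} ∏ (-V(Z_{m'})) ∏ B(X_m, Q_m)`, each sequence `(Z_{m'})` of length `n'`
having the weight `1/n'!`. -/
def dotB (V : Finset L → ℂ) (B : Finset L → Finset L → ℂ)
    (M : Finset L × Finset L × Finset L) : ℂ :=
  ∑' n' : ℕ, ((n'.factorial : ℂ))⁻¹ *
    ∑ c ∈ clusterConfs M n', (∏ m, -V (c.1 m)) * ∏ p ∈ c.2, B p.1 p.2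

/-- The set `M(Z, X, Q)` of sequences of triples with componentwise union `(Z, X, Q)`. -/
def tripleSeqs (M : Finset L × Finset L × Finset L) (n : ℕ) :
    Finset (Fin n → Finset L × Finset L × Finset L) :=
  Finset.univ.filter fun Y => (∀ m, Y m ∈ tripleSet L) ∧
    (Finset.univ.sup fun m => (Y m).1) = M.1 ∧
    (Finset.univ.sup fun m => (Y m).2.1) = M.2.1 ∧
    (Finset.univ.sup fun m => (Y m).2.2) = M.2.2

/-- `L(Z, X, Q) = ∑_n 1/n! ∑_{M(Z, X, Q)} ρ({Z_m ∪ X_m}) ∏ Ḃ(Z_m, X_m, Q_m)`. -/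
def mayerL (V : Finset L → ℂ) (B : Finset L → Finset L → ℂ)
    (M : Finset L × Finset L × Finset L) : ℂ :=
  ∑' n : ℕ, ((n.factorial : ℂ))⁻¹ *
    ∑ Y ∈ tripleSeqs M n, ursell (fun m => (Y m).1 ∪ (Y m).2.1) * ∏ m, dotB V B (Y m)

/-- The series `∑_Z V(Z) + ∑_{(Z, X, Q)} L(Z, X, Q)`, where `V` is the Mayer series of `A`. -/
def logSeries (A : Finset L → ℂ) (B : Finset L → Finset L → ℂ) : ℂ :=
  ∑ Z ∈ Finset.univ.filter (fun Z : Finset L => Z.Nonempty), mayerV A Z +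
    ∑ M ∈ tripleSet L, mayerL (mayerV A) B M

/-- Absolute convergence of all the series that define `V`, `Ḃ` and `L`. -/
def AbsConverges (A : Finset L → ℂ) (B : Finset L → Finset L → ℂ) : Prop :=
  (∀ X : Finset L, 2 ≤ X.card → Summable fun n : ℕ => ((n.factorial : ℝ))⁻¹ *
      ∑ Y ∈ mayerSeqs X n, ‖ursell Y * ∏ m, normAct A (Y m)‖) ∧
  (∀ M ∈ tripleSet L, Summable fun n' : ℕ => ((n'.factorial : ℝ))⁻¹ *
      ∑ c ∈ clusterConfs M n', ‖(∏ m, -mayerV A (c.1 m)) * ∏ p ∈ c.2, B p.1 p.2‖) ∧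
  (∀ M ∈ tripleSet L, Summable fun n : ℕ => ((n.factorial : ℝ))⁻¹ *
      ∑ Y ∈ tripleSeqs M n,
        ‖ursell (fun m => (Y m).1 ∪ (Y m).2.1) * ∏ m, dotB (mayerV A) B (Y m)‖)

/-- The activities in which every polymer with at least two points carries a factor `t`. -/
def scaleA (t : ℂ) (A : Finset L → ℂ) (X : Finset L) : ℂ :=
  if X.card = 1 then A X else t * A X

/-- The large field activities with a factor `t`. -/
def scaleB (t : ℂ) (B : Finset L → Finset L → ℂ) (X Q : Finset L) : ℂ := t * B X Q

end Mayer

end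

/-! Two mechanisms carry the theorem: an interpolation formula that turns a Gaussian integral into a
gas of polymers, and the exponential formula, applied twice, that takes the logarithm of that gas.

Analysis. Fix the field φ. The density of C_s times e^{V₁+V₂} is smooth in the couplings s, and at s
= 1 it is the integrand of Z. The forest formula (`forest_formula`) writes this value as a sum over
forests F of integrals of the F-fold coupling derivative at s^F. Each s^F is ultrametric, hence a
superposition of indicators of equivalence relations; this keeps the Hermitian part of C_s positive
definite (`Accretive.interpCov`), so that the density and all its derivatives exist and have
Gaussian decay. A coupling derivative of the density equals C(ℓ)∂_ℓ applied to it (`heat_equation`),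
and the Leibniz rule then produces the splittings T = F_C ⊔ F_V. The field derivatives arise on the
Gaussian from the outset; the characteristic functions are multiplied in afterwards, which is
exactly the weak meaning of the operators. Since s^F vanishes between the trees of F, density and
Boltzmann factor both factorize over the trees (`leibnizTerm_eq_prod`). Cutting χ_R at the threshold
r point by point and integrating, with `integrable_clusterIntegrand` justifying Fubini, gives Z as a
sum over partitions of the products of A_s(X) + ∑_Q B(X, Q), which is Φ (`integrand_eq_sum`,
`polymerZ_eq_sum_partitions`).

Combinatorics. The sum of (-1)^{|g|} over all subgraphs of a graph is the indicator that it has no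
edges, which for an incidence graph is the hard core condition. Sorting subgraphs by the component
of one vertex gives the relation β' = α'β between the generating series of disjoint and of connected
sequences; since β is a polynomial, absolute convergence of α gives e^α = β at 1 (`exp_mayer`).
Applied to the small field activities, this gives e^{∑ V(Z)} over the nonempty Z ⊆ Ω as the gas in
Ω, with the same V for every Ω (`mayer_smallField`). If the large field polymers cover X, the gas in
the complement of X is therefore e^{∑ V(Z)} over all Z times the product of e^{-V(Z)} over the Z
that meet X. Writing e^{-V} = 1 + (e^{-V} - 1) and expanding yields configurations of large field
polymers linked by factors e^{-V(Z)} - 1. Their connected components form a new hard core gas, whose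
weights are Ḃ (`dotB_eq_sum_connConfs`); a second Mayer expansion gives the terms L
(`exp_sum_mayerL`, `exp_logSeries`).

Small t. The bound 4^n n! on Ursell functions cancels the 1/n! and leaves geometric series
(`mayer_term_le`). Each Ḃ contains a large field polymer, hence a factor t, so all series converge
near t = 0 (`eventually_absConverges`). -/

noncomputable section

open scoped Classical

set_option linter.unusedSectionVars false

/-! ## Sums over connected graphs -/

section GraphSums

variable {V W : Type*} [Fintype V] [DecidableEq V] [Fintype W] [DecidableEq W]

/-- The sum of `(-1)^{|g|}` over the connected spanning subgraphs `g` of `G`. -/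
def connSum (G : SimpleGraph V) : ℂ :=
  ∑ g : SimpleGraph V with g ≤ G ∧ g.Connected, (-1) ^ g.edgeSet.ncard

/-- The indicator of graphs without edges. -/
def edgeless (G : SimpleGraph V) : ℂ := if G = ⊥ then 1 else 0

/-- Subgraphs on a fixed vertex set are subsets of the edge set, so the sum is (1 - 1)^{|E(G)|}. -/
theorem sum_subgraphs_eq_edgeless (G : SimpleGraph V) :
    ∑ g : SimpleGraph V with g ≤ G, (-1 : ℂ) ^ g.edgeSet.ncard = edgeless G := by
  have h : ∑ g : SimpleGraph V with g ≤ G, (-1 : ℂ) ^ g.edgeSet.ncard =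
      ∑ m ∈ G.edgeFinset.powerset, (-1 : ℂ) ^ m.card := by
    refine Finset.sum_bij' (fun g _ => g.edgeFinset)
      (fun m _ => SimpleGraph.fromEdgeSet (m : Set (Sym2 V))) ?_ ?_ ?_ ?_ ?_
    · intro g hg
      simp only [Finset.mem_filter, Finset.mem_univ, true_and] at hg
      simpa using hg
    · intro m hm
      simp only [Finset.mem_powerset] at hm
      simp only [Finset.mem_filter, Finset.mem_univ, true_and]
      intro x y hxy
      rw [SimpleGraph.fromEdgeSet_adj] at hxy
      have := hm hxy.1
      simpa using this
    · intro g hg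
      simp
    · intro m hm
      simp only [Finset.mem_powerset] at hm
      ext e
      simp only [SimpleGraph.mem_edgeFinset, SimpleGraph.edgeSet_fromEdgeSet, Set.mem_sdiff,
        Finset.mem_coe]
      refine ⟨fun h => h.1, fun h => ⟨h, ?_⟩⟩
      have := hm h
      rw [SimpleGraph.mem_edgeFinset] at this
      exact G.not_isDiag_of_mem_edgeSet this
    · intro g hg
      rw [Set.ncard_eq_toFinset_card']
      rfl
  rw [h, edgeless]
  have h2 := Finset.sum_powerset_neg_one_pow_card (x := G.edgeFinset)
  have h3 : ∑ m ∈ G.edgeFinset.powerset, (-1 : ℂ) ^ m.card =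
      ((∑ m ∈ G.edgeFinset.powerset, (-1 : ℤ) ^ m.card : ℤ) : ℂ) := by push_cast; rfl
  rw [h3, h2]
  by_cases hG : G = ⊥
  · simp [hG]
  · rw [if_neg hG, if_neg]
    · simp
    · rwa [SimpleGraph.edgeFinset_eq_empty]

theorem connSum_map (e : V ≃ W) (G : SimpleGraph W) : connSum (G.comap e) = connSum G := by
  refine Finset.sum_bij' (fun g _ => g.map e.toEmbedding) (fun g _ => g.comap e) ?_ ?_ ?_ ?_ ?_
  · intro g hg
    simp only [Finset.mem_filter, Finset.mem_univ, true_and] at hg ⊢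
    refine ⟨?_, ?_⟩
    · rw [SimpleGraph.map_le_iff_le_comap]; exact hg.1
    · exact (SimpleGraph.Iso.map e g).connected_iff.1 hg.2
  · intro g hg
    simp only [Finset.mem_filter, Finset.mem_univ, true_and] at hg ⊢
    exact ⟨fun _ _ h => hg.1 h, (SimpleGraph.Iso.comap e g).connected_iff.2 hg.2⟩
  · intro g hg
    exact SimpleGraph.comap_map_eq e.toEmbedding g
  · intro g hg
    ext x y
    simp only [SimpleGraph.map_adj, SimpleGraph.comap_adj]
    constructor
    · rintro ⟨a, b, h, rfl, rfl⟩; exact h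
    · intro h; exact ⟨e.symm x, e.symm y, by simpa using h, by simp, by simp⟩
  · intro g hg
    rw [SimpleGraph.edgeSet_map]
    rw [Set.ncard_image_of_injective]
    exact Sym2.map.injective e.injective

/-- The disjoint union of a graph on `S` and a graph on the complement of `S`. -/
def glue (S : Finset V) (a : SimpleGraph S) (b : SimpleGraph {x // x ∉ S}) : SimpleGraph V :=
  a.map (Function.Embedding.subtype _) ⊔ b.map (Function.Embedding.subtype _)

theorem glue_adj {S : Finset V} {a : SimpleGraph S} {b : SimpleGraph {x // x ∉ S}} {x y : V} :
    (glue S a b).Adj x y ↔ (∃ (hx : x ∈ S) (hy : y ∈ S), a.Adj ⟨x, hx⟩ ⟨y, hy⟩) ∨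
      (∃ (hx : x ∉ S) (hy : y ∉ S), b.Adj ⟨x, hx⟩ ⟨y, hy⟩) := by
  simp only [glue, SimpleGraph.sup_adj, SimpleGraph.map_adj, Function.Embedding.subtype_apply]
  constructor
  · rintro (⟨u, v, h, rfl, rfl⟩ | ⟨u, v, h, rfl, rfl⟩)
    · exact Or.inl ⟨u.2, v.2, h⟩
    · exact Or.inr ⟨u.2, v.2, h⟩
  · rintro (⟨hx, hy, h⟩ | ⟨hx, hy, h⟩)
    · exact Or.inl ⟨_, _, h, rfl, rfl⟩
    · exact Or.inr ⟨_, _, h, rfl, rfl⟩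

theorem ncard_edgeSet_glue (S : Finset V) (a : SimpleGraph S) (b : SimpleGraph {x // x ∉ S}) :
    (glue S a b).edgeSet.ncard = a.edgeSet.ncard + b.edgeSet.ncard := by
  rw [glue, SimpleGraph.edgeSet_sup, SimpleGraph.edgeSet_map, SimpleGraph.edgeSet_map,
    Set.ncard_union_eq]
  · rw [Set.ncard_image_of_injective, Set.ncard_image_of_injective]
    · exact Sym2.map.injective Subtype.val_injective
    · exact Sym2.map.injective Subtype.val_injective
  · rw [Set.disjoint_left]
    rintro _ ⟨e, he, rfl⟩ ⟨e', he', h⟩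
    induction e using Sym2.ind with | _ x y =>
    induction e' using Sym2.ind with | _ x' y' =>
    simp only [Function.Embedding.sym2Map_apply, Sym2.map_mk, Sym2.eq_iff,
      Function.Embedding.subtype_apply] at h
    rcases h with h | h
    · exact x'.2 (h.1 ▸ x.2)
    · exact x'.2 (h.1 ▸ y.2)

theorem mem_of_glue_reachable {S : Finset V} {a : SimpleGraph S} {b : SimpleGraph {x // x ∉ S}}
    {x y : V} (h : (glue S a b).Reachable x y) (hx : x ∈ S) : y ∈ S := by
  obtain ⟨p⟩ := h
  induction p with
  | nil => exact hx
  | cons hadj _ ih =>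
    apply ih
    rcases glue_adj.1 hadj with ⟨_, h, _⟩ | ⟨h, _⟩
    · exact h
    · exact absurd hx h

theorem glue_comap_of_closed {S : Finset V} {g : SimpleGraph V}
    (h : ∀ x y, g.Adj x y → x ∈ S → y ∈ S) :
    glue S (g.comap Subtype.val) (g.comap Subtype.val) = g := by
  ext x y
  rw [glue_adj]
  simp only [SimpleGraph.comap_adj, exists_prop]
  constructor
  · rintro (h | h) <;> tauto
  · intro hxy
    by_cases hx : x ∈ S
    · exact Or.inl ⟨hx, h x y hxy hx, hxy⟩
    · exact Or.inr ⟨hx, fun hy => hx (h y x hxy.symm hy), hxy⟩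

theorem connected_comap_component (g : SimpleGraph V) (v : V) (S : Finset V)
    (hS : ∀ w, w ∈ S ↔ g.Reachable v w) : (g.comap (Subtype.val : S → V)).Connected := by
  have h := (g.connectedComponentMk v).maximal_connected_induce_supp.1
  have hs : (g.connectedComponentMk v).supp = (S : Set V) := by
    ext w
    simp only [SimpleGraph.ConnectedComponent.mem_supp_iff, SimpleGraph.ConnectedComponent.eq,
      Finset.mem_coe, hS]
    exact ⟨fun h => h.symm, fun h => h.symm⟩
  rw [hs] at h
  exact h

/-- Summation over graphs, decomposed according to the component of a vertex. -/
theorem edgeless_eq_sum_connSum (G : SimpleGraph V) (v : V) :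
    edgeless G = ∑ S : Finset V with v ∈ S,
      connSum (G.comap (Subtype.val : S → V)) *
        edgeless (G.comap (Subtype.val : {x // x ∉ S} → V)) := by
  rw [← sum_subgraphs_eq_edgeless]
  -- With S the component of v, a subgraph is a connected graph on S together with an arbitrary
  -- graph off S, and no edge crosses.
  rw [← Finset.sum_fiberwise_of_maps_to (t := Finset.univ.filter fun S : Finset V => v ∈ S)
    (g := fun g : SimpleGraph V => Finset.univ.filter fun w => g.Reachable v w)]
  swap
  · intro g _
    simp
  refine Finset.sum_congr rfl fun S hS => ?_
  have hvS : v ∈ S := by simpa using hS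
  rw [← sum_subgraphs_eq_edgeless, connSum, Finset.sum_mul_sum, ← Finset.sum_product']
  refine Finset.sum_bij' (fun g _ => (g.comap Subtype.val, g.comap Subtype.val))
      (fun p _ => glue S p.1 p.2) ?_ ?_ ?_ ?_ ?_
  · intro g hg
    simp only [Finset.mem_filter, Finset.mem_univ, true_and] at hg
    simp only [Finset.mem_product, Finset.mem_filter, Finset.mem_univ, true_and]
    refine ⟨⟨fun _ _ h => hg.1 h, connected_comap_component g v S fun w => ?_⟩,
      fun _ _ h => hg.1 h⟩
    rw [← hg.2]; simp
  · rintro ⟨a, b⟩ hp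
    simp only [Finset.mem_product, Finset.mem_filter, Finset.mem_univ, true_and] at hp ⊢
    refine ⟨fun x y hxy => ?_, ?_⟩
    · rcases glue_adj.1 hxy with ⟨_, _, h⟩ | ⟨_, _, h⟩
      · exact hp.1.1 h
      · exact hp.2 h
    · ext w
      simp only [Finset.mem_filter, Finset.mem_univ, true_and]
      refine ⟨fun h => mem_of_glue_reachable h hvS, fun hw => ?_⟩
      have := hp.1.2.preconnected ⟨v, hvS⟩ ⟨w, hw⟩
      have h2 := this.map (⟨Subtype.val, fun {x y} h => glue_adj.2 (Or.inl ⟨x.2, y.2, h⟩)⟩ :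
        a →g glue S a b)
      exact h2
  · intro g hg
    simp only [Finset.mem_filter, Finset.mem_univ, true_and] at hg
    apply glue_comap_of_closed
    intro x y hxy hx
    rw [← hg.2] at hx ⊢
    simp only [Finset.mem_filter, Finset.mem_univ, true_and] at hx ⊢
    exact hx.trans hxy.reachable
  · rintro ⟨a, b⟩ hp
    simp only [Prod.mk.injEq]
    constructor
    · ext x y
      rw [SimpleGraph.comap_adj, glue_adj]
      simp
    · ext x y
      rw [SimpleGraph.comap_adj, glue_adj]
      simpa [x.2] using fun _ => y.2
  · intro g hg
    simp only [Finset.mem_filter, Finset.mem_univ, true_and] at hg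
    rw [← pow_add, ← ncard_edgeSet_glue, glue_comap_of_closed]
    intro x y hxy hx
    rw [← hg.2] at hx ⊢
    simp only [Finset.mem_filter, Finset.mem_univ, true_and] at hx ⊢
    exact hx.trans hxy.reachable

theorem norm_edgeless_le (G : SimpleGraph V) : ‖edgeless G‖ ≤ 1 := by
  unfold edgeless; split_ifs <;> simp

theorem connSum_comap_univ (G : SimpleGraph V) :
    connSum (G.comap (Subtype.val : ↥(Finset.univ : Finset V) → V)) = connSum G :=
  connSum_map (Equiv.subtypeUnivEquiv Finset.mem_univ) G

theorem edgeless_of_isEmpty [IsEmpty V] (G : SimpleGraph V) : edgeless G = 1 :=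
  if_pos (Subsingleton.elim _ _)

/-- Since C(m,k) k! ≤ m!, a geometric sum remains: 4(4^m - 1)/3 + 1 ≤ 4^{m+1}. The base 4 leaves
room for the summand 1, which bounds |`edgeless`| in `norm_connSum_le`. -/
theorem sum_card_bound (m : ℕ) :
    ∑ k ∈ Finset.range m, (m.choose k : ℝ) * (4 ^ (k + 1) * k.factorial) + 1 ≤
      4 ^ (m + 1) * m.factorial := by
  have h1 : ∀ k ∈ Finset.range m, (m.choose k : ℝ) * (4 ^ (k + 1) * k.factorial) ≤
      4 ^ (k + 1) * m.factorial := by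
    intro k hk
    have : (m.choose k * k.factorial : ℕ) ≤ m.factorial := by
      have h := Nat.choose_mul_factorial_mul_factorial (Finset.mem_range.1 hk).le
      rw [← h]
      exact Nat.le_mul_of_pos_right _ (Nat.factorial_pos _)
    have h2 : (m.choose k : ℝ) * k.factorial ≤ m.factorial := by exact_mod_cast this
    calc (m.choose k : ℝ) * (4 ^ (k + 1) * k.factorial)
        = 4 ^ (k + 1) * ((m.choose k : ℝ) * k.factorial) := by ring
      _ ≤ _ := by gcongr
  have h3 : ∑ k ∈ Finset.range m, (4 : ℝ) ^ (k + 1) = 4 * (4 ^ m - 1) / 3 := by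
    simp_rw [pow_succ]
    rw [← Finset.sum_mul, geom_sum_eq (by norm_num)]
    ring
  have h4 : (1 : ℝ) ≤ m.factorial := by exact_mod_cast m.factorial_pos
  calc _ ≤ ∑ k ∈ Finset.range m, (4 : ℝ) ^ (k + 1) * m.factorial + m.factorial := by
        exact add_le_add (Finset.sum_le_sum h1) h4
    _ = (4 * (4 ^ m - 1) / 3 + 1) * m.factorial := by rw [← Finset.sum_mul, h3]; ring
    _ ≤ _ := by
        gcongr
        have : (1 : ℝ) ≤ 4 ^ m := one_le_pow₀ (by norm_num)
        rw [pow_succ]; linarith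

/-- Sums over the sets that contain a given point. -/
theorem sum_mem_card {R : Type*} [Semiring R] {n : ℕ} (v : V) (hV : Fintype.card V = n + 1)
    (f : ℕ → R) : ∑ S : Finset V with v ∈ S, f (S.erase v).card =
      ∑ k ∈ Finset.range (n + 1), (n.choose k : R) * f k := by
  have hcard : ((Finset.univ : Finset V).erase v).card = n := by
    rw [Finset.card_erase_of_mem (Finset.mem_univ _), Finset.card_univ]; omega
  have e1 := Finset.sum_powerset_apply_card f (x := (Finset.univ : Finset V).erase v)
  rw [hcard] at e1
  simp only [nsmul_eq_mul] at e1
  rw [← e1]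
  refine Finset.sum_bij' (fun S _ => S.erase v) (fun S _ => insert v S) ?_ ?_ ?_ ?_ ?_
  · intro S hS
    exact Finset.mem_powerset.2 (Finset.erase_subset_erase _ (Finset.subset_univ _))
  · intro S hS
    simp
  · intro S hS
    exact Finset.insert_erase (by simpa using hS)
  · intro S hS
    exact Finset.erase_insert fun hv => by simpa using Finset.mem_powerset.1 hS hv
  · intro S hS; rfl

/-- The term S = V in the decomposition by the component of v is `connSum G` itself; solving for it
expresses it by smaller connected sums. The bound is crude but uniform in G, and its factorial is
compensated by the 1/n! of the Mayer series. -/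
theorem norm_connSum_le (n : ℕ) : ∀ (V : Type) [Fintype V] [DecidableEq V] (G : SimpleGraph V),
    Fintype.card V = n + 1 → ‖connSum G‖ ≤ 4 ^ (n + 1) * n.factorial := by
  induction n using Nat.strong_induction_on with
  | _ n ih =>
  intro V _ _ G hV
  obtain ⟨v⟩ : Nonempty V := Fintype.card_pos_iff.1 (by omega)
  have h := edgeless_eq_sum_connSum G v
  have hu : (Finset.univ : Finset V) ∈ Finset.univ.filter fun S : Finset V => v ∈ S := by simp
  rw [← Finset.add_sum_erase _ _ hu, connSum_comap_univ] at h
  have : IsEmpty {x // x ∉ (Finset.univ : Finset V)} := ⟨fun x => x.2 (Finset.mem_univ _)⟩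
  rw [edgeless_of_isEmpty (V := {x // x ∉ (Finset.univ : Finset V)}), mul_one] at h
  rw [eq_sub_of_add_eq h.symm]
  have hb : ∀ S ∈ (Finset.univ.filter fun S : Finset V => v ∈ S).erase Finset.univ,
      ‖connSum (G.comap (Subtype.val : S → V)) *
        edgeless (G.comap (Subtype.val : {x // x ∉ S} → V))‖ ≤
      4 ^ ((S.erase v).card + 1) * (S.erase v).card.factorial := by
    intro S hS
    simp only [Finset.mem_erase, ne_eq, Finset.mem_filter, Finset.mem_univ, true_and] at hS
    have hc : S.card < Fintype.card V := (Finset.card_lt_iff_ne_univ S).2 hS.1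
    have hc2 := Finset.card_erase_add_one hS.2
    rw [norm_mul]
    calc _ ≤ (4 : ℝ) ^ ((S.erase v).card + 1) * (S.erase v).card.factorial * 1 := by
          gcongr
          · exact ih _ (by omega) _ _ (by simp; omega)
          · exact norm_edgeless_le _
      _ = _ := mul_one _
  have hsum : ∑ S ∈ (Finset.univ.filter fun S : Finset V => v ∈ S).erase Finset.univ,
      (4 : ℝ) ^ ((S.erase v).card + 1) * (S.erase v).card.factorial =
      ∑ k ∈ Finset.range n, (n.choose k : ℝ) * (4 ^ (k + 1) * k.factorial) := by
    have e1 := sum_mem_card v hV (fun k => (4 : ℝ) ^ (k + 1) * k.factorial)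
    rw [Finset.sum_range_succ, ← Finset.add_sum_erase _ _ hu, add_comm,
      Finset.card_erase_of_mem (Finset.mem_univ _), Finset.card_univ, hV] at e1
    simpa using e1
  calc _ ≤ ‖edgeless G‖ + ‖∑ S ∈ (Finset.univ.filter fun S : Finset V => v ∈ S).erase Finset.univ,
          connSum (G.comap (Subtype.val : S → V)) *
        edgeless (G.comap (Subtype.val : {x // x ∉ S} → V))‖ := norm_sub_le _ _
    _ ≤ 1 + ∑ k ∈ Finset.range n, (n.choose k : ℝ) * (4 ^ (k + 1) * k.factorial) := by
        gcongr
        · exact norm_edgeless_le _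
        · rw [← hsum]; exact norm_sum_le_of_le _ hb
    _ ≤ _ := by rw [add_comm]; exact sum_card_bound n

end GraphSums

/-! ## The exponential formula -/

section ExponentialFormula

/-- Only summability at radius 1 is given. For q strictly between |x| and 1 the factors n q^{n-1}
are bounded, which dominates the differentiated series. -/
theorem hasDerivAt_tsum_pow {c : ℕ → ℂ} (hc : Summable fun n => ‖c n‖) {x : ℝ} (hx : |x| < 1) :
    HasDerivAt (fun x : ℝ => ∑' n, c n * (x : ℂ) ^ n)
      (∑' n, c n * (n * (x : ℂ) ^ (n - 1))) x := by
  obtain ⟨q, hxq, hq⟩ := exists_between hx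
  have hq0 : 0 ≤ q := (abs_nonneg x).trans hxq.le
  have hbd : ∃ K, ∀ n : ℕ, (n : ℝ) * q ^ (n - 1) ≤ K := by
    have h := (tendsto_self_mul_const_pow_of_lt_one hq0 hq).bddAbove_range
    obtain ⟨K, hK⟩ := h
    refine ⟨K + K + 1, fun n => ?_⟩
    have h0 : 0 ≤ K := (hK ⟨0, rfl⟩).trans' (by simp)
    rcases n with _ | n
    · simp; linarith
    · have h1 : (n : ℝ) * q ^ n ≤ K := hK ⟨n, rfl⟩
      have h2 : q ^ n ≤ 1 := pow_le_one₀ hq0 hq.le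
      push_cast
      linarith
  obtain ⟨K, hK⟩ := hbd
  refine hasDerivAt_tsum_of_isPreconnected (u := fun n => ‖c n‖ * K)
    (g := fun n (y : ℝ) => c n * (y : ℂ) ^ n) (g' := fun n y => c n * (n * (y : ℂ) ^ (n - 1))) (hc.mul_right K)
    (t := Metric.ball (0 : ℝ) q) Metric.isOpen_ball (convex_ball 0 q).isPreconnected
    (y₀ := 0) ?_ ?_ ?_ ?_ ?_
  · intro n y hy
    have h1 : HasDerivAt (fun y : ℝ => (y : ℂ) ^ n) ((n : ℂ) * (y : ℂ) ^ (n - 1)) y := by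
      have := (hasDerivAt_id y).ofReal_comp.fun_pow n
      simpa using this
    exact h1.const_mul _
  · intro n y hy
    rw [norm_mul, norm_mul, norm_pow]
    have : ‖(y : ℂ)‖ ≤ q := by
      rw [Complex.norm_real]; simpa using (mem_ball_zero_iff.1 hy).le
    gcongr
    refine le_trans ?_ (hK n)
    simp only [Complex.norm_natCast]
    gcongr
  · exact Metric.mem_ball_self ((abs_nonneg x).trans_lt hxq)
  · refine summable_of_ne_finset_zero (s := {0}) fun n hn => ?_
    simp at hn
    simp [hn]
  · simpa using hxq

/-- The exponential formula: if `β' = α' β` as exponential generating series and `β` is a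
polynomial, then `β(1) = exp α(1)`. -/
theorem exp_tsum_eq_sum_of_recursion {α β : ℕ → ℂ} (N : ℕ) (hα0 : α 0 = 0) (hβ0 : β 0 = 1)
    (hrec : ∀ n, β (n + 1) = ∑ k ∈ Finset.range (n + 1), (n.choose k : ℂ) * (α (k + 1) * β (n - k)))
    (hα : Summable fun n : ℕ => ‖((n.factorial : ℂ))⁻¹ * α n‖) (hfin : ∀ n, N < n → β n = 0) :
    Complex.exp (∑' n : ℕ, ((n.factorial : ℂ))⁻¹ * α n) =
      ∑ n ∈ Finset.range (N + 1), ((n.factorial : ℂ))⁻¹ * β n := by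
  set c : ℕ → ℂ := fun n => ((n.factorial : ℂ))⁻¹ * α n with hc
  set d : ℕ → ℂ := fun n => ((n.factorial : ℂ))⁻¹ * β n with hd
  have hdfin : ∀ n ∉ Finset.range (N + 1), d n = 0 := by
    intro n hn
    simp only [Finset.mem_range, not_lt] at hn
    simp [hd, hfin n (by omega)]
  have hdsum : Summable fun n => ‖d n‖ :=
    summable_of_ne_finset_zero (s := Finset.range (N + 1)) fun n hn => by simp [hdfin n hn]
  set A : ℝ → ℂ := fun x => ∑' n, c n * (x : ℂ) ^ n with hA
  set B : ℝ → ℂ := fun x => ∑' n, d n * (x : ℂ) ^ n with hB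
  -- The radius of convergence may be exactly 1, so no derivative is available at x = 1; continuity
  -- up to that endpoint is what absolute summability gives.
  have hcont : ∀ e : ℕ → ℂ, (Summable fun n => ‖e n‖) →
      ContinuousOn (fun x : ℝ => ∑' n, e n * (x : ℂ) ^ n) (Set.Icc 0 1) := by
    intro e he
    refine continuousOn_tsum (fun n => by fun_prop) he fun n x hx => ?_
    rw [norm_mul, norm_pow, Complex.norm_real, Real.norm_eq_abs, abs_of_nonneg hx.1]
    exact mul_le_of_le_one_right (norm_nonneg _) (pow_le_one₀ hx.1 hx.2)
  -- After division by n! the recursion says that the coefficients of B' are the Cauchy product of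
  -- those of A' and B.
  have hcoef : ∀ n, ((n + 1 : ℕ) : ℂ) * d (n + 1) =
      ∑ k ∈ Finset.range (n + 1), (((k + 1 : ℕ) : ℂ) * c (k + 1)) * d (n - k) := by
    intro n
    simp only [hc, hd, hrec n, Finset.mul_sum]
    refine Finset.sum_congr rfl fun k hk => ?_
    have hk' : k ≤ n := by simpa [Nat.lt_succ_iff] using hk
    rw [Nat.cast_choose ℂ hk', Nat.factorial_succ, Nat.factorial_succ]
    have h1 : (n.factorial : ℂ) ≠ 0 := by exact_mod_cast n.factorial_ne_zero
    have h2 : (k.factorial : ℂ) ≠ 0 := by exact_mod_cast k.factorial_ne_zero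
    have h3 : ((n - k).factorial : ℂ) ≠ 0 := by exact_mod_cast (n - k).factorial_ne_zero
    have h4 : ((n : ℂ) + 1) ≠ 0 := by exact_mod_cast n.succ_ne_zero
    have h5 : ((k : ℂ) + 1) ≠ 0 := by exact_mod_cast k.succ_ne_zero
    push_cast
    field_simp
  have hshift : ∀ (e : ℕ → ℂ), (Summable fun n => ‖e n‖) → ∀ x : ℝ, |x| < 1 →
      (Summable fun n => ‖e n * (n * (x : ℂ) ^ (n - 1))‖) →
      ∑' n, e n * (n * (x : ℂ) ^ (n - 1)) = ∑' n : ℕ, (((n + 1 : ℕ) : ℂ) * e (n + 1)) * (x : ℂ) ^ n := by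
    intro e he x hx hs
    rw [hs.of_norm.tsum_eq_zero_add]
    simp only [Nat.cast_zero, zero_mul, mul_zero, zero_add, Nat.add_sub_cancel]
    exact tsum_congr fun n => by ring
  have hsumm : ∀ (e : ℕ → ℂ), (Summable fun n => ‖e n‖) → ∀ x : ℝ, |x| < 1 →
      (Summable fun n => ‖e n * (n * (x : ℂ) ^ (n - 1))‖) := by
    intro e he x hx
    have h := (tendsto_self_mul_const_pow_of_lt_one (abs_nonneg x) hx).bddAbove_range
    obtain ⟨K, hK⟩ := h
    rw [← summable_nat_add_iff 1]
    refine Summable.of_nonneg_of_le (fun _ => norm_nonneg _) (fun n => ?_)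
      (((summable_nat_add_iff 1).2 he).mul_right (K + 1))
    rw [norm_mul, norm_mul, norm_pow, Complex.norm_natCast, Complex.norm_real, Real.norm_eq_abs]
    gcongr
    have h1 : (n : ℝ) * |x| ^ n ≤ K := hK ⟨n, rfl⟩
    have h2 : |x| ^ n ≤ 1 := pow_le_one₀ (abs_nonneg x) hx.le
    push_cast
    linarith
  have hode : ∀ x : ℝ, |x| < 1 → ∑' n, d n * (n * (x : ℂ) ^ (n - 1)) =
      (∑' n, c n * (n * (x : ℂ) ^ (n - 1))) * B x := by
    intro x hx
    have h1 := hsumm c hα x hx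
    have h1' := (summable_nat_add_iff 1).2 h1
    rw [hshift d hdsum x hx (hsumm d hdsum x hx), hshift c hα x hx h1, hB]
    rw [tsum_mul_tsum_eq_tsum_sum_range_of_summable_norm]
    · refine tsum_congr fun n => ?_
      rw [hcoef, Finset.sum_mul]
      refine Finset.sum_congr rfl fun k hk => ?_
      have hk' : k ≤ n := by simpa [Nat.lt_succ_iff] using hk
      calc _ = ((k + 1 : ℕ) : ℂ) * c (k + 1) * d (n - k) * (x : ℂ) ^ (k + (n - k)) := by
            rw [Nat.add_sub_cancel' hk']
        _ = _ := by rw [pow_add]; ring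
    · refine h1'.congr fun n => ?_
      congr 1
      simp only [Nat.add_sub_cancel]
      ring
    · exact summable_of_ne_finset_zero (s := Finset.range (N + 1)) fun n hn => by simp [hdfin n hn]
  -- B' = A'B on [0, 1) makes B e^{-A} constant there, and continuity carries the constant to x = 1.
  have hconst := constant_of_has_deriv_right_zero (f := fun x => B x * Complex.exp (-A x))
    (a := 0) (b := 1) ((hcont d hdsum).mul ((hcont c hα).neg.cexp)) (fun x hx => by
      have hx1 : |x| < 1 := by rw [abs_of_nonneg hx.1]; exact hx.2
      have h1 := (hasDerivAt_tsum_pow hdsum hx1).mul (hasDerivAt_tsum_pow hα hx1).neg.cexp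
      refine HasDerivAt.hasDerivWithinAt (h1.congr_deriv ?_)
      rw [hode x hx1]
      simp only [hB, Pi.neg_apply]
      ring) 1 (Set.right_mem_Icc.2 zero_le_one)
  have hA0 : A 0 = 0 := by
    simp only [hA]
    rw [tsum_eq_single 0 (fun n hn => by simp [hn])]
    simp [hc, hα0]
  have hB0 : B 0 = 1 := by
    simp only [hB]
    rw [tsum_eq_single 0 (fun n hn => by simp [hn])]
    simp [hd, hβ0]
  simp only [hA0, hB0, neg_zero, Complex.exp_zero, mul_one] at hconst
  have hA1 : A 1 = ∑' n, c n := by simp [hA]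
  have hB1 : B 1 = ∑ n ∈ Finset.range (N + 1), d n := by
    simp only [hB, Complex.ofReal_one, one_pow, mul_one]
    exact tsum_eq_sum hdfin
  rw [← hA1, ← hB1, ← mul_one (Complex.exp _), ← hconst, mul_left_comm, ← Complex.exp_add]
  simp

end ExponentialFormula

/-! ## Polymer gases -/

section PolymerGas

variable {L P : Type*} [Fintype L] [DecidableEq L] [Fintype P] (supp : P → Finset L) (w : P → ℂ)

theorem incidence_comp {κ κ' : Type*} (Y : κ → Finset L) {f : κ' → κ}
    (hf : Function.Injective f) : incidence (Y ∘ f) = (incidence Y).comap f := by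
  ext i j
  simp only [incidence, SimpleGraph.fromRel_adj, SimpleGraph.comap_adj, Function.comp_apply,
    hf.ne_iff]

/-- The sum over sequences of polymers, weighted with Ursell functions. -/
def clusterSum (κ : Type*) [Fintype κ] [DecidableEq κ] : ℂ :=
  ∑ Y : κ → P, connSum (incidence fun i => supp (Y i)) * ∏ i, w (Y i)

/-- The sum over sequences of pairwise disjoint polymers. -/
def gasSum (κ : Type*) [Fintype κ] [DecidableEq κ] : ℂ :=
  ∑ Y : κ → P, edgeless (incidence fun i => supp (Y i)) * ∏ i, w (Y i)

theorem clusterSum_congr {κ κ' : Type*} [Fintype κ] [DecidableEq κ] [Fintype κ'] [DecidableEq κ']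
    (e : κ ≃ κ') : clusterSum supp w κ = clusterSum supp w κ' := by
  refine Fintype.sum_equiv (Equiv.arrowCongr e (Equiv.refl P)) _ _ fun Y => ?_
  congr 1
  · rw [← connSum_map e, ← incidence_comp _ e.injective]
    congr 2
    ext i
    simp
  · exact Fintype.prod_equiv e _ _ fun i => by simp

theorem gasSum_congr {κ κ' : Type*} [Fintype κ] [DecidableEq κ] [Fintype κ'] [DecidableEq κ']
    (e : κ ≃ κ') : gasSum supp w κ = gasSum supp w κ' := by
  refine Fintype.sum_equiv (Equiv.arrowCongr e (Equiv.refl P)) _ _ fun Y => ?_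
  congr 1
  · have : (incidence fun i => supp (Y i)) =
        (incidence fun i => supp (Equiv.arrowCongr e (Equiv.refl P) Y i)).comap e := by
      rw [← incidence_comp _ e.injective]
      congr 1
      ext i
      simp
    rw [this, edgeless, edgeless]
    refine if_congr ⟨fun h => ?_, fun h => by rw [h]; rfl⟩ rfl rfl
    ext i j
    have h2 := congrArg (fun G => G.Adj (e.symm i) (e.symm j)) h
    simpa using h2
  · exact Fintype.prod_equiv e _ _ fun i => by simp

/-- The decomposition of `edgeless` by the component of v, applied to each incidence graph. Weights
are products over positions, so a sequence splits into its parts on S and off S. -/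
theorem gasSum_eq_sum {κ : Type*} [Fintype κ] [DecidableEq κ] (v : κ) :
    gasSum supp w κ =
      ∑ S : Finset κ with v ∈ S, clusterSum supp w S * gasSum supp w {x // x ∉ S} := by
  simp only [gasSum, edgeless_eq_sum_connSum _ v, Finset.sum_mul]
  rw [Finset.sum_comm]
  refine Finset.sum_congr rfl fun S hS => ?_
  rw [clusterSum, Finset.sum_mul_sum, ← Fintype.sum_prod_type']
  refine Fintype.sum_equiv (Equiv.piEquivPiSubtypeProd (· ∈ S) (fun _ => P)) _ _ fun Y => ?_
  rw [← Fintype.prod_subtype_mul_prod_subtype (· ∈ S), ← incidence_comp _ Subtype.val_injective,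
    ← incidence_comp _ Subtype.val_injective]
  simp only [Equiv.piEquivPiSubtypeProd_apply, Function.comp_def]
  rw [mul_mul_mul_comm]
  congr!

/-- The terms depend on S only through its size, and C(n, k) sets of size k + 1 contain the position
0. This is the recursion required by the exponential formula. -/
theorem gasSum_succ (n : ℕ) : gasSum supp w (Fin (n + 1)) =
    ∑ k ∈ Finset.range (n + 1), (n.choose k : ℂ) *
      (clusterSum supp w (Fin (k + 1)) * gasSum supp w (Fin (n - k))) := by
  rw [gasSum_eq_sum supp w 0, ← sum_mem_card (0 : Fin (n + 1)) (by simp)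
    (fun k => clusterSum supp w (Fin (k + 1)) * gasSum supp w (Fin (n - k)))]
  refine Finset.sum_congr rfl fun S hS => ?_
  have h0 : (0 : Fin (n + 1)) ∈ S := by simpa using hS
  have hc := Finset.card_erase_add_one h0
  have hle : S.card ≤ n + 1 := by simpa using Finset.card_le_univ S
  rw [clusterSum_congr supp w (S.equivFinOfCardEq hc.symm)]
  rw [gasSum_congr supp w (Fintype.equivFinOfCardEq (n := n - (S.erase 0).card) ?_)]
  rw [Fintype.card_subtype_compl, Fintype.card_fin]
  simp only [Fintype.card_coe]
  omega

/-- The incidence graph has no edges iff the polymers are pairwise disjoint. -/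
theorem incidence_eq_bot {κ : Type*} (Y : κ → Finset L) :
    incidence Y = ⊥ ↔ Pairwise fun i j => Disjoint (Y i) (Y j) := by
  constructor
  · intro h i j hij
    have h2 := congrArg (fun G => G.Adj i j) h
    simp only [incidence, SimpleGraph.fromRel_adj, SimpleGraph.bot_adj, eq_iff_iff, iff_false,
      not_and, not_or, Finset.not_nonempty_iff_eq_empty] at h2
    exact Finset.disjoint_iff_inter_eq_empty.2 (h2 hij).1
  · intro h
    ext i j
    simp only [incidence, SimpleGraph.fromRel_adj, SimpleGraph.bot_adj, iff_false, not_and, not_or,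
      Finset.not_nonempty_iff_eq_empty]
    exact fun hij => ⟨Finset.disjoint_iff_inter_eq_empty.1 (h hij),
      Finset.disjoint_iff_inter_eq_empty.1 (h hij.symm)⟩

/-- Sums over injective sequences as sums over sets. -/
theorem sum_injective_eq {n : ℕ} (f : Finset P → ℂ) :
    ∑ Y : Fin n → P with Function.Injective Y, f (Finset.univ.image Y) =
      (n.factorial : ℂ) * ∑ S : Finset P with S.card = n, f S := by
  rw [← Finset.sum_fiberwise_of_maps_to (t := Finset.univ.filter fun S : Finset P => S.card = n)
    (g := fun Y : Fin n → P => Finset.univ.image Y)]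
  swap
  · intro Y hY
    simp only [Finset.mem_filter, Finset.mem_univ, true_and] at hY ⊢
    rw [Finset.card_image_of_injective _ hY]; simp
  rw [Finset.mul_sum]
  refine Finset.sum_congr rfl fun S hS => ?_
  have hS' : S.card = n := by simpa using hS
  rw [Finset.sum_congr rfl (g := fun _ => f S) (fun Y hY => by
    rw [(Finset.mem_filter.1 hY).2]), Finset.sum_const, nsmul_eq_mul]
  congr 2
  have e : Fintype.card (Fin n ≃ S) = n.factorial := by
    rw [Fintype.card_equiv (S.equivFinOfCardEq hS').symm, Fintype.card_fin]
  rw [← e, ← Finset.card_univ]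
  refine Finset.card_bij' (fun Y hY => Equiv.ofBijective
      (fun i => (⟨Y i, by
        rw [← (Finset.mem_filter.1 hY).2]; exact Finset.mem_image_of_mem _ (Finset.mem_univ _)⟩ : S))
      ⟨fun i j h => (Finset.mem_filter.1 (Finset.mem_filter.1 hY).1).2 (by simpa using h),
       fun x => by
        have hx : (x : P) ∈ Finset.univ.image Y := by
          rw [(Finset.mem_filter.1 hY).2]; exact x.2
        obtain ⟨i, _, hi⟩ := Finset.mem_image.1 hx
        exact ⟨i, Subtype.ext hi⟩⟩)
    (fun g _ i => (g i : P)) ?_ ?_ ?_ ?_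
  · intro Y hY; exact Finset.mem_univ _
  · intro g _
    simp only [Finset.mem_filter, Finset.mem_univ, true_and]
    refine ⟨Subtype.val_injective.comp g.injective, ?_⟩
    ext x
    simp only [Finset.mem_image, Finset.mem_univ, true_and]
    constructor
    · rintro ⟨i, rfl⟩; exact (g i).2
    · intro hx; exact ⟨g.symm ⟨x, hx⟩, by simp⟩
  · intro Y hY; rfl
  · intro g _; ext i; rfl

/-- The partition function of a gas of pairwise disjoint polymers. -/
def hardCoreSum : ℂ :=
  ∑ S ∈ Finset.univ.filter (fun S : Finset P => (S : Set P).PairwiseDisjoint supp), ∏ p ∈ S, w p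

/-- Disjoint nonempty polymers are distinct, so each admissible sequence is one of n! orderings of a
set. Nonemptiness matters: a polymer with empty support would be disjoint from itself and could be
repeated. -/
theorem gasSum_fin (hw : ∀ p, w p ≠ 0 → (supp p).Nonempty) (n : ℕ) :
    gasSum supp w (Fin n) = (n.factorial : ℂ) *
      ∑ S : Finset P with S.card = n,
        if (S : Set P).PairwiseDisjoint supp then ∏ p ∈ S, w p else 0 := by
  rw [← sum_injective_eq, gasSum, Finset.sum_filter]
  refine Finset.sum_congr rfl fun Y _ => ?_
  by_cases hwY : ∀ i, w (Y i) ≠ 0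
  swap
  · push Not at hwY
    obtain ⟨i, hi⟩ := hwY
    rw [Finset.prod_eq_zero (Finset.mem_univ i) hi, mul_zero]
    split_ifs
    · rw [Finset.prod_eq_zero (Finset.mem_image_of_mem Y (Finset.mem_univ i)) hi]
    · rfl
    · rfl
  by_cases hd : Pairwise fun i j => Disjoint (supp (Y i)) (supp (Y j))
  · have hinj : Function.Injective Y := by
      intro i j hij
      by_contra hne
      have h1 : Disjoint (supp (Y i)) (supp (Y j)) := hd hne
      rw [hij, disjoint_self] at h1
      exact (hw _ (hwY j)).ne_empty h1
    rw [edgeless, if_pos ((incidence_eq_bot _).2 hd), one_mul, if_pos hinj, if_pos,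
      Finset.prod_image fun i _ j _ h => hinj h]
    intro a ha b hb hab
    simp only [Finset.coe_image, Finset.coe_univ, Set.image_univ, Set.mem_range] at ha hb
    obtain ⟨i, rfl⟩ := ha
    obtain ⟨j, rfl⟩ := hb
    exact hd fun h => hab (by rw [h])
  · rw [edgeless, if_neg (fun h => hd ((incidence_eq_bot _).1 h)), zero_mul]
    split_ifs with hinj hp
    · exfalso
      apply hd
      intro i j hij
      refine hp ?_ ?_ (hinj.ne hij) <;> simp
    · rfl
    · rfl

/-- This makes the gas sums vanish beyond |L| polymers, so their generating series is a polynomial.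
-/
theorem card_le_of_pairwiseDisjoint (S : Finset P) (hS : (S : Set P).PairwiseDisjoint supp)
    (hne : ∀ p ∈ S, (supp p).Nonempty) : S.card ≤ Fintype.card L := by
  calc S.card = ∑ p ∈ S, 1 := by simp
    _ ≤ ∑ p ∈ S, (supp p).card := Finset.sum_le_sum fun p hp => (hne p hp).card_pos
    _ = (S.biUnion supp).card := (Finset.card_biUnion hS).symm
    _ ≤ _ := Finset.card_le_univ _

/-- Connectedness requires a vertex; hence the empty sequence contributes nothing and the cluster
series has no constant term. -/
theorem connSum_of_isEmpty {V : Type*} [Fintype V] [DecidableEq V] [IsEmpty V]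
    (G : SimpleGraph V) : connSum G = 0 := by
  refine Finset.sum_eq_zero fun g hg => ?_
  obtain ⟨v⟩ := ((Finset.mem_filter.1 hg).2.2).nonempty
  exact isEmptyElim v

/-- The Mayer expansion. -/
theorem exp_mayer (hw : ∀ p, w p ≠ 0 → (supp p).Nonempty)
    (hs : Summable fun n : ℕ => ‖((n.factorial : ℂ))⁻¹ * clusterSum supp w (Fin n)‖) :
    Complex.exp (∑' n : ℕ, ((n.factorial : ℂ))⁻¹ * clusterSum supp w (Fin n)) =
      hardCoreSum supp w := by
  have hz : ∀ S : Finset P, Fintype.card L < S.card → (S : Set P).PairwiseDisjoint supp →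
      ∏ p ∈ S, w p = 0 := by
    intro S hS hd
    by_contra hne
    exact hS.not_ge (card_le_of_pairwiseDisjoint supp S hd fun p hp =>
      hw p (Finset.prod_ne_zero_iff.1 hne p hp))
  have hterm : ∀ n : ℕ, ((n.factorial : ℂ))⁻¹ * gasSum supp w (Fin n) =
      ∑ S : Finset P with S.card = n,
        if (S : Set P).PairwiseDisjoint supp then ∏ p ∈ S, w p else 0 := by
    intro n
    rw [gasSum_fin supp w hw, inv_mul_cancel_left₀]
    exact_mod_cast n.factorial_ne_zero
  rw [exp_tsum_eq_sum_of_recursion (α := fun n => clusterSum supp w (Fin n))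
    (β := fun n => gasSum supp w (Fin n)) (Fintype.card L) ?_ ?_ (gasSum_succ supp w) hs ?_]
  · simp only [hterm]
    rw [hardCoreSum, Finset.sum_filter]
    rw [← Finset.sum_subset (Finset.subset_univ
      (Finset.univ.filter fun S : Finset P => S.card < Fintype.card L + 1))]
    · rw [← Finset.sum_fiberwise_of_maps_to (t := Finset.range (Fintype.card L + 1))
        (g := fun S : Finset P => S.card) (fun S hS => by simpa using hS)]
      refine Finset.sum_congr rfl fun n hn => ?_
      refine Finset.sum_congr ?_ fun _ _ => rfl
      ext S
      have := Finset.mem_range.1 hn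
      simp only [Finset.mem_filter, Finset.mem_univ, true_and]
      omega
    · intro S _ hS
      simp only [Finset.mem_filter, Finset.mem_univ, true_and, not_lt] at hS
      split_ifs with h
      · exact hz S (by omega) h
      · rfl
  · refine Finset.sum_eq_zero fun Y _ => ?_
    rw [connSum_of_isEmpty, zero_mul]
  · simp [gasSum, edgeless_of_isEmpty]
  · intro n hn
    rw [gasSum_fin supp w hw, Finset.sum_eq_zero, mul_zero]
    intro S hS
    have hS' : S.card = n := by simpa using hS
    split_ifs with h
    · exact hz S (by omega) h
    · rfl

end PolymerGas

/-! ## Packings -/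

section Packings

variable {L P : Type*} [Fintype L] [DecidableEq L] [Fintype P]

/-- The sets of pairwise disjoint nonempty polymers inside `Λ`. -/
def packings (supp : P → Finset L) (Λ : Finset L) : Finset (Finset P) :=
  Finset.univ.filter fun S =>
    (S : Set P).PairwiseDisjoint supp ∧ ∀ p ∈ S, (supp p).Nonempty ∧ supp p ⊆ Λ

/-- The sum over packings of `Λ` with weights `w` for polymers and `u` for uncovered points. -/
def packSum (supp : P → Finset L) (u : L → ℂ) (w : P → ℂ) (Λ : Finset L) : ℂ :=
  ∑ S ∈ packings supp Λ, (∏ p ∈ S, w p) * ∏ x ∈ Λ \ S.biUnion supp, u x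

variable {supp : P → Finset L} {u : L → ℂ} {w : P → ℂ}

theorem mem_packings {Λ : Finset L} {S : Finset P} : S ∈ packings supp Λ ↔
    (S : Set P).PairwiseDisjoint supp ∧ ∀ p ∈ S, (supp p).Nonempty ∧ supp p ⊆ Λ := by
  simp [packings]

theorem packSum_empty : packSum supp u w ∅ = 1 := by
  have : packings supp (∅ : Finset L) = {∅} := by
    ext S
    rw [mem_packings, Finset.mem_singleton]
    constructor
    · rintro ⟨_, h⟩
      refine Finset.eq_empty_of_forall_notMem fun p hp => ?_
      obtain ⟨h1, h2⟩ := h p hp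
      exact h1.ne_empty (Finset.subset_empty.1 h2)
    · rintro rfl; simp
  simp [packSum, this]

/-- Decomposition of a packing according to the polymer that contains a given point. -/
theorem packSum_rec {Λ : Finset L} {x : L} (hx : x ∈ Λ) : packSum supp u w Λ =
    u x * packSum supp u w (Λ.erase x) +
      ∑ p : P with x ∈ supp p ∧ supp p ⊆ Λ, w p * packSum supp u w (Λ \ supp p) := by
  rw [packSum, ← Finset.sum_filter_add_sum_filter_not _ (fun S => ∀ p ∈ S, x ∉ supp p)]
  congr 1
  · rw [packSum, Finset.mul_sum]
    refine Finset.sum_congr ?_ fun S hS => ?_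
    · ext S
      simp only [Finset.mem_filter, mem_packings]
      constructor
      · rintro ⟨⟨h1, h2⟩, h3⟩
        exact ⟨h1, fun p hp => ⟨(h2 p hp).1, Finset.subset_erase.2 ⟨(h2 p hp).2, h3 p hp⟩⟩⟩
      · rintro ⟨h1, h2⟩
        exact ⟨⟨h1, fun p hp => ⟨(h2 p hp).1, (Finset.subset_erase.1 (h2 p hp).2).1⟩⟩,
          fun p hp => (Finset.subset_erase.1 (h2 p hp).2).2⟩
    · rw [mem_packings] at hS
      have hxS : x ∉ S.biUnion supp := by
        simp only [Finset.mem_biUnion, not_exists, not_and]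
        exact fun p hp => (Finset.subset_erase.1 (hS.2 p hp).2).2
      have : Λ \ S.biUnion supp = insert x (Λ.erase x \ S.biUnion supp) := by
        rw [Finset.erase_sdiff_comm, Finset.insert_erase]
        simp [hx, hxS]
      rw [this, Finset.prod_insert (by simp)]
      ring
  · simp only [packSum, Finset.mul_sum]
    rw [Finset.sum_sigma']
    symm
    refine Finset.sum_bij (fun q _ => insert q.1 q.2) ?_ ?_ ?_ ?_
    · rintro ⟨p, S⟩ hq
      simp only [Finset.mem_sigma, Finset.mem_filter, Finset.mem_univ, true_and,
        mem_packings] at hq ⊢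
      obtain ⟨⟨hxp, hpΛ⟩, hd, hS⟩ := hq
      refine ⟨⟨?_, ?_⟩, ?_⟩
      · rw [Finset.coe_insert]
        refine hd.insert fun q hq _ => ?_
        exact (Finset.disjoint_sdiff.mono_right (hS q hq).2)
      · intro q hq
        rcases Finset.mem_insert.1 hq with rfl | hq
        · exact ⟨⟨x, hxp⟩, hpΛ⟩
        · exact ⟨(hS q hq).1, (hS q hq).2.trans Finset.sdiff_subset⟩
      · push Not
        exact ⟨p, Finset.mem_insert_self _ _, hxp⟩
    · rintro ⟨p, S⟩ hq ⟨p', S'⟩ hq' h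
      simp only [Finset.mem_sigma, Finset.mem_filter, Finset.mem_univ, true_and,
        mem_packings] at hq hq' h
      have hn : ∀ {p : P} {S : Finset P}, x ∈ supp p → (∀ q ∈ S, (supp q).Nonempty ∧
          supp q ⊆ Λ \ supp p) → ∀ q ∈ S, x ∉ supp q := by
        intro p S hp hS q hq hxq
        exact (Finset.mem_sdiff.1 ((hS q hq).2 hxq)).2 hp
      have h1 := hn hq.1.1 hq.2.2
      have h2 := hn hq'.1.1 hq'.2.2
      have hpp : p = p' := by
        have : p ∈ insert p' S' := h ▸ Finset.mem_insert_self _ _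
        rcases Finset.mem_insert.1 this with h3 | h3
        · exact h3
        · exact absurd hq.1.1 (h2 p h3)
      subst hpp
      have h3 : p ∉ S := fun hp => h1 p hp hq.1.1
      have h4 : p ∉ S' := fun hp => h2 p hp hq.1.1
      have : S = S' := by rw [← Finset.erase_insert h3, h, Finset.erase_insert h4]
      rw [this]
    · intro S hS
      simp only [Finset.mem_filter, mem_packings] at hS
      obtain ⟨⟨hd, hS⟩, h⟩ := hS
      push Not at h
      obtain ⟨p, hp, hxp⟩ := h
      refine ⟨⟨p, S.erase p⟩, ?_, Finset.insert_erase hp⟩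
      simp only [Finset.mem_sigma, Finset.mem_filter, Finset.mem_univ, true_and, mem_packings]
      refine ⟨⟨hxp, (hS p hp).2⟩, hd.subset (by simp), fun q hq => ?_⟩
      rw [Finset.mem_erase] at hq
      exact ⟨(hS q hq.2).1, Finset.subset_sdiff.2 ⟨(hS q hq.2).2, hd hq.2 hp hq.1⟩⟩
    · rintro ⟨p, S⟩ hq
      simp only [Finset.mem_sigma, Finset.mem_filter, Finset.mem_univ, true_and,
        mem_packings] at hq
      have h3 : p ∉ S := fun hp =>
        (Finset.mem_sdiff.1 ((hq.2.2 p hp).2 hq.1.1)).2 hq.1.1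
      rw [Finset.prod_insert h3, Finset.biUnion_insert, mul_assoc]
      congr 3
      rw [sdiff_sdiff_left]; rfl

/-- The recursion determines the sum over packings. -/
theorem eq_packSum_of_rec {f : Finset L → ℂ} (h0 : f ∅ = 1)
    (hrec : ∀ Λ : Finset L, ∀ x ∈ Λ, f Λ = u x * f (Λ.erase x) +
      ∑ p : P with x ∈ supp p ∧ supp p ⊆ Λ, w p * f (Λ \ supp p)) (Λ : Finset L) :
    f Λ = packSum supp u w Λ := by
  induction Λ using Finset.strongInduction with
  | _ Λ ih =>
  rcases Λ.eq_empty_or_nonempty with rfl | ⟨x, hx⟩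
  · rw [h0, packSum_empty]
  · rw [hrec Λ x hx, packSum_rec hx, ih _ (Finset.erase_ssubset hx)]
    congr 1
    refine Finset.sum_congr rfl fun p hp => ?_
    rw [ih]
    simp only [Finset.mem_filter, Finset.mem_univ, true_and] at hp
    exact Finset.sdiff_ssubset hp.2 ⟨x, hp.1⟩

/-- Weight 1 on uncovered points gives the hard core gas, as weight 0 gives exact covers
(`packSum_zero`). Packings with an empty polymer have weight zero. -/
theorem packSum_one_univ (hw : ∀ p, w p ≠ 0 → (supp p).Nonempty) :
    packSum supp 1 w Finset.univ = hardCoreSum supp w := by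
  simp only [packSum, Pi.one_apply, Finset.prod_const_one, mul_one, hardCoreSum]
  refine Finset.sum_subset ?_ ?_
  · intro S hS
    simpa using (mem_packings.1 hS).1
  · intro S hS hS2
    by_contra hne
    apply hS2
    exact mem_packings.2 ⟨by simpa using hS, fun p hp =>
      ⟨hw p (Finset.prod_ne_zero_iff.1 hne p hp), Finset.subset_univ _⟩⟩

/-- Sums over exact covers. -/
theorem packSum_zero (Λ : Finset L) : packSum supp 0 w Λ =
    ∑ S ∈ packings supp Λ with S.biUnion supp = Λ, ∏ p ∈ S, w p := by
  rw [packSum, Finset.sum_filter]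
  refine Finset.sum_congr rfl fun S hS => ?_
  have hsub : S.biUnion supp ⊆ Λ := Finset.biUnion_subset.2 fun p hp => ((mem_packings.1 hS).2 p hp).2
  split_ifs with h
  · rw [h]; simp
  · have : (Λ \ S.biUnion supp).Nonempty := by
      rw [Finset.sdiff_nonempty]
      exact fun h' => h (hsub.antisymm h')
    obtain ⟨x, hx⟩ := this
    rw [Finset.prod_eq_zero hx (by simp), mul_zero]

end Packings

/-! ### Sums over partitions as packing sums -/

section Partitions

variable {L : Type*} [Fintype L] [DecidableEq L]

theorem sum_partitions (A : Finset L → ℂ) (Ω : Finset L) :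
    ∑ S ∈ partitions Ω, ∏ Z ∈ S, A Z = packSum id 0 A Ω := by
  rw [packSum_zero]
  refine Finset.sum_congr ?_ fun _ _ => rfl
  ext S
  simp only [partitions, Finset.mem_filter, Finset.mem_univ, true_and, mem_packings, id]
  rw [Finset.sup_eq_biUnion]
  constructor
  · rintro ⟨h1, h2, rfl⟩
    exact ⟨⟨h2, fun p hp => ⟨h1 p hp, Finset.subset_biUnion_of_mem id hp⟩⟩, rfl⟩
  · rintro ⟨⟨h1, h2⟩, h3⟩
    exact ⟨fun X hX => (h2 X hX).1, h1, h3⟩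

/-- The activities of pairs `(X, Q)`, extended by `0` to pairs without `∅ ≠ Q ⊆ X`. -/
def markedWeight (B : Finset L → Finset L → ℂ) (p : Finset L × Finset L) : ℂ :=
  if p.2.Nonempty ∧ p.2 ⊆ p.1 then B p.1 p.2 else 0

/-- The zero weight of inadmissible pairs replaces the conditions on marks, and the zero weight of
uncovered points forces a cover. -/
theorem sum_markedPartitions (B : Finset L → Finset L → ℂ) (Ω : Finset L) :
    ∑ S ∈ markedPartitions Ω, ∏ p ∈ S, B p.1 p.2 = packSum Prod.fst 0 (markedWeight B) Ω := by
  rw [packSum_zero]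
  have hsub : markedPartitions Ω ⊆ Finset.filter (fun S => S.biUnion Prod.fst = Ω)
      (packings Prod.fst Ω) := by
    intro S
    simp only [markedPartitions, Finset.mem_filter, Finset.mem_univ, true_and, mem_packings]
    rw [Finset.sup_eq_biUnion]
    rintro ⟨h1, h2, rfl⟩
    exact ⟨⟨h2, fun p hp => ⟨(h1 p hp).1.mono (h1 p hp).2,
      Finset.subset_biUnion_of_mem Prod.fst hp⟩⟩, rfl⟩
  rw [← Finset.sum_subset hsub]
  · refine Finset.sum_congr rfl fun S hS => Finset.prod_congr rfl fun p hp => ?_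
    simp only [markedPartitions, Finset.mem_filter, Finset.mem_univ, true_and] at hS
    rw [markedWeight, if_pos (hS.1 p hp)]
  · intro S hS hS2
    by_contra hne
    apply hS2
    simp only [Finset.mem_filter, mem_packings] at hS
    simp only [markedPartitions, Finset.mem_filter, Finset.mem_univ, true_and]
    rw [Finset.sup_eq_biUnion]
    refine ⟨fun p hp => ?_, hS.1.1, hS.2⟩
    have := Finset.prod_ne_zero_iff.1 hne p hp
    rw [markedWeight] at this
    by_contra h
    exact this (if_neg h)

/-- Sums over pairs of complementary subsets, decomposed according to the side of a point. -/
theorem sum_powerset_split {Λ : Finset L} {x : L} (hx : x ∈ Λ) (f : Finset L → Finset L → ℂ) :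
    ∑ Ω ∈ Λ.powerset, f Ω (Λ \ Ω) =
      ∑ Ω ∈ Λ.powerset with x ∈ Ω, f Ω (Λ \ Ω) + ∑ Ω ∈ Λ.powerset with x ∈ Ω, f (Λ \ Ω) Ω := by
  rw [← Finset.sum_filter_add_sum_filter_not _ (fun Ω => x ∈ Ω)]
  congr 1
  refine Finset.sum_bij' (fun Ω _ => Λ \ Ω) (fun Ω _ => Λ \ Ω) ?_ ?_ ?_ ?_ ?_
  · intro Ω hΩ
    simp only [Finset.mem_filter, Finset.mem_powerset] at hΩ ⊢
    exact ⟨Finset.sdiff_subset, Finset.mem_sdiff.2 ⟨hx, hΩ.2⟩⟩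
  · intro Ω hΩ
    simp only [Finset.mem_filter, Finset.mem_powerset] at hΩ ⊢
    exact ⟨Finset.sdiff_subset, fun h => (Finset.mem_sdiff.1 h).2 hΩ.2⟩
  · intro Ω hΩ
    simp only [Finset.mem_filter, Finset.mem_powerset] at hΩ
    exact Finset.sdiff_sdiff_eq_self hΩ.1
  · intro Ω hΩ
    simp only [Finset.mem_filter, Finset.mem_powerset] at hΩ
    exact Finset.sdiff_sdiff_eq_self hΩ.1
  · intro Ω hΩ
    simp only [Finset.mem_filter, Finset.mem_powerset] at hΩ
    rw [Finset.sdiff_sdiff_eq_self hΩ.1]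

/-- An exact cover of Ω contains one polymer p through x. Choosing p first leaves a free choice of Ω
\ supp p inside Λ \ supp p. -/
theorem sum_powerset_exchange {P : Type*} [Fintype P] {supp : P → Finset L} {w : P → ℂ}
    {Λ : Finset L} {x : L} (g : Finset L → ℂ) :
    ∑ Ω ∈ Λ.powerset with x ∈ Ω, packSum supp 0 w Ω * g (Λ \ Ω) =
      ∑ p : P with x ∈ supp p ∧ supp p ⊆ Λ, w p *
        ∑ Ω ∈ (Λ \ supp p).powerset, packSum supp 0 w Ω * g ((Λ \ supp p) \ Ω) := by
  have h1 : ∀ Ω ∈ Λ.powerset.filter (x ∈ ·), packSum supp 0 w Ω * g (Λ \ Ω) =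
      ∑ p : P with x ∈ supp p ∧ supp p ⊆ Ω, w p * packSum supp 0 w (Ω \ supp p) * g (Λ \ Ω) := by
    intro Ω hΩ
    simp only [Finset.mem_filter, Finset.mem_powerset] at hΩ
    rw [packSum_rec hΩ.2]
    simp [Finset.sum_mul]
  rw [Finset.sum_congr rfl h1]
  simp only [Finset.mul_sum]
  rw [Finset.sum_sigma', Finset.sum_sigma']
  refine Finset.sum_bij' (fun q _ => ⟨q.2, q.1 \ supp q.2⟩) (fun q _ => ⟨q.2 ∪ supp q.1, q.1⟩)
    ?_ ?_ ?_ ?_ ?_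
  · rintro ⟨Ω, p⟩ h
    simp only [Finset.mem_sigma, Finset.mem_filter, Finset.mem_powerset, Finset.mem_univ,
      true_and] at h ⊢
    exact ⟨⟨h.2.1, h.2.2.trans h.1.1⟩, Finset.sdiff_subset_sdiff h.1.1 le_rfl⟩
  · rintro ⟨p, Ω⟩ h
    simp only [Finset.mem_sigma, Finset.mem_filter, Finset.mem_powerset, Finset.mem_univ,
      true_and] at h ⊢
    exact ⟨⟨Finset.union_subset (h.2.trans Finset.sdiff_subset) h.1.2,
      Finset.mem_union_right _ h.1.1⟩, h.1.1, Finset.subset_union_right⟩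
  · rintro ⟨Ω, p⟩ h
    simp only [Finset.mem_sigma, Finset.mem_filter, Finset.mem_powerset, Finset.mem_univ,
      true_and] at h
    simp [Finset.sdiff_union_of_subset h.2.2]
  · rintro ⟨p, Ω⟩ h
    simp only [Finset.mem_sigma, Finset.mem_filter, Finset.mem_powerset, Finset.mem_univ,
      true_and] at h
    have : Disjoint Ω (supp p) := Finset.sdiff_disjoint.mono_left h.2
    simp [Finset.union_sdiff_cancel_right this]
  · rintro ⟨Ω, p⟩ h
    simp only [Finset.mem_sigma, Finset.mem_filter, Finset.mem_powerset, Finset.mem_univ,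
      true_and] at h
    have : (Λ \ supp p) \ (Ω \ supp p) = Λ \ Ω := by
      ext y
      have := @h.2.2 y
      simp only [Finset.mem_sdiff]
      tauto
    rw [this, mul_assoc]

/-- The polymer gas with two kinds of activities is a sum over partitions of the whole set. -/
theorem polymerZ_eq_sum_partitions (A : Finset L → ℂ) (B : Finset L → Finset L → ℂ) :
    polymerZ A B = ∑ S ∈ partitions Finset.univ, ∏ X ∈ S,
      (A X + ∑ Q ∈ X.powerset with Q.Nonempty, B X Q) := by
  rw [sum_partitions]
  -- As a function of Λ the left side satisfies the packing recursion for the summed weight: the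
  -- block of x comes either from A, if x ∈ Ω, or from some B(X, Q).
  have key : ∀ Λ : Finset L, ∑ Ω ∈ Λ.powerset, packSum id 0 A Ω *
      packSum Prod.fst 0 (markedWeight B) (Λ \ Ω) = packSum id 0 (fun X => A X +
        ∑ Q ∈ X.powerset with Q.Nonempty, B X Q) Λ := by
    refine eq_packSum_of_rec (f := fun Λ => ∑ Ω ∈ Λ.powerset, packSum id 0 A Ω *
      packSum Prod.fst 0 (markedWeight B) (Λ \ Ω)) ?_ ?_
    · simp [packSum_empty]
    · intro Λ x hx
      simp only [Pi.zero_apply, zero_mul, zero_add, add_mul, Finset.sum_add_distrib]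
      rw [sum_powerset_split hx fun Ω Ω' => packSum id 0 A Ω *
        packSum Prod.fst 0 (markedWeight B) Ω']
      congr 1
      · exact sum_powerset_exchange _
      · simp only [mul_comm (packSum id 0 A _)]
        rw [sum_powerset_exchange]
        rw [← Finset.univ_product_univ, Finset.sum_filter, Finset.sum_product, Finset.sum_filter]
        refine Finset.sum_congr rfl fun X _ => ?_
        simp only [id]
        split_ifs with hX
        · rw [Finset.sum_mul, Finset.sum_filter, ← Finset.sum_subset (Finset.subset_univ X.powerset)]
          · refine Finset.sum_congr rfl fun Q hQ => ?_
            rw [Finset.mem_powerset] at hQ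
            simp only [markedWeight, hQ, and_true]
            have hset : ∑ Ω ∈ (Λ \ X).powerset, packSum Prod.fst 0 (markedWeight B) Ω *
                packSum id 0 A ((Λ \ X) \ Ω) = ∑ Ω ∈ (Λ \ X).powerset, packSum id 0 A Ω *
                packSum Prod.fst 0 (markedWeight B) ((Λ \ X) \ Ω) := by
              refine Finset.sum_bij' (fun Ω _ => (Λ \ X) \ Ω) (fun Ω _ => (Λ \ X) \ Ω) ?_ ?_ ?_ ?_ ?_
              · intro Ω _; exact Finset.mem_powerset.2 Finset.sdiff_subset
              · intro Ω _; exact Finset.mem_powerset.2 Finset.sdiff_subset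
              · intro Ω h; exact Finset.sdiff_sdiff_eq_self (Finset.mem_powerset.1 h)
              · intro Ω h; exact Finset.sdiff_sdiff_eq_self (Finset.mem_powerset.1 h)
              · intro Ω h
                rw [Finset.sdiff_sdiff_eq_self (Finset.mem_powerset.1 h), mul_comm]
            split_ifs with hQn
            · rw [hset]
              exact congrArg _ (Finset.sum_congr rfl fun _ _ => mul_comm _ _)
            · simp
          · intro Q _ hQ
            rw [Finset.mem_powerset] at hQ
            simp [markedWeight, hQ]
        · simp
  rw [← key, polymerZ]
  simp only [sum_partitions, sum_markedPartitions, Finset.powerset_univ, Finset.compl_eq_univ_sdiff]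

end Partitions

/-! ## The Mayer series of the small field activities -/

section SmallField

variable {L : Type*} [Fintype L] [DecidableEq L]

theorem ursell_eq_connSum {n : ℕ} (Y : Fin n → Finset L) : ursell Y = connSum (incidence Y) := by
  unfold ursell connSum
  refine Finset.sum_congr (by ext; simp) fun g _ => ?_
  rw [Set.ncard_eq_toFinset_card']
  congr 2

/-- A cluster expansion whose clusters are grouped by labels. -/
theorem exp_mayer_grouped {P T : Type*} [Fintype P] (supp : P → Finset L) (w : P → ℂ)
    (labels : Finset T) (seqs : T → (n : ℕ) → Finset (Fin n → P)) (v : P → ℂ)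
    (hw : ∀ p, w p ≠ 0 → (supp p).Nonempty)
    (hgroup : ∀ n, clusterSum supp w (Fin n) = ∑ t ∈ labels, ∑ Y ∈ seqs t n,
      ursell (fun m => supp (Y m)) * ∏ m, v (Y m))
    (hs : ∀ t ∈ labels, Summable fun n : ℕ => ((n.factorial : ℝ))⁻¹ *
      ∑ Y ∈ seqs t n, ‖ursell (fun m => supp (Y m)) * ∏ m, v (Y m)‖) :
    Complex.exp (∑ t ∈ labels, ∑' n : ℕ, ((n.factorial : ℂ))⁻¹ *
      ∑ Y ∈ seqs t n, ursell (fun m => supp (Y m)) * ∏ m, v (Y m)) = hardCoreSum supp w := by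
  have hs' : ∀ t ∈ labels, Summable fun n : ℕ => ‖((n.factorial : ℂ))⁻¹ *
      ∑ Y ∈ seqs t n, ursell (fun m => supp (Y m)) * ∏ m, v (Y m)‖ := by
    intro t ht
    refine Summable.of_nonneg_of_le (fun _ => norm_nonneg _) (fun n => ?_) (hs t ht)
    rw [norm_mul, norm_inv, Complex.norm_natCast]
    gcongr
    exact norm_sum_le _ _
  rw [← exp_mayer supp w hw]
  · rw [← Summable.tsum_finsetSum fun t ht => (hs' t ht).of_norm]
    congr 1
    refine tsum_congr fun n => ?_
    rw [hgroup, Finset.mul_sum]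
  · refine Summable.of_nonneg_of_le (fun _ => norm_nonneg _) (fun n => ?_)
      (summable_sum fun t ht => hs' t ht)
    rw [hgroup, Finset.mul_sum]
    exact norm_sum_le _ _

variable {A : Finset L → ℂ}

/-- A partition is a packing by its blocks with at least two points, the singletons being its
uncovered points with weight A({x}). Dividing by the product of all A({x}) gives each remaining
block its normalized activity. -/
theorem prod_singleton_mul_normAct_sum (hA : ∀ x, A {x} ≠ 0) (Ω : Finset L) :
    packSum id 0 A Ω = (∏ x ∈ Ω, A {x}) *
      packSum id 1 (fun Z => if 2 ≤ Z.card then normAct A Z else 0) Ω := by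
  have h1 : packSum id 0 A Ω =
      packSum id (fun x => A {x}) (fun Z => if 2 ≤ Z.card then A Z else 0) Ω := by
    refine eq_packSum_of_rec packSum_empty (fun Λ x hx => ?_) Ω
    rw [packSum_rec hx, Pi.zero_apply, zero_mul, zero_add]
    have hx' : ({x} : Finset L) ∈ Finset.univ.filter (fun p : Finset L => x ∈ id p ∧ id p ⊆ Λ) := by
      simpa using hx
    rw [← Finset.add_sum_erase _ _ hx']
    congr 1
    · simp [Finset.sdiff_singleton_eq_erase]
    · refine Eq.trans (Finset.sum_congr rfl fun Z hZ => ?_)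
        (Finset.sum_subset (Finset.erase_subset {x} _) ?_)
      · simp only [id, Finset.mem_erase, Finset.mem_filter, Finset.mem_univ, true_and] at hZ
        rw [if_pos]
        refine Nat.one_lt_iff_ne_zero_and_ne_one.2 ⟨fun h => ?_, fun h => ?_⟩
        · rw [Finset.card_eq_zero] at h
          subst h
          simp at hZ
        · obtain ⟨y, rfl⟩ := Finset.card_eq_one.1 h
          simp only [Finset.mem_singleton] at hZ
          exact hZ.1 (by rw [hZ.2.1])
      · intro Z hZ hZ2
        have : Z = {x} := by
          by_contra h
          exact hZ2 (Finset.mem_erase.2 ⟨h, hZ⟩)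
        simp [this]
  rw [h1, packSum, packSum, Finset.mul_sum]
  refine Finset.sum_congr rfl fun S hS => ?_
  rw [mem_packings] at hS
  have hsub : S.biUnion id ⊆ Ω := Finset.biUnion_subset.2 fun p hp => (hS.2 p hp).2
  rw [← Finset.prod_sdiff hsub, Finset.prod_biUnion hS.1]
  have : ∀ Z ∈ S, (if 2 ≤ Z.card then normAct A Z else 0) =
      (if 2 ≤ Z.card then A Z else 0) * (∏ x ∈ Z, A {x})⁻¹ := by
    intro Z _
    split_ifs
    · rw [normAct, Finset.prod_inv_distrib]
    · simp
  rw [Finset.prod_congr rfl this, Finset.prod_mul_distrib, Finset.prod_inv_distrib]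
  simp only [id, Pi.one_apply, Finset.prod_const_one, mul_one]
  have hne : ∏ Z ∈ S, ∏ x ∈ Z, A {x} ≠ 0 :=
    Finset.prod_ne_zero_iff.2 fun Z _ => Finset.prod_ne_zero_iff.2 fun x _ => hA x
  field_simp

/-- One family V serves all Ω simultaneously, because a cluster contributes to the gas in Ω exactly
when its union lies in Ω. The later cancellation between numerator and large field corrections
depends on this. -/
theorem mayer_smallField (hA : ∀ x, A {x} ≠ 0)
    (hs : ∀ X : Finset L, 2 ≤ X.card → Summable fun n : ℕ => ((n.factorial : ℝ))⁻¹ *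
      ∑ Y ∈ mayerSeqs X n, ‖ursell Y * ∏ m, normAct A (Y m)‖) (Ω : Finset L) :
    packSum id 0 A Ω = Complex.exp (∑ Z ∈ Ω.powerset with Z.Nonempty, mayerV A Z) := by
  rw [prod_singleton_mul_normAct_sum hA]
  have hsplit : ∑ Z ∈ Ω.powerset with Z.Nonempty, mayerV A Z =
      ∑ x ∈ Ω, Complex.log (A {x}) + ∑ Z ∈ Ω.powerset with 2 ≤ Z.card, mayerV A Z := by
    rw [← Finset.sum_filter_add_sum_filter_not _ (fun Z => Z.card = 1)]
    congr 1
    · symm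
      refine Finset.sum_bij (fun x _ => {x}) ?_ ?_ ?_ ?_
      · intro x hx; simp [hx]
      · intro x _ y _ h; simpa using h
      · intro Z hZ
        simp only [Finset.mem_filter, Finset.mem_powerset] at hZ
        obtain ⟨x, rfl⟩ := Finset.card_eq_one.1 hZ.2
        exact ⟨x, by simpa using hZ.1.1, rfl⟩
      · intro x _; simp [mayerV]
    · refine Finset.sum_congr ?_ fun _ _ => rfl
      ext Z
      simp only [Finset.mem_filter, ← Finset.card_pos]
      have : 0 < Z.card ∧ Z.card ≠ 1 ↔ 2 ≤ Z.card := by omega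
      tauto
  rw [hsplit, Complex.exp_add, Complex.exp_sum,
    Finset.prod_congr rfl fun x _ => Complex.exp_log (hA x)]
  congr 1
  -- The cutoff to subsets of Ω turns the packing sum in Ω into a hard core sum over all of L.
  set w : Finset L → ℂ := fun Z => if 2 ≤ Z.card ∧ Z ⊆ Ω then normAct A Z else 0 with hw
  have h1 : packSum id 1 (fun Z => if 2 ≤ Z.card then normAct A Z else 0) Ω =
      hardCoreSum id w := by
    simp only [packSum, Pi.one_apply, Finset.prod_const_one, mul_one, hardCoreSum]
    refine Eq.trans (Finset.sum_congr rfl fun S hS => Finset.prod_congr rfl fun Z hZ => ?_)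
        (Finset.sum_subset (s₁ := packings id Ω) ?_ ?_)
    · simp only [hw]
      have : Z ⊆ Ω := ((mem_packings.1 hS).2 Z hZ).2
      simp [this]
    · intro S hS
      simpa using (mem_packings.1 hS).1
    · intro S hS hS2
      by_contra hne
      apply hS2
      refine mem_packings.2 ⟨by simpa using hS, fun Z hZ => ?_⟩
      have := Finset.prod_ne_zero_iff.1 hne Z hZ
      simp only [hw, ne_eq, ite_eq_right_iff, Classical.not_imp] at this
      exact ⟨Finset.card_pos.1 (by have := this.1.1; simp only [id]; omega), this.1.2⟩
  rw [h1]
  symm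
  have h2 : ∀ Z ∈ Ω.powerset.filter (2 ≤ ·.card), mayerV A Z = ∑' n : ℕ, ((n.factorial : ℂ))⁻¹ *
      ∑ Y ∈ mayerSeqs Z n, ursell (fun m => id (Y m)) * ∏ m, normAct A (Y m) := by
    intro Z hZ
    have := (Finset.mem_filter.1 hZ).2
    rw [mayerV, if_neg (by omega)]
    rfl
  rw [Finset.sum_congr rfl h2]
  refine exp_mayer_grouped id w _ mayerSeqs _ ?_ ?_ ?_
  · intro Z hZ
    simp only [hw, ne_eq, ite_eq_right_iff, Classical.not_imp] at hZ
    exact Finset.card_pos.1 (by have := hZ.1.1; simp only [id]; omega)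
  · intro n
    rw [clusterSum]
    simp only [ursell_eq_connSum, id]
    rcases n with _ | n
    -- The empty sequence has union ∅, which is not among the labels; it must and does contribute
    -- zero.
    · simp [connSum_of_isEmpty]
    have : ∀ Y : Fin (n + 1) → Finset L, connSum (incidence fun i => Y i) * ∏ i, w (Y i) =
        if (∀ m, 2 ≤ (Y m).card) ∧ Finset.univ.sup Y ⊆ Ω then
          connSum (incidence fun i => Y i) * ∏ i, normAct A (Y i) else 0 := by
      intro Y
      split_ifs with h
      · congr 1
        refine Finset.prod_congr rfl fun i _ => ?_
        simp only [hw]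
        rw [if_pos ⟨h.1 i, (Finset.le_sup (f := Y) (Finset.mem_univ i)).trans h.2⟩]
      · have : ∃ i, w (Y i) = 0 := by
          by_contra hne
          push Not at hne
          apply h
          have h3 : ∀ i, 2 ≤ (Y i).card ∧ Y i ⊆ Ω := fun i => by
            have := hne i
            simp only [hw, ne_eq, ite_eq_right_iff, Classical.not_imp] at this
            exact this.1
          exact ⟨fun i => (h3 i).1, Finset.sup_le fun i _ => (h3 i).2⟩
        obtain ⟨i, hi⟩ := this
        rw [Finset.prod_eq_zero (Finset.mem_univ i) hi, mul_zero]
    rw [Finset.sum_congr rfl fun Y _ => this Y, ← Finset.sum_filter,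
      ← Finset.sum_fiberwise_of_maps_to (t := Ω.powerset.filter (2 ≤ ·.card))
        (g := fun Y : Fin (n + 1) → Finset L => Finset.univ.sup Y)]
    · refine Finset.sum_congr rfl fun Z hZ => Finset.sum_congr ?_ fun _ _ => rfl
      ext Y
      simp only [Finset.mem_filter, Finset.mem_powerset, Finset.mem_univ, true_and,
        mayerSeqs] at hZ ⊢
      constructor
      · rintro ⟨⟨h1, h2⟩, h3⟩; exact ⟨h3, h1⟩
      · rintro ⟨h1, h2⟩; exact ⟨⟨h2, h1 ▸ hZ.1⟩, h1⟩
    · intro Y hY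
      simp only [Finset.mem_filter, Finset.mem_powerset, Finset.mem_univ, true_and] at hY ⊢
      exact ⟨hY.2, (hY.1 0).trans (Finset.card_le_card (Finset.le_sup (f := Y) (Finset.mem_univ 0)))⟩
  · intro Z hZ
    exact hs Z (Finset.mem_filter.1 hZ).2

end SmallField

/-! ## Sums over sequences with prescribed range -/

section Range

variable {T : Type*} [Fintype T]

/-- Sequences with range exactly `K`, with weights `1/n!`, sum up to `∏_{t ∈ K} (e^{x t} - 1)`. -/
theorem hasSum_sequences (x : T → ℂ) (K : Finset T) :
    HasSum (fun n : ℕ => ((n.factorial : ℂ))⁻¹ *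
      ∑ z : Fin n → T with Finset.univ.image z = K, ∏ m, x (z m))
      (∏ t ∈ K, (Complex.exp (x t) - 1)) := by
  induction K using Finset.strongInduction with
  | _ K ih =>
  -- The exponential series sums sequences with range inside K, while ∏ e^{x t} = ∏ (1 + (e^{x t} -
  -- 1)) expands over subsets of K. Subtracting the proper subsets, known by induction, isolates the
  -- sequences with range K.
  have h1 : HasSum (fun n : ℕ => ((n.factorial : ℂ))⁻¹ * (∑ t ∈ K, x t) ^ n)
      (Complex.exp (∑ t ∈ K, x t)) := by
    rw [Complex.exp_eq_exp_ℂ]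
    simpa using NormedSpace.exp_series_hasSum_exp' (𝕂 := ℂ) (∑ t ∈ K, x t)
  have h2 : ∀ n : ℕ, (∑ t ∈ K, x t) ^ n =
      ∑ K' ∈ K.powerset, ∑ z : Fin n → T with Finset.univ.image z = K', ∏ m, x (z m) := by
    intro n
    have := Finset.prod_univ_sum (fun _ : Fin n => K) (fun _ t => x t)
    rw [Finset.prod_const, Finset.card_univ, Fintype.card_fin] at this
    rw [this, ← Finset.sum_fiberwise_of_maps_to (t := K.powerset)
      (g := fun z : Fin n → T => Finset.univ.image z)]
    · refine Finset.sum_congr rfl fun K' hK' => Finset.sum_congr ?_ fun _ _ => rfl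
      ext z
      simp only [Finset.mem_filter, Fintype.mem_piFinset, Finset.mem_univ, true_and,
        Finset.mem_powerset, and_iff_right_iff_imp] at hK' ⊢
      rintro rfl m
      exact hK' (Finset.mem_image_of_mem z (Finset.mem_univ m))
    · intro z hz
      rw [Fintype.mem_piFinset] at hz
      rw [Finset.mem_powerset]
      intro t ht
      obtain ⟨m, _, rfl⟩ := Finset.mem_image.1 ht
      exact hz m
  have h3 : HasSum (fun n : ℕ => ∑ K' ∈ K.ssubsets, ((n.factorial : ℂ))⁻¹ *
      ∑ z : Fin n → T with Finset.univ.image z = K', ∏ m, x (z m))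
      (∑ K' ∈ K.ssubsets, ∏ t ∈ K', (Complex.exp (x t) - 1)) :=
    hasSum_sum fun K' hK' => ih K' (Finset.mem_ssubsets.1 hK')
  have h4 := h1.sub h3
  have e1 : Complex.exp (∑ t ∈ K, x t) = ∑ K' ∈ K.powerset, ∏ t ∈ K', (Complex.exp (x t) - 1) := by
    rw [← Finset.prod_one_add, Complex.exp_sum]
    simp
  have e2 : K.powerset = insert K K.ssubsets := (Finset.insert_erase (Finset.mem_powerset_self K)).symm
  have e3 : K ∉ K.ssubsets := by simp [Finset.mem_ssubsets]
  have e4 : ∏ t ∈ K, (Complex.exp (x t) - 1) = Complex.exp (∑ t ∈ K, x t) -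
      ∑ K' ∈ K.ssubsets, ∏ t ∈ K', (Complex.exp (x t) - 1) := by
    rw [e1, e2, Finset.sum_insert e3, add_sub_cancel_right]
  rw [e4]
  refine Eq.subst (motive := fun f => HasSum f _) (funext fun n => ?_) h4
  rw [h2, e2, Finset.sum_insert e3, mul_add, ← Finset.mul_sum, add_sub_cancel_right]

end Range

/-! ## Configurations of small field factors and large field polymers -/

section Configurations

variable {L : Type*} [Fintype L] [DecidableEq L]

/-- The set of points of a small field factor `Z` or of a large field polymer `(X, Q)`. -/
def objSupp : Finset L ⊕ (Finset L × Finset L) → Finset L := Sum.elim id Prod.fst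

/-- The union of all sets of a configuration. -/
def confSupp (K : Finset (Finset L ⊕ (Finset L × Finset L))) : Finset L := K.biUnion objSupp

/-- Each small field factor meets a large field polymer; these are pairwise disjoint. -/
structure IsConf (K : Finset (Finset L ⊕ (Finset L × Finset L))) : Prop where
  meets : ∀ Z, Sum.inl Z ∈ K → ∃ p, Sum.inr p ∈ K ∧ (Z ∩ p.1).Nonempty
  marked : ∀ p, Sum.inr p ∈ K → p.2.Nonempty ∧ p.2 ⊆ p.1
  disj : ∀ p q, Sum.inr p ∈ K → Sum.inr q ∈ K → p ≠ q → Disjoint p.1 q.1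

/-- The incidence graph of a configuration. -/
def confGraph (K : Finset (Finset L ⊕ (Finset L × Finset L))) :
    SimpleGraph (Finset L ⊕ (Finset L × Finset L)) where
  Adj o o' := o ≠ o' ∧ o ∈ K ∧ o' ∈ K ∧ (objSupp o ∩ objSupp o').Nonempty
  symm := ⟨fun o o' h => ⟨h.1.symm, h.2.2.1, h.2.1, by rw [Finset.inter_comm]; exact h.2.2.2⟩⟩
  loopless := ⟨fun _ h => h.1 rfl⟩

/-- Connected configurations. -/
def ConfConnected (K : Finset (Finset L ⊕ (Finset L × Finset L))) : Prop :=
  K.Nonempty ∧ ∀ o ∈ K, ∀ o' ∈ K, (confGraph K).Reachable o o'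

variable {K K₁ K₂ : Finset (Finset L ⊕ (Finset L × Finset L))}

theorem IsConf.objSupp_nonempty (hK : IsConf K) {o} (ho : o ∈ K) : (objSupp o).Nonempty := by
  rcases o with Z | p
  · obtain ⟨p, _, hp⟩ := hK.meets Z ho
    exact hp.mono Finset.inter_subset_left
  · exact (hK.marked p ho).1.mono (hK.marked p ho).2

theorem objSupp_subset_confSupp {o} (ho : o ∈ K) : objSupp o ⊆ confSupp K :=
  Finset.subset_biUnion_of_mem objSupp ho

theorem IsConf.union (h₁ : IsConf K₁) (h₂ : IsConf K₂)
    (h : Disjoint (confSupp K₁) (confSupp K₂)) : IsConf (K₁ ∪ K₂) := by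
  refine ⟨fun Z hZ => ?_, fun p hp => ?_, fun p q hp hq hpq => ?_⟩
  · rcases Finset.mem_union.1 hZ with hZ | hZ
    · obtain ⟨p, hp, h⟩ := h₁.meets Z hZ
      exact ⟨p, Finset.mem_union_left _ hp, h⟩
    · obtain ⟨p, hp, h⟩ := h₂.meets Z hZ
      exact ⟨p, Finset.mem_union_right _ hp, h⟩
  · rcases Finset.mem_union.1 hp with hp | hp
    · exact h₁.marked p hp
    · exact h₂.marked p hp
  · rcases Finset.mem_union.1 hp with hp | hp <;> rcases Finset.mem_union.1 hq with hq | hq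
    · exact h₁.disj p q hp hq hpq
    · exact h.mono (objSupp_subset_confSupp hp) (objSupp_subset_confSupp hq)
    · exact (h.mono (objSupp_subset_confSupp hq) (objSupp_subset_confSupp hp)).symm
    · exact h₂.disj p q hp hq hpq

/-- A part of a configuration that does not touch the rest. -/
theorem IsConf.part (hK : IsConf K) (hsub : K₁ ⊆ K)
    (hcl : ∀ o ∈ K₁, ∀ o' ∈ K, o' ∉ K₁ → Disjoint (objSupp o) (objSupp o')) : IsConf K₁ := by
  refine ⟨fun Z hZ => ?_, fun p hp => hK.marked p (hsub hp),
    fun p q hp hq => hK.disj p q (hsub hp) (hsub hq)⟩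
  obtain ⟨p, hp, h⟩ := hK.meets Z (hsub hZ)
  refine ⟨p, ?_, h⟩
  by_contra hp1
  exact h.ne_empty (Finset.disjoint_iff_inter_eq_empty.1 (hcl _ hZ _ hp hp1))

/-- The component of a configuration that contains a point. -/
def confComponent (K : Finset (Finset L ⊕ (Finset L × Finset L))) (x : L) :
    Finset (Finset L ⊕ (Finset L × Finset L)) :=
  K.filter fun o => ∃ o' ∈ K, x ∈ objSupp o' ∧ (confGraph K).Reachable o' o

theorem confComponent_closed {x : L} {o o' : Finset L ⊕ (Finset L × Finset L)}
    (ho : o ∈ confComponent K x) (ho' : o' ∈ K) (hn : o' ∉ confComponent K x) :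
    Disjoint (objSupp o) (objSupp o') := by
  rw [Finset.disjoint_iff_inter_eq_empty]
  by_contra h
  obtain ⟨hoK, o₀, h₀, hx, hr⟩ := Finset.mem_filter.1 ho
  apply hn
  refine Finset.mem_filter.2 ⟨ho', o₀, h₀, hx, hr.trans (SimpleGraph.Adj.reachable ?_)⟩
  exact ⟨fun e => hn (e ▸ ho), hoK, ho', Finset.nonempty_iff_ne_empty.2 h⟩

/-- A path of K that starts in K₁ cannot leave it, because nothing outside touches K₁. -/
theorem reachable_of_closed {o o' : Finset L ⊕ (Finset L × Finset L)}
    (hcl : ∀ o ∈ K₁, ∀ o' ∈ K, o' ∉ K₁ → Disjoint (objSupp o) (objSupp o'))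
    (ho : o ∈ K₁) (h : (confGraph K).Reachable o o') :
    o' ∈ K₁ ∧ (confGraph K₁).Reachable o o' := by
  obtain ⟨p⟩ := h
  induction p with
  | nil => exact ⟨ho, SimpleGraph.Reachable.refl _⟩
  | @cons a b c hadj _ ih =>
    have hb : b ∈ K₁ := by
      by_contra hb
      exact hadj.2.2.2.ne_empty (Finset.disjoint_iff_inter_eq_empty.1 (hcl _ ho _ hadj.2.2.1 hb))
    obtain ⟨h1, h2⟩ := ih hb
    refine ⟨h1, SimpleGraph.Reachable.trans (SimpleGraph.Adj.reachable ?_) h2⟩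
    exact ⟨hadj.1, ho, hb, hadj.2.2.2⟩

theorem confComponent_subset (x : L) : confComponent K x ⊆ K := Finset.filter_subset _ _

theorem confGraph_mono (h : K₁ ⊆ K) : confGraph K₁ ≤ confGraph K :=
  fun _ _ hadj => ⟨hadj.1, h hadj.2.1, h hadj.2.2.1, hadj.2.2.2⟩

theorem reachable_of_common {x : L} {o o' : Finset L ⊕ (Finset L × Finset L)} (ho : o ∈ K)
    (ho' : o' ∈ K) (hx : x ∈ objSupp o) (hx' : x ∈ objSupp o') : (confGraph K).Reachable o o' := by
  by_cases h : o = o'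
  · rw [h]
  · exact SimpleGraph.Adj.reachable ⟨h, ho, ho', ⟨x, Finset.mem_inter.2 ⟨hx, hx'⟩⟩⟩

theorem confComponent_connected {x : L} (hx : x ∈ confSupp K) :
    ConfConnected (confComponent K x) ∧ x ∈ confSupp (confComponent K x) := by
  obtain ⟨o₀, h₀, hx₀⟩ := Finset.mem_biUnion.1 hx
  have hmem : o₀ ∈ confComponent K x :=
    Finset.mem_filter.2 ⟨h₀, o₀, h₀, hx₀, SimpleGraph.Reachable.refl _⟩
  have hr : ∀ o ∈ confComponent K x, (confGraph (confComponent K x)).Reachable o₀ o := by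
    intro o ho
    obtain ⟨_, o₁, h₁, hx₁, hr⟩ := Finset.mem_filter.1 ho
    exact (reachable_of_closed
      (fun _ ho _ ho' hn => confComponent_closed ho ho' hn) hmem
      ((reachable_of_common h₀ h₁ hx₀ hx₁).trans hr)).2
  exact ⟨⟨⟨_, hmem⟩, fun o ho o' ho' => (hr o ho).symm.trans (hr o' ho')⟩,
    Finset.mem_biUnion.2 ⟨o₀, hmem, hx₀⟩⟩

theorem confComponent_union {x : L} (hc : ConfConnected K₁) (hx : x ∈ confSupp K₁)
    (h : Disjoint (confSupp K₁) (confSupp K₂)) : confComponent (K₁ ∪ K₂) x = K₁ := by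
  obtain ⟨o₀, h₀, hx₀⟩ := Finset.mem_biUnion.1 hx
  have hcl : ∀ o ∈ K₁, ∀ o' ∈ K₁ ∪ K₂, o' ∉ K₁ → Disjoint (objSupp o) (objSupp o') := by
    intro o ho o' ho' hn
    have := (Finset.mem_union.1 ho').resolve_left hn
    exact h.mono (objSupp_subset_confSupp ho) (objSupp_subset_confSupp this)
  ext o
  constructor
  · intro ho
    obtain ⟨hoK, o₁, h₁, hx₁, hr⟩ := Finset.mem_filter.1 ho
    have h₁' : o₁ ∈ K₁ := by
      rcases Finset.mem_union.1 h₁ with h₁ | h₁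
      · exact h₁
      · exact absurd (objSupp_subset_confSupp h₁ hx₁) (Finset.disjoint_left.1 h hx)
    exact (reachable_of_closed hcl h₁' hr).1
  · intro ho
    exact Finset.mem_filter.2 ⟨Finset.mem_union_left _ ho, o₀, Finset.mem_union_left _ h₀, hx₀,
      (hc.2 o₀ h₀ o ho).mono (confGraph_mono Finset.subset_union_left)⟩

/-- The weight of a configuration. -/
def confWeight (y : Finset L → ℂ) (B : Finset L → Finset L → ℂ)
    (K : Finset (Finset L ⊕ (Finset L × Finset L))) : ℂ :=
  ∏ o ∈ K, Sum.elim y (fun p => B p.1 p.2) o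

/-- The sum over all configurations inside `Λ`. -/
def confSum (y : Finset L → ℂ) (B : Finset L → Finset L → ℂ) (Λ : Finset L) : ℂ :=
  ∑ K ∈ Finset.univ.filter
    (fun K : Finset (Finset L ⊕ (Finset L × Finset L)) => IsConf K ∧ confSupp K ⊆ Λ),
    confWeight y B K

variable {y : Finset L → ℂ} {B : Finset L → Finset L → ℂ}

theorem confSupp_eq_empty (hK : IsConf K) (h : confSupp K = ∅) : K = ∅ := by
  refine Finset.eq_empty_of_forall_notMem fun o ho => ?_
  have h1 := hK.objSupp_nonempty ho
  exact h1.ne_empty (Finset.subset_empty.1 (h ▸ objSupp_subset_confSupp ho))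

theorem isConf_empty : IsConf (∅ : Finset (Finset L ⊕ (Finset L × Finset L))) :=
  ⟨by simp, by simp, by simp⟩

theorem confSum_empty : confSum y B ∅ = 1 := by
  have : Finset.univ.filter (fun K : Finset (Finset L ⊕ (Finset L × Finset L)) =>
      IsConf K ∧ confSupp K ⊆ ∅) = {∅} := by
    ext K
    simp only [Finset.mem_filter, Finset.mem_univ, true_and, Finset.mem_singleton,
      Finset.subset_empty]
    refine ⟨fun h => confSupp_eq_empty h.1 h.2, ?_⟩
    rintro rfl
    exact ⟨isConf_empty, by simp [confSupp]⟩
  rw [confSum, this]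
  simp [confWeight]

theorem disjoint_of_confSupp (h₁ : IsConf K₁) (h : Disjoint (confSupp K₁) (confSupp K₂)) :
    Disjoint K₁ K₂ := by
  rw [Finset.disjoint_left]
  intro o ho ho'
  obtain ⟨x, hx⟩ := h₁.objSupp_nonempty ho
  exact Finset.disjoint_left.1 h (objSupp_subset_confSupp ho hx) (objSupp_subset_confSupp ho' hx)

theorem confSupp_union : confSupp (K₁ ∪ K₂) = confSupp K₁ ∪ confSupp K₂ :=
  Finset.union_biUnion

theorem confSupp_sdiff_confComponent (x : L) :
    Disjoint (confSupp (confComponent K x)) (confSupp (K \ confComponent K x)) := by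
  rw [confSupp, confSupp, Finset.disjoint_biUnion_left]
  intro o ho
  rw [Finset.disjoint_biUnion_right]
  intro o' ho'
  rw [Finset.mem_sdiff] at ho'
  exact confComponent_closed ho ho'.1 ho'.2

/-- Decomposition according to the component of a point. -/
theorem confSum_rec (Λ : Finset L) (x : L) : confSum y B Λ =
    confSum y B (Λ.erase x) + ∑ K ∈ Finset.univ.filter
      (fun K : Finset (Finset L ⊕ (Finset L × Finset L)) =>
        (IsConf K ∧ ConfConnected K) ∧ x ∈ confSupp K ∧ confSupp K ⊆ Λ),
      confWeight y B K * confSum y B (Λ \ confSupp K) := by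
  rw [confSum, ← Finset.sum_filter_add_sum_filter_not _ (fun K => x ∉ confSupp K)]
  congr 1
  · rw [confSum, Finset.filter_filter]
    refine Finset.sum_congr ?_ fun _ _ => rfl
    ext K
    simp only [Finset.mem_filter, Finset.mem_univ, true_and, Finset.subset_erase]
    tauto
  · simp only [confSum, Finset.mul_sum]
    rw [Finset.sum_sigma']
    -- The part of K away from the component of x shares no point with it. Conversely, the union
    -- with a configuration of disjoint support has the given connected one as its component.
    refine Finset.sum_bij' (fun K _ => ⟨confComponent K x, K \ confComponent K x⟩)
      (fun q _ => q.1 ∪ q.2) ?_ ?_ ?_ ?_ ?_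
    · intro K hK
      simp only [Finset.mem_filter, Finset.mem_univ, true_and, not_not] at hK
      obtain ⟨⟨hK, hΛ⟩, hxK⟩ := hK
      have hsub : confSupp (confComponent K x) ⊆ confSupp K :=
        Finset.biUnion_subset_biUnion_of_subset_left _ (confComponent_subset x)
      have hsub2 : confSupp (K \ confComponent K x) ⊆ confSupp K :=
        Finset.biUnion_subset_biUnion_of_subset_left _ Finset.sdiff_subset
      simp only [Finset.mem_sigma, Finset.mem_filter, Finset.mem_univ, true_and]
      refine ⟨⟨⟨hK.part (confComponent_subset x)
        (fun _ ho _ ho' hn => confComponent_closed ho ho' hn), (confComponent_connected hxK).1⟩,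
        (confComponent_connected hxK).2, hsub.trans hΛ⟩, hK.part Finset.sdiff_subset ?_, ?_⟩
      · intro o ho o' ho' hn
        rw [Finset.mem_sdiff] at ho
        have : o' ∈ confComponent K x := by
          by_contra h
          exact hn (Finset.mem_sdiff.2 ⟨ho', h⟩)
        exact (confComponent_closed this ho.1 ho.2).symm
      · exact Finset.subset_sdiff.2 ⟨hsub2.trans hΛ, (confSupp_sdiff_confComponent x).symm⟩
    · rintro ⟨K₁, K₂⟩ h
      simp only [Finset.mem_sigma, Finset.mem_filter, Finset.mem_univ, true_and, not_not,
        Finset.subset_sdiff] at h ⊢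
      obtain ⟨⟨⟨h₁, hc⟩, hx₁, hΛ₁⟩, h₂, hΛ₂, hd⟩ := h
      rw [confSupp_union]
      exact ⟨⟨h₁.union h₂ hd.symm, Finset.union_subset hΛ₁ hΛ₂⟩, Finset.mem_union_left _ hx₁⟩
    · intro K hK
      exact Finset.union_sdiff_of_subset (confComponent_subset x)
    · rintro ⟨K₁, K₂⟩ h
      simp only [Finset.mem_sigma, Finset.mem_filter, Finset.mem_univ, true_and,
        Finset.subset_sdiff] at h
      obtain ⟨⟨⟨h₁, hc⟩, hx₁, hΛ₁⟩, h₂, hΛ₂, hd⟩ := h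
      rw [confComponent_union hc hx₁ hd.symm,
        Finset.union_sdiff_cancel_left (disjoint_of_confSupp h₁ hd.symm)]
    · intro K hK
      simp only [confWeight]
      rw [mul_comm, Finset.prod_sdiff (confComponent_subset x)]

/-- The triple `(Z, X, Q)` of a configuration. -/
def confLabel (K : Finset (Finset L ⊕ (Finset L × Finset L))) :
    Finset L × Finset L × Finset L :=
  (K.toLeft.sup id, K.toRight.sup Prod.fst, K.toRight.sup Prod.snd)

theorem confSupp_eq_label : confSupp K = (confLabel K).1 ∪ (confLabel K).2.1 := by
  ext x
  simp only [confSupp, confLabel, Finset.mem_biUnion, Finset.mem_union, Finset.mem_sup,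
    Finset.mem_toLeft, Finset.mem_toRight, id]
  constructor
  · rintro ⟨Z | p, h, hx⟩
    · exact Or.inl ⟨Z, h, hx⟩
    · exact Or.inr ⟨p, h, hx⟩
  · rintro (⟨Z, h, hx⟩ | ⟨p, h, hx⟩)
    · exact ⟨_, h, hx⟩
    · exact ⟨_, h, hx⟩

theorem confLabel_mem (hK : IsConf K) (hne : K.Nonempty) : confLabel K ∈ tripleSet L := by
  have hp : ∃ p, Sum.inr p ∈ K := by
    obtain ⟨Z | p, ho⟩ := hne
    · obtain ⟨p, hp, _⟩ := hK.meets Z ho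
      exact ⟨p, hp⟩
    · exact ⟨p, ho⟩
  simp only [tripleSet, Finset.mem_filter, Finset.mem_univ, true_and, confLabel]
  refine ⟨?_, ?_, ?_⟩
  · obtain ⟨p, hp⟩ := hp
    exact (hK.marked p hp).1.mono (Finset.le_sup (f := Prod.snd) (Finset.mem_toRight.2 hp))
  · refine Finset.sup_le fun p hp => ?_
    rw [Finset.mem_toRight] at hp
    exact (hK.marked p hp).2.trans (Finset.le_sup (f := Prod.fst) (Finset.mem_toRight.2 hp))
  · by_cases h : ∃ Z, Sum.inl Z ∈ K
    · right
      obtain ⟨Z, hZ⟩ := h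
      obtain ⟨p, hp, hn⟩ := hK.meets Z hZ
      exact hn.mono (Finset.inter_subset_inter
        (Finset.le_sup (f := id) (Finset.mem_toLeft.2 hZ))
        (Finset.le_sup (f := Prod.fst) (Finset.mem_toRight.2 hp)))
    · left
      push Not at h
      have : K.toLeft = ∅ := Finset.eq_empty_of_forall_notMem fun Z hZ =>
        h Z (Finset.mem_toLeft.1 hZ)
      rw [this]; rfl

/-- The connected configurations with a given triple. -/
def connConfs (M : Finset L × Finset L × Finset L) :
    Finset (Finset (Finset L ⊕ (Finset L × Finset L))) :=
  Finset.univ.filter fun K => (IsConf K ∧ ConfConnected K) ∧ confLabel K = M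

/-- Configurations form a gas of connected configurations. -/
theorem confSum_eq_packSum (Λ : Finset L) : confSum y B Λ =
    packSum (fun M : Finset L × Finset L × Finset L => M.1 ∪ M.2.1) 1
      (fun M => if M ∈ tripleSet L then ∑ K ∈ connConfs M, confWeight y B K else 0) Λ := by
  refine eq_packSum_of_rec confSum_empty (fun Λ x _ => ?_) Λ
  rw [confSum_rec Λ x, Pi.one_apply, one_mul]
  congr 1
  -- The factor of the remaining points depends on K only through its support, hence only through
  -- its triple, so the weights can be summed over each triple.
  rw [← Finset.sum_fiberwise_of_maps_to (t := Finset.univ.filter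
    fun M : Finset L × Finset L × Finset L => x ∈ M.1 ∪ M.2.1 ∧ M.1 ∪ M.2.1 ⊆ Λ) (g := confLabel)]
  · refine Finset.sum_congr rfl fun M hM => ?_
    simp only [Finset.mem_filter, Finset.mem_univ, true_and] at hM
    have hset : (Finset.univ.filter (fun K : Finset (Finset L ⊕ (Finset L × Finset L)) =>
        (IsConf K ∧ ConfConnected K) ∧ x ∈ confSupp K ∧ confSupp K ⊆ Λ)).filter
        (fun K => confLabel K = M) = connConfs M := by
      ext K
      simp only [connConfs, Finset.mem_filter, Finset.mem_univ, true_and]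
      constructor
      · tauto
      · rintro ⟨h, rfl⟩
        rw [confSupp_eq_label]
        exact ⟨⟨h, hM⟩, rfl⟩
    rw [hset]
    have : ∀ K ∈ connConfs M, confWeight y B K * confSum y B (Λ \ confSupp K) =
        confWeight y B K * confSum y B (Λ \ (M.1 ∪ M.2.1)) := by
      intro K hK
      simp only [connConfs, Finset.mem_filter, Finset.mem_univ, true_and] at hK
      rw [confSupp_eq_label, hK.2]
    rw [Finset.sum_congr rfl this, ← Finset.sum_mul]
    split_ifs with h
    · rfl
    · have : connConfs M = ∅ := by
        refine Finset.eq_empty_of_forall_notMem fun K hK => h ?_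
        simp only [connConfs, Finset.mem_filter, Finset.mem_univ, true_and] at hK
        rw [← hK.2]
        exact confLabel_mem hK.1.1 hK.1.2.1
      rw [this]; simp
  · intro K hK
    simp only [Finset.mem_filter, Finset.mem_univ, true_and] at hK ⊢
    rw [← confSupp_eq_label]
    exact hK.2

end Configurations

/-! ## The modified Mayer series -/

section Mayer

variable {L : Type*} [Fintype L] [DecidableEq L]

/-- Repeated objects are adjacent to one another because their supports are nonempty, so
connectedness depends only on the range of the family. -/
theorem incidence_connected_iff {κ : Type*} (f : κ → Finset L ⊕ (Finset L × Finset L))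
    {K : Finset (Finset L ⊕ (Finset L × Finset L))} (hf : ∀ o, o ∈ K ↔ ∃ i, f i = o)
    (hne : ∀ i, (objSupp (f i)).Nonempty) :
    (incidence fun i => objSupp (f i)).Connected ↔ ConfConnected K := by
  have hadj : ∀ i j, (incidence fun i => objSupp (f i)).Adj i j ↔
      i ≠ j ∧ (objSupp (f i) ∩ objSupp (f j)).Nonempty := by
    intro i j
    simp only [incidence, SimpleGraph.fromRel_adj, Finset.inter_comm (objSupp (f j)), or_self]
  constructor
  · intro h
    obtain ⟨i⟩ := h.nonempty
    refine ⟨⟨f i, (hf _).2 ⟨i, rfl⟩⟩, fun o ho o' ho' => ?_⟩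
    obtain ⟨i, rfl⟩ := (hf o).1 ho
    obtain ⟨j, rfl⟩ := (hf o').1 ho'
    obtain ⟨p⟩ := h.preconnected i j
    clear ho ho'
    induction p with
    | nil => exact SimpleGraph.Reachable.refl _
    | @cons a b c hab _ ih =>
      refine SimpleGraph.Reachable.trans ?_ ih
      by_cases he : f a = f b
      · rw [he]
      · exact SimpleGraph.Adj.reachable
          ⟨he, (hf _).2 ⟨a, rfl⟩, (hf _).2 ⟨b, rfl⟩, ((hadj _ _).1 hab).2⟩
  · intro h
    have key : ∀ o o', (confGraph K).Reachable o o' → ∀ i j, f i = o → f j = o' →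
        (incidence fun i => objSupp (f i)).Reachable i j := by
      rintro o o' ⟨p⟩
      have hstep : ∀ i j, (objSupp (f i) ∩ objSupp (f j)).Nonempty →
          (incidence fun i => objSupp (f i)).Reachable i j := by
        intro i j hij
        by_cases he : i = j
        · rw [he]
        · exact SimpleGraph.Adj.reachable ((hadj _ _).2 ⟨he, hij⟩)
      induction p with
      | nil =>
        rintro i j rfl hj
        exact hstep i j (by rw [hj, Finset.inter_self]; exact hne i)
      | @cons a b c hab _ ih =>
        rintro i j rfl hj
        obtain ⟨k, hk⟩ := (hf b).1 hab.2.2.1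
        exact (hstep i k (by rw [hk]; exact hab.2.2.2)).trans (ih k j hk hj)
    obtain ⟨o, ho⟩ := h.1
    obtain ⟨i, _⟩ := (hf o).1 ho
    have : Nonempty κ := ⟨i⟩
    exact ⟨fun i j => key _ _ (h.2 _ ((hf _).2 ⟨i, rfl⟩) _ ((hf _).2 ⟨j, rfl⟩)) i j rfl rfl⟩

/-- Consequently the conditions on (Z_{m'}) in Ḃ see only the set of values of the sequence; the
weights 1/n'! can be summed for each such set. -/
theorem mem_clusterConfs_iff {M : Finset L × Finset L × Finset L} (hM : M ∈ tripleSet L) {n : ℕ}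
    (c : (Fin n → Finset L) × Finset (Finset L × Finset L)) :
    c ∈ clusterConfs M n ↔ (Finset.univ.image c.1).disjSum c.2 ∈ connConfs M := by
  obtain ⟨z, S⟩ := c
  obtain ⟨Z, X, Q⟩ := M
  simp only [tripleSet, Finset.mem_filter, Finset.mem_univ, true_and] at hM
  simp only [clusterConfs, connConfs, markedPartitions, Finset.mem_filter, Finset.mem_univ,
    true_and, confLabel, Finset.toLeft_disjSum, Finset.toRight_disjSum, Prod.mk.injEq,
    Finset.sup_image, Function.id_comp]
  set f : Fin n ⊕ S → Finset L ⊕ (Finset L × Finset L) :=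
    Sum.elim (fun m => Sum.inl (z m)) (fun p => Sum.inr p.1) with hf
  have hff : (Sum.elim z fun p : S => p.1.1) = fun i => objSupp (f i) := by
    funext i
    rcases i with m | p <;> rfl
  have hmem : ∀ o, o ∈ (Finset.univ.image z).disjSum S ↔ ∃ i, f i = o := by
    intro o
    rcases o with W | p
    · simp [hf]
    · simp [hf]
  have hmemS : ∀ p ∈ S, ∃ p' : S, p'.1 = p := fun p hp => ⟨⟨p, hp⟩, rfl⟩
  rw [hff]
  constructor
  · rintro ⟨⟨h1, h2, h3⟩, h4, h5, h6, h7⟩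
    have hS : S.Nonempty := by
      rw [Finset.nonempty_iff_ne_empty]
      rintro rfl
      have : Q ⊆ ∅ := hM.2.1.trans (by rw [← h3]; exact le_rfl)
      exact hM.1.ne_empty (Finset.subset_empty.1 this)
    obtain ⟨p₀, hp₀⟩ := hS
    -- The graph has the further vertex p₀, so connectedness gives each Z_m a neighbour: the
    -- alternative Z_m = ∅ in the definition never occurs.
    have hne : ∀ i, (objSupp (f i)).Nonempty := by
      rintro (m | p)
      · obtain ⟨w⟩ := h5.preconnected (Sum.inl m) (Sum.inr ⟨p₀, hp₀⟩)
        cases w with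
        | cons hadj _ =>
          simp only [incidence, SimpleGraph.fromRel_adj] at hadj
          rcases hadj.2 with h | h
          · exact h.mono Finset.inter_subset_left
          · exact h.mono Finset.inter_subset_right
      · exact (h1 p.1 p.2).1.mono (h1 p.1 p.2).2
    refine ⟨⟨⟨fun W hW => ?_, fun p hp => ?_, fun p q hp hq hpq => ?_⟩,
      (incidence_connected_iff f hmem hne).1 h5⟩, h6, h3, h7⟩
    · simp only [Finset.inl_mem_disjSum, Finset.mem_image, Finset.mem_univ, true_and] at hW
      obtain ⟨m, rfl⟩ := hW
      rcases h4 m with h | h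
      · exact absurd h (hne (Sum.inl m)).ne_empty
      · obtain ⟨x, hx⟩ := h
        rw [Finset.mem_inter, ← h3, Finset.mem_sup] at hx
        obtain ⟨hx, p, hp, hxp⟩ := hx
        exact ⟨p, Finset.inr_mem_disjSum.2 hp, x, Finset.mem_inter.2 ⟨hx, hxp⟩⟩
    · exact h1 p (Finset.inr_mem_disjSum.1 hp)
    · exact h2 (Finset.inr_mem_disjSum.1 hp) (Finset.inr_mem_disjSum.1 hq) hpq
  · rintro ⟨⟨hK, hc⟩, h6, h3, h7⟩
    have hne : ∀ i, (objSupp (f i)).Nonempty := fun i => hK.objSupp_nonempty ((hmem _).2 ⟨i, rfl⟩)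
    refine ⟨⟨fun p hp => hK.marked p (Finset.inr_mem_disjSum.2 hp), fun p hp q hq hpq =>
      hK.disj p q (Finset.inr_mem_disjSum.2 hp) (Finset.inr_mem_disjSum.2 hq) hpq, h3⟩,
      fun m => Or.inr ?_, (incidence_connected_iff f hmem hne).2 hc, h6, h7⟩
    obtain ⟨p, hp, hn⟩ := hK.meets (z m) (by simp)
    refine hn.mono (Finset.inter_subset_inter le_rfl ?_)
    rw [← h3]
    exact Finset.le_sup (f := Prod.fst) (Finset.inr_mem_disjSum.1 hp)

/-- Sequences with a prescribed set of values sum up to the product of the e^{-V(Z)} - 1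
(`hasSum_sequences`). Thus the series Ḃ converges for arbitrary V, to the total weight of the
connected configurations of the triple. -/
theorem dotB_eq_sum_connConfs (V : Finset L → ℂ) (B : Finset L → Finset L → ℂ)
    {M : Finset L × Finset L × Finset L} (hM : M ∈ tripleSet L) :
    dotB V B M = ∑ K ∈ connConfs M, confWeight (fun Z => Complex.exp (-V Z) - 1) B K := by
  have h1 : ∀ n : ℕ, ∑ c ∈ clusterConfs M n, (∏ m, -V (c.1 m)) * ∏ p ∈ c.2, B p.1 p.2 =
      ∑ K ∈ connConfs M, (∏ p ∈ K.toRight, B p.1 p.2) *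
        ∑ z : Fin n → Finset L with Finset.univ.image z = K.toLeft, ∏ m, -V (z m) := by
    intro n
    rw [← Finset.sum_fiberwise_of_maps_to (t := connConfs M)
      (g := fun c => (Finset.univ.image c.1).disjSum c.2)
      (fun c hc => (mem_clusterConfs_iff hM c).1 hc)]
    refine Finset.sum_congr rfl fun K hK => ?_
    rw [Finset.mul_sum]
    refine Finset.sum_bij' (fun c _ => c.1) (fun z _ => (z, K.toRight)) ?_ ?_ ?_ ?_ ?_
    · intro c hc
      have := (Finset.mem_filter.1 hc).2
      simp [← this]
    · intro z hz
      have : (Finset.univ.image z).disjSum K.toRight = K := by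
        rw [(Finset.mem_filter.1 hz).2, Finset.toLeft_disjSum_toRight]
      refine Finset.mem_filter.2 ⟨(mem_clusterConfs_iff hM _).2 ?_, this⟩
      simpa only [this] using hK
    · intro c hc
      have := (Finset.mem_filter.1 hc).2
      simp [← this]
    · intro z hz; rfl
    · intro c hc
      have := (Finset.mem_filter.1 hc).2
      simp [← this, mul_comm]
  have h2 : HasSum (fun n : ℕ => ((n.factorial : ℂ))⁻¹ *
      ∑ c ∈ clusterConfs M n, (∏ m, -V (c.1 m)) * ∏ p ∈ c.2, B p.1 p.2)
      (∑ K ∈ connConfs M, (∏ p ∈ K.toRight, B p.1 p.2) *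
        ∏ Z ∈ K.toLeft, (Complex.exp (-V Z) - 1)) := by
    have := hasSum_sum (s := connConfs M) fun K _ =>
      (hasSum_sequences (fun Z => -V Z) K.toLeft).mul_left (∏ p ∈ K.toRight, B p.1 p.2)
    refine Eq.subst (motive := fun f => HasSum f _) (funext fun n => ?_) this
    rw [h1, Finset.mul_sum]
    exact Finset.sum_congr rfl fun K _ => by rw [mul_left_comm]; congr!
  rw [dotB, h2.tsum_eq]
  refine Finset.sum_congr rfl fun K _ => ?_
  rw [confWeight]
  conv_rhs => rw [← Finset.toLeft_disjSum_toRight (u := K)]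
  rw [Finset.prod_disjSum, mul_comm]
  rfl

variable {A : Finset L → ℂ} {B : Finset L → Finset L → ℂ}

/-- The second Mayer expansion: triples are the polymers, with support Z ∪ X and weight Ḃ, and
clusters are grouped by their componentwise unions. These unions are again triples of `tripleSet`.
-/
theorem exp_sum_mayerL (V : Finset L → ℂ)
    (hs : ∀ M ∈ tripleSet L, Summable fun n : ℕ => ((n.factorial : ℝ))⁻¹ *
      ∑ Y ∈ tripleSeqs M n, ‖ursell (fun m => (Y m).1 ∪ (Y m).2.1) * ∏ m, dotB V B (Y m)‖) :
    Complex.exp (∑ M ∈ tripleSet L, mayerL V B M) =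
      confSum (fun Z => Complex.exp (-V Z) - 1) B Finset.univ := by
  set w : Finset L × Finset L × Finset L → ℂ := fun M =>
    if M ∈ tripleSet L then dotB V B M else 0 with hw
  have hw2 : (fun M => if M ∈ tripleSet L then
      ∑ K ∈ connConfs M, confWeight (fun Z => Complex.exp (-V Z) - 1) B K else 0) = w := by
    funext M
    simp only [hw]
    split_ifs with h
    · rw [dotB_eq_sum_connConfs V B h]
    · rfl
  have hne : ∀ M, w M ≠ 0 → (M.1 ∪ M.2.1).Nonempty := by
    intro M hM
    simp only [hw, ne_eq, ite_eq_right_iff, Classical.not_imp, tripleSet, Finset.mem_filter] at hM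
    exact (hM.1.2.1.mono hM.1.2.2.1).mono Finset.subset_union_right
  rw [confSum_eq_packSum, hw2, packSum_one_univ hne]
  refine exp_mayer_grouped (fun M : Finset L × Finset L × Finset L => M.1 ∪ M.2.1) w (tripleSet L)
    tripleSeqs (dotB V B) hne ?_ hs
  intro n
  rw [clusterSum]
  simp only [ursell_eq_connSum]
  rcases n with _ | n
  · simp [connSum_of_isEmpty]
  have : ∀ Y : Fin (n + 1) → Finset L × Finset L × Finset L,
      connSum (incidence fun i => (Y i).1 ∪ (Y i).2.1) * ∏ i, w (Y i) =
      if ∀ m, Y m ∈ tripleSet L then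
        connSum (incidence fun i => (Y i).1 ∪ (Y i).2.1) * ∏ i, dotB V B (Y i) else 0 := by
    intro Y
    split_ifs with h
    · congr 1
      exact Finset.prod_congr rfl fun i _ => by simp only [hw, if_pos (h i)]
    · push Not at h
      obtain ⟨i, hi⟩ := h
      rw [Finset.prod_eq_zero (Finset.mem_univ i) (by simp only [hw, if_neg hi]), mul_zero]
  rw [Finset.sum_congr rfl fun Y _ => this Y, ← Finset.sum_filter,
    ← Finset.sum_fiberwise_of_maps_to (t := tripleSet L)
      (g := fun Y : Fin (n + 1) → Finset L × Finset L × Finset L =>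
        (Finset.univ.sup fun m => (Y m).1, Finset.univ.sup fun m => (Y m).2.1,
          Finset.univ.sup fun m => (Y m).2.2))]
  · refine Finset.sum_congr rfl fun M hM => Finset.sum_congr ?_ fun _ _ => rfl
    ext Y
    simp only [Finset.mem_filter, Finset.mem_univ, true_and, tripleSeqs, Prod.ext_iff]
  · intro Y hY
    simp only [Finset.mem_filter, Finset.mem_univ, true_and, tripleSet] at hY ⊢
    refine ⟨(hY 0).1.mono (Finset.le_sup (f := fun m => (Y m).2.2) (Finset.mem_univ 0)),
      Finset.sup_le fun m _ => (hY m).2.1.trans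
        (Finset.le_sup (f := fun m => (Y m).2.1) (Finset.mem_univ m)), ?_⟩
    by_cases h : ∀ m, (Y m).1 = ∅
    · left
      exact Finset.sup_eq_bot_iff _ _ |>.2 fun m _ => h m
    · right
      push Not at h
      obtain ⟨m, hm⟩ := h
      have h1 := (hY m).2.2.resolve_left (Finset.nonempty_iff_ne_empty.1 (by simpa using hm))
      exact h1.mono (Finset.inter_subset_inter
        (Finset.le_sup (f := fun m => (Y m).1) (Finset.mem_univ m))
        (Finset.le_sup (f := fun m => (Y m).2.1) (Finset.mem_univ m)))

/-- The configuration sum, arranged according to the points covered by large field polymers. -/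
theorem confSum_univ (y : Finset L → ℂ) :
    confSum y B Finset.univ = ∑ X : Finset L,
      (∏ Z : Finset L with (Z ∩ X).Nonempty, (1 + y Z)) *
        ∑ S ∈ markedPartitions X, ∏ p ∈ S, B p.1 p.2 := by
  have h : ∀ X : Finset L, (∏ Z : Finset L with (Z ∩ X).Nonempty, (1 + y Z)) *
      ∑ S ∈ markedPartitions X, ∏ p ∈ S, B p.1 p.2 =
      ∑ q ∈ (Finset.univ.filter fun Z : Finset L => (Z ∩ X).Nonempty).powerset ×ˢ
        markedPartitions X, (∏ Z ∈ q.1, y Z) * ∏ p ∈ q.2, B p.1 p.2 := by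
    intro X
    -- A set Z that meets X but is absent from the configuration contributes the 1 of 1 + y(Z).
    rw [Finset.prod_one_add, Finset.sum_mul_sum, Finset.sum_product]
  rw [Finset.sum_congr rfl fun X _ => h X, Finset.sum_sigma', confSum]
  refine Finset.sum_bij' (fun K _ => ⟨K.toRight.sup Prod.fst, (K.toLeft, K.toRight)⟩)
    (fun q _ => q.2.1.disjSum q.2.2) ?_ ?_ ?_ ?_ ?_
  · intro K hK
    have hK := (Finset.mem_filter.1 hK).2.1
    simp only [Finset.mem_sigma, Finset.mem_univ, true_and, Finset.mem_product,
      Finset.mem_powerset, markedPartitions, Finset.mem_filter]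
    refine ⟨fun Z hZ => ?_, fun p hp => hK.marked p (Finset.mem_toRight.1 hp),
      fun p hp q hq hpq => hK.disj p q ?_ ?_ hpq, trivial⟩
    · obtain ⟨p, hp, h⟩ := hK.meets Z (Finset.mem_toLeft.1 hZ)
      refine Finset.mem_filter.2 ⟨Finset.mem_univ _, h.mono (Finset.inter_subset_inter le_rfl ?_)⟩
      exact Finset.le_sup (f := Prod.fst) (Finset.mem_toRight.2 hp)
    · exact Finset.mem_toRight.1 hp
    · exact Finset.mem_toRight.1 hq
  · rintro ⟨X, Zs, S⟩ h
    simp only [Finset.mem_sigma, Finset.mem_univ, true_and, Finset.mem_product,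
      Finset.mem_powerset, markedPartitions, Finset.mem_filter] at h ⊢
    obtain ⟨h1, h2, h3, rfl⟩ := h
    refine ⟨⟨fun Z hZ => ?_, fun p hp => h2 p (Finset.inr_mem_disjSum.1 hp),
      fun p q hp hq hpq => h3 (Finset.inr_mem_disjSum.1 hp) (Finset.inr_mem_disjSum.1 hq) hpq⟩,
      Finset.subset_univ _⟩
    obtain ⟨x, hx⟩ := (Finset.mem_filter.1 (h1 (Finset.inl_mem_disjSum.1 hZ))).2
    rw [Finset.mem_inter, Finset.mem_sup] at hx
    obtain ⟨hx, p, hp, hxp⟩ := hx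
    exact ⟨p, Finset.inr_mem_disjSum.2 hp, x, Finset.mem_inter.2 ⟨hx, hxp⟩⟩
  · intro K hK
    exact Finset.toLeft_disjSum_toRight
  · rintro ⟨X, Zs, S⟩ h
    simp only [Finset.mem_sigma, Finset.mem_univ, true_and, Finset.mem_product,
      Finset.mem_powerset, markedPartitions, Finset.mem_filter] at h
    obtain ⟨h1, h2, h3, rfl⟩ := h
    simp
  · intro K hK
    rw [confWeight]
    conv_lhs => rw [← Finset.toLeft_disjSum_toRight (u := K)]
    rw [Finset.prod_disjSum]
    rfl

/-- The modified Mayer series. -/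
theorem exp_logSeries (hA : ∀ x, A {x} ≠ 0) (h : AbsConverges A B) :
    Complex.exp (logSeries A B) = polymerZ A B := by
  obtain ⟨h1, _, h3⟩ := h
  rw [logSeries, Complex.exp_add, exp_sum_mayerL (mayerV A) h3, confSum_univ, polymerZ,
    Finset.mul_sum]
  -- The small field region Ω is the complement of the set X covered by large field polymers.
  refine Eq.trans ?_ (Equiv.sum_comp (Function.Involutive.toPerm compl compl_involutive)
    (fun Ω => (∑ S ∈ partitions Ω, ∏ Z ∈ S, A Z) * ∑ S ∈ markedPartitions Ωᶜ, ∏ p ∈ S, B p.1 p.2))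
  refine Finset.sum_congr rfl fun X _ => ?_
  simp only [Function.Involutive.coe_toPerm, compl_compl]
  rw [sum_partitions, mayer_smallField hA h1, ← mul_assoc]
  congr 1
  -- Since 1 + (e^{-V} - 1) = e^{-V}, the V(Z) with Z meeting X cancel in the exponent; the nonempty
  -- subsets of the complement of X remain, and they give the gas there.
  simp only [add_sub_cancel]
  rw [← Complex.exp_sum, ← Complex.exp_add]
  congr 1
  rw [Finset.sum_neg_distrib, ← sub_eq_add_neg, sub_eq_iff_eq_add,
    ← Finset.sum_filter_add_sum_filter_not _ (fun Z => (Z ∩ X).Nonempty), add_comm]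
  congr 1
  · refine Finset.sum_congr ?_ fun _ _ => rfl
    ext Z
    simp only [Finset.mem_filter, Finset.mem_univ, true_and, Finset.mem_powerset,
      Finset.not_nonempty_iff_eq_empty, ← Finset.disjoint_iff_inter_eq_empty,
      ← Finset.subset_compl_iff_disjoint_right]
    tauto
  · refine Finset.sum_congr ?_ fun _ _ => rfl
    ext Z
    simp only [Finset.mem_filter, Finset.mem_univ, true_and]
    exact ⟨fun h => h.2, fun h => ⟨h.mono Finset.inter_subset_left, h⟩⟩

end Mayer

/-! ## Convergence for small activities -/

section SmallActivities

variable {L : Type*} [Fintype L] [DecidableEq L]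

theorem norm_ursell_le {n : ℕ} (Y : Fin n → Finset L) : ‖ursell Y‖ ≤ 4 ^ n * n.factorial := by
  rw [ursell_eq_connSum]
  rcases n with _ | n
  · rw [connSum_of_isEmpty]; simp
  · refine (norm_connSum_le n (Fin (n + 1)) _ (by simp)).trans ?_
    gcongr
    omega

/-- The n! in the Ursell bound cancels the weight 1/n!, and dropping the constraint on unions leaves
the n-th power of the total activity. -/
theorem mayer_term_le {P : Type*} [Fintype P] (supp : P → Finset L) (v : P → ℂ) (a : P → ℝ)
    (n : ℕ) (seqs : Finset (Fin n → P))
    (h : ∀ Y ∈ seqs, ∀ m, ‖v (Y m)‖ ≤ a (Y m)) (ha : ∀ p, 0 ≤ a p) :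
    ((n.factorial : ℝ))⁻¹ * ∑ Y ∈ seqs, ‖ursell (fun m => supp (Y m)) * ∏ m, v (Y m)‖ ≤
      (4 * ∑ p, a p) ^ n := by
  have h1 : ∑ Y ∈ seqs, ‖ursell (fun m => supp (Y m)) * ∏ m, v (Y m)‖ ≤
      ∑ Y : Fin n → P, 4 ^ n * n.factorial * ∏ m, a (Y m) := by
    refine (Finset.sum_le_sum fun Y hY => ?_).trans
      (Finset.sum_le_sum_of_subset_of_nonneg (Finset.subset_univ seqs) fun Y _ _ => ?_)
    · rw [norm_mul, norm_prod]
      gcongr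
      · exact norm_ursell_le _
      · exact h Y hY _
    · have := Finset.prod_nonneg fun m (_ : m ∈ Finset.univ) => ha (Y m)
      positivity
  have h2 := Finset.prod_univ_sum (fun _ : Fin n => (Finset.univ : Finset P)) (fun _ p => a p)
  rw [Finset.prod_const, Finset.card_univ, Fintype.card_fin, Fintype.piFinset_univ] at h2
  rw [← Finset.mul_sum, ← h2] at h1
  have hf : (0 : ℝ) < n.factorial := by exact_mod_cast n.factorial_pos
  calc _ ≤ ((n.factorial : ℝ))⁻¹ * (4 ^ n * n.factorial * (∑ p, a p) ^ n) := by gcongr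
    _ = _ := by rw [mul_pow]; field_simp

theorem summable_mayer {P : Type*} [Fintype P] (supp : P → Finset L) (v : P → ℂ) (a : P → ℝ)
    (seqs : (n : ℕ) → Finset (Fin n → P))
    (h : ∀ n, ∀ Y ∈ seqs n, ∀ m, ‖v (Y m)‖ ≤ a (Y m)) (ha : ∀ p, 0 ≤ a p)
    (hsmall : 4 * ∑ p, a p < 1) :
    Summable fun n : ℕ => ((n.factorial : ℝ))⁻¹ *
      ∑ Y ∈ seqs n, ‖ursell (fun m => supp (Y m)) * ∏ m, v (Y m)‖ := by
  have h0 : 0 ≤ 4 * ∑ p, a p := by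
    have := Finset.sum_nonneg fun p (_ : p ∈ Finset.univ) => ha p
    positivity
  refine Summable.of_nonneg_of_le (fun n => ?_) (fun n => mayer_term_le supp v a n _ (h n) ha)
    (summable_geometric_of_lt_one h0 hsmall)
  positivity

variable (A : Finset L → ℂ) (B : Finset L → Finset L → ℂ)

theorem normAct_scaleA (t : ℂ) {X : Finset L} (hX : 2 ≤ X.card) :
    normAct (scaleA t A) X = t * normAct A X := by
  rw [normAct, normAct, scaleA, if_neg (by omega), mul_assoc]
  congr 2

theorem eventually_norm_mul_lt (c : ℝ) {ε : ℝ} (hε : 0 < ε) : ∀ᶠ t in 𝓝 (0 : ℂ), ‖t‖ * c < ε := by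
  have : Filter.Tendsto (fun t : ℂ => ‖t‖ * c) (𝓝 0) (𝓝 (‖(0 : ℂ)‖ * c)) :=
    (continuous_norm.mul continuous_const).tendsto 0
  rw [norm_zero, zero_mul] at this
  exact this.eventually (gt_mem_nhds hε)

/-- No Ursell function occurs here, so the 1/n'! survives and an exponential series dominates
without any smallness. -/
theorem summable_dotB (V : Finset L → ℂ) (M : Finset L × Finset L × Finset L) :
    Summable fun n' : ℕ => ((n'.factorial : ℝ))⁻¹ *
      ∑ c ∈ clusterConfs M n', ‖(∏ m, -V (c.1 m)) * ∏ p ∈ c.2, B p.1 p.2‖ := by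
  refine Summable.of_nonneg_of_le (fun n => by positivity) (fun n => ?_)
    ((Real.summable_pow_div_factorial (∑ Z, ‖V Z‖)).mul_right
      (∑ S : Finset (Finset L × Finset L), ∏ p ∈ S, ‖B p.1 p.2‖))
  have h2 := Finset.prod_univ_sum (fun _ : Fin n => (Finset.univ : Finset (Finset L)))
    (fun _ Z => ‖V Z‖)
  rw [Finset.prod_const, Finset.card_univ, Fintype.card_fin, Fintype.piFinset_univ] at h2
  rw [h2, div_eq_inv_mul, mul_assoc, Finset.sum_mul_sum, ← Fintype.sum_prod_type']
  gcongr
  refine (Finset.sum_le_sum fun c _ => ?_).trans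
    (Finset.sum_le_sum_of_subset_of_nonneg (Finset.subset_univ _) fun c _ _ => ?_)
  · rw [norm_mul, norm_prod, norm_prod]
    simp
  · exact mul_nonneg (Finset.prod_nonneg fun _ _ => norm_nonneg _)
      (Finset.prod_nonneg fun _ _ => norm_nonneg _)

theorem summable_mayerV_scaled {t : ℂ} (ht : ‖t‖ * (4 * ∑ Z, ‖normAct A Z‖) < 1 / 2)
    (X : Finset L) : Summable fun n : ℕ => ((n.factorial : ℝ))⁻¹ *
      ∑ Y ∈ mayerSeqs X n, ‖ursell Y * ∏ m, normAct (scaleA t A) (Y m)‖ := by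
  refine summable_mayer id (normAct (scaleA t A)) (fun Z => ‖t‖ * ‖normAct A Z‖) _ ?_ ?_ ?_
  · intro n Y hY m
    rw [normAct_scaleA A t ((Finset.mem_filter.1 hY).2.2 m), norm_mul]
  · intro Z; positivity
  · rw [← Finset.mul_sum]; linarith

/-- The 2 is the sum of the powers of 1/2, and the logarithm covers singletons, which are not
scaled. The bound must be uniform in t so that the factors e^{-V} - 1 stay bounded as t tends to 0.
-/
theorem norm_mayerV_scaled_le {t : ℂ} (ht : ‖t‖ * (4 * ∑ Z, ‖normAct A Z‖) < 1 / 2)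
    (X : Finset L) : ‖mayerV (scaleA t A) X‖ ≤ 2 + ‖Complex.log (A X)‖ := by
  rw [mayerV]
  split_ifs with h
  · rw [scaleA, if_pos h]; linarith
  · have h1 := summable_mayerV_scaled A ht X
    have h2 : ∀ n : ℕ, ‖((n.factorial : ℂ))⁻¹ *
        ∑ Y ∈ mayerSeqs X n, ursell Y * ∏ m, normAct (scaleA t A) (Y m)‖ ≤
        ((n.factorial : ℝ))⁻¹ *
        ∑ Y ∈ mayerSeqs X n, ‖ursell Y * ∏ m, normAct (scaleA t A) (Y m)‖ := by
      intro n
      rw [norm_mul, norm_inv, Complex.norm_natCast]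
      gcongr
      exact norm_sum_le _ _
    have h3 : ∀ n : ℕ, ((n.factorial : ℝ))⁻¹ *
        ∑ Y ∈ mayerSeqs X n, ‖ursell Y * ∏ m, normAct (scaleA t A) (Y m)‖ ≤ (1 / 2 : ℝ) ^ n := by
      intro n
      refine (mayer_term_le id (normAct (scaleA t A)) (fun Z => ‖t‖ * ‖normAct A Z‖) n _ ?_ ?_).trans ?_
      · intro Y hY m
        rw [normAct_scaleA A t ((Finset.mem_filter.1 hY).2.2 m), norm_mul]
      · intro Z; positivity
      · rw [← Finset.mul_sum]
        exact pow_le_pow_left₀ (by positivity) (by linarith) n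
    have h4 := tsum_of_norm_bounded (hasSum_geometric_of_lt_one (by norm_num) (by norm_num))
      (fun n => (h2 n).trans (h3 n))
    refine h4.trans ?_
    have := norm_nonneg (Complex.log (A X))
    norm_num

/-- Smallness comes from the large field polymers alone: a connected configuration contains at least
one of them, and the other powers of t are at most 1 in modulus. -/
theorem norm_dotB_scaled_le {t : ℂ} (ht1 : ‖t‖ ≤ 1) (V : Finset L → ℂ) (b : Finset L → ℝ)
    (hV : ∀ Z, ‖V Z‖ ≤ b Z) {M : Finset L × Finset L × Finset L} (hM : M ∈ tripleSet L) :
    ‖dotB V (scaleB t B) M‖ ≤ ‖t‖ * ∑ K ∈ connConfs M,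
      (∏ Z ∈ K.toLeft, (Real.exp (b Z) + 1)) * ∏ p ∈ K.toRight, ‖B p.1 p.2‖ := by
  rw [dotB_eq_sum_connConfs V _ hM, Finset.mul_sum]
  refine norm_sum_le_of_le _ fun K hK => ?_
  simp only [connConfs, Finset.mem_filter, Finset.mem_univ, true_and] at hK
  rw [confWeight]
  conv_lhs => rw [← Finset.toLeft_disjSum_toRight (u := K)]
  rw [Finset.prod_disjSum, norm_mul, norm_prod, norm_prod, mul_left_comm]
  gcongr with Z hZ
  · simp only [Sum.elim_inl]
    refine (norm_sub_le _ _).trans ?_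
    rw [norm_one]
    gcongr
    rw [Complex.norm_exp]
    gcongr
    exact ((Complex.re_le_norm _).trans (by rw [norm_neg])).trans (hV Z)
  · simp only [Sum.elim_inr, scaleB, norm_mul]
    rw [Finset.prod_mul_distrib, Finset.prod_const]
    gcongr
    -- Without a large field polymer the marked set Q of the label would be empty.
    have hne : K.toRight.Nonempty := by
      have := confLabel_mem hK.1.1 hK.1.2.1
      simp only [tripleSet, Finset.mem_filter, Finset.mem_univ, true_and, confLabel] at this
      rw [Finset.nonempty_iff_ne_empty]
      intro h
      rw [h] at this
      simp at this
    exact pow_le_of_le_one (norm_nonneg _) ht1 hne.card_pos.ne'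

/-- Three conditions on t suffice: one for the series V, one for L with the t-independent bounds `a`
on Ḃ/t, and |t| < 1 to reduce powers of t to the first. -/
theorem eventually_absConverges :
    ∀ᶠ t in 𝓝 (0 : ℂ), AbsConverges (scaleA t A) (scaleB t B) := by
  set a : Finset L × Finset L × Finset L → ℝ := fun M => ∑ K ∈ connConfs M,
    (∏ Z ∈ K.toLeft, (Real.exp (2 + ‖Complex.log (A Z)‖) + 1)) * ∏ p ∈ K.toRight, ‖B p.1 p.2‖ with ha
  have ha0 : ∀ M, 0 ≤ a M := fun M => Finset.sum_nonneg fun K _ =>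
    mul_nonneg (Finset.prod_nonneg fun _ _ => by positivity)
      (Finset.prod_nonneg fun _ _ => norm_nonneg _)
  filter_upwards [eventually_norm_mul_lt (4 * ∑ Z, ‖normAct A Z‖) (by norm_num : (0 : ℝ) < 1 / 2),
    eventually_norm_mul_lt (4 * ∑ M, a M) one_pos, eventually_norm_mul_lt 1 one_pos]
    with t h1 h2 h3
  refine ⟨fun X _ => summable_mayerV_scaled A h1 X, fun M _ => summable_dotB _ _ _, fun M _ => ?_⟩
  refine summable_mayer (fun M : Finset L × Finset L × Finset L => M.1 ∪ M.2.1) _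
    (fun M => ‖t‖ * a M) _ ?_ ?_ ?_
  · intro n Y hY m
    exact norm_dotB_scaled_le B (by linarith) _ _ (norm_mayerV_scaled_le A h1)
      ((Finset.mem_filter.1 hY).2.1 m)
  · intro M
    exact mul_nonneg (norm_nonneg _) (ha0 M)
  · rw [← Finset.mul_sum]; linarith

/-- The modified Mayer series of scaled activities. -/
theorem eventually_exp_logSeries (hA : ∀ x, A {x} ≠ 0) : ∀ᶠ t in 𝓝 (0 : ℂ),
    AbsConverges (scaleA t A) (scaleB t B) ∧
      Complex.exp (logSeries (scaleA t A) (scaleB t B)) = polymerZ (scaleA t A) (scaleB t B) := by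
  filter_upwards [eventually_absConverges A B] with t ht
  refine ⟨ht, exp_logSeries (fun x => ?_) ht⟩
  rw [scaleA, if_pos (Finset.card_singleton x)]
  exact hA x

end SmallActivities

/-! ## Forest interpolation -/

section Forests

variable {ι : Type*}

theorem edgeGraph_adj {F : Finset (Pairs ι)} {x y : ι} :
    (edgeGraph F).Adj x y ↔ ∃ ℓ ∈ F, ℓ.1 = s(x, y) := by
  rw [edgeGraph, SimpleGraph.fromEdgeSet_adj]
  refine ⟨fun h => h.1, fun h => ⟨h, ?_⟩⟩
  obtain ⟨ℓ, _, h⟩ := h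
  rintro rfl
  exact ℓ.2 (by rw [h]; simp)

theorem mem_edgeSet_edgeGraph {F : Finset (Pairs ι)} {e : Sym2 ι} :
    e ∈ (edgeGraph F).edgeSet ↔ ∃ ℓ ∈ F, ℓ.1 = e := by
  induction e using Sym2.ind with | _ x y => exact edgeGraph_adj

theorem edgeGraph_mono {F F' : Finset (Pairs ι)} (h : F ⊆ F') : edgeGraph F ≤ edgeGraph F' := by
  intro x y hxy
  obtain ⟨ℓ, hℓ, he⟩ := edgeGraph_adj.1 hxy
  exact edgeGraph_adj.2 ⟨ℓ, h hℓ, he⟩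

/-- The interpolated coupling is the minimum along the path. -/
theorem forestInterp_eq_of_path {F : Finset (Pairs ι)} (hF : (edgeGraph F).IsAcyclic) (u : F → ℝ)
    {x y : ι} {ℓ : Pairs ι} (hℓ : s(x, y) = ℓ.1) (p : (edgeGraph F).Walk x y) (hp : p.IsPath) :
    forestInterp F u ℓ = sInf {t | ∃ e : F, e.1.1 ∈ p.edges ∧ t = u e} := by
  rw [forestInterp]
  congr 1
  ext t
  simp only [Set.mem_ofPred_eq]
  constructor
  · rintro ⟨x', y', p', hp', h', e, he, rfl⟩
    rw [← hℓ, Sym2.eq_iff] at h'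
    rcases h' with ⟨rfl, rfl⟩ | ⟨rfl, rfl⟩
    · have := (hF.subsingleton_path _ _).elim ⟨p, hp⟩ ⟨p', hp'⟩
      rw [Subtype.mk.injEq] at this
      exact ⟨e, this ▸ he, rfl⟩
    · have := (hF.subsingleton_path _ _).elim ⟨p, hp⟩ ⟨p'.reverse, hp'.reverse⟩
      rw [Subtype.mk.injEq] at this
      refine ⟨e, ?_, rfl⟩
      rw [this, SimpleGraph.Walk.edges_reverse, List.mem_reverse]
      exact he
  · rintro ⟨e, he, rfl⟩
    exact ⟨x, y, p, hp, hℓ, e, he, rfl⟩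

theorem exists_mem_edges {F : Finset (Pairs ι)} {x y : ι} (hxy : x ≠ y)
    (p : (edgeGraph F).Walk x y) : ∃ e : F, e.1.1 ∈ p.edges := by
  cases p with
  | nil => exact absurd rfl hxy
  | cons hadj q =>
    obtain ⟨ℓ, hℓ, he⟩ := edgeGraph_adj.1 hadj
    exact ⟨⟨ℓ, hℓ⟩, by simp [he]⟩

/-- The infimum runs over a finite nonempty set, since a pair has distinct ends, and is therefore
attained. This is the form in which s^F is used below. -/
theorem forestInterp_spec {F : Finset (Pairs ι)} (hF : (edgeGraph F).IsAcyclic) (u : F → ℝ)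
    {x y : ι} {ℓ : Pairs ι} (hℓ : s(x, y) = ℓ.1) (p : (edgeGraph F).Walk x y) (hp : p.IsPath) :
    (∃ e : F, e.1.1 ∈ p.edges ∧ forestInterp F u ℓ = u e) ∧
      ∀ e : F, e.1.1 ∈ p.edges → forestInterp F u ℓ ≤ u e := by
  have hxy : x ≠ y := by
    rintro rfl
    exact ℓ.2 (by rw [← hℓ]; simp)
  rw [forestInterp_eq_of_path hF u hℓ p hp]
  have hfin : {t | ∃ e : F, e.1.1 ∈ p.edges ∧ t = u e}.Finite :=
    (Set.finite_range u).subset (by rintro t ⟨e, _, rfl⟩; exact ⟨e, rfl⟩)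
  have hne : {t | ∃ e : F, e.1.1 ∈ p.edges ∧ t = u e}.Nonempty := by
    obtain ⟨e, he⟩ := exists_mem_edges hxy p
    exact ⟨_, e, he, rfl⟩
  refine ⟨hne.csInf_mem hfin, fun e he => csInf_le hfin.bddBelow ⟨e, he, rfl⟩⟩

/-- The two ends of `ℓ` lie in the same component of `F`. -/
def Linked (F : Finset (Pairs ι)) (ℓ : Pairs ι) : Prop :=
  ∃ x y, s(x, y) = ℓ.1 ∧ (edgeGraph F).Reachable x y

theorem linked_iff {F : Finset (Pairs ι)} {ℓ : Pairs ι} {x y : ι} (h : s(x, y) = ℓ.1) :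
    Linked F ℓ ↔ (edgeGraph F).Reachable x y := by
  refine ⟨?_, fun hr => ⟨x, y, h, hr⟩⟩
  rintro ⟨x', y', h', hr⟩
  rw [← h, Sym2.eq_iff] at h'
  rcases h' with ⟨rfl, rfl⟩ | ⟨rfl, rfl⟩
  · exact hr
  · exact hr.symm

theorem linked_of_mem {F : Finset (Pairs ι)} {ℓ : Pairs ι} (h : ℓ ∈ F) : Linked F ℓ := by
  obtain ⟨e, he⟩ := ℓ
  induction e using Sym2.ind with | _ x y =>
  exact ⟨x, y, rfl, (edgeGraph_adj.2 ⟨_, h, rfl⟩).reachable⟩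

theorem exists_ends (ℓ : Pairs ι) : ∃ x y, s(x, y) = ℓ.1 ∧ x ≠ y := by
  obtain ⟨e, he⟩ := ℓ
  induction e using Sym2.ind with | _ x y =>
  exact ⟨x, y, rfl, by simpa using he⟩

theorem forestInterp_of_not_linked {F : Finset (Pairs ι)} (u : F → ℝ) {ℓ : Pairs ι}
    (h : ¬ Linked F ℓ) : forestInterp F u ℓ = 0 := by
  rw [forestInterp]
  convert Real.sInf_empty
  ext t
  simp only [Set.mem_ofPred_eq, Set.mem_empty_iff_false, iff_false]
  rintro ⟨x, y, p, _, hxy, _⟩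
  exact h ⟨x, y, hxy, ⟨p⟩⟩

theorem exists_path_of_linked {F : Finset (Pairs ι)} {ℓ : Pairs ι} (h : Linked F ℓ) :
    ∃ x y, s(x, y) = ℓ.1 ∧ ∃ p : (edgeGraph F).Walk x y, p.IsPath := by
  obtain ⟨x, y, hxy, hr⟩ := h
  obtain ⟨p, hp⟩ := hr.exists_isPath
  exact ⟨x, y, hxy, p, hp⟩

theorem exists_forestInterp_eq {F : Finset (Pairs ι)} (hF : (edgeGraph F).IsAcyclic) (u : F → ℝ)
    {ℓ : Pairs ι} (h : Linked F ℓ) : ∃ e : F, forestInterp F u ℓ = u e := by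
  obtain ⟨x, y, hxy, p, hp⟩ := exists_path_of_linked h
  obtain ⟨e, _, he⟩ := (forestInterp_spec hF u hxy p hp).1
  exact ⟨e, he⟩

theorem forestInterp_mem {F : Finset (Pairs ι)} (hF : (edgeGraph F).IsAcyclic) {u : F → ℝ}
    (hu : u ∈ Set.Icc (0 : F → ℝ) 1) : forestInterp F u ∈ Set.Icc (0 : Pairs ι → ℝ) 1 := by
  have h : ∀ ℓ, 0 ≤ forestInterp F u ℓ ∧ forestInterp F u ℓ ≤ 1 := by
    intro ℓ
    by_cases hℓ : Linked F ℓ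
    · obtain ⟨e, he⟩ := exists_forestInterp_eq hF u hℓ
      rw [he]
      exact ⟨hu.1 e, hu.2 e⟩
    · rw [forestInterp_of_not_linked u hℓ]
      exact ⟨le_rfl, zero_le_one⟩
  exact ⟨fun ℓ => (h ℓ).1, fun ℓ => (h ℓ).2⟩

theorem coupling_of_ne (s : Pairs ι → ℝ) {x y : ι} {ℓ : Pairs ι} (h : s(x, y) = ℓ.1) :
    coupling s x y = s ℓ := by
  have hxy : x ≠ y := by
    rintro rfl
    exact ℓ.2 (by rw [← h]; simp)
  rw [coupling, dif_neg hxy]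
  congr 1
  exact Subtype.ext h

theorem coupling_self (s : Pairs ι → ℝ) (x : ι) : coupling s x x = 1 := dif_pos rfl

/-- Couplings in `[0, 1]` that are ultrametric. -/
def ultraCouplings (ι : Type*) : Set (Pairs ι → ℝ) :=
  {s | s ∈ Set.Icc (0 : Pairs ι → ℝ) 1 ∧
    ∀ x y z, min (coupling s x y) (coupling s y z) ≤ coupling s x z}

theorem coupling_le_one {s : Pairs ι → ℝ} (hs : s ∈ Set.Icc (0 : Pairs ι → ℝ) 1) (x y : ι) :
    coupling s x y ≤ 1 := by
  rw [coupling]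
  split_ifs
  · exact le_rfl
  · exact hs.2 _

theorem coupling_nonneg {s : Pairs ι → ℝ} (hs : s ∈ Set.Icc (0 : Pairs ι → ℝ) 1) (x y : ι) :
    0 ≤ coupling s x y := by
  rw [coupling]
  split_ifs
  · exact zero_le_one
  · exact hs.1 _

theorem pair_ne {x y : ι} (h : x ≠ y) : ¬ (s(x, y)).IsDiag := by simpa using h

/-- The path from x to z uses only edges of the paths from x to y and from y to z; its weakest edge
lies on one of these. -/
theorem forestInterp_mem_ultra {F : Finset (Pairs ι)} (hF : (edgeGraph F).IsAcyclic) {u : F → ℝ}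
    (hu : u ∈ Set.Icc (0 : F → ℝ) 1) : forestInterp F u ∈ ultraCouplings ι := by
  have hmem := forestInterp_mem hF hu
  refine ⟨hmem, fun x y z => ?_⟩
  by_cases hxz : x = z
  · subst hxz
    rw [coupling_self]
    exact (min_le_left _ _).trans (coupling_le_one hmem _ _)
  by_cases hxy : x = y
  · subst hxy; exact min_le_right _ _
  by_cases hyz : y = z
  · subst hyz; exact min_le_left _ _
  rw [coupling_of_ne _ (ℓ := ⟨s(x, y), pair_ne hxy⟩) rfl,
    coupling_of_ne _ (ℓ := ⟨s(y, z), pair_ne hyz⟩) rfl,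
    coupling_of_ne _ (ℓ := ⟨s(x, z), pair_ne hxz⟩) rfl]
  by_cases h1 : (edgeGraph F).Reachable x y
  swap
  · refine (min_le_left _ _).trans ?_
    rw [forestInterp_of_not_linked u (mt (linked_iff rfl).1 h1)]
    exact hmem.1 _
  by_cases h2 : (edgeGraph F).Reachable y z
  swap
  · refine (min_le_right _ _).trans ?_
    rw [forestInterp_of_not_linked u (mt (linked_iff rfl).1 h2)]
    exact hmem.1 _
  obtain ⟨p, hp⟩ := h1.exists_isPath
  obtain ⟨q, hq⟩ := h2.exists_isPath
  obtain ⟨⟨e, he, hE⟩, _⟩ := forestInterp_spec hF u (ℓ := ⟨s(x, z), pair_ne hxz⟩) rfl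
    (p.append q).bypass (p.append q).bypass_isPath
  have he' := (p.append q).edges_bypass_subset_edges he
  rw [SimpleGraph.Walk.edges_append, List.mem_append] at he'
  rw [hE]
  rcases he' with h | h
  · exact (min_le_left _ _).trans ((forestInterp_spec hF u rfl p hp).2 e h)
  · exact (min_le_right _ _).trans ((forestInterp_spec hF u rfl q hq).2 e h)

theorem coupling_sup_const (s : Pairs ι → ℝ) {t : ℝ} (ht : t ≤ 1) (x y : ι) :
    coupling (fun ℓ => max (s ℓ) t) x y = max (coupling s x y) t := by
  by_cases h : x = y
  · subst h
    rw [coupling_self, coupling_self, max_eq_left ht]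
  · rw [coupling_of_ne _ (ℓ := ⟨s(x, y), pair_ne h⟩) rfl,
      coupling_of_ne s (ℓ := ⟨s(x, y), pair_ne h⟩) rfl]

/-- Minimum and maximum distribute over each other. Hence the interpolating couplings of
`forest_ftc` stay ultrametric, where the Gaussian density is available. -/
theorem sup_const_mem_ultra {s : Pairs ι → ℝ} (hs : s ∈ ultraCouplings ι) {t : ℝ} (ht0 : 0 ≤ t)
    (ht : t ≤ 1) : (fun ℓ => max (s ℓ) t) ∈ ultraCouplings ι := by
  refine ⟨⟨fun ℓ => ht0.trans (le_max_right _ _), fun ℓ => max_le (hs.1.2 ℓ) ht⟩, fun x y z => ?_⟩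
  simp only [coupling_sup_const s ht]
  rw [← max_min_distrib_right]
  exact max_le_max_right _ (hs.2 x y z)

/-- Enlarging a forest by an edge whose parameter is minimal. -/
theorem max_forestInterp_insert {F : Finset (Pairs ι)} {ℓ : Pairs ι}
    (hF' : (edgeGraph (insert ℓ F)).IsAcyclic) {v : Pairs ι → ℝ} (h0 : 0 ≤ v ℓ)
    (hv : ∀ e ∈ F, v ℓ ≤ v e) (ℓ' : Pairs ι) :
    max (forestInterp (insert ℓ F) (fun e => v e) ℓ') (v ℓ) =
      max (forestInterp F (fun e => v e) ℓ') (v ℓ) := by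
  have hF : (edgeGraph F).IsAcyclic := hF'.anti (edgeGraph_mono (Finset.subset_insert _ _))
  by_cases h : Linked F ℓ'
  · obtain ⟨x, y, hxy, p, hp⟩ := exists_path_of_linked h
    have hmap := hp.mapLe (edgeGraph_mono (Finset.subset_insert ℓ F))
    obtain ⟨⟨e, he, hE⟩, hle⟩ := forestInterp_spec hF (fun e => v e) hxy p hp
    obtain ⟨⟨e', he', hE'⟩, hle'⟩ := forestInterp_spec hF' (fun e => v e) hxy _ hmap
    have hed : (p.mapLe (edgeGraph_mono (Finset.subset_insert ℓ F))).edges = p.edges := by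
      simp
    rw [hed] at he' hle'
    have heF : e'.1 ∈ F := by
      obtain ⟨ℓ₁, hℓ₁, h₁⟩ := mem_edgeSet_edgeGraph.1 (p.edges_subset_edgeSet he')
      rwa [← Subtype.ext h₁]
    congr 1
    refine le_antisymm ?_ ?_
    · rw [hE]; exact hle' ⟨e.1, Finset.mem_insert_of_mem e.2⟩ he
    · rw [hE']; exact hle ⟨e'.1, heF⟩ he'
  · rw [forestInterp_of_not_linked _ h, max_eq_right h0]
    by_cases h' : Linked (insert ℓ F) ℓ'
    · obtain ⟨x, y, hxy, p, hp⟩ := exists_path_of_linked h'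
      -- Ends that are joined only after adding ℓ have ℓ on their path, so the new value is at most
      -- v ℓ and the maximum hides it.
      refine max_eq_right ((forestInterp_spec hF' (fun e => v e) hxy p hp).2
        ⟨ℓ, Finset.mem_insert_self _ _⟩ ?_)
      by_contra hn
      apply h
      refine ⟨x, y, hxy, ⟨p.transfer _ fun e he => ?_⟩⟩
      obtain ⟨ℓ₁, hℓ₁, h₁⟩ := mem_edgeSet_edgeGraph.1 (p.edges_subset_edgeSet he)
      rcases Finset.mem_insert.1 hℓ₁ with rfl | hℓ₁
      · exact absurd (h₁ ▸ he) hn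
      · exact mem_edgeSet_edgeGraph.2 ⟨ℓ₁, hℓ₁, h₁⟩
    · rw [forestInterp_of_not_linked _ h', max_eq_right h0]

theorem edgeGraph_insert {F : Finset (Pairs ι)} {ℓ : Pairs ι} {x y : ι} (h : s(x, y) = ℓ.1) :
    edgeGraph (insert ℓ F) = edgeGraph F ⊔ SimpleGraph.edge x y := by
  rw [SimpleGraph.edge]
  have hxy : x ≠ y := by
    rintro rfl
    exact ℓ.2 (by rw [← h]; simp)
  ext a b
  rw [SimpleGraph.sup_adj, edgeGraph_adj, edgeGraph_adj, SimpleGraph.fromEdgeSet_adj,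
    Set.mem_singleton_iff]
  simp only [Finset.mem_insert, exists_eq_or_imp]
  rw [or_comm, h]
  refine or_congr Iff.rfl ⟨fun h' => ⟨h'.symm, ?_⟩, fun h' => h'.1.symm⟩
  rintro rfl
  exact ℓ.2 (by rw [h']; simp)

theorem acyclic_insert_iff {F : Finset (Pairs ι)} {ℓ : Pairs ι} (hℓ : ℓ ∉ F)
    (hF : (edgeGraph F).IsAcyclic) : (edgeGraph (insert ℓ F)).IsAcyclic ↔ ¬ Linked F ℓ := by
  obtain ⟨x, y, hxy, hne⟩ := exists_ends ℓ
  rw [edgeGraph_insert hxy, linked_iff hxy, SimpleGraph.isAcyclic_sup_fromEdgeSet_iff]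
  have hadj : ¬ (edgeGraph F).Adj x y := by
    intro h
    obtain ⟨ℓ', hℓ', he⟩ := edgeGraph_adj.1 h
    rw [hxy] at he
    exact hℓ (Subtype.ext he ▸ hℓ')
  constructor
  · rintro ⟨_, h⟩ hr
    rcases h hr with h | h
    · exact hne h
    · exact hadj h
  · intro h
    exact ⟨hF, fun hr => absurd hr h⟩

theorem continuous_forestInterp {F : Finset (Pairs ι)} (hF : (edgeGraph F).IsAcyclic) :
    Continuous fun u : F → ℝ => forestInterp F u := by
  refine continuous_pi fun ℓ => ?_
  by_cases h : Linked F ℓ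
  · obtain ⟨x, y, hxy, p, hp⟩ := exists_path_of_linked h
    have hxy' : x ≠ y := by
      rintro rfl
      exact ℓ.2 (by rw [← hxy]; simp)
    have hne : (Finset.univ.filter fun e : F => e.1.1 ∈ p.edges).Nonempty := by
      obtain ⟨e, he⟩ := exists_mem_edges hxy' p
      exact ⟨e, by simpa using he⟩
    have : (fun u : F → ℝ => forestInterp F u ℓ) = fun u =>
        (Finset.univ.filter fun e : F => e.1.1 ∈ p.edges).inf' hne fun e => u e := by
      funext u
      obtain ⟨⟨e, he, hE⟩, hle⟩ := forestInterp_spec hF u hxy p hp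
      refine le_antisymm (Finset.le_inf' _ _ fun e he => hle e (by simpa using he)) ?_
      rw [hE]
      exact Finset.inf'_le _ (by simpa using he)
    rw [this]
    exact Continuous.finset_inf'_apply hne fun e _ => continuous_apply e
  · simp only [forestInterp_of_not_linked _ h]
    exact continuous_const

/-- A closed subset of the cube. Compactness makes the Gaussian decay estimates uniform over all
forests and parameters. -/
theorem isCompact_ultraCouplings [Finite ι] : IsCompact (ultraCouplings ι) := by
  have hc : ∀ x y : ι, Continuous fun s : Pairs ι → ℝ => coupling s x y := by
    intro x y
    unfold coupling
    split_ifs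
    · exact continuous_const
    · exact continuous_apply _
  have : ultraCouplings ι = Set.Icc (0 : Pairs ι → ℝ) 1 ∩
      ⋂ x, ⋂ y, ⋂ z, {s | min (coupling s x y) (coupling s y z) ≤ coupling s x z} := by
    ext s
    simp [ultraCouplings]
  rw [this]
  refine isCompact_Icc.inter_right ?_
  exact isClosed_iInter fun x => isClosed_iInter fun y => isClosed_iInter fun z =>
    isClosed_le ((hc x y).min (hc y z)) (hc x z)

end Forests

/-! ## Blocks of a partition -/

section Blocks

variable {L : Type*} [Fintype L] [DecidableEq L]

theorem eq_of_mem_partitions {π : Finset (Finset L)} (hπ : π ∈ partitions Finset.univ)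
    {X Y : Finset L} (hX : X ∈ π) (hY : Y ∈ π) {x : L} (hx : x ∈ X) (hy : x ∈ Y) : X = Y := by
  by_contra h
  have := (Finset.mem_filter.1 hπ).2.2.1 hX hY h
  exact Finset.disjoint_left.1 this hx hy

theorem exists_block {π : Finset (Finset L)} (hπ : π ∈ partitions Finset.univ) (x : L) :
    ∃ X ∈ π, x ∈ X := by
  have h : x ∈ π.sup id := by
    rw [(Finset.mem_filter.1 hπ).2.2.2]
    exact Finset.mem_univ x
  simpa using Finset.mem_sup.1 h

theorem nonempty_of_mem_partitions {π : Finset (Finset L)} (hπ : π ∈ partitions Finset.univ)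
    {X : Finset L} (hX : X ∈ π) : X.Nonempty := (Finset.mem_filter.1 hπ).2.1 X hX

theorem mem_partitions_univ {π : Finset (Finset L)} (h1 : ∀ X ∈ π, X.Nonempty)
    (h2 : ∀ X ∈ π, ∀ Y ∈ π, ∀ x, x ∈ X → x ∈ Y → X = Y) (h3 : ∀ x, ∃ X ∈ π, x ∈ X) :
    π ∈ partitions Finset.univ := by
  refine Finset.mem_filter.2 ⟨Finset.mem_univ _, h1, ?_, ?_⟩
  · intro X hX Y hY hXY
    exact Finset.disjoint_left.2 fun x hx hy => hXY (h2 X hX Y hY x hx hy)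
  · ext x
    obtain ⟨X, hX, hx⟩ := h3 x
    simp only [Finset.mem_univ, iff_true]
    exact Finset.mem_sup.2 ⟨X, hX, hx⟩

/-- The pair `ℓ` lies in one of the blocks of `π`. -/
def InBlock (π : Finset (Finset L)) (ℓ : Pairs L) : Prop :=
  ∃ X ∈ π, ∃ ℓ' : Pairs X, Pairs.incl X ℓ' = ℓ

theorem incl_val {X : Finset L} {ℓ : Pairs X} {a b : X} (h : s(a, b) = ℓ.1) :
    (Pairs.incl X ℓ).1 = s((a : L), (b : L)) := by
  change Sym2.map Subtype.val ℓ.1 = _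
  rw [← h]
  rfl

theorem incl_injective (X : Finset L) : Function.Injective (Pairs.incl X) := by
  intro a b h
  exact Subtype.ext (Sym2.map.injective Subtype.val_injective (congrArg Subtype.val h))

theorem inBlock_iff {π : Finset (Finset L)} {ℓ : Pairs L} {x y : L} (h : s(x, y) = ℓ.1) :
    InBlock π ℓ ↔ ∃ X ∈ π, x ∈ X ∧ y ∈ X := by
  constructor
  · rintro ⟨X, hX, ℓ', rfl⟩
    obtain ⟨a, b, hab, hne⟩ := exists_ends ℓ'
    refine ⟨X, hX, ?_⟩
    have : s(x, y) = s((a : L), (b : L)) := h.trans (incl_val hab)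
    rw [Sym2.eq_iff] at this
    rcases this with ⟨rfl, rfl⟩ | ⟨rfl, rfl⟩
    · exact ⟨a.2, b.2⟩
    · exact ⟨b.2, a.2⟩
  · rintro ⟨X, hX, hx, hy⟩
    have hne : x ≠ y := by
      rintro rfl
      exact ℓ.2 (by rw [← h]; simp)
    refine ⟨X, hX, ⟨s(⟨x, hx⟩, ⟨y, hy⟩), pair_ne fun h' => hne (congrArg Subtype.val h')⟩, ?_⟩
    exact Subtype.ext h

theorem eq_of_incl_eq {π : Finset (Finset L)} (hπ : π ∈ partitions Finset.univ) {X Y : Finset L}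
    (hX : X ∈ π) (hY : Y ∈ π) {ℓ : Pairs X} {ℓ' : Pairs Y}
    (h : Pairs.incl X ℓ = Pairs.incl Y ℓ') : X = Y := by
  obtain ⟨a, b, hab, _⟩ := exists_ends ℓ
  obtain ⟨a', b', hab', _⟩ := exists_ends ℓ'
  have : s((a : L), (b : L)) = s((a' : L), (b' : L)) := by
    rw [← incl_val hab, ← incl_val hab', h]
  rw [Sym2.eq_iff] at this
  rcases this with ⟨h1, _⟩ | ⟨h1, _⟩
  · exact eq_of_mem_partitions hπ hX hY a.2 (h1 ▸ a'.2)
  · exact eq_of_mem_partitions hπ hX hY a.2 (h1 ▸ b'.2)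

/-- If every edge lies in a block, a walk never leaves the block of its start, so it is a walk of
the induced graph. -/
theorem reachable_comap_of_block {π : Finset (Finset L)} (hπ : π ∈ partitions Finset.univ)
    {G : SimpleGraph L} (hG : ∀ x y, G.Adj x y → ∃ X ∈ π, x ∈ X ∧ y ∈ X) {X : Finset L}
    (hX : X ∈ π) {x y : L} (hx : x ∈ X) (h : G.Reachable x y) :
    ∃ hy : y ∈ X, (G.comap (Subtype.val : X → L)).Reachable ⟨x, hx⟩ ⟨y, hy⟩ := by
  obtain ⟨p⟩ := h
  induction p with
  | nil => exact ⟨hx, SimpleGraph.Reachable.refl _⟩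
  | @cons a b c hab q ih =>
    obtain ⟨Y, hY, ha, hb⟩ := hG a b hab
    obtain rfl := eq_of_mem_partitions hπ hX hY hx ha
    obtain ⟨hc, h⟩ := ih hb
    refine ⟨hc, SimpleGraph.Reachable.trans ?_ h⟩
    exact SimpleGraph.Adj.reachable (by simpa using hab)

theorem mem_parts_ofSetoid {G : SimpleGraph L} {X : Finset L} :
    X ∈ (Finpartition.ofSetoid G.reachableSetoid).parts ↔
      ∃ x, ∀ y, y ∈ X ↔ G.Reachable x y := by
  rw [Finpartition.ofSetoid, Finpartition.ofSetSetoid_parts, Finset.mem_image]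
  constructor
  · rintro ⟨x, _, rfl⟩
    exact ⟨x, fun y => by
      rw [Finset.mem_filter]
      exact ⟨fun h => h.2, fun h => ⟨Finset.mem_univ _, h⟩⟩⟩
  · rintro ⟨x, hx⟩
    refine ⟨x, Finset.mem_univ _, ?_⟩
    ext y
    rw [hx, Finset.mem_filter]
    exact ⟨fun h => h.2, fun h => ⟨Finset.mem_univ _, h⟩⟩

theorem parts_mem_partitions (G : SimpleGraph L) :
    (Finpartition.ofSetoid G.reachableSetoid).parts ∈ partitions Finset.univ := by
  refine mem_partitions_univ ?_ ?_ ?_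
  · intro X hX
    obtain ⟨x, hx⟩ := mem_parts_ofSetoid.1 hX
    exact ⟨x, (hx x).2 (SimpleGraph.Reachable.refl _)⟩
  · intro X hX Y hY a ha hb
    obtain ⟨x, hx⟩ := mem_parts_ofSetoid.1 hX
    obtain ⟨y, hy⟩ := mem_parts_ofSetoid.1 hY
    ext b
    rw [hx, hy]
    have h := ((hx a).1 ha).trans ((hy a).1 hb).symm
    exact ⟨fun h' => h.symm.trans h', fun h' => h.trans h'⟩
  · intro x
    refine ⟨Finset.univ.filter fun y => G.Reachable x y, ?_, ?_⟩
    · exact mem_parts_ofSetoid.2 ⟨x, fun y => by simp⟩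
    · simp

theorem parts_eq_of_blocks {π : Finset (Finset L)} (hπ : π ∈ partitions Finset.univ)
    {G : SimpleGraph L} (hG : ∀ x y, G.Adj x y → ∃ X ∈ π, x ∈ X ∧ y ∈ X)
    (hc : ∀ X ∈ π, ∀ x ∈ X, ∀ y ∈ X, G.Reachable x y) :
    (Finpartition.ofSetoid G.reachableSetoid).parts = π := by
  ext X
  rw [mem_parts_ofSetoid]
  constructor
  · rintro ⟨x, hx⟩
    obtain ⟨Y, hY, hxY⟩ := exists_block hπ x
    have : X = Y := by
      ext y
      rw [hx]
      exact ⟨fun h => (reachable_comap_of_block hπ hG hY hxY h).1, fun h => hc Y hY x hxY y h⟩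
    rwa [this]
  · intro hX
    obtain ⟨x, hx⟩ := nonempty_of_mem_partitions hπ hX
    exact ⟨x, fun y => ⟨fun h => hc X hX x hx y h,
      fun h => (reachable_comap_of_block hπ hG hX hx h).1⟩⟩

/-- Couplings that do not vanish exactly inside the blocks of `π`. -/
theorem couplingParts_eq {π : Finset (Finset L)} (hπ : π ∈ partitions Finset.univ)
    {s : Pairs L → ℝ} (h : ∀ ℓ, s ℓ ≠ 0 ↔ InBlock π ℓ) : couplingParts s = π := by
  have hadj : ∀ x y, (SimpleGraph.fromEdgeSet
      {e : Sym2 L | ∃ ℓ : Pairs L, ℓ.1 = e ∧ s ℓ ≠ 0}).Adj x y →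
      ∃ X ∈ π, x ∈ X ∧ y ∈ X := by
    intro x y hxy
    obtain ⟨ℓ, he, hs⟩ := ((SimpleGraph.fromEdgeSet_adj _).1 hxy).1
    exact (inBlock_iff he.symm).1 ((h ℓ).1 hs)
  rw [← parts_eq_of_blocks hπ hadj]
  · rw [couplingParts]
  · intro X hX x hx y hy
    by_cases hxy : x = y
    · rw [hxy]
    · refine SimpleGraph.Adj.reachable ((SimpleGraph.fromEdgeSet_adj _).2 ⟨?_, hxy⟩)
      exact ⟨⟨s(x, y), pair_ne hxy⟩, rfl, (h _).2 ((inBlock_iff rfl).2 ⟨X, hX, hx, hy⟩)⟩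

/-- The edges of `F` inside `X`. -/
def restrictEdges (X : Finset L) (F : Finset (Pairs L)) : Finset (Pairs X) :=
  Finset.univ.filter fun ℓ => Pairs.incl X ℓ ∈ F

theorem mem_restrictEdges {X : Finset L} {F : Finset (Pairs L)} {ℓ : Pairs X} :
    ℓ ∈ restrictEdges X F ↔ Pairs.incl X ℓ ∈ F := by simp [restrictEdges]

theorem edgeGraph_restrictEdges (X : Finset L) (F : Finset (Pairs L)) :
    edgeGraph (restrictEdges X F) = (edgeGraph F).comap (Subtype.val : X → L) := by
  ext x y
  rw [SimpleGraph.comap_adj, edgeGraph_adj, edgeGraph_adj]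
  constructor
  · rintro ⟨ℓ, hℓ, h⟩
    exact ⟨_, mem_restrictEdges.1 hℓ, incl_val h.symm⟩
  · rintro ⟨ℓ, hℓ, h⟩
    have hne : (x : L) ≠ y := by
      intro h'
      exact ℓ.2 (by rw [h, h']; simp)
    refine ⟨⟨s(x, y), pair_ne fun h' => hne (congrArg _ h')⟩, ?_, rfl⟩
    rw [mem_restrictEdges]
    convert hℓ using 1
    exact Subtype.ext h.symm

/-- `F` is a forest and its trees are the blocks of `π`. -/
def SpansBlocks (π : Finset (Finset L)) (F : Finset (Pairs L)) : Prop :=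
  (∀ ℓ ∈ F, InBlock π ℓ) ∧ ∀ X ∈ π, restrictEdges X F ∈ spanningTrees X

/-- The partition into the components of a forest. -/
def forestParts (F : Finset (Pairs L)) : Finset (Finset L) :=
  (Finpartition.ofSetoid (edgeGraph F).reachableSetoid).parts

theorem isTree_restrictEdges {π : Finset (Finset L)} {F : Finset (Pairs L)}
    (h : SpansBlocks π F) {X : Finset L} (hX : X ∈ π) :
    ((edgeGraph F).comap (Subtype.val : X → L)).IsTree := by
  rw [← edgeGraph_restrictEdges]
  exact (Finset.mem_filter.1 (h.2 X hX)).2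

theorem spansBlocks_forestParts {F : Finset (Pairs L)} (hF : (edgeGraph F).IsAcyclic) :
    SpansBlocks (forestParts F) F := by
  refine ⟨fun ℓ hℓ => ?_, fun X hX => ?_⟩
  · obtain ⟨x, y, hxy, _⟩ := exists_ends ℓ
    obtain ⟨X, hX, hx⟩ := exists_block (parts_mem_partitions (edgeGraph F)) x
    refine (inBlock_iff hxy).2 ⟨X, hX, hx, ?_⟩
    obtain ⟨z, hz⟩ := mem_parts_ofSetoid.1 hX
    rw [hz] at hx ⊢
    exact hx.trans (edgeGraph_adj.2 ⟨ℓ, hℓ, hxy.symm⟩).reachable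
  · obtain ⟨z, hz⟩ := mem_parts_ofSetoid.1 hX
    rw [spanningTrees, Finset.mem_filter, edgeGraph_restrictEdges]
    refine ⟨Finset.mem_univ _, connected_comap_component _ z X hz, ?_⟩
    exact hF.of_comap (Function.Embedding.subtype _)

theorem adj_block {π : Finset (Finset L)} {F : Finset (Pairs L)} (h : ∀ ℓ ∈ F, InBlock π ℓ)
    (x y : L) (hxy : (edgeGraph F).Adj x y) : ∃ X ∈ π, x ∈ X ∧ y ∈ X := by
  obtain ⟨ℓ, hℓ, he⟩ := edgeGraph_adj.1 hxy
  exact (inBlock_iff he.symm).1 (h ℓ hℓ)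

theorem reachable_of_spansBlocks {π : Finset (Finset L)} {F : Finset (Pairs L)}
    (h : SpansBlocks π F) {X : Finset L} (hX : X ∈ π) {x y : L} (hx : x ∈ X) (hy : y ∈ X) :
    (edgeGraph F).Reachable x y := by
  have := (isTree_restrictEdges h hX).1.preconnected ⟨x, hx⟩ ⟨y, hy⟩
  exact this.map (SimpleGraph.Hom.comap (Subtype.val : X → L) (edgeGraph F))

theorem forestParts_eq {π : Finset (Finset L)} (hπ : π ∈ partitions Finset.univ)
    {F : Finset (Pairs L)} (h : SpansBlocks π F) : forestParts F = π :=
  parts_eq_of_blocks hπ (adj_block h.1) fun _ hX _ hx _ hy => reachable_of_spansBlocks h hX hx hy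

/-- Every edge is a bridge: a walk avoiding it would stay in its block, where the graph is a tree.
-/
theorem acyclic_of_spansBlocks {π : Finset (Finset L)} (hπ : π ∈ partitions Finset.univ)
    {F : Finset (Pairs L)} (h : SpansBlocks π F) : (edgeGraph F).IsAcyclic := by
  rw [SimpleGraph.isAcyclic_iff_forall_adj_isBridge]
  intro x y hxy
  obtain ⟨X, hX, hx, hy⟩ := adj_block h.1 x y hxy
  rw [SimpleGraph.isBridge_iff]
  intro hr
  have hG : ∀ a b, ((edgeGraph F).deleteEdges {s(x, y)}).Adj a b → ∃ X ∈ π, a ∈ X ∧ b ∈ X :=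
    fun a b hab => adj_block h.1 a b (SimpleGraph.deleteEdges_adj.1 hab).1
  obtain ⟨_, hr'⟩ := reachable_comap_of_block hπ hG hX hx hr
  have hb := SimpleGraph.isAcyclic_iff_forall_adj_isBridge.1 (isTree_restrictEdges h hX).2
    (v := ⟨x, hx⟩) (w := ⟨y, hy⟩) (by simpa using hxy)
  rw [SimpleGraph.isBridge_iff] at hb
  refine hb (hr'.mono ?_)
  intro a b hab
  rw [SimpleGraph.comap_adj, SimpleGraph.deleteEdges_adj] at hab
  rw [SimpleGraph.deleteEdges_adj, SimpleGraph.comap_adj]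
  refine ⟨hab.1, fun h' => hab.2 ?_⟩
  rw [Set.mem_singleton_iff] at h' ⊢
  exact congrArg (Sym2.map Subtype.val) h'

theorem linked_iff_inBlock {π : Finset (Finset L)} (hπ : π ∈ partitions Finset.univ)
    {F : Finset (Pairs L)} (h : SpansBlocks π F) (ℓ : Pairs L) : Linked F ℓ ↔ InBlock π ℓ := by
  obtain ⟨x, y, hxy, _⟩ := exists_ends ℓ
  rw [linked_iff hxy, inBlock_iff hxy]
  constructor
  · intro hr
    obtain ⟨X, hX, hx⟩ := exists_block hπ x
    exact ⟨X, hX, hx, (reachable_comap_of_block hπ (adj_block h.1) hX hx hr).1⟩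
  · rintro ⟨X, hX, hx, hy⟩
    exact reachable_of_spansBlocks h hX hx hy

/-- Sums over forests, arranged by the partition into trees. -/
theorem sum_forests_eq (f : Finset (Pairs L) → ℂ) :
    ∑ F ∈ Finset.univ.filter (fun F : Finset (Pairs L) => (edgeGraph F).IsAcyclic), f F =
      ∑ π ∈ partitions (Finset.univ : Finset L),
        ∑ F ∈ Finset.univ.filter (fun F : Finset (Pairs L) => SpansBlocks π F), f F := by
  rw [← Finset.sum_fiberwise_of_maps_to (g := forestParts)
    (t := partitions (Finset.univ : Finset L)) fun F _ => parts_mem_partitions (edgeGraph F)]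
  refine Finset.sum_congr rfl fun π hπ => Finset.sum_congr ?_ fun _ _ => rfl
  ext F
  simp only [Finset.mem_filter, Finset.mem_univ, true_and]
  constructor
  · rintro ⟨hF, rfl⟩
    exact spansBlocks_forestParts hF
  · intro h
    exact ⟨acyclic_of_spansBlocks hπ h, forestParts_eq hπ h⟩

/-- A sum over sets of pairs in the blocks of `π` factorizes. -/
theorem sum_inBlock_eq_prod {π : Finset (Finset L)} (hπ : π ∈ partitions Finset.univ)
    (t : (X : Finset L) → Finset (Finset (Pairs X))) (h : (X : Finset L) → Finset (Pairs X) → ℂ) :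
    ∑ F ∈ Finset.univ.filter (fun F : Finset (Pairs L) => (∀ ℓ ∈ F, InBlock π ℓ) ∧
        ∀ X ∈ π, restrictEdges X F ∈ t X), ∏ X ∈ π, h X (restrictEdges X F) =
      ∏ X ∈ π, ∑ T ∈ t X, h X T := by
  rw [Finset.prod_sum]
  have hglue : ∀ (p : (X : Finset L) → X ∈ π → Finset (Pairs X)) (X : Finset L) (hX : X ∈ π),
      restrictEdges X (π.attach.biUnion fun Y => (p Y.1 Y.2).image (Pairs.incl Y.1)) = p X hX := by
    intro p X hX
    ext ℓ
    rw [mem_restrictEdges, Finset.mem_biUnion]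
    constructor
    · rintro ⟨⟨Y, hY⟩, _, hℓ⟩
      obtain ⟨ℓ', hℓ', he⟩ := Finset.mem_image.1 hℓ
      obtain rfl := eq_of_incl_eq hπ hY hX he
      rwa [← incl_injective _ he]
    · intro hℓ
      exact ⟨⟨X, hX⟩, Finset.mem_attach _ _, Finset.mem_image_of_mem _ hℓ⟩
  refine Finset.sum_bij' (fun F _ => fun X _ => restrictEdges X F)
    (fun p _ => π.attach.biUnion fun Y => (p Y.1 Y.2).image (Pairs.incl Y.1)) ?_ ?_ ?_ ?_ ?_
  · intro F hF
    exact Finset.mem_pi.2 fun X hX => (Finset.mem_filter.1 hF).2.2 X hX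
  · intro p hp
    refine Finset.mem_filter.2 ⟨Finset.mem_univ _, ?_, ?_⟩
    · intro ℓ hℓ
      obtain ⟨⟨Y, hY⟩, _, hℓ⟩ := Finset.mem_biUnion.1 hℓ
      obtain ⟨ℓ', _, he⟩ := Finset.mem_image.1 hℓ
      exact ⟨Y, hY, ℓ', he⟩
    · intro X hX
      rw [hglue p X hX]
      exact Finset.mem_pi.1 hp X hX
  · intro F hF
    ext ℓ
    rw [Finset.mem_biUnion]
    constructor
    · rintro ⟨⟨Y, hY⟩, _, hℓ⟩
      obtain ⟨ℓ', h', rfl⟩ := Finset.mem_image.1 hℓ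
      exact mem_restrictEdges.1 h'
    · intro hℓ
      obtain ⟨X, hX, ℓ', rfl⟩ := (Finset.mem_filter.1 hF).2.1 ℓ hℓ
      exact ⟨⟨X, hX⟩, Finset.mem_attach _ _,
        Finset.mem_image_of_mem _ (mem_restrictEdges.2 hℓ)⟩
  · intro p hp
    funext X hX
    exact hglue p X hX
  · intro F hF
    exact (Finset.prod_attach π fun X => h X (restrictEdges X F)).symm

/-- Inside a block the interpolation is that of the tree on the block. -/
theorem forestInterp_incl {F : Finset (Pairs L)} (hF : (edgeGraph F).IsAcyclic) {X : Finset L}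
    (hX : restrictEdges X F ∈ spanningTrees X) (w : Pairs L → ℝ) (ℓ : Pairs X) :
    forestInterp F (fun e => w e) (Pairs.incl X ℓ) =
      forestInterp (restrictEdges X F) (fun e => w (Pairs.incl X e)) ℓ := by
  have hT := (Finset.mem_filter.1 hX).2
  obtain ⟨x, y, hxy, _⟩ := exists_ends ℓ
  obtain ⟨p, hp⟩ := (hT.1.preconnected x y).exists_isPath
  let φ : edgeGraph (restrictEdges X F) →g edgeGraph F :=
    ⟨Subtype.val, fun {a b} hab => by
      rw [edgeGraph_restrictEdges] at hab
      exact hab⟩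
  have hφ : Function.Injective φ := Subtype.val_injective
  have hq := hp.map hφ
  have hxy' : s((x : L), (y : L)) = (Pairs.incl X ℓ).1 := (incl_val hxy).symm
  obtain ⟨⟨e, he, hE⟩, hle⟩ := forestInterp_spec hT.2 (fun e => w (Pairs.incl X e)) hxy p hp
  obtain ⟨⟨e', he', hE'⟩, hle'⟩ := forestInterp_spec hF (fun e => w e) hxy' (p.map φ) hq
  rw [SimpleGraph.Walk.edges_map] at he' hle'
  refine le_antisymm ?_ ?_
  · rw [hE]
    exact hle' ⟨Pairs.incl X e, mem_restrictEdges.1 e.2⟩ (List.mem_map_of_mem he)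
  · rw [hE']
    obtain ⟨e₁, he₁, h₁⟩ := List.mem_map.1 he'
    obtain ⟨ℓ₁, hℓ₁, h₂⟩ := mem_edgeSet_edgeGraph.1 (p.edges_subset_edgeSet he₁)
    have h₃ : Pairs.incl X ℓ₁ = e'.1 := by
      refine Subtype.ext ?_
      rw [← h₁, ← h₂]
      rfl
    rw [← h₃]
    refine hle ⟨ℓ₁, hℓ₁⟩ ?_
    change ℓ₁.1 ∈ p.edges
    rw [h₂]
    exact he₁

theorem forestInterp_pos {ι : Type*} {F : Finset (Pairs ι)} (hF : (edgeGraph F).IsAcyclic)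
    {u : F → ℝ} (hu : ∀ e, u e ∈ Set.Ioo (0 : ℝ) 1) {ℓ : Pairs ι} (h : Linked F ℓ) :
    forestInterp F u ℓ ∈ Set.Ioo (0 : ℝ) 1 := by
  obtain ⟨e, he⟩ := exists_forestInterp_eq hF u h
  rw [he]
  exact hu e

end Blocks

/-! ## The forest interpolation formula -/

section UnitCube

variable {P : Type*} [Fintype P] [DecidableEq P]

theorem volume_restrict_cube : (volume.restrict (Set.Icc (0 : P → ℝ) 1) : Measure (P → ℝ)) =
    Measure.pi fun _ : P => volume.restrict (Set.Icc (0 : ℝ) 1) := by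
  have : Set.Icc (0 : P → ℝ) 1 = Set.pi Set.univ fun _ => Set.Icc (0 : ℝ) 1 := by
    rw [Set.pi_univ_Icc]; rfl
  rw [this, volume_pi, Measure.restrict_pi_pi]

instance isProbabilityMeasure_unitInterval :
    IsProbabilityMeasure (volume.restrict (Set.Icc (0 : ℝ) 1)) := ⟨by simp⟩

instance isProbabilityMeasure_cube :
    IsProbabilityMeasure (volume.restrict (Set.Icc (0 : P → ℝ) 1)) := by
  rw [volume_restrict_cube]; infer_instance

/-- Resampling one coordinate preserves the uniform measure of the cube. -/
theorem measurePreserving_update (ℓ : P) :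
    MeasurePreserving (fun p : (P → ℝ) × ℝ => Function.update p.1 ℓ p.2)
      ((volume.restrict (Set.Icc (0 : P → ℝ) 1)).prod (volume.restrict (Set.Icc (0 : ℝ) 1)))
      (volume.restrict (Set.Icc (0 : P → ℝ) 1)) := by
  have hm : Measurable fun p : (P → ℝ) × ℝ => Function.update p.1 ℓ p.2 := by
    refine measurable_pi_iff.2 fun e => ?_
    by_cases h : e = ℓ
    · subst h; simpa using measurable_snd
    · simp only [Function.update_of_ne h]
      exact (measurable_pi_apply e).comp measurable_fst
  refine ⟨hm, ?_⟩
  rw [volume_restrict_cube]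
  symm
  refine Measure.pi_eq fun s hs => ?_
  rw [Measure.map_apply hm (MeasurableSet.univ_pi hs)]
  have : (fun p : (P → ℝ) × ℝ => Function.update p.1 ℓ p.2) ⁻¹' Set.univ.pi s =
      (Set.univ.pi (Function.update s ℓ Set.univ)) ×ˢ s ℓ := by
    ext p
    simp only [Set.mem_preimage, Set.mem_pi, Set.mem_univ, true_implies, Set.mem_prod]
    constructor
    · intro h
      refine ⟨fun e => ?_, by simpa using h ℓ⟩
      by_cases he : e = ℓ
      · subst he; simp
      · simpa [he] using h e
    · rintro ⟨h1, h2⟩ e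
      by_cases he : e = ℓ
      · subst he; simpa using h2
      · simpa [he] using h1 e
  rw [this, Measure.prod_prod, Measure.pi_pi, ← Finset.mul_prod_erase _ _ (Finset.mem_univ ℓ),
    ← Finset.mul_prod_erase Finset.univ (fun i => (volume.restrict (Set.Icc (0 : ℝ) 1)) (s i))
      (Finset.mem_univ ℓ)]
  rw [Function.update_self, measure_univ, one_mul, mul_comm]
  congr 1
  refine Finset.prod_congr rfl fun e he => ?_
  rw [Function.update_of_ne (Finset.ne_of_mem_erase he)]

/-- Used from right to left, it merges the parameter of a newly added edge with the integral over
the remaining ones. -/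
theorem integral_update (ℓ : P) {g : (P → ℝ) → ℂ}
    (hg : Integrable g (volume.restrict (Set.Icc (0 : P → ℝ) 1))) :
    ∫ w in Set.Icc (0 : P → ℝ) 1, g w =
      ∫ τ in Set.Icc (0 : ℝ) 1, ∫ w in Set.Icc (0 : P → ℝ) 1, g (Function.update w ℓ τ) := by
  have h := measurePreserving_update ℓ
  have hi := h.integrable_comp_of_integrable hg
  refine Eq.trans ?_ (integral_prod_symm _ hi)
  have h2 := integral_map h.measurable.aemeasurable (f := g)
    (by rw [h.map_eq]; exact hg.aestronglyMeasurable)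
  rwa [h.map_eq] at h2

theorem ae_coord_ne {e ℓ : P} (h : e ≠ ℓ) :
    ∀ᵐ w ∂(volume.restrict (Set.Icc (0 : P → ℝ) 1)), w e ≠ w ℓ := by
  have hm : MeasurableSet {w : P → ℝ | w e = w ℓ} :=
    measurableSet_eq_fun (measurable_pi_apply e) (measurable_pi_apply ℓ)
  rw [ae_iff]
  simp only [ne_eq, not_not]
  have hp := measurePreserving_update ℓ
  rw [← hp.measure_preimage hm.nullMeasurableSet,
    Measure.measure_prod_null (hp.measurable hm)]
  refine Filter.Eventually.of_forall fun w => ?_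
  have : (Prod.mk w ⁻¹' ((fun p : (P → ℝ) × ℝ => Function.update p.1 ℓ p.2) ⁻¹'
      {w : P → ℝ | w e = w ℓ})) = {w e} := by
    ext τ
    simp [h, eq_comm]
  simp only [this]
  simp

/-- Ties between parameters are negligible, so the edges of a forest are almost surely ordered by
their parameters. -/
theorem ae_injective :
    ∀ᵐ w ∂(volume.restrict (Set.Icc (0 : P → ℝ) 1)), Function.Injective w := by
  have : ∀ᵐ w ∂(volume.restrict (Set.Icc (0 : P → ℝ) 1)), ∀ e ℓ : P, e ≠ ℓ → w e ≠ w ℓ := by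
    rw [ae_all_iff]; intro e
    rw [ae_all_iff]; intro ℓ
    by_cases h : e = ℓ
    · exact Filter.Eventually.of_forall fun w h' => absurd h h'
    · filter_upwards [ae_coord_ne h] with w hw _ using hw
  filter_upwards [this] with w hw e ℓ h
  by_contra h'
  exact hw e ℓ h' h

/-- On the open cube the couplings are nonzero exactly inside blocks, and derivatives within the
closed cube are ordinary ones. -/
theorem ae_mem_Ioo :
    ∀ᵐ w ∂(volume.restrict (Set.Icc (0 : P → ℝ) 1)), ∀ e, w e ∈ Set.Ioo (0 : ℝ) 1 := by
  rw [volume_restrict_cube, ae_all_iff]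
  intro e
  have h : ∀ᵐ τ ∂(volume.restrict (Set.Icc (0 : ℝ) 1)), τ ∈ Set.Ioo (0 : ℝ) 1 := by
    rw [Measure.restrict_congr_set Ioo_ae_eq_Icc.symm]
    exact ae_restrict_mem measurableSet_Ioo
  exact (Measure.tendsto_eval_ae_ae (μ := fun _ : P => volume.restrict (Set.Icc (0 : ℝ) 1))
    (i := e)).eventually h

end UnitCube

/-! ### Interpolation along growing forests -/

section Interpolation

variable {ι : Type*} [Fintype ι]

/-- The parameters v of the edges already chosen are frozen on F; the others are integrated. The
integration runs over all pairs, and coordinates off the forest are idle. -/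
theorem integrable_forest {D : (Pairs ι → ℝ) → ℂ} (hD : ContinuousOn D (ultraCouplings ι))
    {F F' : Finset (Pairs ι)} (hF' : (edgeGraph F').IsAcyclic) {v : Pairs ι → ℝ}
    (hv : v ∈ Set.Icc (0 : Pairs ι → ℝ) 1) :
    Integrable (fun w => D (forestInterp F' fun e => F.piecewise v w e))
      (volume.restrict (Set.Icc (0 : Pairs ι → ℝ) 1)) := by
  refine ContinuousOn.integrableOn_compact isCompact_Icc ?_
  refine hD.comp ?_ ?_
  · refine ((continuous_forestInterp hF').comp (continuous_pi fun e => ?_)).continuousOn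
    by_cases he : e.1 ∈ F
    · simpa [he] using continuous_const
    · simpa [he] using continuous_apply e.1
  · intro w hw
    refine forestInterp_mem_ultra hF' ⟨fun e => ?_, fun e => ?_⟩
    · by_cases he : e.1 ∈ F
      · simpa [he] using hv.1 e.1
      · simpa [he] using hw.1 e.1
    · by_cases he : e.1 ∈ F
      · simpa [he] using hv.2 e.1
      · simpa [he] using hw.2 e.1

theorem measurableSet_le_on (S : Finset (Pairs ι)) {f : (Pairs ι → ℝ) → ℝ} (hf : Measurable f) :
    MeasurableSet {w : Pairs ι → ℝ | ∀ e ∈ S, w e ≤ f w} := by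
  have : {w : Pairs ι → ℝ | ∀ e ∈ S, w e ≤ f w} = ⋂ e ∈ S, {w | w e ≤ f w} := by
    ext w; simp
  rw [this]
  exact Finset.measurableSet_biInter _ fun e _ => measurableSet_le (measurable_pi_apply e) hf

variable {D : Finset (Pairs ι) → (Pairs ι → ℝ) → ℂ}
  (hD : ∀ E, ContinuousOn (D E) (ultraCouplings ι))
  (hD' : ∀ E, ∀ s ∈ ultraCouplings ι, ∃ T : (Pairs ι → ℝ) →L[ℝ] ℂ,
    HasFDerivWithinAt (D E) T (Set.Icc 0 1) s ∧
      ∀ ℓ, ℓ ∉ E → T (Pi.single ℓ 1) = D (insert ℓ E) s)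

include hD hD' in
/-- Interpolating all couplings that do not join vertices of the same tree. -/
theorem forest_ftc {F : Finset (Pairs ι)} (hF : (edgeGraph F).IsAcyclic) {v : Pairs ι → ℝ}
    (hv : v ∈ Set.Icc (0 : Pairs ι → ℝ) 1) {t : ℝ} (ht : t ∈ Set.Icc (0 : ℝ) 1)
    (htv : ∀ e ∈ F, t ≤ v e) :
    D F (fun ℓ => max (forestInterp F (fun e => v e) ℓ) t) =
      D F (forestInterp F fun e => v e) +
        ∑ ℓ ∈ Finset.univ.filter (fun ℓ => ¬ Linked F ℓ), ∫ τ in Set.Icc 0 t,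
          D (insert ℓ F) (fun ℓ => max (forestInterp F (fun e => v e) ℓ) τ) := by
  have hu : (fun e : F => v e) ∈ Set.Icc (0 : F → ℝ) 1 := ⟨fun e => hv.1 e, fun e => hv.2 e⟩
  have hmem : ∀ τ ∈ Set.Icc 0 t, (fun ℓ => max (forestInterp F (fun e => v e) ℓ) τ) ∈
      ultraCouplings ι := fun τ hτ =>
    sup_const_mem_ultra (forestInterp_mem_ultra hF hu) hτ.1 (hτ.2.trans ht.2)
  -- For τ ≤ t the linked couplings are minima of parameters that are at least t, so max(·, τ)
  -- leaves them fixed and moves only the unlinked ones, linearly.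
  let γ : ℝ → Pairs ι → ℝ := fun τ ℓ =>
    if Linked F ℓ then forestInterp F (fun e => v e) ℓ else τ
  have hγ : ∀ τ ∈ Set.Icc 0 t, γ τ = fun ℓ => max (forestInterp F (fun e => v e) ℓ) τ := by
    intro τ hτ
    funext ℓ
    by_cases h : Linked F ℓ
    · obtain ⟨e, he⟩ := exists_forestInterp_eq hF (fun e : F => v e) h
      simp only [γ, if_pos h]
      rw [he, max_eq_left (hτ.2.trans (htv e e.2))]
    · simp only [γ, if_neg h]
      rw [forestInterp_of_not_linked _ h, max_eq_right hτ.1]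
  have hγc : Continuous γ := continuous_pi fun ℓ => by
    by_cases h : Linked F ℓ
    · simp only [γ, if_pos h]; exact continuous_const
    · simp only [γ, if_neg h]; exact continuous_id
  have hγd : ∀ τ, HasDerivAt γ (fun ℓ => if Linked F ℓ then 0 else 1) τ := by
    intro τ
    refine hasDerivAt_pi.2 fun ℓ => ?_
    by_cases h : Linked F ℓ
    · simp only [γ, if_pos h]; exact hasDerivAt_const _ _
    · simp only [γ, if_neg h]; exact hasDerivAt_id _
  have hγm : ∀ τ ∈ Set.Icc 0 t, γ τ ∈ ultraCouplings ι := fun τ hτ => hγ τ hτ ▸ hmem τ hτ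
  have hc : ∀ E, ContinuousOn (fun τ => D E (γ τ)) (Set.Icc 0 t) := fun E =>
    (hD E).comp hγc.continuousOn hγm
  have hsum : (fun ℓ => if Linked F ℓ then 0 else 1 : Pairs ι → ℝ) =
      ∑ ℓ ∈ Finset.univ.filter (fun ℓ => ¬ Linked F ℓ), Pi.single ℓ 1 := by
    funext ℓ
    rw [Finset.sum_apply]
    simp only [Pi.single_apply, Finset.sum_ite_eq, Finset.mem_filter, Finset.mem_univ, true_and]
    by_cases h : Linked F ℓ <;> simp [h]
  have hder : ∀ τ ∈ Set.Ioo 0 t, HasDerivAt (fun τ => D F (γ τ))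
      (∑ ℓ ∈ Finset.univ.filter (fun ℓ => ¬ Linked F ℓ), D (insert ℓ F) (γ τ)) τ := by
    intro τ hτ
    have hτ' := Set.Ioo_subset_Icc_self hτ
    obtain ⟨T, hT, hT'⟩ := hD' F (γ τ) (hγm τ hτ')
    -- The differential is taken within the full cube, although continuity and derivatives are
    -- assumed only at ultrametric points; the path runs through such points.
    have h := hT.comp_hasDerivWithinAt (s := Set.Icc 0 t) τ (hγd τ).hasDerivWithinAt
      (fun x hx => (hγm x hx).1)
    refine (h.hasDerivAt (Icc_mem_nhds hτ.1 hτ.2)).congr_deriv ?_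
    rw [hsum, map_sum]
    exact Finset.sum_congr rfl fun ℓ hℓ =>
      hT' ℓ fun h' => (Finset.mem_filter.1 hℓ).2 (linked_of_mem h')
  have hci : ContinuousOn (fun τ => ∑ ℓ ∈ Finset.univ.filter (fun ℓ => ¬ Linked F ℓ),
      D (insert ℓ F) (γ τ)) (Set.Icc 0 t) := continuousOn_finsetSum _ fun ℓ _ => hc _
  have hftc := intervalIntegral.integral_eq_sub_of_hasDerivAt_of_le ht.1 (hc F) hder
    (hci.intervalIntegrable_of_Icc ht.1)
  rw [intervalIntegral.integral_of_le ht.1, ← integral_Icc_eq_integral_Ioc,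
    integral_finsetSum _ fun ℓ _ => (hc _).integrableOn_compact isCompact_Icc] at hftc
  have h0 : γ 0 = forestInterp F fun e => v e := by
    rw [hγ 0 ⟨le_rfl, ht.1⟩]
    funext ℓ
    exact max_eq_left ((forestInterp_mem hF hu).1 ℓ)
  rw [h0, hγ t ⟨ht.1, le_rfl⟩] at hftc
  rw [eq_sub_iff_add_eq'] at hftc
  rw [← hftc]
  congr 1
  refine Finset.sum_congr rfl fun ℓ _ => setIntegral_congr_fun measurableSet_Icc fun τ hτ => ?_
  exact congrArg _ (hγ τ hτ)

/-- Almost everywhere exactly one coordinate is the largest. -/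
theorem ae_sum_max (S : Finset (Pairs ι)) (hS : S.Nonempty) (t : ℝ) (h : (Pairs ι → ℝ) → ℂ) :
    ∀ᵐ w ∂(volume.restrict (Set.Icc (0 : Pairs ι → ℝ) 1)),
      ∑ ℓ ∈ S, Set.indicator {w : Pairs ι → ℝ | w ℓ ≤ t}
        (Set.indicator {w : Pairs ι → ℝ | ∀ e ∈ S, w e ≤ w ℓ} h) w =
      Set.indicator {w : Pairs ι → ℝ | ∀ e ∈ S, w e ≤ t} h w := by
  filter_upwards [ae_injective] with w hw
  obtain ⟨ℓ, hℓ, hmax⟩ := S.exists_max_image w hS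
  rw [Finset.sum_eq_single ℓ]
  · by_cases ht : w ℓ ≤ t
    · rw [Set.indicator_of_mem (show w ∈ {w : Pairs ι → ℝ | w ℓ ≤ t} from ht),
        Set.indicator_of_mem (show w ∈ {w : Pairs ι → ℝ | ∀ e ∈ S, w e ≤ w ℓ} from hmax),
        Set.indicator_of_mem]
      exact fun e he => (hmax e he).trans ht
    · rw [Set.indicator_of_notMem (show w ∉ {w : Pairs ι → ℝ | w ℓ ≤ t} from ht),
        Set.indicator_of_notMem]
      exact fun h' => ht (h' ℓ hℓ)
  · intro e he hne
    have : w ∉ {w : Pairs ι → ℝ | ∀ e' ∈ S, w e' ≤ w e} := fun h' =>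
      hne (hw (le_antisymm (hmax e he) (h' ℓ hℓ)))
    rw [Set.indicator_apply, Set.indicator_of_notMem this, ite_self]
  · exact fun h' => absurd hℓ h'

include hD hD' in
-- Here D E plays the role of the derivative with respect to the couplings in E. Lowering the
-- unlinked couplings from t to 0 yields the term of F itself plus an integral over a first new edge
-- ℓ with parameter τ ≤ t; the induction hypothesis for F ∪ {ℓ} at level τ adds further edges with
-- parameters at most τ. A forest F' thus arises once for each choice of its edge of largest
-- parameter outside F, and these choices exhaust the cube up to a null set.
theorem forest_formula_aux (n : ℕ) : ∀ F : Finset (Pairs ι), (Finset.univ \ F).card = n →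
    (edgeGraph F).IsAcyclic → ∀ v ∈ Set.Icc (0 : Pairs ι → ℝ) 1, ∀ t ∈ Set.Icc (0 : ℝ) 1,
    (∀ e ∈ F, t ≤ v e) →
    D F (fun ℓ => max (forestInterp F (fun e => v e) ℓ) t) =
      ∑ F' ∈ Finset.univ.filter (fun F' : Finset (Pairs ι) =>
          (edgeGraph F').IsAcyclic ∧ F ⊆ F'),
        ∫ w in Set.Icc (0 : Pairs ι → ℝ) 1, Set.indicator {w | ∀ e ∈ F' \ F, w e ≤ t}
          (fun w => D F' (forestInterp F' fun e => F.piecewise v w e)) w := by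
  induction n using Nat.strong_induction_on with | _ n ih =>
  intro F hn hF v hv t ht htv
  set μ := (volume.restrict (Set.Icc (0 : Pairs ι → ℝ) 1) : Measure (Pairs ι → ℝ)) with hμ
  set H : Finset (Pairs ι) → (Pairs ι → ℝ) → ℂ :=
    fun F' w => D F' (forestInterp F' fun e => F.piecewise v w e) with hH
  have hmeas : ∀ (F' : Finset (Pairs ι)) (ℓ : Pairs ι),
      MeasurableSet {w : Pairs ι → ℝ | ∀ e ∈ F' \ F, w e ≤ w ℓ} :=
    fun F' ℓ => measurableSet_le_on _ (measurable_pi_apply ℓ)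
  have hmeas' : ∀ ℓ : Pairs ι, MeasurableSet {w : Pairs ι → ℝ | w ℓ ≤ t} :=
    fun ℓ => measurableSet_le (measurable_pi_apply ℓ) measurable_const
  have hint : ∀ F' : Finset (Pairs ι), (edgeGraph F').IsAcyclic → Integrable (H F') μ :=
    fun F' h' => integrable_forest (hD F') h' hv
  have hstep : ∀ ℓ ∈ Finset.univ.filter (fun ℓ => ¬ Linked F ℓ),
      ∫ τ in Set.Icc 0 t, D (insert ℓ F) (fun ℓ => max (forestInterp F (fun e => v e) ℓ) τ) =
      ∑ F' ∈ Finset.univ.filter (fun F' : Finset (Pairs ι) =>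
          (edgeGraph F').IsAcyclic ∧ insert ℓ F ⊆ F'),
        ∫ w, Set.indicator {w : Pairs ι → ℝ | w ℓ ≤ t}
          (Set.indicator {w : Pairs ι → ℝ | ∀ e ∈ F' \ F, w e ≤ w ℓ} (H F')) w ∂μ := by
    intro ℓ hℓ
    have hℓ' := (Finset.mem_filter.1 hℓ).2
    have hℓF : ℓ ∉ F := fun h => hℓ' (linked_of_mem h)
    have hins := (acyclic_insert_iff hℓF hF).2 hℓ'
    have hK : ∀ F' ∈ Finset.univ.filter (fun F' : Finset (Pairs ι) =>
          (edgeGraph F').IsAcyclic ∧ insert ℓ F ⊆ F'),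
        Integrable (Set.indicator {w : Pairs ι → ℝ | w ℓ ≤ t}
          (Set.indicator {w : Pairs ι → ℝ | ∀ e ∈ F' \ F, w e ≤ w ℓ} (H F'))) μ :=
      fun F' hF' => ((hint F' (Finset.mem_filter.1 hF').2.1).indicator (hmeas F' ℓ)).indicator
        (hmeas' ℓ)
    have hτ : ∀ τ ∈ Set.Icc (0 : ℝ) t,
        D (insert ℓ F) (fun ℓ => max (forestInterp F (fun e => v e) ℓ) τ) =
        ∑ F' ∈ Finset.univ.filter (fun F' : Finset (Pairs ι) =>
          (edgeGraph F').IsAcyclic ∧ insert ℓ F ⊆ F'),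
          ∫ w, Set.indicator {w : Pairs ι → ℝ | w ℓ ≤ t}
          (Set.indicator {w : Pairs ι → ℝ | ∀ e ∈ F' \ F, w e ≤ w ℓ} (H F'))
            (Function.update w ℓ τ) ∂μ := by
      intro τ hτ
      have hτ1 : τ ∈ Set.Icc (0 : ℝ) 1 := ⟨hτ.1, hτ.2.trans ht.2⟩
      have hup : ∀ e ∈ F, Function.update v ℓ τ e = v e := fun e he =>
        Function.update_of_ne (fun h => hℓF (by rwa [h] at he)) _ _
      -- At level τ the edge ℓ with parameter τ may be added to the forest without changing the
      -- couplings.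
      have h1 : (fun ℓ' => max (forestInterp F (fun e => v e) ℓ') τ) =
          fun ℓ' => max (forestInterp (insert ℓ F) (fun e => Function.update v ℓ τ e) ℓ') τ := by
        funext ℓ'
        have := max_forestInterp_insert (v := Function.update v ℓ τ) hins
          (by rw [Function.update_self]; exact hτ.1)
          (by intro e he
              rw [Function.update_self, hup e he]
              exact hτ.2.trans (htv e he)) ℓ'
        rw [Function.update_self] at this
        rw [this]
        congr 2
        funext e
        exact (hup e e.2).symm
      have hcube : Function.update v ℓ τ ∈ Set.Icc (0 : Pairs ι → ℝ) 1 := by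
        constructor <;> intro e <;> by_cases he : e = ℓ
        · subst he; simpa using hτ1.1
        · simpa [he] using hv.1 e
        · subst he; simpa using hτ1.2
        · simpa [he] using hv.2 e
      rw [h1, ih _ ?_ (insert ℓ F) rfl hins _ hcube τ hτ1 ?_]
      · refine Finset.sum_congr rfl fun F' hF' => integral_congr_ae
          (Filter.Eventually.of_forall fun w => ?_)
        have hsub := (Finset.mem_filter.1 hF').2.2
        have hpw : (insert ℓ F).piecewise (Function.update v ℓ τ) w =
            F.piecewise v (Function.update w ℓ τ) := by
          funext e
          by_cases he : e = ℓ
          · subst he; simp [hℓF]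
          · by_cases heF : e ∈ F <;> simp [he, heF]
        have hset : (∀ e ∈ F' \ insert ℓ F, w e ≤ τ) ↔
            ∀ e ∈ F' \ F, Function.update w ℓ τ e ≤ Function.update w ℓ τ ℓ := by
          rw [Function.update_self]
          constructor
          · intro h e he
            by_cases hel : e = ℓ
            · subst hel; simp
            · rw [Function.update_of_ne hel]
              refine h e (Finset.mem_sdiff.2 ⟨(Finset.mem_sdiff.1 he).1, fun h' => ?_⟩)
              rcases Finset.mem_insert.1 h' with h' | h'
              · exact hel h'
              · exact (Finset.mem_sdiff.1 he).2 h'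
          · intro h e he
            have hel : e ≠ ℓ := fun h' => (Finset.mem_sdiff.1 he).2 (h' ▸ Finset.mem_insert_self _ _)
            have := h e (Finset.mem_sdiff.2 ⟨(Finset.mem_sdiff.1 he).1, fun h' =>
              (Finset.mem_sdiff.1 he).2 (Finset.mem_insert_of_mem h')⟩)
            rwa [Function.update_of_ne hel] at this
        simp only
        rw [Set.indicator_of_mem (show Function.update w ℓ τ ∈ {w : Pairs ι → ℝ | w ℓ ≤ t} by
          simpa using hτ.2)]
        by_cases hall : ∀ e ∈ F' \ insert ℓ F, w e ≤ τ
        · rw [Set.indicator_of_mem (show w ∈ {w : Pairs ι → ℝ | ∀ e ∈ F' \ insert ℓ F, w e ≤ τ}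
            from hall), Set.indicator_of_mem (show Function.update w ℓ τ ∈
              {w : Pairs ι → ℝ | ∀ e ∈ F' \ F, w e ≤ w ℓ} from hset.1 hall)]
          simp only [hH, hpw]
        · rw [Set.indicator_of_notMem (show w ∉ {w : Pairs ι → ℝ | ∀ e ∈ F' \ insert ℓ F, w e ≤ τ}
            from hall), Set.indicator_of_notMem (show Function.update w ℓ τ ∉
              {w : Pairs ι → ℝ | ∀ e ∈ F' \ F, w e ≤ w ℓ} from fun h => hall (hset.2 h))]
      · rw [← hn]
        refine Finset.card_lt_card ⟨Finset.sdiff_subset_sdiff le_rfl (Finset.subset_insert _ _), ?_⟩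
        intro h
        have := h (Finset.mem_sdiff.2 ⟨Finset.mem_univ ℓ, hℓF⟩)
        exact (Finset.mem_sdiff.1 this).2 (Finset.mem_insert_self _ _)
      · intro e he
        rcases Finset.mem_insert.1 he with rfl | he
        · rw [Function.update_self]
        · rw [hup e he]; exact hτ.2.trans (htv e he)
    rw [setIntegral_congr_fun measurableSet_Icc hτ, integral_finsetSum]
    -- The parameter τ takes the place of the idle coordinate ℓ, and the indicator of w ℓ ≤ t
    -- restricts [0, 1] to [0, t].
    · refine Finset.sum_congr rfl fun F' hF' => ?_
      rw [integral_update ℓ (hK F' hF')]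
      symm
      have hset : Set.Icc (0 : ℝ) t = Set.Icc (0 : ℝ) 1 ∩ Set.Iic t := by
        ext τ; exact ⟨fun h => ⟨⟨h.1, h.2.trans ht.2⟩, h.2⟩, fun h => ⟨h.1.1, h.2⟩⟩
      rw [hset, ← setIntegral_indicator measurableSet_Iic]
      refine integral_congr_ae (Filter.Eventually.of_forall fun τ => ?_)
      by_cases h : τ ≤ t
      · rw [Set.indicator_of_mem (show τ ∈ Set.Iic t from h)]
      · simp only
        rw [Set.indicator_of_notMem (show τ ∉ Set.Iic t from h)]
        refine integral_eq_zero_of_ae (Filter.Eventually.of_forall fun w => ?_)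
        refine Set.indicator_of_notMem ?_ _
        simpa using h
    · intro F' hF'
      have := ((measurePreserving_update ℓ).integrable_comp_of_integrable
        (hK F' hF')).integral_prod_right
      exact Integrable.mono_measure this (Measure.restrict_mono (Set.Icc_subset_Icc_right ht.2) le_rfl)
  rw [forest_ftc hD hD' hF hv ht htv, Finset.sum_congr rfl hstep]
  have hself : F ∈ Finset.univ.filter (fun F' : Finset (Pairs ι) =>
      (edgeGraph F').IsAcyclic ∧ F ⊆ F') := by simp [hF]
  rw [← Finset.add_sum_erase _ _ hself]
  congr 1
  · have : ∀ w : Pairs ι → ℝ, Set.indicator {w : Pairs ι → ℝ | ∀ e ∈ F \ F, w e ≤ t}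
        (fun w => D F (forestInterp F fun e => F.piecewise v w e)) w =
        D F (forestInterp F fun e => v e) := by
      intro w
      rw [Set.indicator_of_mem (by simp)]
      congr 2
      funext e
      rw [Finset.piecewise_eq_of_mem _ _ _ e.2]
    simp only [this, integral_const, hμ, probReal_univ, one_smul]
  -- The cube is cut up according to which edge of F' \ F has the largest parameter.
  · have hrhs : ∀ F' ∈ (Finset.univ.filter (fun F' : Finset (Pairs ι) =>
        (edgeGraph F').IsAcyclic ∧ F ⊆ F')).erase F,
        ∫ w, Set.indicator {w | ∀ e ∈ F' \ F, w e ≤ t} (H F') w ∂μ =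
        ∑ ℓ ∈ F' \ F, ∫ w, Set.indicator {w : Pairs ι → ℝ | w ℓ ≤ t}
          (Set.indicator {w : Pairs ι → ℝ | ∀ e ∈ F' \ F, w e ≤ w ℓ} (H F')) w ∂μ := by
      intro F' hF'
      obtain ⟨hne, hF'⟩ := Finset.mem_erase.1 hF'
      have hF'2 := (Finset.mem_filter.1 hF').2
      have hnon : (F' \ F).Nonempty := by
        rw [Finset.sdiff_nonempty]
        exact fun h => hne (Finset.Subset.antisymm h hF'2.2)
      rw [← integral_finsetSum _ fun ℓ _ =>
        ((hint F' hF'2.1).indicator (hmeas F' ℓ)).indicator (hmeas' ℓ)]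
      exact integral_congr_ae ((ae_sum_max _ hnon t (H F')).mono fun w hw => hw.symm)
    rw [Finset.sum_congr rfl hrhs]
    refine Finset.sum_comm' fun ℓ F' => ?_
    simp only [Finset.mem_filter, Finset.mem_univ, true_and, Finset.mem_erase, Finset.mem_sdiff]
    constructor
    · rintro ⟨hl, hac, hsub⟩
      have hℓF' := hsub (Finset.mem_insert_self _ _)
      have hℓF : ℓ ∉ F := fun h => hl (linked_of_mem h)
      exact ⟨⟨hℓF', hℓF⟩, fun h => hℓF (h ▸ hℓF'), hac, (Finset.subset_insert _ _).trans hsub⟩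
    · rintro ⟨⟨hℓF', hℓF⟩, _, hac, hsub⟩
      have hsub' := Finset.insert_subset hℓF' hsub
      exact ⟨(acyclic_insert_iff hℓF hF).1 (hac.anti (edgeGraph_mono hsub')), hac, hsub'⟩

include hD hD' in
/-- The forest interpolation formula of Brydges, Kennedy, Abdesselam and Rivasseau. -/
theorem forest_formula :
    D ∅ 1 = ∑ F ∈ Finset.univ.filter (fun F : Finset (Pairs ι) => (edgeGraph F).IsAcyclic),
      ∫ w in Set.Icc (0 : Pairs ι → ℝ) 1, D F (forestInterp F fun e => w e) := by
  have hE : (edgeGraph (∅ : Finset (Pairs ι))).IsAcyclic := by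
    have : edgeGraph (∅ : Finset (Pairs ι)) = ⊥ := by
      ext x y
      simp [edgeGraph_adj]
    rw [this]
    exact SimpleGraph.isAcyclic_bot
  have h0 : (0 : Pairs ι → ℝ) ∈ Set.Icc (0 : Pairs ι → ℝ) 1 := ⟨le_rfl, zero_le_one⟩
  -- At level t = 1 the maximum is the constant coupling 1 and the constraint w e ≤ t is void.
  have h := forest_formula_aux hD hD' _ ∅ rfl hE 0 h0 1 ⟨zero_le_one, le_rfl⟩ (by simp)
  have h1 : (fun ℓ => max (forestInterp (∅ : Finset (Pairs ι)) (fun e => (0 : Pairs ι → ℝ) e) ℓ)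
      1) = 1 := by
    funext ℓ
    refine max_eq_right ((forestInterp_mem hE ?_).2 ℓ)
    exact ⟨fun _ => le_rfl, fun _ => zero_le_one⟩
  rw [h1] at h
  rw [h]
  refine Finset.sum_congr (by ext F; simp) fun F _ => ?_
  refine setIntegral_congr_fun measurableSet_Icc fun w hw => ?_
  rw [Set.indicator_of_mem (show w ∈ {w : Pairs ι → ℝ | ∀ e ∈ F \ ∅, w e ≤ 1} from
    fun e _ => hw.2 e)]
  simp

end Interpolation

/-! ## Accretive matrices -/

section Accretive

variable {κ : Type*} [Fintype κ] [DecidableEq κ]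

/-- The sesquilinear form of a matrix. -/
def sesqForm (M : Matrix κ κ ℂ) (ψ : κ → ℂ) : ℂ := ∑ a, ∑ b, star (ψ a) * M a b * ψ b

/-- Matrices whose sesquilinear form has positive real part. -/
def Accretive (M : Matrix κ κ ℂ) : Prop := ∀ ψ : κ → ℂ, ψ ≠ 0 → 0 < (sesqForm M ψ).re

theorem sesqForm_eq_dotProduct (M : Matrix κ κ ℂ) (ψ : κ → ℂ) :
    sesqForm M ψ = star ψ ⬝ᵥ M.mulVec ψ := by
  simp only [sesqForm, dotProduct, Matrix.mulVec, Finset.mul_sum, mul_assoc, Pi.star_apply]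

theorem sesqForm_one (ψ : κ → ℂ) :
    sesqForm (1 : Matrix κ κ ℂ) ψ = ((∑ a, ‖ψ a‖ ^ 2 : ℝ) : ℂ) := by
  rw [sesqForm_eq_dotProduct, Matrix.one_mulVec, dotProduct, Complex.ofReal_sum]
  refine Finset.sum_congr rfl fun a _ => ?_
  rw [Pi.star_apply, Complex.star_def, Complex.conj_mul', ← Complex.ofReal_pow]

theorem sesqForm_one_re (ψ : κ → ℂ) : (sesqForm (1 : Matrix κ κ ℂ) ψ).re = ∑ a, ‖ψ a‖ ^ 2 := by
  rw [sesqForm_one, Complex.ofReal_re]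

theorem sesqForm_smul (M : Matrix κ κ ℂ) (c : ℂ) (ψ : κ → ℂ) :
    sesqForm (c • M) ψ = c * sesqForm M ψ := by
  simp only [sesqForm, Finset.mul_sum, Matrix.smul_apply, smul_eq_mul]
  refine Finset.sum_congr rfl fun a _ => Finset.sum_congr rfl fun b _ => by ring

theorem sesqForm_add (M M' : Matrix κ κ ℂ) (ψ : κ → ℂ) :
    sesqForm (M + M') ψ = sesqForm M ψ + sesqForm M' ψ := by
  simp only [sesqForm, ← Finset.sum_add_distrib, Matrix.add_apply]
  refine Finset.sum_congr rfl fun a _ => Finset.sum_congr rfl fun b _ => by ring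

theorem sum_norm_sq_pos {ψ : κ → ℂ} (h : ψ ≠ 0) : 0 < ∑ a, ‖ψ a‖ ^ 2 := by
  obtain ⟨a, ha⟩ := Function.ne_iff.1 h
  refine Finset.sum_pos' (fun _ _ => by positivity) ⟨a, Finset.mem_univ _, ?_⟩
  have : 0 < ‖ψ a‖ := norm_pos_iff.2 ha
  positivity

theorem accretive_one : Accretive (1 : Matrix κ κ ℂ) := fun ψ hψ => by
  rw [sesqForm_one_re]; exact sum_norm_sq_pos hψ

theorem Accretive.segment {M : Matrix κ κ ℂ} (hM : Accretive M) {u : ℝ}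
    (hu : u ∈ Set.Icc (0 : ℝ) 1) :
    Accretive ((1 - (u : ℂ)) • (1 : Matrix κ κ ℂ) + (u : ℂ) • M) := by
  intro ψ hψ
  rw [sesqForm_add, sesqForm_smul, sesqForm_smul, Complex.add_re, ← Complex.ofReal_one,
    ← Complex.ofReal_sub, Complex.re_ofReal_mul, Complex.re_ofReal_mul]
  have h1 := accretive_one ψ hψ
  have h2 := hM ψ hψ
  rcases eq_or_lt_of_le hu.1 with h | h
  · rw [← h]; simpa using h1
  · have := mul_pos h h2
    have := mul_nonneg (sub_nonneg.2 hu.2) h1.le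
    linarith

theorem Accretive.smul {M : Matrix κ κ ℂ} (hM : Accretive M) {c : ℝ} (hc : 0 < c) :
    Accretive ((c : ℂ) • M) := by
  intro ψ hψ
  rw [sesqForm_smul, Complex.re_ofReal_mul]
  exact mul_pos hc (hM ψ hψ)

theorem Accretive.det_ne_zero {M : Matrix κ κ ℂ} (hM : Accretive M) : M.det ≠ 0 := by
  intro h
  obtain ⟨v, hv, h0⟩ := Matrix.exists_mulVec_eq_zero_iff.2 h
  have := hM v hv
  rw [sesqForm_eq_dotProduct, h0] at this
  simp at this

theorem Accretive.re_pos_of_mem_roots {M : Matrix κ κ ℂ} (hM : Accretive M) {z : ℂ}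
    (hz : z ∈ M.charpoly.roots) : 0 < z.re := by
  have h := (Polynomial.mem_roots'.1 hz).2
  rw [Polynomial.IsRoot.def, Matrix.eval_charpoly] at h
  obtain ⟨v, hv, h0⟩ := Matrix.exists_mulVec_eq_zero_iff.2 h
  rw [Matrix.sub_mulVec, sub_eq_zero] at h0
  have h1 := hM v hv
  rw [sesqForm_eq_dotProduct, ← h0, Matrix.scalar_apply, ← Matrix.smul_one_eq_diagonal,
    ← sesqForm_eq_dotProduct, sesqForm_smul, sesqForm_one, Complex.re_mul_ofReal] at h1
  exact pos_of_mul_pos_left h1 (sum_norm_sq_pos hv).le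

/-- The characteristic polynomial at -(1 - u)/u, rescaled. The roots move along segments from 1,
inside the right half plane when M is accretive, so the principal roots can be followed
continuously. -/
theorem det_segment (M : Matrix κ κ ℂ) (u : ℝ) :
    ((1 - (u : ℂ)) • (1 : Matrix κ κ ℂ) + (u : ℂ) • M).det =
      (M.charpoly.roots.map fun z => (1 - (u : ℂ)) + u * z).prod := by
  have hcard : M.charpoly.roots.card = Fintype.card κ := by
    rw [← (IsAlgClosed.splits M.charpoly).natDegree_eq_card_roots, Matrix.charpoly_natDegree_eq_dim]
  by_cases hu : (u : ℂ) = 0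
  · rw [hu]; simp
  · have h1 : (1 - (u : ℂ)) • (1 : Matrix κ κ ℂ) + (u : ℂ) • M =
        (-(u : ℂ)) • (Matrix.scalar κ (-(1 - (u : ℂ)) / u) - M) := by
      rw [smul_sub, neg_smul, neg_smul, sub_neg_eq_add, Matrix.scalar_apply,
        ← Matrix.smul_one_eq_diagonal, smul_smul, ← neg_smul]
      congr 2
      field_simp
    rw [h1, Matrix.det_smul, ← Matrix.eval_charpoly,
      (IsAlgClosed.splits M.charpoly).eval_eq_prod_roots_of_monic M.charpoly_monic, ← hcard,
      ← Multiset.prod_replicate, ← Multiset.map_const', ← Multiset.prod_map_mul]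
    refine congrArg _ (Multiset.map_congr rfl fun z _ => ?_)
    field_simp
    ring

theorem cpow_neg_half_sq (z : ℂ) : (z ^ (-(1 / 2) : ℂ)) ^ 2 = z⁻¹ := by
  rw [← Complex.cpow_nat_mul]
  norm_num
  exact Complex.cpow_neg_one z

theorem Accretive.roots_segment_re {M : Matrix κ κ ℂ} (hM : Accretive M) {u : ℝ}
    (hu : u ∈ Set.Icc (0 : ℝ) 1) {z : ℂ} (hz : z ∈ M.charpoly.roots) :
    0 < ((1 - (u : ℂ)) + u * z).re := by
  have h := hM.re_pos_of_mem_roots hz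
  rw [Complex.add_re, Complex.re_ofReal_mul, ← Complex.ofReal_one, ← Complex.ofReal_sub,
    Complex.ofReal_re]
  rcases eq_or_lt_of_le hu.1 with h' | h'
  · rw [← h']; simp
  · have := mul_pos h' h
    linarith [hu.2]

/-- The inverse square root of the determinant along the segment from the unit matrix. -/
def detInvSqrtPath (M : Matrix κ κ ℂ) (u : ℝ) : ℂ :=
  (M.charpoly.roots.map fun z : ℂ => ((1 - (u : ℂ)) + u * z) ^ (-(1 / 2) : ℂ)).prod

theorem detInvSqrtPath_one (M : Matrix κ κ ℂ) : detInvSqrtPath M 1 = detInvSqrt M := by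
  simp [detInvSqrtPath, detInvSqrt]

theorem detInvSqrtPath_zero (M : Matrix κ κ ℂ) : detInvSqrtPath M 0 = 1 := by
  simp [detInvSqrtPath]

theorem detInvSqrtPath_sq (M : Matrix κ κ ℂ) (u : ℝ) :
    detInvSqrtPath M u ^ 2 = (((1 - (u : ℂ)) • (1 : Matrix κ κ ℂ) + (u : ℂ) • M).det)⁻¹ := by
  rw [det_segment, detInvSqrtPath, ← Multiset.prod_map_pow, ← Multiset.prod_map_inv']
  rw [Multiset.map_map]
  refine congrArg _ (Multiset.map_congr rfl fun z _ => cpow_neg_half_sq _)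

theorem detInvSqrt_sq (M : Matrix κ κ ℂ) : detInvSqrt M ^ 2 = M.det⁻¹ := by
  have := detInvSqrtPath_sq M 1
  rw [detInvSqrtPath_one] at this
  rw [this]
  simp

theorem Accretive.continuousOn_detInvSqrtPath {M : Matrix κ κ ℂ} (hM : Accretive M) :
    ContinuousOn (detInvSqrtPath M) (Set.Icc 0 1) := by
  have : ∀ m : Multiset ℂ, (∀ z ∈ m, z ∈ M.charpoly.roots) →
      ContinuousOn (fun u : ℝ => (m.map fun z : ℂ =>
        ((1 - (u : ℂ)) + u * z) ^ (-(1 / 2) : ℂ)).prod) (Set.Icc 0 1) := by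
    intro m
    induction m using Multiset.induction_on with
    | empty => intro _; simpa using continuousOn_const
    | cons z m ih =>
      intro h
      simp only [Multiset.map_cons, Multiset.prod_cons]
      refine ContinuousOn.mul ?_ (ih fun w hw => h w (Multiset.mem_cons_of_mem hw))
      refine ContinuousOn.cpow (by fun_prop) continuousOn_const fun u hu => ?_
      exact Or.inl (hM.roots_segment_re hu (h z (Multiset.mem_cons_self _ _)))
  exact this _ fun _ h => h

theorem continuous_sesqForm {X : Type*} [TopologicalSpace X] {M : X → Matrix κ κ ℂ}
    (hM : Continuous M) : Continuous fun p : X × (κ → ℂ) => sesqForm (M p.1) p.2 := by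
  refine continuous_finsetSum _ fun a _ => continuous_finsetSum _ fun b _ => ?_
  refine Continuous.mul (Continuous.mul ?_ ?_) ?_
  · exact continuous_star.comp ((continuous_apply a).comp continuous_snd)
  · exact (hM.comp continuous_fst).matrix_elem a b
  · exact (continuous_apply b).comp continuous_snd

theorem sesqForm_ofReal_smul (M : Matrix κ κ ℂ) (c : ℝ) (ψ : κ → ℂ) :
    sesqForm M (c • ψ) = (c ^ 2 : ℝ) * sesqForm M ψ := by
  simp only [sesqForm, Finset.mul_sum, Pi.smul_apply, Complex.real_smul, star_mul',
    Complex.star_def, Complex.conj_ofReal]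
  refine Finset.sum_congr rfl fun a _ => Finset.sum_congr rfl fun b _ => ?_
  push_cast
  ring

theorem accretive_iff_sphere {M : Matrix κ κ ℂ} :
    Accretive M ↔ ∀ ψ ∈ Metric.sphere (0 : κ → ℂ) 1, 0 < (sesqForm M ψ).re := by
  constructor
  · intro h ψ hψ
    refine h ψ ?_
    rintro rfl
    simp at hψ
  · intro h ψ hψ
    have hn : 0 < ‖ψ‖ := norm_pos_iff.2 hψ
    have := h (‖ψ‖⁻¹ • ψ) (by simp [norm_smul, hn.ne'])
    rw [sesqForm_ofReal_smul, Complex.re_ofReal_mul] at this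
    exact pos_of_mul_pos_right this (by positivity)

/-- By homogeneity positivity is tested on the unit sphere, whose compactness makes the condition
open. -/
theorem isOpen_accretive {X : Type*} [TopologicalSpace X] {M : X → Matrix κ κ ℂ}
    (hM : Continuous M) : IsOpen {x | Accretive (M x)} := by
  rw [isOpen_iff_mem_nhds]
  intro x hx
  simp only [accretive_iff_sphere]
  refine (isCompact_sphere (0 : κ → ℂ) 1).eventually_forall_of_forall_eventually fun ψ hψ => ?_
  have hf := Complex.continuous_re.comp (continuous_sesqForm hM)
  have ho := isOpen_lt (continuous_const (y := (0 : ℝ))) hf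
  exact ho.mem_nhds (accretive_iff_sphere.1 hx ψ hψ)

/-- A quantitative lower bound. -/
theorem Accretive.exists_lower {M : Matrix κ κ ℂ} (hM : Accretive M) :
    ∃ c : ℝ, 0 < c ∧ ∀ ψ : κ → ℂ, c * ∑ a, ‖ψ a‖ ^ 2 ≤ (sesqForm M ψ).re := by
  have hc : Continuous fun ψ : κ → ℂ => (sesqForm M ψ).re := by
    refine Complex.continuous_re.comp ?_
    refine continuous_finsetSum _ fun a _ => continuous_finsetSum _ fun b _ => ?_
    refine Continuous.mul (Continuous.mul ?_ continuous_const) (continuous_apply b)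
    exact continuous_star.comp (continuous_apply a)
  have hs : Continuous fun ψ : κ → ℂ => ∑ a, ‖ψ a‖ ^ 2 := by fun_prop
  rcases (Metric.sphere (0 : κ → ℂ) 1).eq_empty_or_nonempty with h | h
  · refine ⟨1, one_pos, fun ψ => ?_⟩
    have : ψ = 0 := by
      by_contra hψ
      have hn : 0 < ‖ψ‖ := norm_pos_iff.2 hψ
      have : ‖ψ‖⁻¹ • ψ ∈ Metric.sphere (0 : κ → ℂ) 1 := by simp [norm_smul, hn.ne']
      rw [h] at this
      exact this
    subst this
    simp [sesqForm]
  · have hpos : ∀ ψ ∈ Metric.sphere (0 : κ → ℂ) 1, 0 < ∑ a, ‖ψ a‖ ^ 2 := fun ψ hψ =>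
      sum_norm_sq_pos (by rintro rfl; simp at hψ)
    obtain ⟨ψ₀, h₀, hmin⟩ := (isCompact_sphere (0 : κ → ℂ) 1).exists_isMinOn h
      (hc.continuousOn.div hs.continuousOn fun ψ hψ => (hpos ψ hψ).ne')
    refine ⟨_, div_pos (accretive_iff_sphere.1 hM ψ₀ h₀) (hpos ψ₀ h₀), fun ψ => ?_⟩
    by_cases hψ : ψ = 0
    · subst hψ; simp [sesqForm]
    · have hn : 0 < ‖ψ‖ := norm_pos_iff.2 hψ
      have hmem : ‖ψ‖⁻¹ • ψ ∈ Metric.sphere (0 : κ → ℂ) 1 := by simp [norm_smul, hn.ne']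
      have h1 : (sesqForm M ψ₀).re / (∑ a, ‖ψ₀ a‖ ^ 2) * ∑ a, ‖(‖ψ‖⁻¹ • ψ) a‖ ^ 2 ≤
        (sesqForm M (‖ψ‖⁻¹ • ψ)).re := (le_div_iff₀ (hpos _ hmem)).1 (hmin hmem)
      rw [sesqForm_ofReal_smul, Complex.re_ofReal_mul] at h1
      have h2 : ∑ a, ‖(‖ψ‖⁻¹ • ψ) a‖ ^ 2 = (‖ψ‖⁻¹) ^ 2 * ∑ a, ‖ψ a‖ ^ 2 := by
        rw [Finset.mul_sum]
        refine Finset.sum_congr rfl fun a _ => ?_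
        rw [Pi.smul_apply, norm_smul, norm_inv, norm_norm, mul_pow]
      rw [h2, mul_left_comm] at h1
      exact le_of_mul_le_mul_left h1 (by positivity)

/-- Locally, `detInvSqrt` is a branch of the inverse square root of the determinant. -/
theorem detInvSqrt_eventually_eq {X : Type*} [TopologicalSpace X] {M : X → Matrix κ κ ℂ}
    (hM : Continuous M) {x₀ : X} (h₀ : Accretive (M x₀)) :
    ∀ᶠ x in 𝓝 x₀, (M x).det / (M x₀).det ∈ Complex.slitPlane ∧ detInvSqrt (M x) =
      detInvSqrt (M x₀) * ((M x).det / (M x₀).det) ^ (-(1 / 2) : ℂ) := by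
  let p : X → ℝ → ℂ := fun x u => ((1 - (u : ℂ)) • (1 : Matrix κ κ ℂ) + (u : ℂ) • M x).det
  have hp : Continuous fun q : X × ℝ => p q.1 q.2 := by
    refine Continuous.matrix_det ?_
    have h2 : Continuous fun q : X × ℝ => M q.1 := hM.comp continuous_fst
    fun_prop
  have hne : ∀ x, Accretive (M x) → ∀ u ∈ Set.Icc (0 : ℝ) 1, p x u ≠ 0 := fun x hx u hu =>
    (hx.segment hu).det_ne_zero
  have hp1 : ∀ x, p x 1 = (M x).det := fun x => by simp [p]
  -- At x = x₀ the quotient is 1 for every u; compactness of [0, 1] keeps it in the slit plane for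
  -- all nearby x.
  have htube : ∀ᶠ x in 𝓝 x₀, ∀ u ∈ Set.Icc (0 : ℝ) 1, p x u / p x₀ u ∈ Complex.slitPlane := by
    refine isCompact_Icc.eventually_forall_of_forall_eventually fun u hu => ?_
    have hc : ContinuousAt (fun q : X × ℝ => p q.1 q.2 / p x₀ q.2) (x₀, u) := by
      refine hp.continuousAt.div ?_ (hne x₀ h₀ u hu)
      exact (hp.comp (continuous_const.prodMk continuous_snd :
        Continuous fun q : X × ℝ => (x₀, q.2))).continuousAt
    refine hc.eventually (Complex.isOpen_slitPlane.mem_nhds ?_)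
    simp only
    rw [div_self (hne x₀ h₀ u hu)]
    exact Complex.one_mem_slitPlane
  filter_upwards [htube, (isOpen_accretive hM).mem_nhds h₀] with x hx hacc
  refine ⟨by rw [← hp1, ← hp1]; exact hx 1 ⟨zero_le_one, le_rfl⟩, ?_⟩
  have hpu : ∀ y, Continuous fun u => p y u := fun y =>
    hp.comp (continuous_const.prodMk continuous_id : Continuous fun u : ℝ => (y, u))
  -- Both sides are continuous in u, have the same nonvanishing square and agree at u = 0, where
  -- both equal 1. This fixes the sign at u = 1.
  have key := isPreconnected_Icc.eq_of_sq_eq (S := Set.Icc (0 : ℝ) 1)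
    (f := detInvSqrtPath (M x))
    (g := fun u => detInvSqrtPath (M x₀) u * (p x u / p x₀ u) ^ (-(1 / 2) : ℂ))
    hacc.continuousOn_detInvSqrtPath ?_ ?_ ?_ (y := 0) ⟨le_rfl, zero_le_one⟩ ?_
  · have := key (x := 1) ⟨zero_le_one, le_rfl⟩
    simp only [detInvSqrtPath_one, hp1] at this
    exact this
  · refine h₀.continuousOn_detInvSqrtPath.mul (ContinuousOn.cpow ?_ continuousOn_const hx)
    exact (hpu x).continuousOn.div (hpu x₀).continuousOn fun u hu => hne x₀ h₀ u hu
  · intro u hu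
    simp only [Pi.pow_apply]
    rw [mul_pow, cpow_neg_half_sq, detInvSqrtPath_sq, detInvSqrtPath_sq]
    change (p x u)⁻¹ = (p x₀ u)⁻¹ * _
    have := hne x₀ h₀ u hu
    field_simp
  · intro u hu
    have hx0 : p x u / p x₀ u ≠ 0 := div_ne_zero (hne x hacc u hu) (hne x₀ h₀ u hu)
    refine mul_ne_zero ?_ ?_
    · intro h
      have := detInvSqrtPath_sq (M x₀) u
      rw [h] at this
      simp only [ne_eq, OfNat.ofNat_ne_zero, not_false_eq_true, zero_pow] at this
      exact hne x₀ h₀ u hu (inv_eq_zero.1 this.symm)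
    · rw [Complex.cpow_ne_zero_iff]
      exact Or.inl hx0
  · simp [detInvSqrtPath_zero, p]

/-- Accretivity of a matrix follows from that of the real part of its inverse. -/
theorem accretive_of_inv {M : Matrix κ κ ℂ}
    (h : ((1 / 2 : ℂ) • (M⁻¹ + M⁻¹.conjTranspose)).PosDef) : Accretive M := by
  have hinv : Accretive M⁻¹ := by
    intro ψ hψ
    have h1 := h.re_dotProduct_pos hψ
    rw [← sesqForm_eq_dotProduct, sesqForm_smul, sesqForm_add] at h1
    have h2 : sesqForm M⁻¹.conjTranspose ψ = star (sesqForm M⁻¹ ψ) := by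
      simp only [sesqForm, star_sum, Matrix.conjTranspose_apply]
      rw [Finset.sum_comm]
      refine Finset.sum_congr rfl fun a _ => Finset.sum_congr rfl fun b _ => ?_
      simp only [star_mul', star_star]
      ring
    rw [h2] at h1
    simp only [RCLike.re_to_complex, Complex.mul_re, Complex.add_re, Complex.star_def,
      Complex.conj_re, Complex.add_im, Complex.conj_im] at h1
    norm_num at h1
    linarith
  have hu : IsUnit M.det := Matrix.isUnit_nonsing_inv_det_iff.1 (isUnit_iff_ne_zero.2
    hinv.det_ne_zero)
  -- The form of M⁻¹ at Mψ is the complex conjugate of the form of M at ψ.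
  intro ψ hψ
  have hne : M.mulVec ψ ≠ 0 := by
    intro h0
    have := Matrix.exists_mulVec_eq_zero_iff.1 ⟨ψ, hψ, h0⟩
    exact hu.ne_zero this
  have h1 := hinv _ hne
  rw [sesqForm_eq_dotProduct, Matrix.mulVec_mulVec, Matrix.nonsing_inv_mul _ hu,
    Matrix.one_mulVec] at h1
  rw [sesqForm_eq_dotProduct]
  have : star (M.mulVec ψ) ⬝ᵥ ψ = star (star ψ ⬝ᵥ M.mulVec ψ) := by
    rw [Matrix.star_dotProduct]
  rw [this, Complex.star_def, Complex.conj_re] at h1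
  exact h1

end Accretive

/-! ## Interpolated covariances -/

section InterpCov

variable {ι : Type*} [Fintype ι] [DecidableEq ι] {N : ℕ}

theorem coupling_comm (s : Pairs ι → ℝ) (x y : ι) : coupling s x y = coupling s y x := by
  by_cases h : x = y
  · rw [h]
  · rw [coupling_of_ne s (ℓ := ⟨s(x, y), pair_ne h⟩) rfl,
      coupling_of_ne s (ℓ := ⟨s(x, y), pair_ne h⟩) Sym2.eq_swap]

/-- Masking by an equivalence relation leaves the sum of the forms of the restrictions of ψ to the
classes, and the squared norms of these restrictions add up. -/
theorem lower_of_setoid {C : Matrix (ι × Fin N) (ι × Fin N) ℂ} {c : ℝ}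
    (hc : ∀ ψ : ι × Fin N → ℂ, c * ∑ a, ‖ψ a‖ ^ 2 ≤ (sesqForm C ψ).re) (r : Setoid ι)
    (ψ : ι × Fin N → ℂ) :
    c * ∑ a, ‖ψ a‖ ^ 2 ≤ ∑ a, ∑ b, (star (ψ a) * C a b * ψ b).re *
      (if r a.1 b.1 then 1 else 0) := by
  let ψq : Quotient r → ι × Fin N → ℂ := fun q a => if Quotient.mk r a.1 = q then ψ a else 0
  have h1 : ∑ q, c * ∑ a, ‖ψq q a‖ ^ 2 = c * ∑ a, ‖ψ a‖ ^ 2 := by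
    rw [← Finset.mul_sum, Finset.sum_comm]
    congr 1
    refine Finset.sum_congr rfl fun a _ => ?_
    rw [Finset.sum_eq_single (Quotient.mk r a.1)]
    · simp [ψq]
    · intro q _ hq
      simp [ψq, hq.symm]
    · simp
  have h2 : ∑ q, (sesqForm C (ψq q)).re = ∑ a, ∑ b, (star (ψ a) * C a b * ψ b).re *
      (if r a.1 b.1 then 1 else 0) := by
    simp only [sesqForm, Complex.re_sum]
    rw [Finset.sum_comm]
    refine Finset.sum_congr rfl fun a _ => ?_
    rw [Finset.sum_comm]
    refine Finset.sum_congr rfl fun b _ => ?_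
    rw [Finset.sum_eq_single (Quotient.mk r a.1)]
    · by_cases h : r a.1 b.1
      · have : Quotient.mk r b.1 = Quotient.mk r a.1 := Quotient.sound (r.symm h)
        simp [ψq, this, h]
      · have : Quotient.mk r b.1 ≠ Quotient.mk r a.1 := fun h' => h (r.symm (Quotient.exact h'))
        simp [ψq, this, h]
    · intro q _ hq
      simp [ψq, hq.symm]
    · simp
  rw [← h1, ← h2]
  exact Finset.sum_le_sum fun q _ => hc (ψq q)

/-- The layer cake representation, which writes a coupling as an average of indicators. -/
theorem integral_indicator_le {k : ℝ} (hk0 : 0 ≤ k) (hk1 : k ≤ 1) :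
    ∫ τ in Set.Ioc (0 : ℝ) 1, (if τ ≤ k then (1 : ℝ) else 0) = k := by
  have : (fun τ : ℝ => if τ ≤ k then (1 : ℝ) else 0) = Set.indicator (Set.Iic k) fun _ => 1 := by
    funext τ
    simp [Set.indicator_apply]
  have hs : Set.Ioc (0 : ℝ) 1 ∩ Set.Iic k = Set.Ioc 0 k := by
    ext τ
    simp only [Set.mem_inter_iff, Set.mem_Ioc, Set.mem_Iic]
    constructor
    · rintro ⟨⟨h1, _⟩, h2⟩; exact ⟨h1, h2⟩
    · rintro ⟨h1, h2⟩; exact ⟨⟨h1, h2.trans hk1⟩, h2⟩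
  rw [this, setIntegral_indicator measurableSet_Iic, hs]
  simp [hk0]

theorem integrable_indicator_le (k : ℝ) :
    IntegrableOn (fun τ : ℝ => if τ ≤ k then (1 : ℝ) else 0) (Set.Ioc (0 : ℝ) 1) := by
  have : (fun τ : ℝ => if τ ≤ k then (1 : ℝ) else 0) = Set.indicator (Set.Iic k) fun _ => 1 := by
    funext τ
    simp [Set.indicator_apply]
  rw [this]
  exact (integrable_const 1).indicator measurableSet_Iic

/-- Ultrametric interpolations of an accretive covariance are accretive. -/
theorem Accretive.interpCov {C : Matrix (ι × Fin N) (ι × Fin N) ℂ} (hC : Accretive C)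
    {s : Pairs ι → ℝ} (hs : s ∈ ultraCouplings ι) : Accretive (interpCov C s) := by
  obtain ⟨c, hc, hlow⟩ := hC.exists_lower
  intro ψ hψ
  refine (mul_pos hc (sum_norm_sq_pos hψ)).trans_le ?_
  -- The ultrametric inequality says precisely that τ ≤ s({x, y}) is a transitive relation for each
  -- τ; averaging the masked bounds over τ gives the interpolated form.
  have key : ∀ τ ∈ Set.Ioc (0 : ℝ) 1, c * ∑ a, ‖ψ a‖ ^ 2 ≤
      ∑ a, ∑ b, (star (ψ a) * C a b * ψ b).re *
        (if τ ≤ coupling s a.1 b.1 then 1 else 0) := by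
    intro τ hτ
    let r : Setoid ι :=
      { r := fun x y => τ ≤ coupling s x y
        iseqv := ⟨fun x => by rw [coupling_self]; exact hτ.2,
          fun {x y} h => by rw [coupling_comm]; exact h,
          fun {x y z} h h' => (le_min h h').trans (hs.2 x y z)⟩ }
    exact lower_of_setoid hlow r ψ
  have hint : IntegrableOn (fun τ : ℝ => ∑ a, ∑ b, (star (ψ a) * C a b * ψ b).re *
      (if τ ≤ coupling s a.1 b.1 then 1 else 0)) (Set.Ioc (0 : ℝ) 1) :=
    integrable_finsetSum _ fun a _ => integrable_finsetSum _ fun b _ =>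
      (integrable_indicator_le _).const_mul _
  have h := setIntegral_mono_on (integrable_const _) hint measurableSet_Ioc key
  rw [integral_finsetSum _ fun a _ => integrable_finsetSum _ fun b _ =>
      (integrable_indicator_le _).const_mul _] at h
  have h2 : ∀ a ∈ Finset.univ, ∫ τ in Set.Ioc (0 : ℝ) 1,
      ∑ b, (star (ψ a) * C a b * ψ b).re * (if τ ≤ coupling s a.1 b.1 then 1 else 0) =
      ∑ b, (star (ψ a) * C a b * ψ b).re * coupling s a.1 b.1 := by
    intro a _
    rw [integral_finsetSum _ fun b _ => (integrable_indicator_le _).const_mul _]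
    refine Finset.sum_congr rfl fun b _ => ?_
    rw [integral_const_mul, integral_indicator_le (coupling_nonneg hs.1 _ _)
      (coupling_le_one hs.1 _ _)]
  rw [Finset.sum_congr rfl h2] at h
  simp only [integral_const, MeasurableSet.univ, measureReal_restrict_apply, Set.univ_inter,
    Real.volume_real_Ioc, sub_zero, zero_le_one, sup_of_le_left, smul_eq_mul, one_mul] at h
  refine h.trans (le_of_eq ?_)
  simp only [sesqForm, Complex.re_sum]
  refine Finset.sum_congr rfl fun a _ => Finset.sum_congr rfl fun b _ => ?_
  rw [← Complex.re_mul_ofReal]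
  congr 1
  simp only [_root_.interpCov, Matrix.of_apply]
  ring

/-- The form of a block is the full form at the vector extended by zero. -/
theorem Accretive.restrictCov {L : Type*} [Fintype L] [DecidableEq L]
    {C : Matrix (L × Fin N) (L × Fin N) ℂ} (hC : Accretive C) (X : Finset L) :
    Accretive (restrictCov C X) := by
  intro ψ hψ
  let ψ' : L × Fin N → ℂ := fun a => if h : a.1 ∈ X then ψ (⟨a.1, h⟩, a.2) else 0
  have hne : ψ' ≠ 0 := by
    obtain ⟨a, ha⟩ := Function.ne_iff.1 hψ
    refine Function.ne_iff.2 ⟨(a.1, a.2), ?_⟩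
    simpa [ψ', a.1.2] using ha
  have hsum : ∀ f : L × Fin N → ℂ, (∀ a, a.1 ∉ X → f a = 0) →
      ∑ a, f a = ∑ a : X × Fin N, f (a.1, a.2) := by
    intro f hf
    rw [Fintype.sum_prod_type, Fintype.sum_prod_type]
    rw [Finset.sum_coe_sort X fun x => ∑ m, f (x, m)]
    refine (Finset.sum_subset (Finset.subset_univ X) fun x _ hx => ?_).symm
    exact Finset.sum_eq_zero fun m _ => hf _ hx
  have h := hC ψ' hne
  have : sesqForm C ψ' = sesqForm (_root_.restrictCov C X) ψ := by
    rw [sesqForm, hsum]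
    · refine Finset.sum_congr rfl fun a _ => ?_
      rw [hsum]
      · refine Finset.sum_congr rfl fun b _ => ?_
        simp [ψ', _root_.restrictCov]
      · intro b hb
        simp [ψ', hb]
    · intro a ha
      exact Finset.sum_eq_zero fun b _ => by simp [ψ', ha]
  rwa [this] at h

theorem contDiff_coupling (x y : ι) : ContDiff ℝ ∞ fun s : Pairs ι → ℝ => coupling s x y := by
  unfold coupling
  split_ifs
  · exact contDiff_const
  · exact contDiff_apply ℝ ℝ _

theorem contDiff_interpCov (C : Matrix (ι × Fin N) (ι × Fin N) ℂ) (a b : ι × Fin N) :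
    ContDiff ℝ ∞ fun s : Pairs ι → ℝ => interpCov C s a b := by
  simp only [interpCov, Matrix.of_apply]
  exact contDiff_const.mul (Complex.ofRealCLM.contDiff.comp (contDiff_coupling a.1 b.1))

theorem continuous_interpCov (C : Matrix (ι × Fin N) (ι × Fin N) ℂ) :
    Continuous fun s : Pairs ι → ℝ => interpCov C s :=
  continuous_matrix fun a b => (contDiff_interpCov C a b).continuous

theorem interpCov_isSymm {C : Matrix (ι × Fin N) (ι × Fin N) ℂ} (hC : C.IsSymm)
    (s : Pairs ι → ℝ) : (interpCov C s).IsSymm := by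
  refine Matrix.IsSymm.ext fun a b => ?_
  simp only [interpCov, Matrix.of_apply]
  rw [coupling_comm, hC.apply]

theorem interpCov_one (C : Matrix (ι × Fin N) (ι × Fin N) ℂ) : interpCov C 1 = C := by
  ext a b
  have : coupling (1 : Pairs ι → ℝ) a.1 b.1 = 1 := by
    rw [coupling]; split_ifs <;> rfl
  simp [interpCov, this]

/-- The couplings for which the interpolated covariance is accretive. -/
def accretiveCouplings (C : Matrix (ι × Fin N) (ι × Fin N) ℂ) : Set (Pairs ι → ℝ) :=
  {s | Accretive (interpCov C s)}

/-- Changing one coupling usually leaves the ultrametric set, but all partial derivatives there are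
needed; this open set gives room for them. -/
theorem isOpen_accretiveCouplings (C : Matrix (ι × Fin N) (ι × Fin N) ℂ) :
    IsOpen (accretiveCouplings C) := isOpen_accretive (continuous_interpCov C)

theorem ultra_subset_accretive {C : Matrix (ι × Fin N) (ι × Fin N) ℂ} (hC : Accretive C) :
    ultraCouplings ι ⊆ accretiveCouplings C := fun _ hs => hC.interpCov hs

end InterpCov

/-! ### Smooth dependence of inverses and determinant roots -/

section SmoothMatrix

variable {κ : Type*} [Fintype κ] [DecidableEq κ] {E : Type*} [NormedAddCommGroup E]
  [NormedSpace ℝ E]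

theorem contDiff_det {M : E → Matrix κ κ ℂ} (hM : ∀ a b, ContDiff ℝ ∞ fun x => M x a b) :
    ContDiff ℝ ∞ fun x => (M x).det := by
  simp only [Matrix.det_apply]
  refine ContDiff.sum fun σ _ => ContDiff.const_smul _ ?_
  exact contDiff_prod fun a _ => hM _ _

theorem contDiffAt_inv_entry {M : E → Matrix κ κ ℂ} (hM : ∀ a b, ContDiff ℝ ∞ fun x => M x a b)
    {x : E} (hx : Accretive (M x)) (a b : κ) : ContDiffAt ℝ ∞ (fun x => (M x)⁻¹ a b) x := by
  simp only [Matrix.inv_def, Matrix.smul_apply, Ring.inverse_eq_inv', smul_eq_mul]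
  refine ContDiffAt.mul ((contDiff_det hM).contDiffAt.inv hx.det_ne_zero) ?_
  simp only [Matrix.adjugate_apply]
  refine ContDiff.contDiffAt (contDiff_det fun c d => ?_)
  by_cases h : c = b
  · subst h
    simp only [Matrix.updateRow_self]
    exact contDiff_const
  · simp only [Matrix.updateRow_ne h]
    exact hM c d

/-- Eigenvalues need not depend smoothly on x. Near a point, however, the product of principal roots
is a constant times a principal power of a ratio of determinants, which is smooth. -/
theorem contDiffAt_detInvSqrt {M : E → Matrix κ κ ℂ} (hM : ∀ a b, ContDiff ℝ ∞ fun x => M x a b)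
    {x : E} (hx : Accretive (M x)) : ContDiffAt ℝ ∞ (fun x => detInvSqrt (M x)) x := by
  have hc : Continuous M := continuous_matrix fun a b => (hM a b).continuous
  have h := detInvSqrt_eventually_eq hc hx
  have heq : (fun y => detInvSqrt (M y)) =ᶠ[𝓝 x] fun y =>
      detInvSqrt (M x) * Complex.exp (Complex.log ((M y).det / (M x).det) * (-(1 / 2))) := by
    filter_upwards [h] with y hy
    rw [hy.2, Complex.cpow_def_of_ne_zero (Complex.slitPlane_ne_zero hy.1)]
  refine ContDiffAt.congr_of_eventuallyEq ?_ heq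
  have hd : ContDiffAt ℝ ∞ (fun y => (M y).det / (M x).det) x :=
    (contDiff_det hM).contDiffAt.div_const _
  have hl : ContDiffAt ℝ ∞ (fun y => Complex.log ((M y).det / (M x).det)) x := by
    have h1 : ContDiffAt ℂ ∞ Complex.log ((M x).det / (M x).det) :=
      Complex.contDiffAt_log h.self_of_nhds.1
    exact (h1.restrict_scalars ℝ).comp x hd
  exact contDiffAt_const.mul ((hl.mul contDiffAt_const).cexp)

end SmoothMatrix

/-! ### Joint smoothness of the Gaussian density -/

section SmoothGauss

variable {ι : Type*} [Fintype ι] [DecidableEq ι] {N : ℕ}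

theorem contDiff_coord (a : ι × Fin N) : ContDiff ℝ ∞ fun φ : ι → Spin N => (φ a.1 a.2 : ℂ) := by
  have h : ContDiff ℝ ∞ fun φ : ι → Spin N => φ a.1 a.2 :=
    ((EuclideanSpace.proj (𝕜 := ℝ) a.2).comp
      (ContinuousLinearMap.proj (R := ℝ) (φ := fun _ : ι => Spin N) a.1)).contDiff
  exact Complex.ofRealCLM.contDiff.comp h

theorem contDiffOn_gaussDensity (C : Matrix (ι × Fin N) (ι × Fin N) ℂ) :
    ContDiffOn ℝ ∞ (fun p : (Pairs ι → ℝ) × (ι → Spin N) => gaussDensity (interpCov C p.1) p.2)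
      (accretiveCouplings C ×ˢ Set.univ) := by
  rintro ⟨s, φ⟩ ⟨hs, _⟩
  refine ContDiffAt.contDiffWithinAt ?_
  have hsm : ∀ a b, ContDiff ℝ ∞ fun s : Pairs ι → ℝ =>
      ((2 * (Real.pi : ℂ)) • interpCov C s) a b := fun a b =>
    contDiff_const.mul (contDiff_interpCov C a b)
  have hacc : Accretive ((2 * (Real.pi : ℂ)) • interpCov C s) := by
    have := Accretive.smul hs (c := 2 * Real.pi) (by positivity)
    push_cast at this
    exact this
  have hfst : ContDiffAt ℝ ∞ (fun p : (Pairs ι → ℝ) × (ι → Spin N) => p.1) (s, φ) :=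
    contDiffAt_fst
  have h1 := (contDiffAt_detInvSqrt hsm hacc).comp (s, φ) hfst
  have h2 : ∀ a b, ContDiffAt ℝ ∞ (fun p : (Pairs ι → ℝ) × (ι → Spin N) =>
      (interpCov C p.1)⁻¹ a b) (s, φ) := fun a b =>
    (contDiffAt_inv_entry (contDiff_interpCov C) hs a b).comp (s, φ) hfst
  have h3 : ∀ a : ι × Fin N, ContDiffAt ℝ ∞ (fun p : (Pairs ι → ℝ) × (ι → Spin N) =>
      (p.2 a.1 a.2 : ℂ)) (s, φ) := fun a =>
    (contDiff_coord a).contDiffAt.comp (s, φ) contDiffAt_snd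
  refine h1.mul (ContDiffAt.cexp (contDiffAt_const.mul ?_))
  exact ContDiffAt.sum fun a _ => ContDiffAt.sum fun b _ => ((h3 a).mul (h2 a b)).mul (h3 b)

end SmoothGauss

/-! ## Derivatives with respect to fields and parameters -/

section FoldrPerm

variable {α β : Type*} {op : α → β → β} {P : β → Prop}

theorem foldr_induction (hP : ∀ a b, P b → P (op a b)) (l : List α) {b : β} (hb : P b) :
    P (l.foldr op b) := by
  induction l with
  | nil => exact hb
  | cons a l ih => exact hP a _ ih

/-- Differential operators commute only on smooth functions, hence the invariant P. The lemma makes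
the arbitrary order of `Finset.toList` irrelevant. -/
theorem foldr_perm_of_comm (hP : ∀ a b, P b → P (op a b))
    (hc : ∀ a a' b, P b → op a (op a' b) = op a' (op a b)) {l l' : List α} (h : l.Perm l') {b : β}
    (hb : P b) : l.foldr op b = l'.foldr op b := by
  induction h with
  | nil => rfl
  | cons a _ ih => rw [List.foldr_cons, List.foldr_cons, ih]
  | swap a a' l => exact hc _ _ _ (foldr_induction hP l hb)
  | trans _ _ h1 h2 => exact h1.trans h2

theorem foldr_insert_toList [DecidableEq α] (hP : ∀ a b, P b → P (op a b))
    (hc : ∀ a a' b, P b → op a (op a' b) = op a' (op a b)) {E : Finset α} {a : α} (ha : a ∉ E)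
    {b : β} (hb : P b) : (insert a E).toList.foldr op b = op a (E.toList.foldr op b) :=
  foldr_perm_of_comm hP hc (Finset.toList_insert ha) hb

end FoldrPerm

/-! ### Mixed derivatives in fields and parameters -/

section FieldSmooth

variable {E F : Type*} [NormedAddCommGroup E] [NormedSpace ℝ E] [NormedAddCommGroup F]
  [NormedSpace ℝ F]

theorem fderiv_fderiv_apply {h : E → ℂ} {p : E} (hh : ContDiffAt ℝ ∞ h p) (a b : E) :
    fderiv ℝ (fun q => fderiv ℝ h q a) p b = fderiv ℝ (fderiv ℝ h) p b a := by
  have hd : DifferentiableAt ℝ (fderiv ℝ h) p :=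
    (hh.fderiv_right (m := 1) (by norm_cast)).differentiableAt (by norm_num)
  rw [fderiv_clm_apply hd (differentiableAt_const a)]
  simp

theorem fderiv_fderiv_comm {h : E → ℂ} {p : E} (hh : ContDiffAt ℝ ∞ h p) (a b : E) :
    fderiv ℝ (fun q => fderiv ℝ h q a) p b = fderiv ℝ (fun q => fderiv ℝ h q b) p a := by
  rw [fderiv_fderiv_apply hh, fderiv_fderiv_apply hh]
  exact (hh.isSymmSndFDerivAt (by
    rw [minSmoothness_of_isRCLikeNormedField]; exact WithTop.coe_le_coe.2 le_top)) b a

/-- Smoothness in the field and in a parameter from an open set. -/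
def FieldSmooth (U : Set E) (g : E → F → ℂ) : Prop :=
  ContDiffOn ℝ ∞ (fun p : E × F => g p.1 p.2) (U ×ˢ Set.univ)

variable {U : Set E} {g : E → F → ℂ}

theorem FieldSmooth.contDiffAt (hU : IsOpen U) (hg : FieldSmooth U g) {s : E} (hs : s ∈ U)
    (φ : F) : ContDiffAt ℝ ∞ (fun p : E × F => g p.1 p.2) (s, φ) :=
  ContDiffOn.contDiffAt hg ((hU.prod isOpen_univ).mem_nhds ⟨hs, Set.mem_univ _⟩)

theorem FieldSmooth.contDiffAt_fst (hU : IsOpen U) (hg : FieldSmooth U g) {s : E} (hs : s ∈ U)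
    (φ : F) : ContDiffAt ℝ ∞ (fun s => g s φ) s := by
  have h1 : ContDiffAt ℝ ∞ (fun s : E => (s, φ)) s := contDiffAt_id.prodMk contDiffAt_const
  exact (hg.contDiffAt hU hs φ).comp s h1

theorem FieldSmooth.fderiv_snd (hU : IsOpen U) (hg : FieldSmooth U g) {s : E} (hs : s ∈ U)
    (φ w : F) : fderiv ℝ (g s) φ w = fderiv ℝ (fun p : E × F => g p.1 p.2) (s, φ) (0, w) := by
  have h1 : HasFDerivAt (fun φ : F => (s, φ)) (ContinuousLinearMap.inr ℝ E F) φ :=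
    hasFDerivAt_prodMk_right s φ
  have h2 := ((hg.contDiffAt hU hs φ).differentiableAt (by simp)).hasFDerivAt
  have h3 : HasFDerivAt (g s) _ φ :=
    HasFDerivAt.comp (g := fun p : E × F => g p.1 p.2) φ h2 h1
  rw [h3.fderiv]
  simp

theorem FieldSmooth.fderiv_fst (hU : IsOpen U) (hg : FieldSmooth U g) {s : E} (hs : s ∈ U)
    (φ : F) (v : E) :
    fderiv ℝ (fun s => g s φ) s v = fderiv ℝ (fun p : E × F => g p.1 p.2) (s, φ) (v, 0) := by
  have h1 : HasFDerivAt (fun s : E => (s, φ)) (ContinuousLinearMap.inl ℝ E F) s :=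
    hasFDerivAt_prodMk_left s φ
  have h2 := ((hg.contDiffAt hU hs φ).differentiableAt (by simp)).hasFDerivAt
  have h3 : HasFDerivAt (fun s => g s φ) _ s :=
    HasFDerivAt.comp (g := fun p : E × F => g p.1 p.2) s h2 h1
  rw [h3.fderiv]
  simp

theorem FieldSmooth.deriv_snd (hU : IsOpen U) (hg : FieldSmooth U g) (w : F) :
    FieldSmooth U fun s φ => fderiv ℝ (g s) φ w := by
  have h : ContDiffOn ℝ ∞ (fun p : E × F => fderiv ℝ (fun p : E × F => g p.1 p.2) p (0, w))
      (U ×ˢ Set.univ) :=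
    (ContDiffOn.fderiv_of_isOpen hg (hU.prod isOpen_univ) (by simp)).clm_apply contDiffOn_const
  exact h.congr fun p hp => hg.fderiv_snd hU hp.1 p.2 w

/-- Derivatives in the field and in the parameter commute. -/
theorem FieldSmooth.comm (hU : IsOpen U) (hg : FieldSmooth U g) {s : E} (hs : s ∈ U) (φ w : F)
    (v : E) : fderiv ℝ (fun s => fderiv ℝ (g s) φ w) s v =
      fderiv ℝ (fun φ => fderiv ℝ (fun s => g s φ) s v) φ w := by
  set h : E × F → ℂ := fun p => g p.1 p.2 with hh
  have hsm := hg.contDiffAt hU hs φ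
  have hd : DifferentiableAt ℝ (fderiv ℝ h) (s, φ) :=
    (hsm.fderiv_right (m := 1) (by norm_cast)).differentiableAt (by norm_num)
  have hdir : ∀ a : E × F, DifferentiableAt ℝ (fun p => fderiv ℝ h p a) (s, φ) := fun a =>
    hd.clm_apply (differentiableAt_const a)
  have h1 : (fun s => fderiv ℝ (g s) φ w) =ᶠ[𝓝 s] fun s => fderiv ℝ h (s, φ) (0, w) := by
    filter_upwards [hU.mem_nhds hs] with s' hs' using hg.fderiv_snd hU hs' φ w
  have h2 : (fun φ => fderiv ℝ (fun s => g s φ) s v) = fun φ => fderiv ℝ h (s, φ) (v, 0) := by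
    funext φ'
    exact hg.fderiv_fst hU hs φ' v
  have h3 : HasFDerivAt (fun s => fderiv ℝ h (s, φ) (0, w)) _ s :=
    HasFDerivAt.comp (g := fun p => fderiv ℝ h p (0, w)) s (hdir (0, w)).hasFDerivAt
      (hasFDerivAt_prodMk_left s φ)
  have h4 : HasFDerivAt (fun φ => fderiv ℝ h (s, φ) (v, 0)) _ φ :=
    HasFDerivAt.comp (g := fun p => fderiv ℝ h p (v, 0)) φ (hdir (v, 0)).hasFDerivAt
      (hasFDerivAt_prodMk_right s φ)
  rw [h1.fderiv_eq, h2, h3.fderiv, h4.fderiv]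
  simpa using fderiv_fderiv_comm hsm (0, w) (v, 0)

end FieldSmooth

/-! ### The operators C(ℓ)∂_ℓ -/

section EdgeOps

variable {ι : Type*} [Fintype ι] [DecidableEq ι] {N : ℕ}

/-- The weight of `∂_a ∂_b` in `C(ℓ)∂_ℓ`. -/
def edgeWeight (C : Matrix (ι × Fin N) (ι × Fin N) ℂ) (ℓ : Pairs ι) (a b : ι × Fin N) : ℂ :=
  if s(a.1, b.1) = ℓ.1 then 1 / 2 * C a b else 0

theorem edgeOp_eq_sum (C : Matrix (ι × Fin N) (ι × Fin N) ℂ) (ℓ : Pairs ι)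
    (f : (ι → Spin N) → ℂ) (φ : ι → Spin N) : edgeOp C ℓ f φ = ∑ a : ι × Fin N, ∑ b : ι × Fin N,
      edgeWeight C ℓ a b * fieldDeriv a.1 a.2 (fieldDeriv b.1 b.2 f) φ := by
  have h : ∀ x : ι, ∑ m : Fin N, ∑ b : ι × Fin N, edgeWeight C ℓ (x, m) b *
        fieldDeriv x m (fieldDeriv b.1 b.2 f) φ =
      1 / 2 * ∑ y : ι, if s(x, y) = ℓ.1 then ∑ m : Fin N, ∑ n : Fin N,
        C (x, m) (y, n) * fieldDeriv x m (fieldDeriv y n f) φ else 0 := by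
    intro x
    simp only [Fintype.sum_prod_type]
    rw [Finset.sum_comm, Finset.mul_sum]
    refine Finset.sum_congr rfl fun y _ => ?_
    by_cases h : s(x, y) = ℓ.1
    · simp only [edgeWeight, h, if_true, Finset.mul_sum, mul_assoc]
    · simp [edgeWeight, h]
  rw [edgeOp, Fintype.sum_prod_type, Finset.mul_sum]
  exact Finset.sum_congr rfl fun x _ => (h x).symm

theorem contDiff_fieldDeriv {f : (ι → Spin N) → ℂ} (hf : ContDiff ℝ ∞ f) (x : ι) (m : Fin N) :
    ContDiff ℝ ∞ (fieldDeriv x m f) :=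
  (hf.fderiv_right (m := ∞) (by simp)).clm_apply contDiff_const

theorem contDiff_edgeOp {f : (ι → Spin N) → ℂ} (hf : ContDiff ℝ ∞ f)
    (C : Matrix (ι × Fin N) (ι × Fin N) ℂ) (ℓ : Pairs ι) : ContDiff ℝ ∞ (edgeOp C ℓ f) := by
  have : edgeOp C ℓ f = fun φ => ∑ a : ι × Fin N, ∑ b : ι × Fin N,
      edgeWeight C ℓ a b * fieldDeriv a.1 a.2 (fieldDeriv b.1 b.2 f) φ :=
    funext (edgeOp_eq_sum C ℓ f)
  rw [this]
  exact ContDiff.sum fun a _ => ContDiff.sum fun b _ =>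
    contDiff_const.mul (contDiff_fieldDeriv (contDiff_fieldDeriv hf _ _) _ _)

theorem fieldDeriv_comm {f : (ι → Spin N) → ℂ} (hf : ContDiff ℝ ∞ f) (x y : ι) (m n : Fin N) :
    fieldDeriv x m (fieldDeriv y n f) = fieldDeriv y n (fieldDeriv x m f) :=
  funext fun _ => fderiv_fderiv_comm hf.contDiffAt _ _

theorem fieldDeriv_sum {K : Type*} (S : Finset K) (k : K → ℂ) {f : K → (ι → Spin N) → ℂ}
    (hf : ∀ i, ContDiff ℝ ∞ (f i)) (x : ι) (m : Fin N) :
    fieldDeriv x m (fun φ => ∑ i ∈ S, k i * f i φ) =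
      fun φ => ∑ i ∈ S, k i * fieldDeriv x m (f i) φ := by
  funext φ
  have hd : ∀ i, DifferentiableAt ℝ (f i) φ := fun i => (hf i).differentiable (by simp) φ
  rw [fieldDeriv, fderiv_fun_sum fun i _ => (hd i).const_mul (k i), _root_.sum_apply]
  refine Finset.sum_congr rfl fun i _ => ?_
  rw [fderiv_const_mul (hd i)]
  rfl

theorem edgeOp_eq_sum' (C : Matrix (ι × Fin N) (ι × Fin N) ℂ) (ℓ : Pairs ι)
    (f : (ι → Spin N) → ℂ) : edgeOp C ℓ f = fun φ => ∑ p : (ι × Fin N) × (ι × Fin N),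
      edgeWeight C ℓ p.1 p.2 * fieldDeriv p.1.1 p.1.2 (fieldDeriv p.2.1 p.2.2 f) φ := by
  funext φ
  rw [edgeOp_eq_sum]
  exact (Fintype.sum_prod_type fun p : (ι × Fin N) × (ι × Fin N) =>
    edgeWeight C ℓ p.1 p.2 * fieldDeriv p.1.1 p.1.2 (fieldDeriv p.2.1 p.2.2 f) φ).symm

theorem edgeOp_comm {f : (ι → Spin N) → ℂ} (hf : ContDiff ℝ ∞ f)
    (C : Matrix (ι × Fin N) (ι × Fin N) ℂ) (ℓ ℓ' : Pairs ι) :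
    edgeOp C ℓ (edgeOp C ℓ' f) = edgeOp C ℓ' (edgeOp C ℓ f) := by
  have hexp : ∀ ℓ ℓ' : Pairs ι, edgeOp C ℓ (edgeOp C ℓ' f) = fun φ =>
      ∑ p : (ι × Fin N) × (ι × Fin N), ∑ q : (ι × Fin N) × (ι × Fin N),
        edgeWeight C ℓ p.1 p.2 * (edgeWeight C ℓ' q.1 q.2 *
          fieldDeriv p.1.1 p.1.2 (fieldDeriv p.2.1 p.2.2
            (fieldDeriv q.1.1 q.1.2 (fieldDeriv q.2.1 q.2.2 f))) φ) := by
    intro ℓ ℓ'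
    rw [edgeOp_eq_sum' C ℓ]
    funext φ
    refine Finset.sum_congr rfl fun p _ => ?_
    rw [← Finset.mul_sum]
    congr 1
    rw [edgeOp_eq_sum' C ℓ', fieldDeriv_sum _ _ (fun q => contDiff_fieldDeriv
      (contDiff_fieldDeriv hf _ _) _ _), fieldDeriv_sum _ _ (fun q => contDiff_fieldDeriv
      (contDiff_fieldDeriv (contDiff_fieldDeriv hf _ _) _ _) _ _)]
  rw [hexp, hexp]
  funext φ
  rw [Finset.sum_comm]
  refine Finset.sum_congr rfl fun p _ => Finset.sum_congr rfl fun q _ => ?_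
  have h : fieldDeriv q.1.1 q.1.2 (fieldDeriv q.2.1 q.2.2
      (fieldDeriv p.1.1 p.1.2 (fieldDeriv p.2.1 p.2.2 f))) =
      fieldDeriv p.1.1 p.1.2 (fieldDeriv p.2.1 p.2.2
      (fieldDeriv q.1.1 q.1.2 (fieldDeriv q.2.1 q.2.2 f))) := by
    rw [fieldDeriv_comm (contDiff_fieldDeriv hf _ _) q.2.1 p.1.1,
      fieldDeriv_comm hf q.2.1 p.2.1,
      fieldDeriv_comm (contDiff_fieldDeriv (contDiff_fieldDeriv hf _ _) _ _) q.1.1 p.1.1,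
      fieldDeriv_comm (contDiff_fieldDeriv hf _ _) q.1.1 p.2.1]
  rw [h]
  ring

theorem edgeOps_insert {f : (ι → Spin N) → ℂ} (hf : ContDiff ℝ ∞ f)
    (C : Matrix (ι × Fin N) (ι × Fin N) ℂ) {E : Finset (Pairs ι)} {ℓ : Pairs ι} (hℓ : ℓ ∉ E) :
    edgeOps C (insert ℓ E) f = edgeOp C ℓ (edgeOps C E f) :=
  foldr_insert_toList (P := fun f : (ι → Spin N) → ℂ => ContDiff ℝ ∞ f)
    (fun ℓ _ h => contDiff_edgeOp h C ℓ) (fun ℓ ℓ' _ h => edgeOp_comm h C ℓ ℓ') hℓ hf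

/-- The heat equation produces the new operator innermost, next to the density; this moves it
outside. -/
theorem edgeOps_edgeOp {f : (ι → Spin N) → ℂ} (hf : ContDiff ℝ ∞ f)
    (C : Matrix (ι × Fin N) (ι × Fin N) ℂ) (l : List (Pairs ι)) (ℓ : Pairs ι) :
    l.foldr (edgeOp C) (edgeOp C ℓ f) = edgeOp C ℓ (l.foldr (edgeOp C) f) := by
  have := foldr_perm_of_comm (P := fun f : (ι → Spin N) → ℂ => ContDiff ℝ ∞ f)
    (fun ℓ _ h => contDiff_edgeOp h C ℓ) (fun ℓ ℓ' _ h => edgeOp_comm h C ℓ ℓ')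
    (List.perm_append_singleton ℓ l) hf
  rwa [List.foldr_append] at this

variable {E : Type*} [NormedAddCommGroup E] [NormedSpace ℝ E] {U : Set E}
  {g : E → (ι → Spin N) → ℂ}

theorem FieldSmooth.fieldDeriv (hU : IsOpen U) (hg : FieldSmooth U g) (x : ι) (m : Fin N) :
    FieldSmooth U fun s => fieldDeriv x m (g s) := hg.deriv_snd hU _

theorem FieldSmooth.edgeOp (hU : IsOpen U) (hg : FieldSmooth U g)
    (C : Matrix (ι × Fin N) (ι × Fin N) ℂ) (ℓ : Pairs ι) :
    FieldSmooth U fun s => edgeOp C ℓ (g s) := by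
  have : (fun s => _root_.edgeOp C ℓ (g s)) = fun s φ => ∑ a : ι × Fin N, ∑ b : ι × Fin N,
      edgeWeight C ℓ a b * _root_.fieldDeriv a.1 a.2 (_root_.fieldDeriv b.1 b.2 (g s)) φ :=
    funext fun s => funext (edgeOp_eq_sum C ℓ (g s))
  rw [this]
  exact ContDiffOn.sum fun a _ => ContDiffOn.sum fun b _ =>
    contDiffOn_const.mul ((hg.fieldDeriv hU b.1 b.2).fieldDeriv hU a.1 a.2)

theorem FieldSmooth.edgeOp_foldr (hU : IsOpen U) (hg : FieldSmooth U g)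
    (C : Matrix (ι × Fin N) (ι × Fin N) ℂ) (l : List (Pairs ι)) :
    FieldSmooth U fun s => l.foldr (_root_.edgeOp C) (g s) := by
  induction l with
  | nil => exact hg
  | cons ℓ l ih => exact ih.edgeOp hU C ℓ

theorem FieldSmooth.fderiv_edgeOp (hU : IsOpen U) (hg : FieldSmooth U g)
    (C : Matrix (ι × Fin N) (ι × Fin N) ℂ) (ℓ : Pairs ι) {s : E} (hs : s ∈ U)
    (φ : ι → Spin N) (v : E) : fderiv ℝ (fun s => _root_.edgeOp C ℓ (g s) φ) s v =
      _root_.edgeOp C ℓ (fun φ => fderiv ℝ (fun s => g s φ) s v) φ := by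
  have h1 : (fun s => _root_.edgeOp C ℓ (g s) φ) = fun s =>
      ∑ p : (ι × Fin N) × (ι × Fin N), edgeWeight C ℓ p.1 p.2 *
        _root_.fieldDeriv p.1.1 p.1.2 (_root_.fieldDeriv p.2.1 p.2.2 (g s)) φ :=
    funext fun s => congrFun (edgeOp_eq_sum' C ℓ (g s)) φ
  have hd : ∀ p : (ι × Fin N) × (ι × Fin N), DifferentiableAt ℝ (fun s =>
      _root_.fieldDeriv p.1.1 p.1.2 (_root_.fieldDeriv p.2.1 p.2.2 (g s)) φ) s := fun p =>
    (((hg.fieldDeriv hU p.2.1 p.2.2).fieldDeriv hU p.1.1 p.1.2).contDiffAt_fst hU hs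
      φ).differentiableAt (by simp)
  rw [h1, fderiv_fun_sum fun p _ => (hd p).const_mul _, _root_.sum_apply,
    edgeOp_eq_sum' C ℓ]
  refine Finset.sum_congr rfl fun p _ => ?_
  rw [fderiv_const_mul (hd p)]
  rw [_root_.smul_apply, smul_eq_mul]
  congr 1
  refine ((hg.fieldDeriv hU p.2.1 p.2.2).comm hU hs φ _ v).trans ?_
  change _root_.fieldDeriv p.1.1 p.1.2 _ φ = _
  congr 1
  funext φ'
  exact hg.comm hU hs φ' _ v

theorem FieldSmooth.fderiv_edgeOp_foldr (hU : IsOpen U) (hg : FieldSmooth U g)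
    (C : Matrix (ι × Fin N) (ι × Fin N) ℂ) (l : List (Pairs ι)) {s : E} (hs : s ∈ U) (v : E) :
    (fun φ => fderiv ℝ (fun s => l.foldr (_root_.edgeOp C) (g s) φ) s v) =
      l.foldr (_root_.edgeOp C) fun φ => fderiv ℝ (fun s => g s φ) s v := by
  induction l with
  | nil => rfl
  | cons ℓ l ih =>
    rw [List.foldr_cons, ← ih]
    funext φ
    exact (hg.edgeOp_foldr hU C l).fderiv_edgeOp hU C ℓ hs φ v

end EdgeOps

/-! ## The heat equation for Gaussian densities -/

section Heat

variable {ι : Type*} [Fintype ι] [DecidableEq ι] {N : ℕ}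

theorem contDiff_gaussDensity (M : Matrix (ι × Fin N) (ι × Fin N) ℂ) :
    ContDiff ℝ ∞ (gaussDensity M) :=
  contDiff_const.mul (ContDiff.cexp (contDiff_const.mul (ContDiff.sum fun a _ =>
    ContDiff.sum fun b _ => ((contDiff_coord a).mul contDiff_const).mul (contDiff_coord b))))

/-- The direction of the coordinate `a`. -/
def coordDir (a : ι × Fin N) : ι → Spin N := Pi.single a.1 (EuclideanSpace.single a.2 1)

theorem coordDir_apply (a b : ι × Fin N) : coordDir a b.1 b.2 = if b = a then (1 : ℝ) else 0 := by
  obtain ⟨x, m⟩ := a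
  obtain ⟨y, n⟩ := b
  by_cases h : y = x
  · subst h
    simp [coordDir]
  · simp [coordDir, h]

theorem fieldDeriv_eq_of_hasDerivAt {f : (ι → Spin N) → ℂ} {φ : ι → Spin N} {a : ι × Fin N} {d : ℂ}
    (hf : DifferentiableAt ℝ f φ) (h : HasDerivAt (fun t : ℝ => f (φ + t • coordDir a)) d 0) :
    fieldDeriv a.1 a.2 f φ = d := by
  have h1 : HasDerivAt (fun t : ℝ => φ + t • coordDir a) (coordDir a) 0 := by
    simpa using ((hasDerivAt_id (0 : ℝ)).smul_const (coordDir a)).const_add φ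
  have h2 : HasFDerivAt f (fderiv ℝ f φ) (φ + (0 : ℝ) • coordDir a) := by
    simpa using hf.hasFDerivAt
  exact (h2.comp_hasDerivAt (0 : ℝ) h1).unique h

theorem hasDerivAt_coord (φ : ι → Spin N) (a b : ι × Fin N) :
    HasDerivAt (fun t : ℝ => (((φ + t • coordDir a) b.1 b.2 : ℝ) : ℂ)) (if b = a then 1 else 0)
      0 := by
  have h : (fun t : ℝ => (((φ + t • coordDir a) b.1 b.2 : ℝ) : ℂ)) =
      fun t : ℝ => (((φ b.1 b.2 + t * (if b = a then 1 else 0) : ℝ)) : ℂ) := by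
    funext t
    rw [← coordDir_apply]
    simp
  rw [h]
  have h2 : HasDerivAt (fun t : ℝ => φ b.1 b.2 + t * (if b = a then 1 else 0))
      (if b = a then 1 else 0) 0 := by
    simpa using ((hasDerivAt_id (0 : ℝ)).mul_const (if b = a then (1 : ℝ) else 0)).const_add
      (φ b.1 b.2)
  convert h2.ofReal_comp using 1
  split_ifs <;> simp

/-- The linear form `(M⁻¹ φ)_a`. -/
def invForm (M : Matrix (ι × Fin N) (ι × Fin N) ℂ) (a : ι × Fin N) (φ : ι → Spin N) : ℂ :=
  ∑ b, M⁻¹ a b * (φ b.1 b.2 : ℂ)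

theorem contDiff_invForm (M : Matrix (ι × Fin N) (ι × Fin N) ℂ) (a : ι × Fin N) :
    ContDiff ℝ ∞ (invForm M a) :=
  ContDiff.sum fun b _ => contDiff_const.mul (contDiff_coord b)

theorem fieldDeriv_coord (a b : ι × Fin N) (φ : ι → Spin N) :
    fieldDeriv a.1 a.2 (fun φ => (φ b.1 b.2 : ℂ)) φ = if b = a then 1 else 0 :=
  fieldDeriv_eq_of_hasDerivAt ((contDiff_coord b).differentiable (by simp) φ)
    (hasDerivAt_coord φ a b)

theorem fieldDeriv_invForm (M : Matrix (ι × Fin N) (ι × Fin N) ℂ) (a b : ι × Fin N) :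
    fieldDeriv a.1 a.2 (invForm M b) = fun _ => M⁻¹ b a := by
  unfold invForm
  rw [fieldDeriv_sum _ _ fun c => contDiff_coord c]
  funext φ
  simp only [fieldDeriv_coord]
  simp

theorem fieldDeriv_mul {f g : (ι → Spin N) → ℂ} (hf : ContDiff ℝ ∞ f) (hg : ContDiff ℝ ∞ g)
    (x : ι) (m : Fin N) (φ : ι → Spin N) : fieldDeriv x m (fun φ => f φ * g φ) φ =
      fieldDeriv x m f φ * g φ + f φ * fieldDeriv x m g φ := by
  have h1 := (hf.differentiable (by simp) φ).hasFDerivAt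
  have h2 := (hg.differentiable (by simp) φ).hasFDerivAt
  rw [fieldDeriv, (h1.fun_mul h2).fderiv]
  simp only [_root_.add_apply, _root_.smul_apply, smul_eq_mul, fieldDeriv]
  ring

theorem inv_apply_comm {κ : Type*} [Fintype κ] [DecidableEq κ] {M : Matrix κ κ ℂ}
    (hM : M.IsSymm) (a b : κ) : M⁻¹ a b = M⁻¹ b a := by
  have : M⁻¹.transpose = M⁻¹ := by rw [Matrix.transpose_nonsing_inv, hM.eq]
  conv_lhs => rw [← this]
  rfl

theorem fieldDeriv_gaussDensity {M : Matrix (ι × Fin N) (ι × Fin N) ℂ} (hM : M.IsSymm)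
    (a : ι × Fin N) (φ : ι → Spin N) :
    fieldDeriv a.1 a.2 (gaussDensity M) φ = -invForm M a φ * gaussDensity M φ := by
  refine fieldDeriv_eq_of_hasDerivAt ((contDiff_gaussDensity M).differentiable (by simp) φ) ?_
  have hA := inv_apply_comm hM
  have hq : HasDerivAt (fun t : ℝ => ∑ b, ∑ c, (((φ + t • coordDir a) b.1 b.2 : ℝ) : ℂ) *
      M⁻¹ b c * (((φ + t • coordDir a) c.1 c.2 : ℝ) : ℂ)) (2 * invForm M a φ) 0 := by
    have h1 := HasDerivAt.fun_sum (u := Finset.univ) fun b _ => HasDerivAt.fun_sum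
      (u := Finset.univ) fun c _ =>
      ((hasDerivAt_coord φ a b).mul_const (M⁻¹ b c)).mul (hasDerivAt_coord φ a c)
    refine h1.congr_deriv ?_
    simp only [zero_smul, add_zero, Finset.sum_add_distrib]
    rw [two_mul]
    congr 1
    · rw [Finset.sum_eq_single a]
      · simp [invForm]
      · intro b _ hb; simp [hb]
      · simp
    · rw [invForm]
      refine Finset.sum_congr rfl fun b _ => ?_
      rw [Finset.sum_eq_single a]
      · rw [hA a b]; simp [mul_comm]
      · intro c _ hc; simp [hc]
      · simp
  have h := ((hq.const_mul (-(1 / 2) : ℂ)).cexp).const_mul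
    (detInvSqrt ((2 * (Real.pi : ℂ)) • M))
  refine h.congr_deriv ?_
  simp only [zero_smul, add_zero, gaussDensity]
  ring

theorem edgeOp_gaussDensity {M : Matrix (ι × Fin N) (ι × Fin N) ℂ} (hM : M.IsSymm)
    (C : Matrix (ι × Fin N) (ι × Fin N) ℂ) (ℓ : Pairs ι) (φ : ι → Spin N) :
    edgeOp C ℓ (gaussDensity M) φ = (∑ a, ∑ b, edgeWeight C ℓ a b *
      (invForm M a φ * invForm M b φ - M⁻¹ b a)) * gaussDensity M φ := by
  rw [edgeOp_eq_sum, Finset.sum_mul]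
  refine Finset.sum_congr rfl fun a _ => ?_
  rw [Finset.sum_mul]
  refine Finset.sum_congr rfl fun b _ => ?_
  have h1 : fieldDeriv b.1 b.2 (gaussDensity M) = fun φ => ∑ i ∈ ({()} : Finset Unit),
      (-1 : ℂ) * (invForm M b φ * gaussDensity M φ) := by
    funext φ
    rw [fieldDeriv_gaussDensity hM]
    simp
  rw [h1, fieldDeriv_sum _ _ fun _ => (contDiff_invForm M b).mul (contDiff_gaussDensity M)]
  simp only [Finset.sum_singleton]
  rw [fieldDeriv_mul (contDiff_invForm M b) (contDiff_gaussDensity M), fieldDeriv_invForm,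
    fieldDeriv_gaussDensity hM]
  ring

theorem interpCov_add_single (C : Matrix (ι × Fin N) (ι × Fin N) ℂ) (s : Pairs ι → ℝ)
    (ℓ : Pairs ι) (t : ℝ) : interpCov C (s + t • Pi.single ℓ 1) = interpCov C s +
      (t : ℂ) • Matrix.of fun a b => if s(a.1, b.1) = ℓ.1 then C a b else 0 := by
  ext a b
  simp only [interpCov, Matrix.of_apply, Matrix.add_apply, Matrix.smul_apply, smul_eq_mul]
  by_cases h : a.1 = b.1
  · have h1 : ¬ s(a.1, b.1) = ℓ.1 := by
      intro h'
      exact ℓ.2 (by rw [← h', h]; simp)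
    rw [h, coupling_self, coupling_self, if_neg (by rwa [h] at h1)]
    simp
  · rw [coupling_of_ne _ (ℓ := ⟨s(a.1, b.1), pair_ne h⟩) rfl,
      coupling_of_ne _ (ℓ := ⟨s(a.1, b.1), pair_ne h⟩) rfl]
    by_cases h1 : s(a.1, b.1) = ℓ.1
    · have : (⟨s(a.1, b.1), pair_ne h⟩ : Pairs ι) = ℓ := Subtype.ext h1
      rw [this, if_pos h1]
      simp
      ring
    · have : (⟨s(a.1, b.1), pair_ne h⟩ : Pairs ι) ≠ ℓ := fun h' => h1 (congrArg Subtype.val h')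
      rw [if_neg h1]
      simp [this]

theorem hasDerivAt_line {E : Type*} [NormedAddCommGroup E] [NormedSpace ℝ E] {f : E → ℂ} {s : E}
    (hf : DifferentiableAt ℝ f s) (v : E) :
    HasDerivAt (fun t : ℝ => f (s + t • v)) (fderiv ℝ f s v) 0 := by
  have h1 : HasDerivAt (fun t : ℝ => s + t • v) v 0 := by
    simpa using ((hasDerivAt_id (0 : ℝ)).smul_const v).const_add s
  have h2 : HasFDerivAt f (fderiv ℝ f s) (s + (0 : ℝ) • v) := by
    simpa using hf.hasFDerivAt
  exact h2.comp_hasDerivAt (0 : ℝ) h1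

/-- Jacobi's formula: factor out det M and read off the linear term of the polynomial det(1 + t
M⁻¹D). -/
theorem hasDerivAt_det_line {κ : Type*} [Fintype κ] [DecidableEq κ] {M : Matrix κ κ ℂ}
    (hM : M.det ≠ 0) (D : Matrix κ κ ℂ) :
    HasDerivAt (fun t : ℝ => (M + (t : ℂ) • D).det) (M.det * (M⁻¹ * D).trace) 0 := by
  have hu : IsUnit M.det := isUnit_iff_ne_zero.2 hM
  have h : (fun t : ℝ => (M + (t : ℂ) • D).det) = fun t : ℝ => M.det *
      (1 + (M⁻¹ * D).trace * (t : ℂ) + Polynomial.eval (t : ℂ)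
        (1 + (Polynomial.X : Polynomial ℂ) • (M⁻¹ * D).map ⇑Polynomial.C).det.divX.divX *
          (t : ℂ) ^ 2) := by
    funext t
    rw [← Matrix.det_one_add_smul, ← Matrix.det_mul, mul_add, mul_one, Matrix.mul_smul,
      ← Matrix.mul_assoc, Matrix.mul_nonsing_inv _ hu, Matrix.one_mul]
  rw [h]
  set P := (1 + (Polynomial.X : Polynomial ℂ) • (M⁻¹ * D).map ⇑Polynomial.C).det.divX.divX
  have hid : HasDerivAt (fun t : ℝ => (t : ℂ)) 1 0 := by
    simpa using (hasDerivAt_id (0 : ℝ)).ofReal_comp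
  have hP : HasDerivAt (fun t : ℝ => P.eval (t : ℂ)) (P.derivative.eval 0) 0 := by
    have := (P.hasDerivAt ((0 : ℝ) : ℂ)).comp_ofReal
    simpa using this
  have h2 := ((hid.const_mul (M⁻¹ * D).trace).const_add 1).add (hP.mul (hid.fun_pow 2))
  refine (h2.const_mul M.det).congr_deriv ?_
  simp

section Line

variable {κ : Type*} [Fintype κ] [DecidableEq κ] {M : Matrix κ κ ℂ}

theorem contDiff_line (M D : Matrix κ κ ℂ) (a b : κ) :
    ContDiff ℝ ∞ fun t : ℝ => (M + (t : ℂ) • D) a b := by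
  simp only [Matrix.add_apply, Matrix.smul_apply, smul_eq_mul]
  exact contDiff_const.add (Complex.ofRealCLM.contDiff.mul contDiff_const)

theorem hasDerivAt_ofReal_zero : HasDerivAt (fun t : ℝ => (t : ℂ)) 1 0 := by
  simpa using (hasDerivAt_id (0 : ℝ)).ofReal_comp

/-- Differentiability being known, the value follows by differentiating M_t⁻¹ M_t = 1, which holds
near t = 0 because accretivity is an open condition. -/
theorem hasDerivAt_inv_line (hM : Accretive M) (D : Matrix κ κ ℂ) (a b : κ) :
    HasDerivAt (fun t : ℝ => (M + (t : ℂ) • D)⁻¹ a b) ((-(M⁻¹ * D * M⁻¹)) a b) 0 := by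
  have hu : IsUnit M.det := isUnit_iff_ne_zero.2 hM.det_ne_zero
  have hM0 : Accretive (M + ((0 : ℝ) : ℂ) • D) := by simpa using hM
  let dA : Matrix κ κ ℂ := Matrix.of fun a b => deriv (fun t : ℝ => (M + (t : ℂ) • D)⁻¹ a b) 0
  have hdA : ∀ a b, HasDerivAt (fun t : ℝ => (M + (t : ℂ) • D)⁻¹ a b) (dA a b) 0 := fun a b =>
    ((contDiffAt_inv_entry (contDiff_line M D) hM0 a b).differentiableAt (by simp)).hasDerivAt
  have hdM : ∀ a b, HasDerivAt (fun t : ℝ => (M + (t : ℂ) • D) a b) (D a b) 0 := by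
    intro a b
    have := (hasDerivAt_ofReal_zero.mul_const (D a b)).const_add (M a b)
    rw [one_mul] at this
    exact this
  have hev : ∀ᶠ t : ℝ in 𝓝 0, Accretive (M + (t : ℂ) • D) := by
    have hc : Continuous fun t : ℝ => M + (t : ℂ) • D :=
      continuous_matrix fun a b => (contDiff_line M D a b).continuous
    exact (isOpen_accretive hc).mem_nhds hM0
  have h1 : dA * M + M⁻¹ * D = 0 := by
    ext a c
    have h2 := HasDerivAt.fun_sum (u := Finset.univ) fun b _ => (hdA a b).mul (hdM b c)
    have h3 : (fun t : ℝ => ∑ b, ((fun t : ℝ => (M + (t : ℂ) • D)⁻¹ a b) *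
        fun t : ℝ => (M + (t : ℂ) • D) b c) t) =ᶠ[𝓝 0]
        fun _ => (1 : Matrix κ κ ℂ) a c := by
      filter_upwards [hev] with t ht
      rw [← Matrix.nonsing_inv_mul _ (isUnit_iff_ne_zero.2 ht.det_ne_zero), Matrix.mul_apply]
      rfl
    have h4 := (h2.congr_of_eventuallyEq h3.symm).unique (hasDerivAt_const (0 : ℝ) _)
    simp only [Complex.ofReal_zero, zero_smul, add_zero, Finset.sum_add_distrib] at h4
    rw [Matrix.add_apply, Matrix.mul_apply, Matrix.mul_apply]
    exact h4
  have h5 : dA * M * M⁻¹ = -(M⁻¹ * D) * M⁻¹ := by rw [eq_neg_of_add_eq_zero_left h1]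
  rw [Matrix.mul_assoc, Matrix.mul_nonsing_inv _ hu, Matrix.mul_one, Matrix.neg_mul] at h5
  rw [← h5]
  exact hdA a b

/-- The square is the inverse determinant, whose derivative is given by Jacobi's formula; dividing
by twice the nonzero root avoids any discussion of branches. -/
theorem hasDerivAt_detInvSqrt_line (hM : Accretive M) (D : Matrix κ κ ℂ) {c : ℝ} (hc : 0 < c) :
    HasDerivAt (fun t : ℝ => detInvSqrt ((c : ℂ) • (M + (t : ℂ) • D)))
      (-(1 / 2) * detInvSqrt ((c : ℂ) • M) * (M⁻¹ * D).trace) 0 := by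
  have hdet : M.det ≠ 0 := hM.det_ne_zero
  have hM0 : Accretive ((c : ℂ) • (M + ((0 : ℝ) : ℂ) • D)) := by simpa using hM.smul hc
  have hc0 : (c : ℂ) ≠ 0 := by exact_mod_cast hc.ne'
  have hdn := ((contDiffAt_detInvSqrt (M := fun t : ℝ => (c : ℂ) • (M + (t : ℂ) • D))
    (fun a b => contDiff_const.mul (contDiff_line M D a b)) hM0).differentiableAt
      (by simp)).hasDerivAt
  set dn := deriv (fun t : ℝ => detInvSqrt ((c : ℂ) • (M + (t : ℂ) • D))) 0
  set n₀ := detInvSqrt ((c : ℂ) • M) with hn₀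
  have hK : (c : ℂ) ^ Fintype.card κ ≠ 0 := pow_ne_zero _ hc0
  have h1 := hdn.fun_pow 2
  simp only [detInvSqrt_sq, Matrix.det_smul] at h1
  have h2 := ((hasDerivAt_det_line hdet D).const_mul ((c : ℂ) ^ Fintype.card κ)).fun_inv (by
    simp only [Complex.ofReal_zero, zero_smul, add_zero]
    exact mul_ne_zero hK hdet)
  have h3 := h1.unique h2
  simp only [Complex.ofReal_zero, zero_smul, add_zero] at h3
  have h4 : n₀ ^ 2 = ((c : ℂ) ^ Fintype.card κ * M.det)⁻¹ := by
    rw [hn₀, detInvSqrt_sq, Matrix.det_smul]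
  have hn : n₀ ≠ 0 := by
    intro h
    rw [h] at h4
    exact inv_ne_zero (mul_ne_zero hK hdet) (by rw [← h4]; simp)
  have h5 : 2 * n₀ * dn = -(M⁻¹ * D).trace * n₀ ^ 2 := by
    rw [h4]
    have : 2 * n₀ * dn = ((2 : ℕ) : ℂ) * n₀ ^ (2 - 1) * dn := by norm_num
    rw [this, h3]
    field_simp
  have h6 : dn = -(1 / 2) * n₀ * (M⁻¹ * D).trace := by
    refine mul_left_cancel₀ (mul_ne_zero two_ne_zero hn) ?_
    rw [h5]; ring
  rw [← h6]
  exact hdn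

end Line

theorem sum_inv_mul_inv {M : Matrix (ι × Fin N) (ι × Fin N) ℂ} (hM : M.IsSymm)
    (D : Matrix (ι × Fin N) (ι × Fin N) ℂ) (φ : ι → Spin N) :
    ∑ a : ι × Fin N, ∑ b : ι × Fin N, (φ a.1 a.2 : ℂ) * (M⁻¹ * D * M⁻¹) a b *
      (φ b.1 b.2 : ℂ) = ∑ a, ∑ b, D a b * (invForm M a φ * invForm M b φ) := by
  have hA := inv_apply_comm hM
  have h1 : ∀ a b, D a b * (invForm M a φ * invForm M b φ) = ∑ c, ∑ d,
      (φ c.1 c.2 : ℂ) * (M⁻¹ c a * D a b * M⁻¹ b d) * (φ d.1 d.2 : ℂ) := by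
    intro a b
    rw [invForm, invForm, Finset.sum_mul_sum, Finset.mul_sum]
    refine Finset.sum_congr rfl fun c _ => ?_
    rw [Finset.mul_sum]
    refine Finset.sum_congr rfl fun d _ => ?_
    rw [hA a c]
    ring
  have h2 : ∀ c d : ι × Fin N, (φ c.1 c.2 : ℂ) * (M⁻¹ * D * M⁻¹) c d * (φ d.1 d.2 : ℂ) =
      ∑ a, ∑ b, (φ c.1 c.2 : ℂ) * (M⁻¹ c a * D a b * M⁻¹ b d) * (φ d.1 d.2 : ℂ) := by
    intro c d
    simp only [Matrix.mul_apply, Finset.mul_sum, Finset.sum_mul]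
    exact Finset.sum_comm
  simp only [h1, h2]
  have h3 := Finset.sum_comm (s := (Finset.univ : Finset ((ι × Fin N) × (ι × Fin N))))
    (t := (Finset.univ : Finset ((ι × Fin N) × (ι × Fin N))))
    (f := fun p q => (φ p.1.1 p.1.2 : ℂ) * (M⁻¹ p.1 q.1 * D q.1 q.2 * M⁻¹ q.2 p.2) *
      (φ p.2.1 p.2.2 : ℂ))
  simp only [Fintype.sum_prod_type (α₁ := ι × Fin N) (α₂ := ι × Fin N)] at h3
  exact h3

/-- The derivative of the Gaussian density with respect to the covariance. -/
theorem hasDerivAt_gaussDensity_line {M : Matrix (ι × Fin N) (ι × Fin N) ℂ} (hM : M.IsSymm)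
    (hacc : Accretive M) (D : Matrix (ι × Fin N) (ι × Fin N) ℂ) (φ : ι → Spin N) :
    HasDerivAt (fun t : ℝ => gaussDensity (M + (t : ℂ) • D) φ)
      ((∑ a, ∑ b, 1 / 2 * D a b * (invForm M a φ * invForm M b φ - M⁻¹ b a)) *
        gaussDensity M φ) 0 := by
  have hdn := hasDerivAt_detInvSqrt_line hacc D (c := 2 * Real.pi) (by positivity)
  have hq := HasDerivAt.fun_sum (u := Finset.univ) fun (a : ι × Fin N) _ => HasDerivAt.fun_sum
    (u := Finset.univ) fun (b : ι × Fin N) _ =>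
      ((hasDerivAt_inv_line hacc D a b).const_mul (φ a.1 a.2 : ℂ)).mul_const (φ b.1 b.2 : ℂ)
  have hρ := hdn.fun_mul ((hq.const_mul (-(1 / 2) : ℂ)).cexp)
  have hcast : ((2 * Real.pi : ℝ) : ℂ) = 2 * (Real.pi : ℂ) := by push_cast; rfl
  rw [hcast] at hρ
  refine hρ.congr_deriv ?_
  simp only [Complex.ofReal_zero, zero_smul, add_zero]
  have hneg : ∑ a : ι × Fin N, ∑ b : ι × Fin N, (φ a.1 a.2 : ℂ) * (-(M⁻¹ * D * M⁻¹)) a b *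
      (φ b.1 b.2 : ℂ) = -∑ a, ∑ b, D a b * (invForm M a φ * invForm M b φ) := by
    rw [← sum_inv_mul_inv hM]
    simp only [Matrix.neg_apply, mul_neg, neg_mul, Finset.sum_neg_distrib]
  have htr : (M⁻¹ * D).trace = ∑ a, ∑ b, D a b * M⁻¹ b a := by
    rw [Matrix.trace_mul_comm]
    simp only [Matrix.trace, Matrix.diag_apply, Matrix.mul_apply]
  have hsum : ∑ a, ∑ b, 1 / 2 * D a b * (invForm M a φ * invForm M b φ - M⁻¹ b a) =
      1 / 2 * (∑ a, ∑ b, D a b * (invForm M a φ * invForm M b φ)) -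
        1 / 2 * ∑ a, ∑ b, D a b * M⁻¹ b a := by
    rw [← mul_sub, ← Finset.sum_sub_distrib, Finset.mul_sum]
    refine Finset.sum_congr rfl fun a _ => ?_
    rw [← Finset.sum_sub_distrib, Finset.mul_sum]
    refine Finset.sum_congr rfl fun b _ => ?_
    ring
  rw [hneg, htr, hsum, gaussDensity]
  ring

/-- The interpolated Gaussian density satisfies a heat equation. -/
theorem heat_equation {C : Matrix (ι × Fin N) (ι × Fin N) ℂ} (hC : C.IsSymm) {s : Pairs ι → ℝ}
    (hs : s ∈ accretiveCouplings C) (ℓ : Pairs ι) (φ : ι → Spin N) :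
    fderiv ℝ (fun s => gaussDensity (interpCov C s) φ) s (Pi.single ℓ 1) =
      edgeOp C ℓ (gaussDensity (interpCov C s)) φ := by
  have hsm : FieldSmooth (accretiveCouplings C) fun s => gaussDensity (interpCov C s) :=
    contDiffOn_gaussDensity C
  have hfd := hasDerivAt_line ((hsm.contDiffAt_fst (isOpen_accretiveCouplings C) hs
    φ).differentiableAt (by simp)) (Pi.single ℓ 1)
  simp only [interpCov_add_single] at hfd
  have h := hasDerivAt_gaussDensity_line (interpCov_isSymm hC s) hs
    (Matrix.of fun a b => if s(a.1, b.1) = ℓ.1 then C a b else 0) φ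
  -- Both derivatives equal the same quadratic polynomial in C_s⁻¹φ times the density; the factor
  -- 1/2 for the two orderings of ℓ matches the 1/2 in the Gaussian exponent.
  rw [hfd.unique h, edgeOp_gaussDensity (interpCov_isSymm hC s)]
  congr 1
  refine Finset.sum_congr rfl fun a _ => Finset.sum_congr rfl fun b _ => ?_
  congr 1
  simp only [edgeWeight, Matrix.of_apply]
  split_ifs <;> simp

/-- Coupling derivatives of the Gaussian density are given by the edge operators. -/
theorem fderiv_edgeOps_gaussDensity {C : Matrix (ι × Fin N) (ι × Fin N) ℂ} (hC : C.IsSymm)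
    {s : Pairs ι → ℝ} (hs : s ∈ accretiveCouplings C) {E : Finset (Pairs ι)} {ℓ : Pairs ι}
    (hℓ : ℓ ∉ E) (φ : ι → Spin N) :
    fderiv ℝ (fun s => edgeOps C E (gaussDensity (interpCov C s)) φ) s (Pi.single ℓ 1) =
      edgeOps C (insert ℓ E) (gaussDensity (interpCov C s)) φ := by
  have hsm : FieldSmooth (accretiveCouplings C) fun s => gaussDensity (interpCov C s) :=
    contDiffOn_gaussDensity C
  -- The coupling derivative commutes with the field derivatives and so reaches the density itself,
  -- where the heat equation applies.
  have h1 := congrFun (hsm.fderiv_edgeOp_foldr (isOpen_accretiveCouplings C) C E.toList hs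
    (Pi.single ℓ 1)) φ
  have h2 : (fun φ => fderiv ℝ (fun s => gaussDensity (interpCov C s) φ) s (Pi.single ℓ 1)) =
      edgeOp C ℓ (gaussDensity (interpCov C s)) := funext fun φ => heat_equation hC hs ℓ φ
  rw [h2, edgeOps_edgeOp (contDiff_gaussDensity _)] at h1
  rw [edgeOps_insert (contDiff_gaussDensity _) C hℓ]
  exact h1

end Heat

/-! ## Decay of Gaussian densities and their derivatives -/

section Decay

variable {ι : Type*} [Fintype ι] [DecidableEq ι] {N : ℕ} {S : Type*} [TopologicalSpace S]
  {K : Set S}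

/-- Polynomials in the field with coefficients that are continuous on `K`. -/
inductive PolyField (K : Set S) : (S → (ι → Spin N) → ℂ) → Prop
  | const (c : S → ℂ) (hc : ContinuousOn c K) : PolyField K fun s _ => c s
  | coord (a : ι × Fin N) : PolyField K fun _ φ => (φ a.1 a.2 : ℂ)
  | add {p q : S → (ι → Spin N) → ℂ} (hp : PolyField K p) (hq : PolyField K q) :
      PolyField K fun s φ => p s φ + q s φ
  | mul {p q : S → (ι → Spin N) → ℂ} (hp : PolyField K p) (hq : PolyField K q) :
      PolyField K fun s φ => p s φ * q s φ

theorem PolyField.sum {κ : Type*} (T : Finset κ) {p : κ → S → (ι → Spin N) → ℂ}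
    (hp : ∀ i ∈ T, PolyField K (p i)) : PolyField K fun s φ => ∑ i ∈ T, p i s φ := by
  induction T using Finset.induction_on with
  | empty => simpa using PolyField.const (fun _ : S => (0 : ℂ)) continuousOn_const
  | insert a T ha ih =>
    simp only [Finset.sum_insert ha]
    exact (hp a (Finset.mem_insert_self _ _)).add (ih fun i hi =>
      hp i (Finset.mem_insert_of_mem hi))

theorem PolyField.contDiff {p : S → (ι → Spin N) → ℂ} (hp : PolyField K p) (s : S) :
    ContDiff ℝ ∞ (p s) := by
  induction hp with
  | const c _ => exact contDiff_const
  | coord a => exact contDiff_coord a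
  | add _ _ h1 h2 => exact h1.add h2
  | mul _ _ h1 h2 => exact h1.mul h2

theorem PolyField.fieldDeriv {p : S → (ι → Spin N) → ℂ} (hp : PolyField K p) (a : ι × Fin N) :
    ∃ q : S → (ι → Spin N) → ℂ, PolyField K q ∧
      ∀ s φ, fieldDeriv a.1 a.2 (p s) φ = q s φ := by
  induction hp with
  | const c _ =>
    refine ⟨_, .const (fun _ => 0) continuousOn_const, fun s φ => ?_⟩
    simp [_root_.fieldDeriv]
  | coord b =>
    exact ⟨_, .const (fun _ => if b = a then 1 else 0) continuousOn_const,
      fun s φ => fieldDeriv_coord a b φ⟩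
  | @add p q hp hq h1 h2 =>
    obtain ⟨p', hp', h1⟩ := h1
    obtain ⟨q', hq', h2⟩ := h2
    refine ⟨_, hp'.add hq', fun s φ => ?_⟩
    rw [← h1, ← h2, _root_.fieldDeriv, fderiv_fun_add
      ((hp.contDiff s).differentiable (by simp) φ) ((hq.contDiff s).differentiable (by simp) φ)]
    rfl
  | @mul p q hp hq h1 h2 =>
    obtain ⟨p', hp', h1⟩ := h1
    obtain ⟨q', hq', h2⟩ := h2
    refine ⟨_, (hp'.mul hq).add (hp.mul hq'), fun s φ => ?_⟩
    rw [fieldDeriv_mul (hp.contDiff s) (hq.contDiff s), h1, h2]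

theorem norm_coord_le (φ : ι → Spin N) (a : ι × Fin N) : ‖(φ a.1 a.2 : ℂ)‖ ≤ ‖φ‖ := by
  rw [Complex.norm_real]
  exact (PiLp.norm_apply_le (φ a.1) a.2).trans (norm_le_pi_norm φ a.1)

theorem PolyField.bound (hK : IsCompact K) {p : S → (ι → Spin N) → ℂ} (hp : PolyField K p) :
    ∃ (A : ℝ) (n : ℕ), 0 ≤ A ∧ ∀ s ∈ K, ∀ φ, ‖p s φ‖ ≤ A * (1 + ‖φ‖) ^ n := by
  have hone : ∀ φ : ι → Spin N, 1 ≤ 1 + ‖φ‖ := fun φ => by linarith [norm_nonneg φ]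
  induction hp with
  | const c hc =>
    obtain ⟨A, hA⟩ := hK.exists_bound_of_continuousOn hc
    refine ⟨max A 0, 0, le_max_right _ _, fun s hs φ => ?_⟩
    rw [pow_zero, mul_one]
    exact (hA s hs).trans (le_max_left _ _)
  | coord a =>
    refine ⟨1, 1, zero_le_one, fun s _ φ => ?_⟩
    rw [pow_one, one_mul]
    exact (norm_coord_le φ a).trans (by linarith)
  | add _ _ h1 h2 =>
    obtain ⟨A, n, hA, h1⟩ := h1
    obtain ⟨B, m, hB, h2⟩ := h2
    refine ⟨A + B, n + m, add_nonneg hA hB, fun s hs φ => ?_⟩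
    rw [add_mul]
    refine (norm_add_le _ _).trans (add_le_add ((h1 s hs φ).trans ?_) ((h2 s hs φ).trans ?_))
    · exact mul_le_mul_of_nonneg_left (pow_le_pow_right₀ (hone φ) (Nat.le_add_right _ _)) hA
    · exact mul_le_mul_of_nonneg_left (pow_le_pow_right₀ (hone φ) (Nat.le_add_left _ _)) hB
  | mul _ _ h1 h2 =>
    obtain ⟨A, n, hA, h1⟩ := h1
    obtain ⟨B, m, hB, h2⟩ := h2
    refine ⟨A * B, n + m, mul_nonneg hA hB, fun s hs φ => ?_⟩
    rw [norm_mul]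
    refine (mul_le_mul (h1 s hs φ) (h2 s hs φ) (norm_nonneg _) (by positivity)).trans_eq ?_
    ring

/-- Polynomials times the Gaussian density. -/
def PolyGauss (K : Set S) (M : S → Matrix (ι × Fin N) (ι × Fin N) ℂ)
    (g : S → (ι → Spin N) → ℂ) : Prop :=
  ∃ p : S → (ι → Spin N) → ℂ, PolyField K p ∧ ∀ s φ, g s φ = p s φ * gaussDensity (M s) φ

variable {M : S → Matrix (ι × Fin N) (ι × Fin N) ℂ} {g : S → (ι → Spin N) → ℂ}

/-- The derivative of the Gaussian brings down -(M⁻¹φ)_a, which is linear in φ with coefficients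
continuous on K; the class is therefore stable. -/
theorem PolyGauss.fieldDeriv (hM : ∀ s, (M s).IsSymm)
    (hc : ∀ a b, ContinuousOn (fun s => (M s)⁻¹ a b) K) (hg : PolyGauss K M g) (a : ι × Fin N) :
    PolyGauss K M fun s => fieldDeriv a.1 a.2 (g s) := by
  obtain ⟨p, hp, h⟩ := hg
  obtain ⟨q, hq, hq'⟩ := hp.fieldDeriv a
  refine ⟨_, hq.add (hp.mul (PolyField.sum Finset.univ (p := fun b s φ =>
    -((M s)⁻¹ a b) * (φ b.1 b.2 : ℂ)) fun b _ =>
      (PolyField.const (fun s => -((M s)⁻¹ a b)) (hc a b).neg).mul (PolyField.coord b))),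
    fun s φ => ?_⟩
  have : g s = fun φ => p s φ * gaussDensity (M s) φ := funext (h s)
  change _root_.fieldDeriv a.1 a.2 (g s) φ = _
  rw [this, fieldDeriv_mul (hp.contDiff s) (contDiff_gaussDensity _), hq',
    fieldDeriv_gaussDensity (hM s), invForm]
  simp only [neg_mul, Finset.sum_neg_distrib]
  ring

theorem PolyGauss.edgeOp (hM : ∀ s, (M s).IsSymm)
    (hc : ∀ a b, ContinuousOn (fun s => (M s)⁻¹ a b) K) (hg : PolyGauss K M g)
    (C : Matrix (ι × Fin N) (ι × Fin N) ℂ) (ℓ : Pairs ι) :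
    PolyGauss K M fun s => edgeOp C ℓ (g s) := by
  choose p hp h using fun q : (ι × Fin N) × (ι × Fin N) =>
    (hg.fieldDeriv hM hc q.2).fieldDeriv hM hc q.1
  refine ⟨_, PolyField.sum Finset.univ (p := fun q s φ => edgeWeight C ℓ q.1 q.2 * p q s φ)
    fun q _ => (PolyField.const (fun _ => edgeWeight C ℓ q.1 q.2) continuousOn_const).mul (hp q),
    fun s φ => ?_⟩
  change _root_.edgeOp C ℓ (g s) φ = _
  rw [edgeOp_eq_sum' C ℓ, Finset.sum_mul]
  refine Finset.sum_congr rfl fun q _ => ?_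
  rw [mul_assoc, ← h q s φ]

theorem PolyGauss.edgeOp_foldr (hM : ∀ s, (M s).IsSymm)
    (hc : ∀ a b, ContinuousOn (fun s => (M s)⁻¹ a b) K) (hg : PolyGauss K M g)
    (C : Matrix (ι × Fin N) (ι × Fin N) ℂ) (l : List (Pairs ι)) :
    PolyGauss K M fun s => l.foldr (_root_.edgeOp C) (g s) := by
  induction l with
  | nil => exact hg
  | cons ℓ l ih => exact ih.edgeOp hM hc C ℓ

theorem Accretive.inv {κ : Type*} [Fintype κ] [DecidableEq κ] {M : Matrix κ κ ℂ}
    (hM : Accretive M) : Accretive M⁻¹ := by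
  have hu : IsUnit M.det := isUnit_iff_ne_zero.2 hM.det_ne_zero
  intro ψ hψ
  have hne : M⁻¹.mulVec ψ ≠ 0 := by
    intro h0
    apply hψ
    have := congrArg M.mulVec h0
    rwa [Matrix.mulVec_mulVec, Matrix.mul_nonsing_inv _ hu, Matrix.one_mulVec,
      Matrix.mulVec_zero] at this
  have h1 := hM _ hne
  rw [sesqForm_eq_dotProduct, Matrix.mulVec_mulVec, Matrix.mul_nonsing_inv _ hu,
    Matrix.one_mulVec] at h1
  rw [sesqForm_eq_dotProduct]
  have : star (M⁻¹.mulVec ψ) ⬝ᵥ ψ = star (star ψ ⬝ᵥ M⁻¹.mulVec ψ) := by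
    rw [Matrix.star_dotProduct]
  rw [this, Complex.star_def, Complex.conj_re] at h1
  exact h1

/-- The quadratic form of the inverse covariance. -/
def invQuad (M : Matrix (ι × Fin N) (ι × Fin N) ℂ) (φ : ι → Spin N) : ℂ :=
  ∑ a : ι × Fin N, ∑ b : ι × Fin N, (φ a.1 a.2 : ℂ) * M⁻¹ a b * (φ b.1 b.2 : ℂ)

/-- Fields are real, so the bilinear form coincides with the sesquilinear form of M⁻¹, and
accretivity passes to the inverse. -/
theorem invQuad_re_pos {M : Matrix (ι × Fin N) (ι × Fin N) ℂ} (hM : Accretive M)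
    {φ : ι → Spin N} (hφ : φ ≠ 0) : 0 < (invQuad M φ).re := by
  have hne : (fun a : ι × Fin N => (φ a.1 a.2 : ℂ)) ≠ 0 := by
    intro h
    apply hφ
    funext x
    ext m
    have := congrFun h (x, m)
    simpa using this
  have := hM.inv _ hne
  simpa [sesqForm, invQuad, Complex.conj_ofReal] using this

theorem continuousOn_invQuad (hc : ∀ a b, ContinuousOn (fun s => (M s)⁻¹ a b) K) :
    ContinuousOn (fun p : S × (ι → Spin N) => invQuad (M p.1) p.2) (K ×ˢ Set.univ) := by
  refine continuousOn_finsetSum _ fun a _ => continuousOn_finsetSum _ fun b _ => ?_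
  have h1 : ∀ a : ι × Fin N, ContinuousOn (fun p : S × (ι → Spin N) => (p.2 a.1 a.2 : ℂ))
      (K ×ˢ Set.univ) := fun a =>
    ((contDiff_coord a).continuous.comp continuous_snd).continuousOn
  refine ((h1 a).mul ?_).mul (h1 b)
  exact (hc a b).comp continuousOn_fst fun p hp => hp.1

theorem invQuad_smul (M : Matrix (ι × Fin N) (ι × Fin N) ℂ) (c : ℝ) (φ : ι → Spin N) :
    invQuad M (c • φ) = (c ^ 2 : ℝ) * invQuad M φ := by
  simp only [invQuad, Finset.mul_sum, Pi.smul_apply, PiLp.smul_apply, smul_eq_mul]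
  refine Finset.sum_congr rfl fun a _ => Finset.sum_congr rfl fun b _ => ?_
  push_cast
  ring

/-- Homogeneity reduces the bound to the minimum over K times the unit sphere; the case where this
product is empty is trivial. -/
theorem exists_invQuad_lower (hK : IsCompact K)
    (hc : ∀ a b, ContinuousOn (fun s => (M s)⁻¹ a b) K) (hacc : ∀ s ∈ K, Accretive (M s)) :
    ∃ c : ℝ, 0 < c ∧ ∀ s ∈ K, ∀ φ, c * ‖φ‖ ^ 2 ≤ (invQuad (M s) φ).re := by
  have hcomp : IsCompact (K ×ˢ Metric.sphere (0 : ι → Spin N) 1) := hK.prod (isCompact_sphere _ _)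
  have hmem : ∀ s ∈ K, ∀ φ : ι → Spin N, φ ≠ 0 →
      (s, ‖φ‖⁻¹ • φ) ∈ K ×ˢ Metric.sphere (0 : ι → Spin N) 1 := by
    intro s hs φ hφ
    refine ⟨hs, ?_⟩
    have hn : 0 < ‖φ‖ := norm_pos_iff.2 hφ
    simp [norm_smul, hn.ne']
  have hpos : ∀ p ∈ K ×ˢ Metric.sphere (0 : ι → Spin N) 1, 0 < (invQuad (M p.1) p.2).re := by
    rintro ⟨s, φ⟩ ⟨hs, hφ⟩
    refine invQuad_re_pos (hacc s hs) ?_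
    rintro rfl
    simp at hφ
  have hzero : ∀ s, (invQuad (M s) (0 : ι → Spin N)).re = 0 := by
    intro s; simp [invQuad]
  rcases (K ×ˢ Metric.sphere (0 : ι → Spin N) 1).eq_empty_or_nonempty with h | h
  · refine ⟨1, one_pos, fun s hs φ => ?_⟩
    have : φ = 0 := by
      by_contra hφ
      have := hmem s hs φ hφ
      rw [h] at this
      exact this
    subst this
    rw [hzero]
    simp
  · have hcont : ContinuousOn (fun p : S × (ι → Spin N) => (invQuad (M p.1) p.2).re)
        (K ×ˢ Metric.sphere (0 : ι → Spin N) 1) :=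
      Complex.continuous_re.comp_continuousOn ((continuousOn_invQuad hc).mono
        (Set.prod_mono_right (Set.subset_univ _)))
    obtain ⟨p₀, h₀, hmin⟩ : ∃ p ∈ K ×ˢ Metric.sphere (0 : ι → Spin N) 1,
        ∀ q ∈ K ×ˢ Metric.sphere (0 : ι → Spin N) 1,
          (invQuad (M p.1) p.2).re ≤ (invQuad (M q.1) q.2).re := by
      obtain ⟨p, hp, hmin⟩ := hcomp.exists_isMinOn h hcont
      exact ⟨p, hp, isMinOn_iff.1 hmin⟩
    obtain ⟨c, hcdef⟩ : ∃ c, c = (invQuad (M p₀.1) p₀.2).re := ⟨_, rfl⟩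
    rw [← hcdef] at hmin
    refine ⟨c, hcdef ▸ hpos p₀ h₀, fun s hs φ => ?_⟩
    by_cases hφ : φ = 0
    · subst hφ
      rw [hzero]
      simp
    · have hn : 0 < ‖φ‖ := norm_pos_iff.2 hφ
      have h1 := hmin _ (hmem s hs φ hφ)
      rw [invQuad_smul, Complex.re_ofReal_mul, inv_pow, inv_mul_eq_div,
        le_div_iff₀ (by positivity)] at h1
      exact h1

/-- Half of the Gaussian pays for the polynomial: (1 + x)^n ≤ n! e^{1+x}, and completing the square
gives x ≤ (c/2)x² + 1/(2c). -/
theorem poly_mul_exp_le (n : ℕ) {c : ℝ} (hc : 0 < c) {x : ℝ} (hx : 0 ≤ x) :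
    (1 + x) ^ n * Real.exp (-c * x ^ 2) ≤
      n.factorial * Real.exp (1 + 1 / (2 * c)) * Real.exp (-(c / 2) * x ^ 2) := by
  have h1 : (1 + x) ^ n ≤ n.factorial * Real.exp (1 + x) := by
    have := Real.pow_div_factorial_le_exp (1 + x) (by linarith) n
    rwa [div_le_iff₀ (by positivity), mul_comm] at this
  have h2 : x ≤ c / 2 * x ^ 2 + 1 / (2 * c) := by
    have : 0 ≤ c / 2 * (x - 1 / c) ^ 2 := by positivity
    have h3 : c / 2 * (x - 1 / c) ^ 2 = c / 2 * x ^ 2 - x + 1 / (2 * c) := by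
      field_simp
      ring
    linarith
  calc (1 + x) ^ n * Real.exp (-c * x ^ 2)
      ≤ n.factorial * Real.exp (1 + x) * Real.exp (-c * x ^ 2) :=
        mul_le_mul_of_nonneg_right h1 (Real.exp_nonneg _)
    _ = n.factorial * Real.exp (1 + x + -c * x ^ 2) := by rw [mul_assoc, ← Real.exp_add]
    _ ≤ n.factorial * Real.exp (1 + 1 / (2 * c) + -(c / 2) * x ^ 2) := by
        refine mul_le_mul_of_nonneg_left (Real.exp_le_exp.2 ?_) (by positivity)
        linarith
    _ = _ := by rw [Real.exp_add, mul_assoc]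

theorem PolyGauss.decay (hK : IsCompact K)
    (hn : ContinuousOn (fun s => detInvSqrt ((2 * (Real.pi : ℂ)) • M s)) K)
    (hc : ∀ a b, ContinuousOn (fun s => (M s)⁻¹ a b) K) (hacc : ∀ s ∈ K, Accretive (M s))
    (hg : PolyGauss K M g) :
    ∃ A c : ℝ, 0 ≤ A ∧ 0 < c ∧ ∀ s ∈ K, ∀ φ, ‖g s φ‖ ≤ A * Real.exp (-c * ‖φ‖ ^ 2) := by
  obtain ⟨p, hp, h⟩ := hg
  obtain ⟨A, n, hA, hA'⟩ := hp.bound hK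
  obtain ⟨B, hB⟩ := hK.exists_bound_of_continuousOn hn
  obtain ⟨c, hc0, hlow⟩ := exists_invQuad_lower hK hc hacc
  -- One factor 1/2 stems from the exponent -½⟨φ, M⁻¹φ⟩, the other pays for the polynomial.
  refine ⟨A * max B 0 * (n.factorial * Real.exp (1 + 1 / (2 * (c / 2)))), c / 2 / 2,
    by positivity, by positivity, fun s hs φ => ?_⟩
  have h1 : ‖gaussDensity (M s) φ‖ ≤ max B 0 * Real.exp (-(c / 2) * ‖φ‖ ^ 2) := by
    rw [gaussDensity, norm_mul, Complex.norm_exp]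
    refine mul_le_mul ((hB s hs).trans (le_max_left _ _)) (Real.exp_le_exp.2 ?_)
      (Real.exp_nonneg _) (le_max_right _ _)
    have h2 := hlow s hs φ
    have h3 : (-(1 / 2 : ℂ) * invQuad (M s) φ).re = -(1 / 2) * (invQuad (M s) φ).re := by
      have : (-(1 / 2 : ℂ)) = ((-(1 / 2) : ℝ) : ℂ) := by push_cast; ring
      rw [this, Complex.re_ofReal_mul]
    change (-(1 / 2 : ℂ) * invQuad (M s) φ).re ≤ _
    rw [h3]
    linarith
  rw [h, norm_mul]
  calc ‖p s φ‖ * ‖gaussDensity (M s) φ‖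
      ≤ (A * (1 + ‖φ‖) ^ n) * (max B 0 * Real.exp (-(c / 2) * ‖φ‖ ^ 2)) :=
        mul_le_mul (hA' s hs φ) h1 (norm_nonneg _) (by positivity)
    _ = A * max B 0 * ((1 + ‖φ‖) ^ n * Real.exp (-(c / 2) * ‖φ‖ ^ 2)) := by ring
    _ ≤ A * max B 0 * (n.factorial * Real.exp (1 + 1 / (2 * (c / 2))) *
          Real.exp (-(c / 2 / 2) * ‖φ‖ ^ 2)) :=
        mul_le_mul_of_nonneg_left (poly_mul_exp_le n (by positivity) (norm_nonneg φ))
          (by positivity)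
    _ = _ := by ring

/-- Gaussian decay of all derivatives of the interpolated density, uniformly in the couplings. -/
theorem exists_decay_edgeOps {C : Matrix (ι × Fin N) (ι × Fin N) ℂ} (hC : C.IsSymm)
    (hacc : Accretive C) (E : Finset (Pairs ι)) :
    ∃ A c : ℝ, 0 ≤ A ∧ 0 < c ∧ ∀ s ∈ ultraCouplings ι, ∀ φ,
      ‖edgeOps C E (gaussDensity (interpCov C s)) φ‖ ≤ A * Real.exp (-c * ‖φ‖ ^ 2) := by
  have hK := isCompact_ultraCouplings (ι := ι)
  have hacc' : ∀ s ∈ ultraCouplings ι, Accretive (interpCov C s) := fun s hs => hacc.interpCov hs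
  have hc : ∀ a b, ContinuousOn (fun s => (interpCov C s)⁻¹ a b) (ultraCouplings ι) :=
    fun a b s hs => (contDiffAt_inv_entry (contDiff_interpCov C)
      (hacc' s hs) a b).continuousAt.continuousWithinAt
  have hn : ContinuousOn (fun s => detInvSqrt ((2 * (Real.pi : ℂ)) • interpCov C s))
      (ultraCouplings ι) := by
    intro s hs
    have h := (hacc' s hs).smul (c := 2 * Real.pi) (by positivity)
    push_cast at h
    exact (contDiffAt_detInvSqrt (M := fun s => (2 * (Real.pi : ℂ)) • interpCov C s)
      (fun a b => contDiff_const.mul (contDiff_interpCov C a b)) h).continuousAt.continuousWithinAt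
  have h0 : PolyGauss (ultraCouplings ι) (interpCov C) fun s => gaussDensity (interpCov C s) :=
    ⟨_, .const (fun _ => 1) continuousOn_const, fun s φ => (one_mul _).symm⟩
  exact (h0.edgeOp_foldr (fun s => interpCov_isSymm hC s) hc C E.toList).decay hK hn hc hacc'

theorem continuousOn_edgeOps (C : Matrix (ι × Fin N) (ι × Fin N) ℂ) (E : Finset (Pairs ι)) :
    ContinuousOn (fun p : (Pairs ι → ℝ) × (ι → Spin N) =>
      edgeOps C E (gaussDensity (interpCov C p.1)) p.2) (accretiveCouplings C ×ˢ Set.univ) :=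
  have hsm : FieldSmooth (accretiveCouplings C) fun s => gaussDensity (interpCov C s) :=
    contDiffOn_gaussDensity C
  (hsm.edgeOp_foldr (isOpen_accretiveCouplings C) C E.toList).continuousOn

end Decay

/-! ## Factorization of Gaussian densities over blocks -/

section BlockDiagonal

/-- A block diagonal matrix is block triangular for any order of the blocks. The order is auxiliary
and is removed in the next lemma. -/
theorem charpoly_blockDiagonal'_of_linearOrder {K : Type*} [Fintype K] [LinearOrder K]
    {n : K → Type*} [∀ k, Fintype (n k)] [∀ k, DecidableEq (n k)]
    (d : ∀ k, Matrix (n k) (n k) ℂ) :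
    (Matrix.blockDiagonal' d).charpoly = ∏ k, (d k).charpoly := by
  rw [(Matrix.blockTriangular_blockDiagonal' d).charpoly]
  have h : ∀ k, ((Matrix.blockDiagonal' d).toSquareBlock Sigma.fst k).charpoly =
      (d k).charpoly := by
    intro k
    let e : n k ≃ {a : Σ k, n k // a.1 = k} :=
      { toFun := fun i => ⟨⟨k, i⟩, rfl⟩
        invFun := fun a => a.2 ▸ a.1.2
        left_inv := fun i => rfl
        right_inv := by rintro ⟨⟨k', i⟩, rfl⟩; rfl }
    rw [← Matrix.charpoly_reindex e (d k)]
    congr 1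
    ext a b
    obtain ⟨i, rfl⟩ := e.surjective a
    obtain ⟨j, rfl⟩ := e.surjective b
    rw [Matrix.reindex_apply, Matrix.submatrix_apply, Equiv.symm_apply_apply,
      Equiv.symm_apply_apply]
    exact Matrix.blockDiagonal'_apply_eq d k i j
  refine (Finset.prod_congr rfl (g := fun k => (d k).charpoly) fun k _ => ?_).trans ?_
  · convert h k
  refine Finset.prod_subset (Finset.subset_univ _) fun k _ hk => ?_
  -- Labels of empty blocks are absent from the triangular formula; their characteristic polynomial
  -- is 1.
  have : IsEmpty (n k) := ⟨fun i => by
    rw [Finset.mem_image] at hk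
    exact hk ⟨⟨k, i⟩, Finset.mem_univ _, rfl⟩⟩
  exact Matrix.charpoly_isEmpty

variable {K : Type*} [Fintype K] [DecidableEq K] {n : K → Type*} [∀ k, Fintype (n k)]
  [∀ k, DecidableEq (n k)]

theorem charpoly_blockDiagonal' (d : ∀ k, Matrix (n k) (n k) ℂ) :
    (Matrix.blockDiagonal' d).charpoly = ∏ k, (d k).charpoly := by
  let o : LinearOrder K := LinearOrder.lift' (Fintype.equivFin K) (Fintype.equivFin K).injective
  convert charpoly_blockDiagonal'_of_linearOrder d

/-- The roots of a product of polynomials are the union of the roots with multiplicity, so the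
principal values multiply without sign ambiguity, for arbitrary blocks. -/
theorem detInvSqrt_blockDiagonal' (d : ∀ k, Matrix (n k) (n k) ℂ) :
    detInvSqrt (Matrix.blockDiagonal' d) = ∏ k, detInvSqrt (d k) := by
  have hne : ∏ k, (d k).charpoly ≠ 0 :=
    Finset.prod_ne_zero_iff.2 fun k _ => (Matrix.charpoly_monic _).ne_zero
  rw [detInvSqrt, charpoly_blockDiagonal', Polynomial.roots_prod _ _ hne, Multiset.map_bind,
    Multiset.prod_bind]
  rfl

theorem inv_blockDiagonal' (d : ∀ k, Matrix (n k) (n k) ℂ) (hd : ∀ k, (d k).det ≠ 0) :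
    (Matrix.blockDiagonal' d)⁻¹ = Matrix.blockDiagonal' fun k => (d k)⁻¹ := by
  refine Matrix.inv_eq_right_inv ?_
  rw [← Matrix.blockDiagonal'_mul]
  have : (fun k => d k * (d k)⁻¹) = 1 :=
    funext fun k => Matrix.mul_nonsing_inv _ (isUnit_iff_ne_zero.2 (hd k))
  rw [this, Matrix.blockDiagonal'_one]

theorem detInvSqrt_reindex {κ κ' : Type*} [Fintype κ] [DecidableEq κ] [Fintype κ'] [DecidableEq κ']
    (e : κ ≃ κ') (M : Matrix κ κ ℂ) : detInvSqrt (Matrix.reindex e e M) = detInvSqrt M := by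
  rw [detInvSqrt, Matrix.charpoly_reindex, detInvSqrt]

end BlockDiagonal

/-! ### Gaussian densities of block diagonal covariances -/

section GaussBlocks

variable {L : Type*} [Fintype L] [DecidableEq L] {N : ℕ} {π : Finset (Finset L)}

/-- The points of the blocks of a partition are the points of the set. -/
def blockEquiv (hπ : π ∈ partitions (Finset.univ : Finset L)) : (Σ X : π, (X : Finset L)) ≃ L :=
  Equiv.ofBijective (fun p => (p.2 : L)) ⟨by
    rintro ⟨⟨X, hX⟩, ⟨x, hx⟩⟩ ⟨⟨Y, hY⟩, ⟨y, hy⟩⟩ h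
    obtain rfl : x = y := h
    obtain rfl := eq_of_mem_partitions hπ hX hY hx hy
    rfl, fun x => by
    obtain ⟨X, hX, hx⟩ := exists_block hπ x
    exact ⟨⟨⟨X, hX⟩, ⟨x, hx⟩⟩, rfl⟩⟩

/-- The matrix indices of the blocks of a partition. -/
def indexEquiv (hπ : π ∈ partitions (Finset.univ : Finset L)) (N : ℕ) :
    (Σ X : π, X.1 × Fin N) ≃ L × Fin N :=
  Equiv.ofBijective (fun p => ((p.2.1 : L), p.2.2)) ⟨by
    rintro ⟨⟨X, hX⟩, ⟨⟨x, hx⟩, m⟩⟩ ⟨⟨Y, hY⟩, ⟨⟨y, hy⟩, m'⟩⟩ h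
    obtain ⟨h1, h2⟩ := Prod.ext_iff.1 h
    obtain rfl : x = y := h1
    obtain rfl : m = m' := h2
    obtain rfl := eq_of_mem_partitions hπ hX hY hx hy
    rfl, fun a => by
    obtain ⟨X, hX, hx⟩ := exists_block hπ a.1
    exact ⟨⟨⟨X, hX⟩, (⟨a.1, hx⟩, a.2)⟩, rfl⟩⟩

/-- A matrix vanishes between different blocks of a partition. -/
def BlockDiag (π : Finset (Finset L)) (M : Matrix (L × Fin N) (L × Fin N) ℂ) : Prop :=
  ∀ X ∈ π, ∀ Y ∈ π, X ≠ Y → ∀ a b : L × Fin N, a.1 ∈ X → b.1 ∈ Y → M a b = 0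

theorem BlockDiag.eq_reindex {M : Matrix (L × Fin N) (L × Fin N) ℂ} (h : BlockDiag π M)
    (hπ : π ∈ partitions (Finset.univ : Finset L)) :
    M = Matrix.reindex (indexEquiv hπ N) (indexEquiv hπ N)
      (Matrix.blockDiagonal' fun X : π => restrictCov M X) := by
  ext a b
  obtain ⟨⟨X, i⟩, rfl⟩ := (indexEquiv hπ N).surjective a
  obtain ⟨⟨Y, j⟩, rfl⟩ := (indexEquiv hπ N).surjective b
  rw [Matrix.reindex_apply, Matrix.submatrix_apply, Equiv.symm_apply_apply,
    Equiv.symm_apply_apply]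
  by_cases hXY : X = Y
  · subst hXY
    rw [Matrix.blockDiagonal'_apply_eq]
    rfl
  · rw [Matrix.blockDiagonal'_apply_ne _ _ _ hXY]
    exact h X X.2 Y Y.2 (fun h => hXY (Subtype.ext h)) _ _ i.1.2 j.1.2

theorem BlockDiag.smul {M : Matrix (L × Fin N) (L × Fin N) ℂ} (h : BlockDiag π M) (c : ℂ) :
    BlockDiag π (c • M) := fun X hX Y hY hXY a b ha hb => by
  rw [Matrix.smul_apply, h X hX Y hY hXY a b ha hb, smul_zero]

theorem BlockDiag.gaussDensity_eq {M : Matrix (L × Fin N) (L × Fin N) ℂ} (h : BlockDiag π M)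
    (hπ : π ∈ partitions (Finset.univ : Finset L))
    (hdet : ∀ X ∈ π, (restrictCov M X).det ≠ 0) (φ : L → Spin N) :
    gaussDensity M φ = ∏ X ∈ π, gaussDensity (restrictCov M X) (restrictField X φ) := by
  rw [← Finset.prod_coe_sort π fun X => gaussDensity (restrictCov M X) (restrictField X φ)]
  simp only [gaussDensity]
  rw [Finset.prod_mul_distrib, ← Complex.exp_sum, ← Finset.mul_sum]
  have h1 : detInvSqrt ((2 * (Real.pi : ℂ)) • M) =
      ∏ X : π, detInvSqrt ((2 * (Real.pi : ℂ)) • restrictCov M (X : Finset L)) := by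
    rw [(BlockDiag.smul h _).eq_reindex hπ, detInvSqrt_reindex, detInvSqrt_blockDiagonal']
    rfl
  have h2 : M⁻¹ = Matrix.reindex (indexEquiv hπ N) (indexEquiv hπ N)
      (Matrix.blockDiagonal' fun X : π => (restrictCov M X)⁻¹) := by
    conv_lhs => rw [h.eq_reindex hπ]
    rw [Matrix.inv_reindex, inv_blockDiagonal' _ fun X : π => hdet X X.2]
  rw [h1]
  congr 3
  rw [← (indexEquiv hπ N).sum_comp, Fintype.sum_sigma]
  refine Finset.sum_congr rfl fun X _ => Finset.sum_congr rfl fun i _ => ?_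
  rw [← (indexEquiv hπ N).sum_comp, Fintype.sum_sigma, Finset.sum_eq_single X]
  · refine Finset.sum_congr rfl fun j _ => ?_
    rw [h2, Matrix.reindex_apply, Matrix.submatrix_apply, Equiv.symm_apply_apply,
      Equiv.symm_apply_apply, Matrix.blockDiagonal'_apply_eq]
    rfl
  · intro Y _ hY
    refine Finset.sum_eq_zero fun j _ => ?_
    rw [h2, Matrix.reindex_apply, Matrix.submatrix_apply, Equiv.symm_apply_apply,
      Equiv.symm_apply_apply, Matrix.blockDiagonal'_apply_ne _ _ _ hY.symm, mul_zero, zero_mul]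
  · exact fun h => absurd (Finset.mem_univ X) h

theorem restrictCov_interpCov (C : Matrix (L × Fin N) (L × Fin N) ℂ) (s : Pairs L → ℝ)
    (X : Finset L) :
    restrictCov (interpCov C s) X = interpCov (restrictCov C X) (restrictCoupling X s) := by
  ext a b
  have : coupling s (a.1 : L) (b.1 : L) = coupling (restrictCoupling X s) a.1 b.1 := by
    by_cases hab : a.1 = b.1
    · rw [hab, coupling_self, coupling_self]
    · rw [coupling_of_ne (restrictCoupling X s) (ℓ := ⟨s(a.1, b.1), pair_ne hab⟩) rfl]
      exact coupling_of_ne s rfl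
  simp only [restrictCov, interpCov, Matrix.submatrix_apply, Matrix.of_apply]
  rw [this]

theorem blockDiag_interpCov (C : Matrix (L × Fin N) (L × Fin N) ℂ)
    (hπ : π ∈ partitions (Finset.univ : Finset L)) {s : Pairs L → ℝ}
    (hs : ∀ ℓ, ¬ InBlock π ℓ → s ℓ = 0) : BlockDiag π (interpCov C s) := by
  intro X hX Y hY hXY a b ha hb
  have hne : a.1 ≠ b.1 := fun h => hXY (eq_of_mem_partitions hπ hX hY ha (h ▸ hb))
  rw [interpCov, Matrix.of_apply, coupling_of_ne s (ℓ := ⟨s(a.1, b.1), pair_ne hne⟩) rfl, hs, Complex.ofReal_zero, mul_zero]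
  rw [inBlock_iff rfl]
  rintro ⟨Z, hZ, haZ, hbZ⟩
  exact hXY ((eq_of_mem_partitions hπ hX hZ ha haZ).trans
    (eq_of_mem_partitions hπ hY hZ hb hbZ).symm)

end GaussBlocks

/-! ## Differential operators on products over blocks -/

section EdgeBlocks

variable {L : Type*} [Fintype L] [DecidableEq L] {N : ℕ} {π : Finset (Finset L)}

/-- Restriction of fields as a continuous linear map. -/
def restrictFieldCLM (X : Finset L) (N : ℕ) : (L → Spin N) →L[ℝ] (X → Spin N) :=
  ContinuousLinearMap.pi fun x => ContinuousLinearMap.proj (x : L)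

theorem contDiff_restrictField (X : Finset L) :
    ContDiff ℝ ∞ (restrictField X : (L → Spin N) → X → Spin N) :=
  (restrictFieldCLM X N).contDiff

theorem contDiff_comp_restrictField {X : Finset L} {u : (X → Spin N) → ℂ} (hu : ContDiff ℝ ∞ u) :
    ContDiff ℝ ∞ fun φ : L → Spin N => u (restrictField X φ) :=
  hu.comp (contDiff_restrictField X)

theorem restrictField_single_mem {X : Finset L} {x : L} (hx : x ∈ X) (v : Spin N) :
    restrictField X (Pi.single x v) = Pi.single ⟨x, hx⟩ v := by
  funext y
  by_cases h : y = ⟨x, hx⟩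
  · subst h
    simp [restrictField]
  · have h' : (y : L) ≠ x := fun h' => h (Subtype.ext h')
    simp [restrictField, h, h']

theorem restrictField_single_notMem {X : Finset L} {x : L} (hx : x ∉ X) (v : Spin N) :
    restrictField X (Pi.single x v) = 0 := by
  funext y
  have h' : (y : L) ≠ x := fun h' => hx (h' ▸ y.2)
  simp [restrictField, h']

theorem fieldDeriv_comp_restrictField {X : Finset L} {u : (X → Spin N) → ℂ}
    (hu : ContDiff ℝ ∞ u) (x : L) (m : Fin N) (φ : L → Spin N) :
    fieldDeriv x m (fun φ => u (restrictField X φ)) φ =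
      fderiv ℝ u (restrictField X φ) (restrictField X (Pi.single x (EuclideanSpace.single m 1))) := by
  have h1 : HasFDerivAt u (fderiv ℝ u (restrictField X φ)) (restrictFieldCLM X N φ) :=
    (hu.differentiable (by simp) _).hasFDerivAt
  have h2 := HasFDerivAt.comp (g := u) φ h1 (restrictFieldCLM X N).hasFDerivAt
  change fderiv ℝ (u ∘ restrictFieldCLM X N) φ _ = _
  rw [h2.fderiv]
  rfl

theorem fieldDeriv_restrict_mul {X : Finset L} {u : (X → Spin N) → ℂ} (hu : ContDiff ℝ ∞ u)
    {v : (L → Spin N) → ℂ} (hv : ContDiff ℝ ∞ v) (x : X) (m : Fin N)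
    (h0 : ∀ φ, fieldDeriv (x : L) m v φ = 0) :
    fieldDeriv (x : L) m (fun φ => u (restrictField X φ) * v φ) =
      fun φ => fieldDeriv x m u (restrictField X φ) * v φ := by
  funext φ
  rw [fieldDeriv_mul (contDiff_comp_restrictField hu) hv, h0, mul_zero, add_zero,
    fieldDeriv_comp_restrictField hu, restrictField_single_mem x.2]
  rfl

theorem edgeWeight_incl (C : Matrix (L × Fin N) (L × Fin N) ℂ) {X : Finset L} (ℓ : Pairs X)
    (a b : X × Fin N) : edgeWeight C (Pairs.incl X ℓ) ((a.1 : L), a.2) ((b.1 : L), b.2) =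
      edgeWeight (restrictCov C X) ℓ a b := by
  have h : s((a.1 : L), (b.1 : L)) = (Pairs.incl X ℓ).1 ↔ s(a.1, b.1) = ℓ.1 := by
    change Sym2.map Subtype.val s(a.1, b.1) = Sym2.map Subtype.val ℓ.1 ↔ _
    exact (Sym2.map.injective Subtype.val_injective).eq_iff
  simp only [edgeWeight, h]
  rfl

theorem edgeWeight_incl_eq_zero (C : Matrix (L × Fin N) (L × Fin N) ℂ) {X : Finset L}
    (ℓ : Pairs X) {a b : L × Fin N} (h : a.1 ∉ X ∨ b.1 ∉ X) :
    edgeWeight C (Pairs.incl X ℓ) a b = 0 := by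
  refine if_neg fun hab => ?_
  obtain ⟨x, y, hxy, _⟩ := exists_ends ℓ
  rw [incl_val hxy, Sym2.eq_iff] at hab
  rcases hab with ⟨h1, h2⟩ | ⟨h1, h2⟩ <;> rw [h1, h2] at h <;>
    exact h.elim (fun h => h (Subtype.property _)) fun h => h (Subtype.property _)

/-- Both derivatives of an edge inside X act on fields in X, for which the factor v is a constant.
-/
theorem edgeOp_restrict_mul (C : Matrix (L × Fin N) (L × Fin N) ℂ) {X : Finset L} (ℓ : Pairs X)
    {u : (X → Spin N) → ℂ} (hu : ContDiff ℝ ∞ u) {v : (L → Spin N) → ℂ} (hv : ContDiff ℝ ∞ v)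
    (h0 : ∀ x ∈ X, ∀ m φ, fieldDeriv x m v φ = 0) :
    edgeOp C (Pairs.incl X ℓ) (fun φ => u (restrictField X φ) * v φ) =
      fun φ => edgeOp (restrictCov C X) ℓ u (restrictField X φ) * v φ := by
  funext φ
  rw [edgeOp_eq_sum, edgeOp_eq_sum, Finset.sum_mul]
  have hinj : Function.Injective fun a : X × Fin N => ((a.1 : L), a.2) := by
    rintro ⟨a, m⟩ ⟨b, n⟩ h
    obtain ⟨h1, h2⟩ := Prod.ext_iff.1 h
    exact Prod.ext (Subtype.ext h1) h2
  have hrange : ∀ a : L × Fin N, a ∉ Set.range (fun a : X × Fin N => ((a.1 : L), a.2)) →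
      a.1 ∉ X := fun a ha h => ha ⟨(⟨a.1, h⟩, a.2), rfl⟩
  symm
  refine Fintype.sum_of_injective _ hinj _ _ (fun a ha => ?_) fun a => ?_
  · refine Finset.sum_eq_zero fun b _ => ?_
    rw [edgeWeight_incl_eq_zero C ℓ (Or.inl (hrange a ha)), zero_mul]
  · rw [Finset.sum_mul]
    refine Fintype.sum_of_injective _ hinj _ _ (fun b hb => ?_) fun b => ?_
    · rw [edgeWeight_incl_eq_zero C ℓ (Or.inr (hrange b hb)), zero_mul]
    · rw [edgeWeight_incl, fieldDeriv_restrict_mul hu hv b.1 b.2 (h0 _ b.1.2 _),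
        fieldDeriv_restrict_mul (contDiff_fieldDeriv hu _ _) hv a.1 a.2 (h0 _ a.1.2 _), mul_assoc]

theorem fieldDeriv_prod_eq_zero {S : Finset (Finset L)} {g : (X : Finset L) → (X → Spin N) → ℂ}
    (hg : ∀ X, ContDiff ℝ ∞ (g X)) {x : L} (hx : ∀ X ∈ S, x ∉ X) (m : Fin N) (φ : L → Spin N) :
    fieldDeriv x m (fun φ => ∏ X ∈ S, g X (restrictField X φ)) φ = 0 := by
  induction S using Finset.induction_on with
  | empty => simp [fieldDeriv]
  | insert X S hX ih =>
    simp_rw [Finset.prod_insert hX]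
    rw [fieldDeriv_mul (contDiff_comp_restrictField (hg X))
      (contDiff_prod fun Y _ => contDiff_comp_restrictField (hg Y)),
      ih fun Y hY => hx Y (Finset.mem_insert_of_mem hY), fieldDeriv_comp_restrictField (hg X),
      restrictField_single_notMem (hx X (Finset.mem_insert_self X S))]
    simp

theorem restrictEdges_insert (X : Finset L) (ℓ : Pairs X) (E : Finset (Pairs L)) :
    restrictEdges X (insert (Pairs.incl X ℓ) E) = insert ℓ (restrictEdges X E) := by
  ext e
  rw [mem_restrictEdges, Finset.mem_insert, Finset.mem_insert, mem_restrictEdges,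
    (incl_injective X).eq_iff]

theorem restrictEdges_insert_of_ne (hπ : π ∈ partitions (Finset.univ : Finset L)) {X Y : Finset L}
    (hX : X ∈ π) (hY : Y ∈ π) (hXY : Y ≠ X) (ℓ : Pairs X) (E : Finset (Pairs L)) :
    restrictEdges Y (insert (Pairs.incl X ℓ) E) = restrictEdges Y E := by
  ext e
  rw [mem_restrictEdges, mem_restrictEdges, Finset.mem_insert, or_iff_right]
  exact fun h => hXY (eq_of_incl_eq hπ hY hX h)

theorem contDiff_edgeOps {ι : Type*} [Fintype ι] [DecidableEq ι] {f : (ι → Spin N) → ℂ}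
    (hf : ContDiff ℝ ∞ f) (C : Matrix (ι × Fin N) (ι × Fin N) ℂ) (E : Finset (Pairs ι)) :
    ContDiff ℝ ∞ (edgeOps C E f) :=
  foldr_induction (P := fun f : (ι → Spin N) → ℂ => ContDiff ℝ ∞ f)
    (fun ℓ _ h => contDiff_edgeOp h C ℓ) E.toList hf

/-- The operators `∏ C(ℓ)∂_ℓ` factorize over the blocks of a partition. -/
theorem edgeOps_prod (hπ : π ∈ partitions (Finset.univ : Finset L))
    (C : Matrix (L × Fin N) (L × Fin N) ℂ) {g : (X : Finset L) → (X → Spin N) → ℂ}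
    (hg : ∀ X, ContDiff ℝ ∞ (g X)) {E : Finset (Pairs L)} (hE : ∀ ℓ ∈ E, InBlock π ℓ) :
    edgeOps C E (fun φ => ∏ X ∈ π, g X (restrictField X φ)) =
      fun φ => ∏ X ∈ π, edgeOps (restrictCov C X) (restrictEdges X E) (g X) (restrictField X φ) := by
  induction E using Finset.induction_on with
  | empty =>
    have : ∀ X : Finset L, restrictEdges X (∅ : Finset (Pairs L)) = ∅ := fun X => by
      ext; simp [mem_restrictEdges]
    simp [edgeOps, this]
  | insert ℓ E hℓ ih =>
    obtain ⟨X, hX, ℓ', rfl⟩ := hE ℓ (Finset.mem_insert_self _ _)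
    have hprod : ContDiff ℝ ∞ fun φ : L → Spin N => ∏ X ∈ π, g X (restrictField X φ) :=
      contDiff_prod fun Y _ => contDiff_comp_restrictField (hg Y)
    have hG : ∀ Y : Finset L, ContDiff ℝ ∞
        (edgeOps (restrictCov C Y) (restrictEdges Y E) (g Y)) := fun Y =>
      contDiff_edgeOps (hg Y) _ _
    rw [edgeOps_insert hprod C hℓ, ih fun e he => hE e (Finset.mem_insert_of_mem he)]
    simp_rw [← Finset.mul_prod_erase π _ hX]
    rw [edgeOp_restrict_mul C ℓ' (hG X)
      (contDiff_prod fun Y _ => contDiff_comp_restrictField (hG Y))]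
    · funext φ
      have hℓ' : ℓ' ∉ restrictEdges X E := by rwa [mem_restrictEdges]
      rw [restrictEdges_insert, edgeOps_insert (hg X) _ hℓ']
      congr 1
      refine Finset.prod_congr rfl fun Y hY => ?_
      obtain ⟨hne, hY⟩ := Finset.mem_erase.1 hY
      rw [restrictEdges_insert_of_ne hπ hX hY hne]
    · intro x hx m φ
      refine fieldDeriv_prod_eq_zero hG (fun Y hY hxY => ?_) m φ
      obtain ⟨hne, hY⟩ := Finset.mem_erase.1 hY
      exact hne (eq_of_mem_partitions hπ hY hX hxY hx)

/-- Derivatives of the interpolated Gaussian density factorize over the blocks. -/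
theorem edgeOps_gaussDensity_eq_prod (hπ : π ∈ partitions (Finset.univ : Finset L))
    {C : Matrix (L × Fin N) (L × Fin N) ℂ} {s : Pairs L → ℝ}
    (hs : ∀ ℓ, ¬ InBlock π ℓ → s ℓ = 0) (hacc : Accretive (interpCov C s))
    {E : Finset (Pairs L)} (hE : ∀ ℓ ∈ E, InBlock π ℓ) (φ : L → Spin N) :
    edgeOps C E (gaussDensity (interpCov C s)) φ = ∏ X ∈ π,
      edgeOps (restrictCov C X) (restrictEdges X E)
        (gaussDensity (interpCov (restrictCov C X) (restrictCoupling X s))) (restrictField X φ) := by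
  have h : gaussDensity (interpCov C s) = fun φ => ∏ X ∈ π,
      gaussDensity (interpCov (restrictCov C X) (restrictCoupling X s)) (restrictField X φ) := by
    funext φ
    rw [(blockDiag_interpCov C hπ hs).gaussDensity_eq hπ fun X _ =>
      (hacc.restrictCov X).det_ne_zero]
    simp_rw [restrictCov_interpCov]
  rw [h, edgeOps_prod hπ C (fun X => contDiff_gaussDensity _) hE]

end EdgeBlocks

/-! ## Iterated directional derivatives on convex sets -/

section Directional

variable {G : Type*} [NormedAddCommGroup G] [NormedSpace ℝ G] {S : Set G} {f g : G → ℂ}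

/-- Convex sets with interior points. -/
def FullConvex (S : Set G) : Prop := Convex ℝ S ∧ (interior S).Nonempty

theorem FullConvex.uniqueDiffOn (hS : FullConvex S) : UniqueDiffOn ℝ S :=
  uniqueDiffOn_convex hS.1 hS.2

/-- Symmetry of second derivatives at boundary points of S is obtained from the interior by
continuity; this is the condition for it. -/
theorem FullConvex.subset_closure_interior (hS : FullConvex S) : S ⊆ closure (interior S) := by
  rw [hS.1.closure_interior_eq_closure_of_nonempty_interior hS.2]
  exact subset_closure

theorem FullConvex.prod {H : Type*} [NormedAddCommGroup H] [NormedSpace ℝ H] {T : Set H}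
    (hS : FullConvex S) (hT : FullConvex T) : FullConvex (S ×ˢ T) := by
  refine ⟨hS.1.prod hT.1, ?_⟩
  rw [interior_prod_eq]
  exact hS.2.prod hT.2

theorem fullConvex_cube (P : Type*) [Fintype P] : FullConvex (Set.Icc (0 : P → ℝ) 1) := by
  refine ⟨convex_Icc _ _, ⟨fun _ => 1 / 2, ?_⟩⟩
  rw [← Set.pi_univ_Icc, interior_pi_set Set.finite_univ]
  intro p _
  change (1 / 2 : ℝ) ∈ interior (Set.Icc (0 : ℝ) 1)
  rw [interior_Icc]
  norm_num

/-- The derivative within `S` in the direction `v`, extended by zero. -/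
def dirDeriv (S : Set G) (v : G) (f : G → ℂ) : G → ℂ :=
  S.indicator fun p => fderivWithin ℝ f S p v

theorem dirDeriv_of_mem {p : G} (hp : p ∈ S) (v : G) (f : G → ℂ) :
    dirDeriv S v f p = fderivWithin ℝ f S p v := Set.indicator_of_mem hp _

theorem contDiffOn_dirDeriv (hS : FullConvex S) (hf : ContDiffOn ℝ ∞ f S) (v : G) :
    ContDiffOn ℝ ∞ (dirDeriv S v f) S := by
  refine ContDiffOn.congr ?_ fun p hp => dirDeriv_of_mem hp v f
  exact (hf.fderivWithin hS.uniqueDiffOn (m := ∞) (by simp)).clm_apply contDiffOn_const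

theorem dirDeriv_dirDeriv (hS : FullConvex S) (hf : ContDiffOn ℝ ∞ f S) (v w : G) {p : G}
    (hp : p ∈ S) : dirDeriv S v (dirDeriv S w f) p =
      fderivWithin ℝ (fderivWithin ℝ f S) S p v w := by
  rw [dirDeriv_of_mem hp, fderivWithin_congr (fun q hq => dirDeriv_of_mem hq w f)
    (dirDeriv_of_mem hp w f)]
  have h1 : DifferentiableWithinAt ℝ (fderivWithin ℝ f S) S p :=
    (hf.fderivWithin hS.uniqueDiffOn (m := ∞) (by simp)).differentiableOn (by simp) p hp
  rw [fderivWithin_clm_apply (hS.uniqueDiffOn p hp) h1 (differentiableWithinAt_const w)]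
  simp

/-- Extending derivatives by zero makes this an identity of functions on the whole space, which
reordering a fold of operators requires. -/
theorem dirDeriv_comm (hS : FullConvex S) (hf : ContDiffOn ℝ ∞ f S) (v w : G) :
    dirDeriv S v (dirDeriv S w f) = dirDeriv S w (dirDeriv S v f) := by
  funext p
  by_cases hp : p ∈ S
  · rw [dirDeriv_dirDeriv hS hf v w hp, dirDeriv_dirDeriv hS hf w v hp]
    refine (hf p hp).isSymmSndFDerivWithinAt ?_ hS.uniqueDiffOn (hS.subset_closure_interior hp)
      hp v w
    rw [minSmoothness_of_isRCLikeNormedField]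
    exact WithTop.coe_le_coe.2 le_top
  · exact (Set.indicator_of_notMem hp _).trans (Set.indicator_of_notMem hp _).symm

/-- Iterated partial derivatives are values of the iterated Fréchet derivative on coordinate
vectors, which have sup norm 1. The growth hypothesis on the latter thus controls the former. -/
theorem norm_foldr_fderivWithin_le {P : Type*} [Fintype P] [DecidableEq P] {S : Set (P → ℝ)}
    {f : (P → ℝ) → ℂ} (hS : UniqueDiffOn ℝ S) (hf : ContDiffOn ℝ ∞ f S) (l : List P)
    {D : List P → (P → ℝ) → ℂ} (h0 : ∀ s ∈ S, D [] s = f s)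
    (h1 : ∀ ℓ l, ∀ s ∈ S, D (ℓ :: l) s = fderivWithin ℝ (D l) S s (Pi.single ℓ 1)) {s : P → ℝ}
    (hs : s ∈ S) : ‖D l s‖ ≤ ‖iteratedFDerivWithin ℝ l.length f S s‖ := by
  have key : ∀ l : List P, ∀ s ∈ S, D l s =
      iteratedFDerivWithin ℝ l.length f S s fun i => Pi.single (l.get i) 1 := by
    intro l
    induction l with
    | nil => exact fun s hs => h0 s hs
    | cons ℓ l ih =>
      intro s hs
      rw [h1 ℓ l s hs, fderivWithin_congr ih (ih s hs)]
      have hd : DifferentiableWithinAt ℝ (iteratedFDerivWithin ℝ l.length f S) S s :=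
        hf.differentiableOn_iteratedFDerivWithin (by exact_mod_cast WithTop.coe_lt_top _) hS s hs
      rw [fderivWithin_continuousMultilinear_apply_const_apply (hS s hs) hd]
      rfl
  rw [key l s hs]
  refine (ContinuousMultilinearMap.le_opNorm _ _).trans_eq ?_
  rw [Finset.prod_eq_one, mul_one]
  intro i _
  rw [Pi.norm_single, norm_one]

end Directional

/-! ### Coupling derivatives of functions of fields and couplings -/

section CouplingDirections

variable {L : Type*} [Fintype L] [DecidableEq L] {N : ℕ} {A : Set (L → Spin N)}
  {f : (L → Spin N) × (Pairs L → ℝ) → ℂ}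

/-- Iterated derivatives with respect to the couplings, within `A × [0, 1]^P`. -/
def jointDerivs (A : Set (L → Spin N)) (l : List (Pairs L))
    (f : (L → Spin N) × (Pairs L → ℝ) → ℂ) : (L → Spin N) × (Pairs L → ℝ) → ℂ :=
  l.foldr (fun ℓ => dirDeriv (A ×ˢ Set.Icc 0 1) (0, Pi.single ℓ 1)) f

theorem fullConvex_domain (hA : FullConvex A) :
    FullConvex (A ×ˢ Set.Icc (0 : Pairs L → ℝ) 1) := hA.prod (fullConvex_cube _)

theorem contDiffOn_jointDerivs (hA : FullConvex A) (hf : ContDiffOn ℝ ∞ f (A ×ˢ Set.Icc 0 1))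
    (l : List (Pairs L)) : ContDiffOn ℝ ∞ (jointDerivs A l f) (A ×ˢ Set.Icc 0 1) :=
  foldr_induction (P := fun f => ContDiffOn ℝ ∞ f (A ×ˢ Set.Icc (0 : Pairs L → ℝ) 1))
    (fun _ _ h => contDiffOn_dirDeriv (fullConvex_domain hA) h _) l hf

theorem jointDerivs_perm (hA : FullConvex A) (hf : ContDiffOn ℝ ∞ f (A ×ˢ Set.Icc 0 1))
    {l l' : List (Pairs L)} (h : l.Perm l') : jointDerivs A l f = jointDerivs A l' f :=
  foldr_perm_of_comm (P := fun f => ContDiffOn ℝ ∞ f (A ×ˢ Set.Icc (0 : Pairs L → ℝ) 1))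
    (op := fun ℓ => dirDeriv (A ×ˢ Set.Icc 0 1) (0, Pi.single ℓ 1))
    (fun _ _ h => contDiffOn_dirDeriv (fullConvex_domain hA) h _)
    (fun _ _ _ h => dirDeriv_comm (fullConvex_domain hA) h _ _) h hf

theorem hasFDerivWithinAt_slice (hf : ContDiffOn ℝ ∞ f (A ×ˢ Set.Icc 0 1)) {φ : L → Spin N}
    (hφ : φ ∈ A) {s : Pairs L → ℝ} (hs : s ∈ Set.Icc (0 : Pairs L → ℝ) 1) :
    HasFDerivWithinAt (fun s => f (φ, s)) ((fderivWithin ℝ f (A ×ˢ Set.Icc 0 1) (φ, s)).comp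
      (ContinuousLinearMap.inr ℝ (L → Spin N) (Pairs L → ℝ))) (Set.Icc 0 1) s := by
  have h1 := (hf.differentiableOn (by simp) (φ, s) ⟨hφ, hs⟩).hasFDerivWithinAt
  have h2 : HasFDerivWithinAt (fun s : Pairs L → ℝ => (φ, s))
      (ContinuousLinearMap.inr ℝ (L → Spin N) (Pairs L → ℝ)) (Set.Icc 0 1) s :=
    (hasFDerivAt_prodMk_right φ s).hasFDerivWithinAt
  exact HasFDerivWithinAt.comp (g := f) s h1 h2 fun s hs => ⟨hφ, hs⟩

theorem jointDerivs_cons {φ : L → Spin N} (hφ : φ ∈ A) {s : Pairs L → ℝ}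
    (hs : s ∈ Set.Icc (0 : Pairs L → ℝ) 1) (ℓ : Pairs L) (l : List (Pairs L)) :
    jointDerivs A (ℓ :: l) f (φ, s) =
      fderivWithin ℝ (jointDerivs A l f) (A ×ˢ Set.Icc 0 1) (φ, s) (0, Pi.single ℓ 1) :=
  dirDeriv_of_mem (S := A ×ˢ Set.Icc 0 1) ⟨hφ, hs⟩ _ _

theorem norm_jointDerivs_le (hA : FullConvex A) (hf : ContDiffOn ℝ ∞ f (A ×ˢ Set.Icc 0 1))
    (l : List (Pairs L)) {φ : L → Spin N} (hφ : φ ∈ A) {s : Pairs L → ℝ}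
    (hs : s ∈ Set.Icc (0 : Pairs L → ℝ) 1) : ‖jointDerivs A l f (φ, s)‖ ≤
      ‖iteratedFDerivWithin ℝ l.length (fun s => f (φ, s)) (Set.Icc 0 1) s‖ := by
  have hU := (fullConvex_cube (Pairs L)).uniqueDiffOn
  refine norm_foldr_fderivWithin_le (D := fun l s => jointDerivs A l f (φ, s)) hU ?_ l
    (fun _ _ => rfl) (fun ℓ l s hs => ?_) hs
  · exact hf.comp (contDiff_prodMk_right φ).contDiffOn fun s hs => ⟨hφ, hs⟩
  · rw [jointDerivs_cons hφ hs,
      (hasFDerivWithinAt_slice (contDiffOn_jointDerivs hA hf l) hφ hs).fderivWithin (hU s hs)]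
    rfl

/-- At an interior value of s ℓ the derivative within the cube is two-sided, so it agrees with the
`deriv` of `couplingDeriv`. -/
theorem hasDerivAt_jointDerivs (hA : FullConvex A) (hf : ContDiffOn ℝ ∞ f (A ×ˢ Set.Icc 0 1))
    (l : List (Pairs L)) {φ : L → Spin N} (hφ : φ ∈ A) {s : Pairs L → ℝ}
    (hs : s ∈ Set.Icc (0 : Pairs L → ℝ) 1) {ℓ : Pairs L} (hℓ : s ℓ ∈ Set.Ioo (0 : ℝ) 1) :
    HasDerivAt (fun t => jointDerivs A l f (φ, Function.update s ℓ t))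
      (jointDerivs A (ℓ :: l) f (φ, s)) (s ℓ) := by
  have h1 := hasFDerivWithinAt_slice (contDiffOn_jointDerivs hA hf l) hφ hs
  have h2 : HasDerivWithinAt (fun t : ℝ => Function.update s ℓ t) (Pi.single ℓ 1) (Set.Icc 0 1)
      (s ℓ) := (hasDerivAt_update s ℓ (s ℓ)).hasDerivWithinAt
  have hmaps : Set.MapsTo (fun t : ℝ => Function.update s ℓ t) (Set.Icc 0 1)
      (Set.Icc (0 : Pairs L → ℝ) 1) := by
    intro t ht
    refine ⟨fun e => ?_, fun e => ?_⟩ <;> by_cases he : e = ℓ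
    · subst he; simpa using ht.1
    · simpa [he] using hs.1 e
    · subst he; simpa using ht.2
    · simpa [he] using hs.2 e
  have h1' := h1
  rw [← Function.update_eq_self ℓ s] at h1'
  have h3 := HasFDerivWithinAt.comp_hasDerivWithinAt
    (l := fun s => jointDerivs A l f (φ, s)) (s ℓ) h1' h2 hmaps
  have h4 := h3.hasDerivAt (Icc_mem_nhds hℓ.1 hℓ.2)
  rw [Function.update_eq_self] at h4
  rw [jointDerivs_cons hφ hs]
  exact h4

end CouplingDirections

/-! ## Localization of the coupling derivatives -/

section Localization

variable {L : Type*} [Fintype L] [DecidableEq L] {N : ℕ} {π : Finset (Finset L)}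

/-- Couplings that vanish exactly between different blocks. -/
def blockCouplings (π : Finset (Finset L)) : Set (Pairs L → ℝ) :=
  {s | ∀ ℓ, (InBlock π ℓ → s ℓ ∈ Set.Ioo (0 : ℝ) 1) ∧ (¬ InBlock π ℓ → s ℓ = 0)}

theorem blockCouplings_subset : blockCouplings π ⊆ Set.Icc (0 : Pairs L → ℝ) 1 := by
  intro s hs
  refine ⟨fun ℓ => ?_, fun ℓ => ?_⟩ <;> by_cases h : InBlock π ℓ
  · exact ((hs ℓ).1 h).1.le
  · exact ((hs ℓ).2 h).ge
  · exact ((hs ℓ).1 h).2.le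
  · exact ((hs ℓ).2 h).le.trans zero_le_one

theorem update_mem_blockCouplings {s : Pairs L → ℝ} (hs : s ∈ blockCouplings π) {ℓ : Pairs L}
    (hℓ : InBlock π ℓ) {t : ℝ} (ht : t ∈ Set.Ioo (0 : ℝ) 1) :
    Function.update s ℓ t ∈ blockCouplings π := by
  intro e
  by_cases he : e = ℓ
  · subst he
    rw [Function.update_self]
    exact ⟨fun _ => ht, fun h => absurd hℓ h⟩
  · rw [Function.update_of_ne he]
    exact hs e

theorem couplingParts_of_blockCouplings (hπ : π ∈ partitions (Finset.univ : Finset L))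
    {s : Pairs L → ℝ} (hs : s ∈ blockCouplings π) : couplingParts s = π :=
  couplingParts_eq hπ fun ℓ =>
    ⟨fun h => by_contra fun h' => h ((hs ℓ).2 h'), fun h => ((hs ℓ).1 h).1.ne'⟩

theorem restrictCoupling_update {X : Finset L} (s : Pairs L → ℝ) (ℓ : Pairs X) (t : ℝ) :
    restrictCoupling X (Function.update s (Pairs.incl X ℓ) t) =
      Function.update (restrictCoupling X s) ℓ t := by
  funext e
  by_cases h : e = ℓ
  · subst h
    simp [restrictCoupling]
  · rw [Function.update_of_ne h, restrictCoupling,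
      Function.update_of_ne fun h' => h (incl_injective X h')]
    rfl

theorem restrictCoupling_update_of_ne (hπ : π ∈ partitions (Finset.univ : Finset L))
    {X Y : Finset L} (hX : X ∈ π) (hY : Y ∈ π) (hXY : Y ≠ X) (s : Pairs L → ℝ) (ℓ : Pairs X)
    (t : ℝ) : restrictCoupling Y (Function.update s (Pairs.incl X ℓ) t) = restrictCoupling Y s := by
  funext e
  exact Function.update_of_ne (fun h => hXY (eq_of_incl_eq hπ hY hX h)) _ _

/-- The pair of points of `X` that includes to a given pair of points of `L`, if there is one. -/
def pairOf (X : Finset L) : Pairs L → Option (Pairs X) := Function.partialInv (Pairs.incl X)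

theorem pairOf_incl (X : Finset L) (ℓ : Pairs X) : pairOf X (Pairs.incl X ℓ) = some ℓ :=
  ((incl_injective X).isPartialInv ℓ _).2 rfl

theorem pairOf_incl_of_ne (hπ : π ∈ partitions (Finset.univ : Finset L)) {X Y : Finset L}
    (hX : X ∈ π) (hY : Y ∈ π) (hXY : Y ≠ X) (ℓ : Pairs X) : pairOf Y (Pairs.incl X ℓ) = none := by
  rw [Option.eq_none_iff_forall_ne_some]
  intro e he
  exact hXY (eq_of_incl_eq hπ hY hX (((incl_injective Y).isPartialInv e _).1 he))

variable {A : Set (L → Spin N)} {f : (L → Spin N) × (Pairs L → ℝ) → ℂ}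

/-- A coupling inside a block can move in (0, 1) without leaving `blockCouplings`, where f
factorizes, and only the factor of its own block depends on it. -/
theorem jointDerivs_eq_prod_foldr (hπ : π ∈ partitions (Finset.univ : Finset L))
    (hA : FullConvex A) (hf : ContDiffOn ℝ ∞ f (A ×ˢ Set.Icc 0 1)) {φ : L → Spin N} (hφ : φ ∈ A)
    {b : (X : Finset L) → (Pairs X → ℝ) → ℂ}
    (hb : ∀ s ∈ blockCouplings π, f (φ, s) = ∏ X ∈ π, b X (restrictCoupling X s))
    (l : List (Pairs L)) (hl : ∀ ℓ ∈ l, InBlock π ℓ) : ∀ s ∈ blockCouplings π,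
      jointDerivs A l f (φ, s) =
        ∏ X ∈ π, (l.filterMap (pairOf X)).foldr couplingDeriv (b X) (restrictCoupling X s) := by
  induction l with
  | nil => exact fun s hs => hb s hs
  | cons ℓ l ih =>
    intro s hs
    have ih := ih fun e he => hl e (List.mem_cons_of_mem _ he)
    have hℓ := hl ℓ List.mem_cons_self
    have hd := hasDerivAt_jointDerivs hA hf l hφ (blockCouplings_subset hs) ((hs ℓ).1 hℓ)
    rw [← hd.deriv]
    have hev : (fun t => jointDerivs A l f (φ, Function.update s ℓ t)) =ᶠ[𝓝 (s ℓ)] fun t =>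
        ∏ X ∈ π, (l.filterMap (pairOf X)).foldr couplingDeriv (b X)
          (restrictCoupling X (Function.update s ℓ t)) := by
      filter_upwards [Ioo_mem_nhds ((hs ℓ).1 hℓ).1 ((hs ℓ).1 hℓ).2] with t ht
      exact ih _ (update_mem_blockCouplings hs hℓ ht)
    rw [hev.deriv_eq]
    obtain ⟨X, hX, ℓ', rfl⟩ := hℓ
    have hsplit : (fun t => ∏ Y ∈ π, (l.filterMap (pairOf Y)).foldr couplingDeriv (b Y)
        (restrictCoupling Y (Function.update s (Pairs.incl X ℓ') t))) = fun t =>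
        (l.filterMap (pairOf X)).foldr couplingDeriv (b X)
          (Function.update (restrictCoupling X s) ℓ' t) *
        ∏ Y ∈ π.erase X, (l.filterMap (pairOf Y)).foldr couplingDeriv (b Y)
          (restrictCoupling Y s) := by
      funext t
      rw [← Finset.mul_prod_erase π _ hX, restrictCoupling_update]
      congr 1
      refine Finset.prod_congr rfl fun Y hY => ?_
      obtain ⟨hne, hY⟩ := Finset.mem_erase.1 hY
      rw [restrictCoupling_update_of_ne hπ hX hY hne]
    -- Pulling out a constant from `deriv` over a field needs no differentiability, so nothing is
    -- required of the local factors b.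
    rw [hsplit, deriv_mul_const_field, ← Finset.mul_prod_erase π _ hX,
      List.filterMap_cons_some (pairOf_incl X ℓ')]
    congr 1
    refine Finset.prod_congr rfl fun Y hY => ?_
    obtain ⟨hne, hY⟩ := Finset.mem_erase.1 hY
    rw [List.filterMap_cons_none (pairOf_incl_of_ne hπ hX hY hne ℓ')]

/-- The pairs of a set of in-block edges, listed block by block. -/
def blockList (E : Finset (Pairs L)) (xs : List (Finset L)) : List (Pairs L) :=
  xs.flatMap fun X => (restrictEdges X E).toList.map (Pairs.incl X)

theorem mem_blockList {E : Finset (Pairs L)} {xs : List (Finset L)} {ℓ : Pairs L} :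
    ℓ ∈ blockList E xs ↔ ∃ X ∈ xs, ∃ ℓ' : Pairs X, Pairs.incl X ℓ' ∈ E ∧ Pairs.incl X ℓ' = ℓ := by
  simp only [blockList, List.mem_flatMap, List.mem_map, Finset.mem_toList, mem_restrictEdges]

theorem nodup_blockList (hπ : π ∈ partitions (Finset.univ : Finset L)) (E : Finset (Pairs L))
    {xs : List (Finset L)} (hxs : xs.Nodup) (h : ∀ X ∈ xs, X ∈ π) : (blockList E xs).Nodup := by
  induction xs with
  | nil => exact List.nodup_nil
  | cons X xs ih =>
    rw [List.nodup_cons] at hxs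
    change ((restrictEdges X E).toList.map (Pairs.incl X) ++ blockList E xs).Nodup
    refine List.Nodup.append ((Finset.nodup_toList _).map (incl_injective X))
      (ih hxs.2 fun Y hY => h Y (List.mem_cons_of_mem _ hY)) ?_
    intro ℓ h1 h2
    obtain ⟨ℓ', _, rfl⟩ := List.mem_map.1 h1
    obtain ⟨Y, hY, e, _, he⟩ := mem_blockList.1 h2
    have := eq_of_incl_eq hπ (h Y (List.mem_cons_of_mem _ hY)) (h X List.mem_cons_self) he
    exact hxs.1 (this ▸ hY)

/-- Derivatives of the local factors are not known to commute, so in each block the order must be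
exactly that of `toList`. The global derivatives do commute, and their list is rearranged to match.
-/
theorem filterMap_blockList (hπ : π ∈ partitions (Finset.univ : Finset L)) (E : Finset (Pairs L))
    {xs : List (Finset L)} (hxs : xs.Nodup) (h : ∀ X ∈ xs, X ∈ π) {Y : Finset L} (hY : Y ∈ π) :
    (blockList E xs).filterMap (pairOf Y) =
      if Y ∈ xs then (restrictEdges Y E).toList else [] := by
  induction xs with
  | nil => rfl
  | cons X xs ih =>
    rw [List.nodup_cons] at hxs
    have ih := ih hxs.2 fun Y hY => h Y (List.mem_cons_of_mem _ hY)
    change ((restrictEdges X E).toList.map (Pairs.incl X) ++ blockList E xs).filterMap _ = _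
    rw [List.filterMap_append, List.filterMap_map, ih]
    by_cases hXY : Y = X
    · subst hXY
      have : pairOf Y ∘ Pairs.incl Y = some := funext (pairOf_incl Y)
      rw [this, List.filterMap_some, if_neg hxs.1, if_pos List.mem_cons_self, List.append_nil]
    · have : pairOf Y ∘ Pairs.incl X = fun _ => none :=
        funext (pairOf_incl_of_ne hπ (h X List.mem_cons_self) hY hXY)
      rw [this]
      simp [hXY]

/-- The derivatives with respect to the couplings factorize over the blocks of a partition. -/
theorem jointDerivs_eq_prod (hπ : π ∈ partitions (Finset.univ : Finset L))
    (hA : FullConvex A) (hf : ContDiffOn ℝ ∞ f (A ×ˢ Set.Icc 0 1)) {φ : L → Spin N} (hφ : φ ∈ A)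
    {b : (X : Finset L) → (Pairs X → ℝ) → ℂ}
    (hb : ∀ s ∈ blockCouplings π, f (φ, s) = ∏ X ∈ π, b X (restrictCoupling X s))
    {E : Finset (Pairs L)} (hE : ∀ ℓ ∈ E, InBlock π ℓ) {s : Pairs L → ℝ}
    (hs : s ∈ blockCouplings π) : jointDerivs A E.toList f (φ, s) =
      ∏ X ∈ π, couplingDerivs (restrictEdges X E) (b X) (restrictCoupling X s) := by
  have hmem : ∀ ℓ, ℓ ∈ blockList E π.toList ↔ ℓ ∈ E := by
    intro ℓ
    rw [mem_blockList]
    constructor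
    · rintro ⟨X, _, ℓ', h, rfl⟩
      exact h
    · intro h
      obtain ⟨X, hX, ℓ', rfl⟩ := hE ℓ h
      exact ⟨X, Finset.mem_toList.2 hX, ℓ', h, rfl⟩
  have hin : ∀ X ∈ π.toList, X ∈ π := fun X => Finset.mem_toList.1
  have hperm : E.toList.Perm (blockList E π.toList) := by
    rw [List.perm_ext_iff_of_nodup (Finset.nodup_toList E)
      (nodup_blockList hπ E (Finset.nodup_toList π) hin)]
    intro ℓ
    rw [Finset.mem_toList, hmem]
  rw [jointDerivs_perm hA hf hperm, jointDerivs_eq_prod_foldr hπ hA hf hφ hb _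
    (fun ℓ hℓ => hE ℓ ((hmem ℓ).1 hℓ)) s hs]
  refine Finset.prod_congr rfl fun X hX => ?_
  rw [filterMap_blockList hπ E (Finset.nodup_toList π) hin hX, if_pos (Finset.mem_toList.2 hX)]
  rfl

end Localization

/-! ## The forest expansion at a fixed field -/

section Pointwise

variable {L : Type*} [Fintype L] [DecidableEq L] {N : ℕ}
  {C : Matrix (L × Fin N) (L × Fin N) ℂ} {A : Set (L → Spin N)}
  {f : (L → Spin N) × (Pairs L → ℝ) → ℂ}

/-- The derivative with respect to the couplings in `E` of the interpolated density times `f`, expanded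
by the Leibniz rule. -/
def leibnizTerm (C : Matrix (L × Fin N) (L × Fin N) ℂ) (A : Set (L → Spin N))
    (f : (L → Spin N) × (Pairs L → ℝ) → ℂ) (φ : L → Spin N) (E : Finset (Pairs L))
    (s : Pairs L → ℝ) : ℂ :=
  ∑ E' ∈ E.powerset, edgeOps C E' (gaussDensity (interpCov C s)) φ *
    jointDerivs A (E \ E').toList f (φ, s)

theorem continuousOn_leibnizTerm (hacc : Accretive C) (hA : FullConvex A)
    (hf : ContDiffOn ℝ ∞ f (A ×ˢ Set.Icc 0 1)) {φ : L → Spin N} (hφ : φ ∈ A)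
    (E : Finset (Pairs L)) : ContinuousOn (leibnizTerm C A f φ E) (ultraCouplings L) := by
  refine continuousOn_finsetSum _ fun E' _ => ContinuousOn.mul ?_ ?_
  · exact (continuousOn_edgeOps C E').comp (f := fun s : Pairs L → ℝ => (s, φ))
      (by fun_prop) fun s hs => ⟨ultra_subset_accretive hacc hs, Set.mem_univ _⟩
  · exact (contDiffOn_jointDerivs hA hf _).continuousOn.comp
      (f := fun s : Pairs L → ℝ => (φ, s)) (by fun_prop) fun s hs => ⟨hφ, hs.1⟩

/-- The new edge acts either on the density, where it joins E' (`fderiv_edgeOps_gaussDensity`), or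
on f; accordingly the subsets of E ∪ {ℓ} are those that contain ℓ and those that do not. -/
theorem hasFDerivWithinAt_leibnizTerm (hC : C.IsSymm) (hacc : Accretive C) (hA : FullConvex A)
    (hf : ContDiffOn ℝ ∞ f (A ×ˢ Set.Icc 0 1)) {φ : L → Spin N} (hφ : φ ∈ A)
    (E : Finset (Pairs L)) {s : Pairs L → ℝ} (hs : s ∈ ultraCouplings L) :
    ∃ T : (Pairs L → ℝ) →L[ℝ] ℂ, HasFDerivWithinAt (leibnizTerm C A f φ E) T (Set.Icc 0 1) s ∧
      ∀ ℓ, ℓ ∉ E → T (Pi.single ℓ 1) = leibnizTerm C A f φ (insert ℓ E) s := by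
  have hsm : FieldSmooth (accretiveCouplings C) fun s => gaussDensity (interpCov C s) :=
    contDiffOn_gaussDensity C
  have hs' := ultra_subset_accretive hacc hs
  have h1 : ∀ E' : Finset (Pairs L), HasFDerivWithinAt
      (fun s => edgeOps C E' (gaussDensity (interpCov C s)) φ)
      (fderiv ℝ (fun s => edgeOps C E' (gaussDensity (interpCov C s)) φ) s) (Set.Icc 0 1) s :=
    fun E' => (((hsm.edgeOp_foldr (isOpen_accretiveCouplings C) C E'.toList).contDiffAt_fst
      (isOpen_accretiveCouplings C) hs' φ).differentiableAt (by simp)).hasFDerivAt.hasFDerivWithinAt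
  have h2 : ∀ E' : Finset (Pairs L), HasFDerivWithinAt
      (fun s => jointDerivs A (E \ E').toList f (φ, s))
      ((fderivWithin ℝ (jointDerivs A (E \ E').toList f) (A ×ˢ Set.Icc 0 1) (φ, s)).comp
      (ContinuousLinearMap.inr ℝ (L → Spin N) (Pairs L → ℝ))) (Set.Icc 0 1) s := fun E' =>
    hasFDerivWithinAt_slice (contDiffOn_jointDerivs hA hf _) hφ hs.1
  refine ⟨_, HasFDerivWithinAt.fun_sum fun E' _ => (h1 E').fun_mul (h2 E'), fun ℓ hℓ => ?_⟩
  rw [leibnizTerm, Finset.sum_powerset_insert hℓ, ← Finset.sum_add_distrib, _root_.sum_apply]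
  refine Finset.sum_congr rfl fun E' hE' => ?_
  have hℓ' : ℓ ∉ E' := fun h => hℓ (Finset.mem_powerset.1 hE' h)
  have e1 : insert ℓ E \ insert ℓ E' = E \ E' := by
    ext e
    simp only [Finset.mem_sdiff, Finset.mem_insert]
    constructor
    · rintro ⟨h | h, h'⟩
      · exact absurd (Or.inl h) h'
      · exact ⟨h, fun h'' => h' (Or.inr h'')⟩
    · rintro ⟨h, h'⟩
      exact ⟨Or.inr h, fun h'' => h''.elim (fun h0 => hℓ (h0 ▸ h)) h'⟩
  have e2 : jointDerivs A (insert ℓ E \ E').toList f = jointDerivs A (ℓ :: (E \ E').toList) f := by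
    rw [Finset.insert_sdiff_of_notMem _ hℓ']
    exact jointDerivs_perm hA hf (Finset.toList_insert fun h => hℓ (Finset.mem_sdiff.1 h).1)
  rw [e1, e2, jointDerivs_cons hφ hs.1, ← fderiv_edgeOps_gaussDensity hC hs' hℓ' φ]
  simp only [_root_.add_apply, _root_.smul_apply, smul_eq_mul, ContinuousLinearMap.comp_apply,
    ContinuousLinearMap.inr_apply]
  ring

theorem forest_expansion (hC : C.IsSymm) (hacc : Accretive C) (hA : FullConvex A)
    (hf : ContDiffOn ℝ ∞ f (A ×ˢ Set.Icc 0 1)) {φ : L → Spin N} (hφ : φ ∈ A) :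
    gaussDensity C φ * f (φ, 1) =
      ∑ F ∈ Finset.univ.filter (fun F : Finset (Pairs L) => (edgeGraph F).IsAcyclic),
        ∫ w in Set.Icc (0 : Pairs L → ℝ) 1,
          leibnizTerm C A f φ F (forestInterp F fun e => w e) := by
  have h := forest_formula (D := leibnizTerm C A f φ)
    (fun E => continuousOn_leibnizTerm hacc hA hf hφ E) (fun E s hs => by
      obtain ⟨T, hT, hT'⟩ := hasFDerivWithinAt_leibnizTerm hC hacc hA hf hφ E hs
      refine ⟨T, hT, fun ℓ hℓ => ?_⟩
      convert hT' ℓ hℓ)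
  have h0 : gaussDensity C φ * f (φ, 1) = leibnizTerm C A f φ ∅ 1 := by
    simp [leibnizTerm, edgeOps, jointDerivs, interpCov_one]
  rw [h0]
  convert h

variable {π : Finset (Finset L)}

theorem forestInterp_mem_blockCouplings (hπ : π ∈ partitions (Finset.univ : Finset L))
    {F : Finset (Pairs L)} (hF : SpansBlocks π F) {u : F → ℝ}
    (hu : ∀ e, u e ∈ Set.Ioo (0 : ℝ) 1) : forestInterp F u ∈ blockCouplings π := fun ℓ =>
  ⟨fun h => forestInterp_pos (acyclic_of_spansBlocks hπ hF) hu ((linked_iff_inBlock hπ hF ℓ).2 h),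
    fun h => forestInterp_of_not_linked u fun h' => h ((linked_iff_inBlock hπ hF ℓ).1 h')⟩

/-- The integrand of a tree, summed over the splittings of the tree, without characteristic functions. -/
def treeTerm {ι : Type*} [Fintype ι] [DecidableEq ι] (C : Matrix (ι × Fin N) (ι × Fin N) ℂ)
    (b : (ι → Spin N) → (Pairs ι → ℝ) → ℂ) (T : Finset (Pairs ι)) (φ : ι → Spin N) (u : T → ℝ) : ℂ :=
  ∑ E ∈ T.powerset, edgeOps C E (gaussDensity (interpCov C (forestInterp T u))) φ *
    couplingDerivs (T \ E) (b φ) (forestInterp T u)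

/-- The couplings s^F vanish between blocks and lie in (0, 1) inside, so the density, its
derivatives and the derivatives of f factorize separately; the sum over splittings then factorizes
as well. -/
theorem leibnizTerm_eq_prod (hacc : Accretive C) (hA : FullConvex A)
    (hf : ContDiffOn ℝ ∞ f (A ×ˢ Set.Icc 0 1)) (hπ : π ∈ partitions (Finset.univ : Finset L))
    {b : (X : Finset L) → (X → Spin N) → (Pairs X → ℝ) → ℂ} {φ : L → Spin N} (hφ : φ ∈ A)
    (hb : ∀ s ∈ blockCouplings π,
      f (φ, s) = ∏ X ∈ π, b X (restrictField X φ) (restrictCoupling X s))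
    {F : Finset (Pairs L)} (hF : SpansBlocks π F) {w : Pairs L → ℝ}
    (hw : ∀ e, w e ∈ Set.Ioo (0 : ℝ) 1) :
    leibnizTerm C A f φ F (forestInterp F fun e => w e) = ∏ X ∈ π,
      treeTerm (restrictCov C X) (b X) (restrictEdges X F) (restrictField X φ)
        fun e => w (Pairs.incl X e) := by
  have hac := acyclic_of_spansBlocks hπ hF
  have hs := forestInterp_mem_blockCouplings hπ hF (u := fun e => w e) fun e => hw e
  have hw' : (fun e : F => w e) ∈ Set.Icc (0 : F → ℝ) 1 :=
    ⟨fun e => (hw e).1.le, fun e => (hw e).2.le⟩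
  have hu := hacc.interpCov (forestInterp_mem_ultra hac hw')
  have hin : ∀ E ⊆ F, ∀ ℓ ∈ E, InBlock π ℓ := fun E hE ℓ hℓ => hF.1 ℓ (hE hℓ)
  have hres : ∀ X ∈ π, restrictCoupling X (forestInterp F fun e => w e) =
      forestInterp (restrictEdges X F) fun e => w (Pairs.incl X e) := fun X hX =>
    funext fun ℓ => forestInterp_incl hac (hF.2 X hX) w ℓ
  -- A splitting of the forest amounts to an independent splitting of each of its trees.
  have hpow : F.powerset = Finset.univ.filter fun E : Finset (Pairs L) =>
      (∀ ℓ ∈ E, InBlock π ℓ) ∧ ∀ X ∈ π, restrictEdges X E ∈ (restrictEdges X F).powerset := by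
    ext E
    rw [Finset.mem_powerset, Finset.mem_filter]
    constructor
    · intro h
      refine ⟨Finset.mem_univ _, hin E h, fun X _ => Finset.mem_powerset.2 fun ℓ hℓ => ?_⟩
      rw [mem_restrictEdges] at hℓ ⊢
      exact h hℓ
    · rintro ⟨_, h1, h2⟩ ℓ hℓ
      obtain ⟨X, hX, ℓ', rfl⟩ := h1 ℓ hℓ
      exact mem_restrictEdges.1 (Finset.mem_powerset.1 (h2 X hX) (mem_restrictEdges.2 hℓ))
  rw [leibnizTerm]
  have hterm : ∀ E ∈ F.powerset, edgeOps C E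
        (gaussDensity (interpCov C (forestInterp F fun e => w e))) φ *
      jointDerivs A (F \ E).toList f (φ, forestInterp F fun e => w e) = ∏ X ∈ π,
      (edgeOps (restrictCov C X) (restrictEdges X E) (gaussDensity (interpCov (restrictCov C X)
        (forestInterp (restrictEdges X F) fun e => w (Pairs.incl X e)))) (restrictField X φ) *
      couplingDerivs (restrictEdges X F \ restrictEdges X E) (b X (restrictField X φ))
        (forestInterp (restrictEdges X F) fun e => w (Pairs.incl X e))) := by
    intro E hE
    rw [Finset.mem_powerset] at hE
    rw [edgeOps_gaussDensity_eq_prod hπ (fun ℓ => (hs ℓ).2) hu (hin E hE),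
      jointDerivs_eq_prod hπ hA hf hφ (b := fun X => b X (restrictField X φ)) hb
        (hin _ Finset.sdiff_subset) hs, ← Finset.prod_mul_distrib]
    refine Finset.prod_congr rfl fun X hX => ?_
    have : restrictEdges X (F \ E) = restrictEdges X F \ restrictEdges X E := by
      ext e
      simp only [mem_restrictEdges, Finset.mem_sdiff]
    rw [hres X hX, this]
  rw [Finset.sum_congr rfl hterm, hpow]
  exact sum_inBlock_eq_prod hπ (fun X => (restrictEdges X F).powerset) fun X E =>
    edgeOps (restrictCov C X) E (gaussDensity (interpCov (restrictCov C X)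
        (forestInterp (restrictEdges X F) fun e => w (Pairs.incl X e)))) (restrictField X φ) *
      couplingDerivs (restrictEdges X F \ E) (b X (restrictField X φ))
        (forestInterp (restrictEdges X F) fun e => w (Pairs.incl X e))

end Pointwise

/-! ## Integrals of products over blocks of variables -/

section ProductIntegrals

variable {K : Type*} [Fintype K] {κ : K → Type*} [∀ k, Fintype (κ k)] {I : Type*} [Fintype I]
  {J : Type*} [Fintype J] {Ω : Type*} [MeasurableSpace Ω]

theorem measurePreserving_piCurry (μ : Measure Ω) [SigmaFinite μ] :
    MeasurePreserving (MeasurableEquiv.piCurry fun (k : K) (_ : κ k) => Ω)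
      (Measure.pi fun _ => μ) (Measure.pi fun k => Measure.pi fun _ : κ k => μ) := by
  refine MeasurePreserving.symm (MeasurableEquiv.piCurry fun (k : K) (_ : κ k) => Ω).symm
    ⟨MeasurableEquiv.measurable _, (Measure.pi_eq fun s _ => ?_).symm⟩
  rw [MeasurableEquiv.map_apply]
  have : (MeasurableEquiv.piCurry fun (k : K) (_ : κ k) => Ω).symm ⁻¹' Set.univ.pi s =
      Set.univ.pi fun k => Set.univ.pi fun x => s ⟨k, x⟩ := by
    ext w
    simp only [Set.mem_preimage, Set.mem_univ_pi]
    exact ⟨fun h k x => h ⟨k, x⟩, fun h p => h p.1 p.2⟩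
  rw [this, Measure.pi_pi]
  simp_rw [Measure.pi_pi]
  exact (Fintype.prod_sigma fun p : Σ k, κ k => μ (s p)).symm

/-- Functions on a union of blocks are families of functions on the blocks. -/
def blockSplit (Ω : Type*) [MeasurableSpace Ω] (e : (Σ k, κ k) ≃ I) :
    (I → Ω) ≃ᵐ ((k : K) → κ k → Ω) :=
  (MeasurableEquiv.arrowCongr' e.symm (MeasurableEquiv.refl Ω)).trans
    (MeasurableEquiv.piCurry fun (k : K) (_ : κ k) => Ω)

theorem measurePreserving_blockSplit (e : (Σ k, κ k) ≃ I) (μ : Measure Ω) [SigmaFinite μ] :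
    MeasurePreserving (blockSplit Ω e) (Measure.pi fun _ => μ)
      (Measure.pi fun k => Measure.pi fun _ : κ k => μ) :=
  (measurePreserving_piCurry μ).comp (measurePreserving_arrowCongr' (fun _ => μ) (fun _ => μ) e.symm
    (MeasurableEquiv.refl Ω) fun _ => MeasurePreserving.id μ)

theorem integral_prod_blocks (e : (Σ k, κ k) ≃ I) (μ : Measure Ω) [SigmaFinite μ]
    (g : (k : K) → (κ k → Ω) → ℂ) :
    ∫ w, ∏ k, g k (fun x => w (e ⟨k, x⟩)) ∂(Measure.pi fun _ : I => μ) =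
      ∏ k, ∫ u, g k u ∂(Measure.pi fun _ : κ k => μ) := by
  rw [← integral_fintype_prod_eq_prod]
  exact (measurePreserving_blockSplit e μ).integral_comp'
    fun v : (k : K) → κ k → Ω => ∏ k, g k (v k)

theorem integrable_prod_blocks (e : (Σ k, κ k) ≃ I) (μ : Measure Ω) [SigmaFinite μ]
    {g : (k : K) → (κ k → Ω) → ℂ} (hg : ∀ k, Integrable (g k) (Measure.pi fun _ : κ k => μ)) :
    Integrable (fun w => ∏ k, g k (fun x => w (e ⟨k, x⟩))) (Measure.pi fun _ : I => μ) :=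
  (measurePreserving_blockSplit e μ).integrable_comp_of_integrable
    (g := fun v : (k : K) → κ k → Ω => ∏ k, g k (v k)) (Integrable.fintype_prod_dep hg)

/-- Coordinates outside the range of e integrate to 1, which removes the parameters of pairs off the
forest. -/
theorem integral_comp_injective {e : J → I} (he : Function.Injective e) (μ : Measure Ω)
    [IsProbabilityMeasure μ] (g : (J → Ω) → ℂ) :
    ∫ w, g (fun j => w (e j)) ∂(Measure.pi fun _ : I => μ) =
      ∫ u, g u ∂(Measure.pi fun _ : J => μ) := by
  let p : I → Prop := fun i => i ∈ Set.range e
  have h1 := (measurePreserving_piEquivPiSubtypeProd (fun _ : I => μ) p).integral_comp'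
    fun v => g fun j => v.1 ⟨e j, j, rfl⟩
  have h2 := (measurePreserving_arrowCongr' (fun _ : Subtype p => μ) (fun _ : J => μ)
    (Equiv.ofInjective e he).symm (MeasurableEquiv.refl Ω)
    fun _ => MeasurePreserving.id μ).integral_comp' g
  have h3 := integral_fun_fst (μ := Measure.pi fun _ : Subtype p => μ)
    (ν := Measure.pi fun _ : {i // ¬ p i} => μ)
    fun v : Subtype p → Ω => g fun j => v ⟨e j, j, rfl⟩
  rw [probReal_univ, one_smul] at h3
  refine h1.trans ?_
  convert h3.trans h2

end ProductIntegrals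

/-! ## Extension of fields and couplings by zero -/

section FieldBox

variable {ι : Type*} [Fintype ι] {N : ℕ} {r : ℝ} {R : EReal}

/-- The fields that are bounded by `R`. -/
def fieldBox (ι : Type*) (N : ℕ) (R : EReal) : Set (ι → Spin N) :=
  {φ | ∀ x, ((‖φ x‖ : ℝ) : EReal) ≤ R}

theorem fieldBox_eq_pi : fieldBox ι N R =
    Set.univ.pi fun _ => {v : Spin N | ((‖v‖ : ℝ) : EReal) ≤ R} := by
  ext φ
  simp [fieldBox]

/-- The field domain is closed, possibly with boundary; it contains a ball of radius r > 0, so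
derivatives within it are unique. -/
theorem fullConvex_fieldBox (hr : 0 < r) (hrR : (r : EReal) ≤ R) :
    FullConvex (fieldBox ι N R) := by
  rw [fieldBox_eq_pi]
  constructor
  · refine convex_pi fun _ _ => ?_
    induction R with
    | bot => exact absurd hrR (by simp)
    | coe ρ =>
      have : {v : Spin N | ((‖v‖ : ℝ) : EReal) ≤ (ρ : EReal)} = Metric.closedBall 0 ρ := by
        ext v
        simp
      rw [this]
      exact convex_closedBall _ _
    | top => simpa using convex_univ
  · refine ⟨0, ?_⟩
    rw [interior_pi_set Set.finite_univ]
    intro _ _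
    refine mem_interior.2 ⟨Metric.ball 0 r, fun v hv => ?_, Metric.isOpen_ball,
      Metric.mem_ball_self hr⟩
    rw [mem_ball_zero_iff] at hv
    exact (EReal.coe_le_coe_iff.2 hv.le).trans hrR

theorem isClosed_fieldBox : IsClosed (fieldBox ι N R) := by
  have : fieldBox ι N R = ⋂ x, {φ : ι → Spin N | ((‖φ x‖ : ℝ) : EReal) ≤ R} := by
    ext φ
    simp [fieldBox]
  rw [this]
  refine isClosed_iInter fun x => isClosed_le ?_ continuous_const
  exact continuous_coe_real_ereal.comp (continuous_norm.comp (continuous_apply x))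

theorem isCompact_fieldBox (ρ : ℝ) : IsCompact (fieldBox ι N ρ) := by
  have : {v : Spin N | ((‖v‖ : ℝ) : EReal) ≤ (ρ : EReal)} = Metric.closedBall 0 ρ := by
    ext v
    simp
  rw [fieldBox_eq_pi, this]
  exact isCompact_univ_pi fun _ => isCompact_closedBall _ _

end FieldBox

/-! ### Embedding a tree on a block into the whole set -/

section Extension

variable {L : Type*} [Fintype L] [DecidableEq L] {N : ℕ} {X : Finset L}

/-- The extension of a field by zero. -/
def extendField (φ : X → Spin N) : L → Spin N := fun x => if h : x ∈ X then φ ⟨x, h⟩ else 0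

theorem restrictField_extendField (φ : X → Spin N) : restrictField X (extendField φ) = φ := by
  funext x
  simp [restrictField, extendField]

theorem restrictField_extendField_of_disjoint {Y : Finset L} (h : ∀ x ∈ Y, x ∉ X)
    (φ : X → Spin N) : restrictField Y (extendField φ) = 0 := by
  funext x
  simp [restrictField, extendField, h x x.2]

theorem continuous_extendField : Continuous (extendField : (X → Spin N) → L → Spin N) := by
  refine continuous_pi fun x => ?_
  by_cases h : x ∈ X
  · simpa [extendField, h] using continuous_apply (⟨x, h⟩ : X)
  · simpa [extendField, h] using continuous_const

theorem norm_extendField_le (φ : X → Spin N) : ‖extendField φ‖ ≤ ‖φ‖ := by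
  refine (pi_norm_le_iff_of_nonneg (norm_nonneg _)).2 fun x => ?_
  by_cases h : x ∈ X
  · simpa [extendField, h] using norm_le_pi_norm φ ⟨x, h⟩
  · simp [extendField, h]

theorem extendField_mem_fieldBox {R : EReal} (hR : 0 ≤ R) {φ : X → Spin N}
    (hφ : φ ∈ fieldBox X N R) : extendField φ ∈ fieldBox L N R := by
  intro x
  by_cases h : x ∈ X
  · simpa [extendField, h] using hφ ⟨x, h⟩
  · simpa [extendField, h] using hR

/-- The partition with the block `X` and all other points isolated. -/
def soloPartition (X : Finset L) : Finset (Finset L) :=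
  insert X ((Finset.univ \ X).image fun x => {x})

theorem mem_soloPartition {Y : Finset L} :
    Y ∈ soloPartition X ↔ Y = X ∨ ∃ x, x ∉ X ∧ Y = {x} := by
  simp only [soloPartition, Finset.mem_insert, Finset.mem_image, Finset.mem_sdiff,
    Finset.mem_univ, true_and, eq_comm]

theorem soloPartition_mem (hX : X.Nonempty) :
    soloPartition X ∈ partitions (Finset.univ : Finset L) := by
  refine mem_partitions_univ (fun Y hY => ?_) (fun Y hY Z hZ x hxY hxZ => ?_) fun x => ?_
  · rcases mem_soloPartition.1 hY with rfl | ⟨x, _, rfl⟩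
    · exact hX
    · exact Finset.singleton_nonempty x
  · rcases mem_soloPartition.1 hY with rfl | ⟨y, hy, rfl⟩ <;>
      rcases mem_soloPartition.1 hZ with rfl | ⟨z, hz, rfl⟩
    · rfl
    · rw [Finset.mem_singleton.1 hxZ] at hxY
      exact absurd hxY hz
    · rw [Finset.mem_singleton.1 hxY] at hxZ
      exact absurd hxZ hy
    · rw [← Finset.mem_singleton.1 hxY, ← Finset.mem_singleton.1 hxZ]
  · by_cases h : x ∈ X
    · exact ⟨X, mem_soloPartition.2 (Or.inl rfl), h⟩
    · exact ⟨{x}, mem_soloPartition.2 (Or.inr ⟨x, h, rfl⟩), Finset.mem_singleton_self x⟩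

theorem self_mem_soloPartition : X ∈ soloPartition X := mem_soloPartition.2 (Or.inl rfl)

theorem restrictEdges_image_incl (T : Finset (Pairs X)) :
    restrictEdges X (T.image (Pairs.incl X)) = T := by
  ext e
  rw [mem_restrictEdges, Finset.mem_image]
  constructor
  · rintro ⟨e', he', h⟩
    exact incl_injective X h ▸ he'
  · exact fun h => ⟨e, h, rfl⟩

theorem nonempty_of_mem_spanningTrees {T : Finset (Pairs X)} (hT : T ∈ spanningTrees X) :
    X.Nonempty := by
  obtain ⟨x⟩ := (Finset.mem_filter.1 hT).2.1.nonempty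
  exact ⟨x, x.2⟩

theorem isEmpty_pairs_singleton (x : L) : IsEmpty (Pairs ({x} : Finset L)) := by
  refine ⟨fun ℓ => ?_⟩
  obtain ⟨a, b, _, hab⟩ := exists_ends ℓ
  exact hab (Subsingleton.elim a b)

theorem inBlock_image_incl {E : Finset (Pairs X)} {ℓ : Pairs L}
    (h : ℓ ∈ E.image (Pairs.incl X)) : InBlock (soloPartition X) ℓ := by
  obtain ⟨e, _, rfl⟩ := Finset.mem_image.1 h
  exact ⟨X, self_mem_soloPartition, e, rfl⟩

theorem spansBlocks_soloPartition {T : Finset (Pairs X)} (hT : T ∈ spanningTrees X) :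
    SpansBlocks (soloPartition X) (T.image (Pairs.incl X)) := by
  refine ⟨fun ℓ hℓ => inBlock_image_incl hℓ, fun Y hY => ?_⟩
  rcases mem_soloPartition.1 hY with rfl | ⟨x, _, rfl⟩
  · rwa [restrictEdges_image_incl]
  · exact Finset.mem_filter.2 ⟨Finset.mem_univ _, SimpleGraph.IsTree.of_subsingleton⟩

/-- The extension of edge parameters from a tree on `X` to all pairs of points of `L`. -/
def extendEdges (T : Finset (Pairs X)) (u : T → ℝ) : Pairs L → ℝ :=
  Function.extend (fun t : T => Pairs.incl X t) u fun _ => 1 / 2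

theorem injective_incl_comp (T : Finset (Pairs X)) :
    Function.Injective fun t : T => Pairs.incl X t :=
  (incl_injective X).comp Subtype.val_injective

theorem extendEdges_incl (T : Finset (Pairs X)) (u : T → ℝ) (t : T) :
    extendEdges T u (Pairs.incl X t) = u t := (injective_incl_comp T).extend_apply _ _ t

/-- The default 1/2 only has to lie in both the open and the closed unit interval; `extendInterp`
reads no edge outside T. -/
theorem extendEdges_mem {T : Finset (Pairs X)} {u : T → ℝ} {I : Set ℝ} (hI : (1 / 2 : ℝ) ∈ I)
    (hu : ∀ t, u t ∈ I) (e : Pairs L) : extendEdges T u e ∈ I := by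
  by_cases h : ∃ t : T, Pairs.incl X t = e
  · obtain ⟨t, rfl⟩ := h
    rw [extendEdges_incl]
    exact hu t
  · rw [extendEdges, Function.extend_apply' _ _ _ h]
    exact hI

theorem continuous_extendEdges (T : Finset (Pairs X)) :
    Continuous (extendEdges T : (T → ℝ) → Pairs L → ℝ) := by
  refine continuous_pi fun e => ?_
  by_cases h : ∃ t : T, Pairs.incl X t = e
  · obtain ⟨t, rfl⟩ := h
    simp_rw [extendEdges_incl]
    exact continuous_apply t
  · simp_rw [extendEdges, Function.extend_apply' _ _ _ h]
    exact continuous_const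

/-- The interpolated couplings of a tree on `X`, extended by zero. -/
def extendInterp (T : Finset (Pairs X)) (u : T → ℝ) : Pairs L → ℝ :=
  forestInterp (T.image (Pairs.incl X)) fun e => extendEdges T u e

theorem continuous_extendInterp {T : Finset (Pairs X)} (hT : T ∈ spanningTrees X) :
    Continuous (extendInterp T : (T → ℝ) → Pairs L → ℝ) := by
  have hac := acyclic_of_spansBlocks (soloPartition_mem (nonempty_of_mem_spanningTrees hT))
    (spansBlocks_soloPartition hT)
  refine (continuous_forestInterp hac).comp (continuous_pi fun e => ?_)
  exact (continuous_apply (e : Pairs L)).comp (continuous_extendEdges T)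

theorem forestInterp_congr {ι : Type*} {T T' : Finset (Pairs ι)} (h : T = T') (v : Pairs ι → ℝ) :
    (forestInterp T fun e => v e) = forestInterp T' fun e => v e := by
  subst h
  rfl

theorem restrictCoupling_extendInterp {T : Finset (Pairs X)} (hT : T ∈ spanningTrees X)
    (u : T → ℝ) : restrictCoupling X (extendInterp T u) = forestInterp T u := by
  have hs := spansBlocks_soloPartition hT
  have hac := acyclic_of_spansBlocks (soloPartition_mem (nonempty_of_mem_spanningTrees hT)) hs
  have h1 : restrictCoupling X (extendInterp T u) =
      forestInterp (restrictEdges X (T.image (Pairs.incl X)))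
        fun e => extendEdges T u (Pairs.incl X e) := funext fun ℓ =>
    forestInterp_incl hac (hs.2 X self_mem_soloPartition) (extendEdges T u) ℓ
  rw [h1, forestInterp_congr (restrictEdges_image_incl T) fun e => extendEdges T u (Pairs.incl X e)]
  exact congrArg _ (funext fun t => extendEdges_incl T u t)

variable {A : Set (L → Spin N)} {f : (L → Spin N) × (Pairs L → ℝ) → ℂ}

/-- The coupling derivatives of the local factor of `X` are those of the global function at the
extended field, up to a constant. -/
theorem jointDerivs_extend (hA : FullConvex A) (hf : ContDiffOn ℝ ∞ f (A ×ˢ Set.Icc 0 1))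
    {b : (X : Finset L) → (X → Spin N) → (Pairs X → ℝ) → ℂ}
    (hb : ∀ π ∈ partitions (Finset.univ : Finset L), ∀ φ ∈ A, ∀ s ∈ blockCouplings π,
      f (φ, s) = ∏ X ∈ π, b X (restrictField X φ) (restrictCoupling X s))
    {T : Finset (Pairs X)} (hT : T ∈ spanningTrees X) (E : Finset (Pairs X)) {u : T → ℝ}
    (hu : ∀ t, u t ∈ Set.Ioo (0 : ℝ) 1) {φ : X → Spin N} (hφ : extendField φ ∈ A) :
    jointDerivs A (E.image (Pairs.incl X)).toList f (extendField φ, extendInterp T u) =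
      couplingDerivs E (b X φ) (forestInterp T u) * ∏ Y ∈ (soloPartition X).erase X, b Y 0 0 := by
  have hπ := soloPartition_mem (nonempty_of_mem_spanningTrees hT)
  have hs : extendInterp T u ∈ blockCouplings (soloPartition X) :=
    forestInterp_mem_blockCouplings hπ (spansBlocks_soloPartition hT)
      fun e => extendEdges_mem (by norm_num) hu e
  -- Regularity is assumed of the global function only. With all other points isolated at field
  -- zero, the factorization over blocks exhibits the local factor of X.
  rw [jointDerivs_eq_prod hπ hA hf hφ (b := fun Y => b Y (restrictField Y (extendField φ)))
    (hb _ hπ _ hφ) (fun ℓ => inBlock_image_incl) hs, ← Finset.mul_prod_erase _ _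
    self_mem_soloPartition, restrictEdges_image_incl, restrictField_extendField,
    restrictCoupling_extendInterp hT]
  congr 1
  refine Finset.prod_congr rfl fun Y hY => ?_
  obtain ⟨hne, hY⟩ := Finset.mem_erase.1 hY
  obtain ⟨x, hx, rfl⟩ := (mem_soloPartition.1 hY).resolve_left hne
  have := isEmpty_pairs_singleton x
  rw [restrictField_extendField_of_disjoint (fun y hy => Finset.mem_singleton.1 hy ▸ hx),
    Subsingleton.elim (restrictEdges {x} (E.image (Pairs.incl X))) ∅,
    Subsingleton.elim (restrictCoupling {x} (extendInterp T u)) 0, couplingDerivs,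
    Finset.toList_empty, List.foldr_nil]

end Extension

/-! ## Absolute convergence -/

section GaussianIntegrability

variable {ι : Type*} [Fintype ι] {N : ℕ}

theorem integrable_exp_neg_sq_norm_spin {c : ℝ} (hc : 0 < c) :
    Integrable fun v : Spin N => Real.exp (-c * ‖v‖ ^ 2) := by
  have h := (GaussianFourier.integrable_cexp_neg_mul_sq_norm_add (V := Spin N) (b := (c : ℂ))
    (by simpa using hc) 0 0).norm
  refine h.congr (Filter.Eventually.of_forall fun v => ?_)
  have : -(c : ℂ) * (‖v‖ : ℂ) ^ 2 + 0 * (inner ℝ (0 : Spin N) v : ℝ) =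
      ((-c * ‖v‖ ^ 2 : ℝ) : ℂ) := by
    push_cast
    ring
  change ‖Complex.exp (-(c : ℂ) * (‖v‖ : ℂ) ^ 2 + 0 * (inner ℝ (0 : Spin N) v : ℝ))‖ = _
  rw [this, Complex.norm_exp, Complex.ofReal_re]

/-- The norm of a field is the maximum over its points, so a product of one-point Gaussians of rate
c/(|ι| + 1) dominates; the added 1 keeps the rate meaningful for empty ι. -/
theorem integrable_exp_neg_sq_norm {c : ℝ} (hc : 0 < c) :
    Integrable fun φ : ι → Spin N => Real.exp (-c * ‖φ‖ ^ 2) := by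
  set d : ℝ := c / (Fintype.card ι + 1) with hd
  have hd0 : 0 < d := by positivity
  have h : Integrable fun φ : ι → Spin N => ∏ x, Real.exp (-d * ‖φ x‖ ^ 2) :=
    Integrable.fintype_prod_dep (f := fun (_ : ι) (v : Spin N) => Real.exp (-d * ‖v‖ ^ 2))
      fun _ => integrable_exp_neg_sq_norm_spin hd0
  refine h.mono' (by fun_prop) (Filter.Eventually.of_forall fun φ => ?_)
  rw [Real.norm_of_nonneg (Real.exp_nonneg _), ← Real.exp_sum, Real.exp_le_exp, ← Finset.mul_sum]
  have h1 : ∑ x, ‖φ x‖ ^ 2 ≤ (Fintype.card ι + 1) * ‖φ‖ ^ 2 := by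
    calc ∑ x, ‖φ x‖ ^ 2 ≤ ∑ _x : ι, ‖φ‖ ^ 2 :=
          Finset.sum_le_sum fun x _ => pow_le_pow_left₀ (norm_nonneg _) (norm_le_pi_norm φ x) 2
      _ = Fintype.card ι * ‖φ‖ ^ 2 := by simp
      _ ≤ _ := by nlinarith [sq_nonneg ‖φ‖]
  have h2 := mul_le_mul_of_nonneg_left h1 hd0.le
  have h3 : d * ((Fintype.card ι + 1) * ‖φ‖ ^ 2) = c * ‖φ‖ ^ 2 := by
    rw [hd]
    field_simp
  linarith

theorem measurable_chiQ (r : ℝ) (R : EReal) (Q : Set ι) :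
    Measurable (chiQ r R Q : (ι → Spin N) → ℂ) := by
  refine Finset.measurable_prod _ fun x _ => ?_
  have hn : Measurable fun φ : ι → Spin N => ‖φ x‖ := (measurable_pi_apply x).norm
  by_cases h : x ∈ Q
  · simp only [h, if_true]
    exact Measurable.ite ((measurableSet_lt measurable_const hn).inter
      (measurableSet_le (measurable_coe_real_ereal.comp hn) measurable_const))
      measurable_const measurable_const
  · simp only [h, if_false]
    exact Measurable.ite (measurableSet_le hn measurable_const) measurable_const measurable_const

theorem norm_chiQ_le (r : ℝ) (R : EReal) (Q : Set ι) (φ : ι → Spin N) : ‖chiQ r R Q φ‖ ≤ 1 := by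
  rw [chiQ, norm_prod]
  refine Finset.prod_le_one (fun _ _ => norm_nonneg _) fun x _ => ?_
  split_ifs <;> simp

theorem mem_fieldBox_of_chiQ {r : ℝ} {R : EReal} (hrR : (r : EReal) ≤ R) {Q : Set ι}
    {φ : ι → Spin N} (h : chiQ r R Q φ ≠ 0) : φ ∈ fieldBox ι N R := by
  intro x
  have := Finset.prod_ne_zero_iff.1 h x (Finset.mem_univ x)
  split_ifs at this with h1 h2 h2
  · exact h2.2
  · exact absurd rfl this
  · exact (EReal.coe_le_coe_iff.2 h2).trans hrR
  · exact absurd rfl this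

end GaussianIntegrability

/-! ### Domination of the cluster integrands -/

section Convergence

variable {L : Type*} [Fintype L] [DecidableEq L] {N : ℕ} {r : ℝ} {R : EReal}
  {C : Matrix (L × Fin N) (L × Fin N) ℂ} {f : (L → Spin N) × (Pairs L → ℝ) → ℂ}

/-- Subgaussian growth of the derivatives along the forest interpolations, when the fields are not
bounded. -/
def ForestGrowth (R : EReal) (f : (L → Spin N) × (Pairs L → ℝ) → ℂ) : Prop :=
  R = ⊤ → ∀ (k : ℕ) (ε : ℝ), 0 < ε → ∃ K : ℝ, ∀ φ : L → Spin N,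
    ∀ F : Finset (Pairs L), (edgeGraph F).IsAcyclic → ∀ u ∈ Set.Icc (0 : F → ℝ) 1,
      ‖iteratedFDerivWithin ℝ k (fun s => f (φ, s)) (Set.Icc 0 1) (forestInterp F u)‖ ≤
        K * Real.exp (ε * ‖φ‖ ^ 2)

/-- For R = ∞ this is the growth assumption; for finite R the domain is compact and a constant
suffices. -/
theorem exists_jointDerivs_bound (hr : 0 < r) (hrR : (r : EReal) ≤ R)
    (hf : ContDiffOn ℝ ∞ f (fieldBox L N R ×ˢ Set.Icc 0 1)) (hg : ForestGrowth R f)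
    (l : List (Pairs L)) {ε : ℝ} (hε : 0 < ε) :
    ∃ K : ℝ, 0 ≤ K ∧ ∀ φ ∈ fieldBox L N R, ∀ F : Finset (Pairs L), (edgeGraph F).IsAcyclic →
      ∀ u ∈ Set.Icc (0 : F → ℝ) 1,
        ‖jointDerivs (fieldBox L N R) l f (φ, forestInterp F u)‖ ≤ K * Real.exp (ε * ‖φ‖ ^ 2) := by
  have hA := fullConvex_fieldBox (ι := L) (N := N) hr hrR
  by_cases hR : R = ⊤
  · obtain ⟨K, hK⟩ := hg hR l.length ε hε
    refine ⟨max K 0, le_max_right _ _, fun φ hφ F hF u hu => ?_⟩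
    refine (norm_jointDerivs_le hA hf l hφ (forestInterp_mem hF hu)).trans ((hK φ F hF u hu).trans ?_)
    exact mul_le_mul_of_nonneg_right (le_max_left _ _) (Real.exp_nonneg _)
  · have hcomp : IsCompact (fieldBox L N R ×ˢ Set.Icc (0 : Pairs L → ℝ) 1) := by
      refine IsCompact.prod ?_ isCompact_Icc
      induction R with
      | bot => exact absurd hrR (by simp)
      | coe ρ => exact isCompact_fieldBox ρ
      | top => exact absurd rfl hR
    obtain ⟨K, hK⟩ := hcomp.exists_bound_of_continuousOn
      (contDiffOn_jointDerivs hA hf l).continuousOn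
    refine ⟨max K 0, le_max_right _ _, fun φ hφ F hF u hu => ?_⟩
    have hmem : (φ, forestInterp F u) ∈ fieldBox L N R ×ˢ Set.Icc (0 : Pairs L → ℝ) 1 :=
      ⟨hφ, forestInterp_mem hF hu⟩
    have h1 : 1 ≤ Real.exp (ε * ‖φ‖ ^ 2) :=
      Real.one_le_exp (mul_nonneg hε.le (sq_nonneg _))
    exact ((hK _ hmem).trans (le_max_left K 0)).trans
      (le_mul_of_one_le_right (le_max_right K 0) h1)

theorem ae_fst_mem_Ioo {P E : Type*} [Fintype P] [DecidableEq P] [MeasureSpace E]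
    [SigmaFinite (volume : Measure E)] :
    ∀ᵐ p ∂((volume.restrict (Set.Icc (0 : P → ℝ) 1)).prod (volume : Measure E)),
      ∀ e, p.1 e ∈ Set.Ioo (0 : ℝ) 1 :=
  Measure.quasiMeasurePreserving_fst.ae ae_mem_Ioo

variable {b : (X : Finset L) → (X → Spin N) → (Pairs X → ℝ) → ℂ}

/-- Absolute convergence of the integrals over fields and tree parameters. -/
theorem integrable_clusterIntegrand (hC : C.IsSymm) (hacc : Accretive C) (hr : 0 < r)
    (hrR : (r : EReal) ≤ R) (hf : ContDiffOn ℝ ∞ f (fieldBox L N R ×ˢ Set.Icc 0 1))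
    (hg : ForestGrowth R f)
    (hb : ∀ π ∈ partitions (Finset.univ : Finset L), ∀ φ ∈ fieldBox L N R,
      ∀ s ∈ blockCouplings π, f (φ, s) = ∏ X ∈ π, b X (restrictField X φ) (restrictCoupling X s))
    (hb0 : ∀ X φ s, b X φ s ≠ 0) {X : Finset L} (Q : Set X) {T : Finset (Pairs X)}
    (hT : T ∈ spanningTrees X) (F : Finset (Pairs X)) :
    Integrable (fun p : (T → ℝ) × (X → Spin N) =>
      clusterIntegrand (restrictCov C X) r R Q (b X) T F p.1 p.2)
      ((volume.restrict (Set.Icc (0 : T → ℝ) 1)).prod volume) := by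
  have hA := fullConvex_fieldBox (ι := L) (N := N) hr hrR
  have hR0 : (0 : EReal) ≤ R := (EReal.coe_le_coe_iff.2 hr.le).trans hrR
  have hCX : (restrictCov C X).IsSymm := hC.submatrix _
  have haccX := hacc.restrictCov X
  have hTac : (edgeGraph T).IsAcyclic := (Finset.mem_filter.1 hT).2.isAcyclic
  have hFac := acyclic_of_spansBlocks (soloPartition_mem (nonempty_of_mem_spanningTrees hT))
    (spansBlocks_soloPartition hT)
  set l := ((T \ F).image (Pairs.incl X)).toList with hl
  -- The constant contributed by the isolated points. It is nonzero, so the local derivatives are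
  -- c⁻¹ times global ones, for which continuity and growth are available.
  set c : ℂ := ∏ Y ∈ (soloPartition X).erase X, b Y 0 0 with hc
  have hc0 : c ≠ 0 := Finset.prod_ne_zero_iff.2 fun Y _ => hb0 Y 0 0
  set G : (T → ℝ) × (X → Spin N) → ℂ := fun p =>
    edgeOps (restrictCov C X) F
      (gaussDensity (interpCov (restrictCov C X) (forestInterp T p.1))) p.2 *
    (chiQ r R Q p.2 * (c⁻¹ * jointDerivs (fieldBox L N R) l f
      (extendField p.2, extendInterp T p.1))) with hG
  obtain ⟨a, γ, ha, hγ, hdec⟩ := exists_decay_edgeOps hCX haccX F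
  -- Half of the decay rate γ is spent on the growth of f and the other half remains integrable.
  obtain ⟨K, hK, hbound⟩ := exists_jointDerivs_bound hr hrR hf hg l (ε := γ / 2) (by positivity)
  have hIcc : MeasurableSet (Set.Icc (0 : T → ℝ) 1) := measurableSet_Icc
  have hbox : MeasurableSet (fieldBox X N R) := isClosed_fieldBox.measurableSet
  have hGint : Integrable G ((volume.restrict (Set.Icc (0 : T → ℝ) 1)).prod volume) := by
    have hsupp : Function.support G ⊆ Set.univ ×ˢ fieldBox X N R := by
      intro p hp
      refine ⟨Set.mem_univ _, mem_fieldBox_of_chiQ (Q := Q) hrR fun h => hp ?_⟩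
      simp only [hG, h, zero_mul, mul_zero]
    rw [← integrableOn_iff_integrable_of_support_subset hsupp, IntegrableOn,
      ← Measure.prod_restrict, Measure.restrict_univ]
    have hdom : Integrable (fun p : (T → ℝ) × (X → Spin N) =>
        a * (‖c⁻¹‖ * K) * Real.exp (-(γ / 2) * ‖p.2‖ ^ 2))
        ((volume.restrict (Set.Icc (0 : T → ℝ) 1)).prod
          (volume.restrict (fieldBox X N R))) :=
      (((integrable_exp_neg_sq_norm (by positivity)).restrict).const_mul _).comp_snd _
    refine hdom.mono' ?_ ?_
    · rw [Measure.prod_restrict]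
      have hmem : ∀ p ∈ Set.Icc (0 : T → ℝ) 1 ×ˢ fieldBox X N R,
          forestInterp T p.1 ∈ accretiveCouplings (restrictCov C X) := fun p hp =>
        ultra_subset_accretive haccX (forestInterp_mem_ultra hTac hp.1)
      have hmem' : ∀ p ∈ Set.Icc (0 : T → ℝ) 1 ×ˢ fieldBox X N R,
          (extendField p.2, extendInterp T p.1) ∈
            fieldBox L N R ×ˢ Set.Icc (0 : Pairs L → ℝ) 1 := fun p hp =>
        ⟨extendField_mem_fieldBox hR0 hp.2, forestInterp_mem hFac
          ⟨fun e => (extendEdges_mem (I := Set.Icc 0 1) (by norm_num)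
            (fun t => ⟨hp.1.1 t, hp.1.2 t⟩) e).1, fun e => (extendEdges_mem (I := Set.Icc 0 1)
            (by norm_num) (fun t => ⟨hp.1.1 t, hp.1.2 t⟩) e).2⟩⟩
      have h1 : ContinuousOn (fun p : (T → ℝ) × (X → Spin N) => edgeOps (restrictCov C X) F
          (gaussDensity (interpCov (restrictCov C X) (forestInterp T p.1))) p.2)
          (Set.Icc (0 : T → ℝ) 1 ×ˢ fieldBox X N R) :=
        (continuousOn_edgeOps (restrictCov C X) F).comp
          (f := fun p : (T → ℝ) × (X → Spin N) => (forestInterp T p.1, p.2))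
          (((continuous_forestInterp hTac).comp continuous_fst).prodMk
            continuous_snd).continuousOn fun p hp => ⟨hmem p hp, Set.mem_univ _⟩
      have h2 : ContinuousOn (fun p : (T → ℝ) × (X → Spin N) =>
          jointDerivs (fieldBox L N R) l f (extendField p.2, extendInterp T p.1))
          (Set.Icc (0 : T → ℝ) 1 ×ˢ fieldBox X N R) :=
        (contDiffOn_jointDerivs hA hf l).continuousOn.comp
          (f := fun p : (T → ℝ) × (X → Spin N) => (extendField p.2, extendInterp T p.1))
          ((continuous_extendField.comp continuous_snd).prodMk
            ((continuous_extendInterp hT).comp continuous_fst)).continuousOn hmem'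
      have hm := hIcc.prod hbox
      exact (h1.aestronglyMeasurable hm).mul
        (((measurable_chiQ r R Q).comp measurable_snd).aestronglyMeasurable.mul
          ((h2.aestronglyMeasurable hm).const_mul _))
    · rw [Measure.prod_restrict]
      filter_upwards [ae_restrict_mem (hIcc.prod hbox)] with p hp
      have e1 := hdec _ (forestInterp_mem_ultra hTac hp.1) p.2
      have e2 := hbound _ (extendField_mem_fieldBox hR0 hp.2) _ hFac
        (fun e => extendEdges T p.1 e) ⟨fun e => (extendEdges_mem (I := Set.Icc 0 1) (by norm_num)
            (fun t => ⟨hp.1.1 t, hp.1.2 t⟩) e).1, fun e => (extendEdges_mem (I := Set.Icc 0 1)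
            (by norm_num) (fun t => ⟨hp.1.1 t, hp.1.2 t⟩) e).2⟩
      have e3 : Real.exp (γ / 2 * ‖(extendField p.2 : L → Spin N)‖ ^ 2) ≤
          Real.exp (γ / 2 * ‖p.2‖ ^ 2) :=
        Real.exp_le_exp.2 (mul_le_mul_of_nonneg_left
          (pow_le_pow_left₀ (norm_nonneg _) (norm_extendField_le p.2) 2) (by positivity))
      have e4 := e2.trans (mul_le_mul_of_nonneg_left e3 hK)
      have e5 : Real.exp (-γ * ‖p.2‖ ^ 2) * Real.exp (γ / 2 * ‖p.2‖ ^ 2) =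
          Real.exp (-(γ / 2) * ‖p.2‖ ^ 2) := by
        rw [← Real.exp_add]
        congr 1
        ring
      simp only [hG, norm_mul]
      calc _ ≤ a * Real.exp (-γ * ‖p.2‖ ^ 2) *
            (1 * (‖c⁻¹‖ * (K * Real.exp (γ / 2 * ‖p.2‖ ^ 2)))) := by
            refine mul_le_mul e1 ?_ (by positivity) (by positivity)
            refine mul_le_mul (norm_chiQ_le r R Q p.2) ?_ (by positivity) zero_le_one
            exact mul_le_mul_of_nonneg_left e4 (norm_nonneg _)
        _ = a * (‖c⁻¹‖ * K) * (Real.exp (-γ * ‖p.2‖ ^ 2) * Real.exp (γ / 2 * ‖p.2‖ ^ 2)) := by ring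
        _ = _ := by rw [e5]
  -- The local and global derivatives are identified for parameters in the open cube, which suffices
  -- almost everywhere. Outside the field box both integrands vanish by the characteristic
  -- functions.
  refine hGint.congr ?_
  filter_upwards [ae_fst_mem_Ioo] with p hp
  simp only [hG, clusterIntegrand]
  congr 1
  by_cases h : chiQ r R Q p.2 = 0
  · rw [h, zero_mul, zero_mul]
  · rw [jointDerivs_extend hA hf hb hT (T \ F) hp
      (extendField_mem_fieldBox hR0 (mem_fieldBox_of_chiQ hrR h))]
    rw [← hc, mul_comm _ c, inv_mul_cancel_left₀ hc0]

end Convergence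

/-! ## Resummation of the forest expansion -/

section Resummation

variable {L : Type*} [Fintype L] [DecidableEq L] {N : ℕ} {r : ℝ} {R : EReal}
  {C : Matrix (L × Fin N) (L × Fin N) ℂ} {f : (L → Spin N) × (Pairs L → ℝ) → ℂ}
  {b : (X : Finset L) → (X → Spin N) → (Pairs X → ℝ) → ℂ} {π : Finset (Finset L)}

theorem prod_eq_prod_blocks (hπ : π ∈ partitions (Finset.univ : Finset L)) (g : L → ℂ) :
    ∏ x, g x = ∏ X ∈ π, ∏ x : X, g x := by
  rw [← (blockEquiv hπ).prod_comp, Fintype.prod_sigma,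
    ← Finset.prod_coe_sort π fun X => ∏ x : X, g x]
  rfl

/-- Since r ≤ R, each factor of χ_R is the sum of its small and large field parts; Q records where
the large one is chosen. -/
theorem sum_chiQ (hrR : (r : EReal) ≤ R) (X : Finset L) (φ : X → Spin N) :
    ∑ Q ∈ X.powerset, chiQ r R {x : X | (x : L) ∈ Q} φ = chiR R φ := by
  let g : L → ℂ := fun x => if h : x ∈ X then
    (if r < ‖φ ⟨x, h⟩‖ ∧ ((‖φ ⟨x, h⟩‖ : ℝ) : EReal) ≤ R then 1 else 0) else 0
  let k : L → ℂ := fun x => if h : x ∈ X then (if ‖φ ⟨x, h⟩‖ ≤ r then 1 else 0) else 0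
  have h1 : chiR R φ = ∏ x ∈ X, (g x + k x) := by
    rw [chiR, ← Finset.prod_coe_sort X fun x => g x + k x]
    refine Finset.prod_congr rfl fun x _ => ?_
    have e1 : g x = if r < ‖φ x‖ ∧ ((‖φ x‖ : ℝ) : EReal) ≤ R then 1 else 0 := dif_pos x.2
    have e2 : k x = if ‖φ x‖ ≤ r then 1 else 0 := dif_pos x.2
    rw [e1, e2]
    by_cases hx : ‖φ x‖ ≤ r
    · have := (EReal.coe_le_coe_iff.2 hx).trans hrR
      simp [hx, this, not_lt.2 hx]
    · simp [hx, not_le.1 hx]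
  rw [h1, Finset.prod_add]
  refine Finset.sum_congr rfl fun Q hQ => ?_
  rw [Finset.mem_powerset] at hQ
  have h2 : chiQ r R {x : X | (x : L) ∈ Q} φ = ∏ x ∈ X, if x ∈ Q then g x else k x := by
    rw [chiQ, ← Finset.prod_coe_sort X fun x => if x ∈ Q then g x else k x]
    refine Finset.prod_congr rfl fun x _ => ?_
    have e1 : g x = if r < ‖φ x‖ ∧ ((‖φ x‖ : ℝ) : EReal) ≤ R then 1 else 0 := dif_pos x.2
    have e2 : k x = if ‖φ x‖ ≤ r then 1 else 0 := dif_pos x.2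
    rw [e1, e2]
    by_cases hx : (x : L) ∈ Q <;> simp [hx]
  rw [h2, Finset.prod_ite, Finset.filter_mem_eq_inter, Finset.inter_eq_right.2 hQ,
    Finset.filter_notMem_eq_sdiff]

/-- The sum over the trees on a block of the integrals over the tree parameters. -/
def treeSum (C : Matrix (L × Fin N) (L × Fin N) ℂ)
    (b : (X : Finset L) → (X → Spin N) → (Pairs X → ℝ) → ℂ) (X : Finset L) (φ : X → Spin N) : ℂ :=
  ∑ T ∈ spanningTrees X, ∫ u in Set.Icc (0 : T → ℝ) 1, treeTerm (restrictCov C X) (b X) T φ u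

/-- The edges of different trees are different coordinates of the cube, so Fubini applies to the
product over blocks. -/
theorem integral_leibnizTerm (hacc : Accretive C) {A : Set (L → Spin N)} (hA : FullConvex A)
    (hf : ContDiffOn ℝ ∞ f (A ×ˢ Set.Icc 0 1)) (hπ : π ∈ partitions (Finset.univ : Finset L))
    {φ : L → Spin N} (hφ : φ ∈ A) (hb : ∀ s ∈ blockCouplings π,
      f (φ, s) = ∏ X ∈ π, b X (restrictField X φ) (restrictCoupling X s))
    {F : Finset (Pairs L)} (hF : SpansBlocks π F) :
    ∫ w in Set.Icc (0 : Pairs L → ℝ) 1, leibnizTerm C A f φ F (forestInterp F fun e => w e) =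
      ∏ X ∈ π, ∫ u in Set.Icc (0 : restrictEdges X F → ℝ) 1,
        treeTerm (restrictCov C X) (b X) (restrictEdges X F) (restrictField X φ) u := by
  have h1 : ∫ w in Set.Icc (0 : Pairs L → ℝ) 1,
      leibnizTerm C A f φ F (forestInterp F fun e => w e) =
      ∫ w in Set.Icc (0 : Pairs L → ℝ) 1, ∏ X : π, treeTerm (restrictCov C X) (b X)
        (restrictEdges X F) (restrictField X φ) fun e => w (Pairs.incl X e) := by
    refine integral_congr_ae ?_
    filter_upwards [ae_mem_Ioo] with w hw
    rw [leibnizTerm_eq_prod hacc hA hf hπ hφ hb hF hw]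
    exact (Finset.prod_coe_sort π fun X => treeTerm (restrictCov C X) (b X)
        (restrictEdges X F) (restrictField X φ) fun e => w (Pairs.incl X e)).symm
  let e : (Σ X : π, restrictEdges X.1 F) → Pairs L := fun p => Pairs.incl p.1.1 p.2.1
  have he : Function.Injective e := by
    rintro ⟨⟨X, hX⟩, ⟨a, ha⟩⟩ ⟨⟨Y, hY⟩, ⟨a', ha'⟩⟩ h
    obtain rfl := eq_of_incl_eq hπ hX hY h
    obtain rfl := incl_injective X h
    rfl
  rw [h1, volume_restrict_cube, integral_comp_injective he (volume.restrict (Set.Icc (0 : ℝ) 1))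
    fun v => ∏ X : π, treeTerm (restrictCov C X) (b X) (restrictEdges X.1 F)
      (restrictField X.1 φ) fun t => v ⟨X, t⟩]
  have h2 := integral_prod_blocks (Equiv.refl (Σ X : π, restrictEdges X.1 F))
    (volume.restrict (Set.Icc (0 : ℝ) 1)) fun X : π => treeTerm (restrictCov C X) (b X)
      (restrictEdges X.1 F) (restrictField X.1 φ)
  refine h2.trans ?_
  rw [← Finset.prod_coe_sort π fun X => ∫ u in Set.Icc (0 : restrictEdges X F → ℝ) 1,
        treeTerm (restrictCov C X) (b X) (restrictEdges X F) (restrictField X φ) u]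
  refine Finset.prod_congr rfl fun X _ => ?_
  rw [volume_restrict_cube]

/-- This holds for each field separately, before any field integration. The field derivatives act on
the density alone, so no integration by parts is needed. -/
theorem gaussDensity_mul_eq_sum (hC : C.IsSymm) (hacc : Accretive C) {A : Set (L → Spin N)}
    (hA : FullConvex A) (hf : ContDiffOn ℝ ∞ f (A ×ˢ Set.Icc 0 1)) {φ : L → Spin N} (hφ : φ ∈ A)
    (hb : ∀ π ∈ partitions (Finset.univ : Finset L), ∀ φ ∈ A, ∀ s ∈ blockCouplings π,
      f (φ, s) = ∏ X ∈ π, b X (restrictField X φ) (restrictCoupling X s)) :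
    gaussDensity C φ * f (φ, 1) = ∑ π ∈ partitions (Finset.univ : Finset L),
      ∏ X ∈ π, treeSum C b X (restrictField X φ) := by
  rw [forest_expansion hC hacc hA hf hφ, sum_forests_eq]
  refine Finset.sum_congr rfl fun π hπ => ?_
  rw [Finset.sum_congr rfl fun F hF => integral_leibnizTerm hacc hA hf hπ hφ (hb π hπ φ hφ)
    (Finset.mem_filter.1 hF).2]
  exact sum_inBlock_eq_prod hπ (fun X => spanningTrees X) fun X T =>
    ∫ u in Set.Icc (0 : T → ℝ) 1, treeTerm (restrictCov C X) (b X) T (restrictField X φ) u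

/-- The integrand of the partition function is a sum over partitions of products over blocks. -/
theorem integrand_eq_sum (hC : C.IsSymm) (hacc : Accretive C) (hr : 0 < r) (hrR : (r : EReal) ≤ R)
    (hf : ContDiffOn ℝ ∞ f (fieldBox L N R ×ˢ Set.Icc 0 1))
    (hb : ∀ π ∈ partitions (Finset.univ : Finset L), ∀ φ ∈ fieldBox L N R,
      ∀ s ∈ blockCouplings π, f (φ, s) = ∏ X ∈ π, b X (restrictField X φ) (restrictCoupling X s))
    (φ : L → Spin N) :
    gaussDensity C φ * (chiR R φ * f (φ, 1)) = ∑ π ∈ partitions (Finset.univ : Finset L),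
      ∏ X ∈ π, (chiR R (restrictField X φ) * treeSum C b X (restrictField X φ)) := by
  have h1 : ∀ π ∈ partitions (Finset.univ : Finset L),
      ∏ X ∈ π, (chiR R (restrictField X φ) * treeSum C b X (restrictField X φ)) =
        chiR R φ * ∏ X ∈ π, treeSum C b X (restrictField X φ) := by
    intro π hπ
    rw [Finset.prod_mul_distrib]
    congr 1
    exact (prod_eq_prod_blocks hπ fun x => if ((‖φ x‖ : ℝ) : EReal) ≤ R then 1 else 0).symm
  rw [Finset.sum_congr rfl h1, ← Finset.mul_sum]
  by_cases hφ : φ ∈ fieldBox L N R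
  · rw [← gaussDensity_mul_eq_sum hC hacc (fullConvex_fieldBox hr hrR) hf hφ hb]
    ring
  · have : chiR R φ = 0 := by
      have hφ' : ∃ x, ¬ ((‖φ x‖ : ℝ) : EReal) ≤ R := not_forall.1 hφ
      obtain ⟨x, hx⟩ := hφ'
      exact Finset.prod_eq_zero (Finset.mem_univ x) (if_neg hx)
    rw [this]
    ring

/-- The activity of a block: the sum of its small and large field activities. -/
def blockActivity (C : Matrix (L × Fin N) (L × Fin N) ℂ) (r : ℝ) (R : EReal)
    (b : (X : Finset L) → (X → Spin N) → (Pairs X → ℝ) → ℂ) (X : Finset L) : ℂ :=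
  ∑ Q ∈ X.powerset, ∑ T ∈ spanningTrees X,
    treeIntegral (restrictCov C X) r R {x : X | (x : L) ∈ Q} (b X) T

/-- Characteristic functions do not depend on the couplings, so they may enter under the integral
over the tree parameters and produce the integrands of the activities. -/
theorem chiR_mul_treeSum (hrR : (r : EReal) ≤ R) (X : Finset L) (φ : X → Spin N) :
    chiR R φ * treeSum C b X φ = ∑ Q ∈ X.powerset, ∑ T ∈ spanningTrees X,
      ∫ u in Set.Icc (0 : T → ℝ) 1, ∑ E ∈ T.powerset,
        clusterIntegrand (restrictCov C X) r R {x : X | (x : L) ∈ Q} (b X) T E u φ := by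
  rw [← sum_chiQ hrR X φ, treeSum, Finset.sum_mul]
  refine Finset.sum_congr rfl fun Q _ => ?_
  rw [Finset.mul_sum]
  refine Finset.sum_congr rfl fun T _ => ?_
  rw [← integral_const_mul]
  congr 1
  funext u
  rw [treeTerm, Finset.mul_sum]
  refine Finset.sum_congr rfl fun E _ => ?_
  rw [clusterIntegrand]
  ring

variable (hint : ∀ (X : Finset L) (Q : Set X), ∀ T ∈ spanningTrees X, ∀ F : Finset (Pairs X),
  Integrable (fun p : (T → ℝ) × (X → Spin N) =>
    clusterIntegrand (restrictCov C X) r R Q (b X) T F p.1 p.2)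
    ((volume.restrict (Set.Icc (0 : T → ℝ) 1)).prod volume))

include hint in
theorem integrable_chiR_mul_treeSum (hrR : (r : EReal) ≤ R) (X : Finset L) :
    Integrable fun φ : X → Spin N => chiR R φ * treeSum C b X φ := by
  simp_rw [chiR_mul_treeSum hrR]
  refine integrable_finsetSum _ fun Q _ => integrable_finsetSum _ fun T hT => ?_
  have h : Integrable (fun p : (T → ℝ) × (X → Spin N) => ∑ E ∈ T.powerset,
      clusterIntegrand (restrictCov C X) r R {x : X | (x : L) ∈ Q} (b X) T E p.1 p.2)
      ((volume.restrict (Set.Icc (0 : T → ℝ) 1)).prod volume) :=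
    integrable_finsetSum _ fun E _ => hint X _ T hT E
  exact h.integral_prod_right

include hint in
-- Fubini: the pointwise expansion integrates over tree parameters first, the activities over fields
-- first. Joint integrability of each splitting allows the exchange.
theorem integral_chiR_mul_treeSum (hrR : (r : EReal) ≤ R) (X : Finset L) :
    ∫ φ : X → Spin N, chiR R φ * treeSum C b X φ = blockActivity C r R b X := by
  have h : ∀ (Q : Finset L), ∀ T ∈ spanningTrees X,
      Integrable (fun p : (T → ℝ) × (X → Spin N) => ∑ E ∈ T.powerset,
        clusterIntegrand (restrictCov C X) r R {x : X | (x : L) ∈ Q} (b X) T E p.1 p.2)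
        ((volume.restrict (Set.Icc (0 : T → ℝ) 1)).prod volume) := fun Q T hT =>
    integrable_finsetSum _ fun E _ => hint X _ T hT E
  simp_rw [chiR_mul_treeSum hrR]
  rw [integral_finsetSum _ fun Q _ => integrable_finsetSum _ fun T hT =>
    (h Q T hT).integral_prod_right, blockActivity]
  refine Finset.sum_congr rfl fun Q _ => ?_
  rw [integral_finsetSum _ fun T hT => (h Q T hT).integral_prod_right]
  refine Finset.sum_congr rfl fun T hT => ?_
  rw [← integral_prod_symm _ (h Q T hT), integral_finsetSum _ fun E _ => hint X _ T hT E,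
    treeIntegral]
  refine Finset.sum_congr rfl fun E _ => ?_
  rw [integral_prod _ (hint X _ T hT E)]

include hint in
theorem integrable_prod_treeSum (hrR : (r : EReal) ≤ R)
    (hπ : π ∈ partitions (Finset.univ : Finset L)) : Integrable fun φ : L → Spin N =>
      ∏ X ∈ π, (chiR R (restrictField X φ) * treeSum C b X (restrictField X φ)) := by
  have h := integrable_prod_blocks (blockEquiv hπ) (volume : Measure (Spin N))
    fun X : π => integrable_chiR_mul_treeSum hint hrR (X : Finset L)
  refine Integrable.congr h (Filter.Eventually.of_forall fun φ => ?_)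
  exact Finset.prod_coe_sort π fun X =>
    chiR R (restrictField X φ) * treeSum C b X (restrictField X φ)

include hint in
theorem integral_prod_treeSum (hrR : (r : EReal) ≤ R)
    (hπ : π ∈ partitions (Finset.univ : Finset L)) : ∫ φ : L → Spin N,
      ∏ X ∈ π, (chiR R (restrictField X φ) * treeSum C b X (restrictField X φ)) =
        ∏ X ∈ π, blockActivity C r R b X := by
  have h := integral_prod_blocks (blockEquiv hπ) (volume : Measure (Spin N))
    fun X : π => fun φ : X.1 → Spin N => chiR R φ * treeSum C b X φ
  rw [← Finset.prod_coe_sort π fun X => blockActivity C r R b X,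
    ← Finset.prod_congr rfl fun X : π => fun _ => integral_chiR_mul_treeSum hint hrR (X : Finset L)]
  refine Eq.trans ?_ h
  refine integral_congr_ae (Filter.Eventually.of_forall fun φ => ?_)
  exact (Finset.prod_coe_sort π fun X =>
    chiR R (restrictField X φ) * treeSum C b X (restrictField X φ)).symm

end Resummation

/-! ### Identification of the block activities -/

section Activities

variable {L : Type*} [Fintype L] [DecidableEq L] {N : ℕ}

theorem blockActivity_boltzmann (C : Matrix (L × Fin N) (L × Fin N) ℂ) (r : ℝ) (R : EReal)
    (V₁ : (X : Finset L) → (X → Spin N) → (Pairs X → ℝ) → (X → Spin N) → ℂ)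
    (V₂ : (X : Finset L) → X → (X → Spin N) → (Pairs X → ℝ) → (X → Spin N) → ℂ)
    (J : L → Spin N) (X : Finset L) :
    blockActivity C r R (boltzmann V₁ V₂ J) X = smallActivity C r R V₁ V₂ J X +
      ∑ Q ∈ X.powerset.filter (fun Q => Q.Nonempty), largeActivity C r R V₁ V₂ J X Q := by
  have h0 : {x : X | (x : L) ∈ (∅ : Finset L)} = ∅ := by
    ext x
    simp
  rw [blockActivity, ← Finset.sum_filter_not_add_sum_filter X.powerset fun Q => Q.Nonempty]
  congr 1
  have : X.powerset.filter (fun Q => ¬ Q.Nonempty) = {∅} := by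
    ext Q
    simp only [Finset.mem_filter, Finset.mem_powerset, Finset.not_nonempty_iff_eq_empty,
      Finset.mem_singleton, and_iff_right_iff_imp]
    rintro rfl
    exact Finset.empty_subset X
  rw [this, Finset.sum_singleton, h0, smallActivity]

end Activities

end

theorem mainTheorem4 {L : Type*} [Fintype L] [DecidableEq L] (N : ℕ)
    -- the covariance
    (C : Matrix (L × Fin N) (L × Fin N) ℂ) (hsymm : C.IsSymm) (hnormal : IsStarNormal C)
    (hpos : ((1 / 2 : ℂ) • (C⁻¹ + C⁻¹.conjTranspose)).PosDef)
    -- the thresholds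
    (r : ℝ) (R : EReal) (hr : 0 < r) (hrR : (r : EReal) ≤ R)
    -- the interpolated interactions, their local parts and the source field
    (V₁ V₂ : (L → Spin N) → (Pairs L → ℝ) → (L → Spin N) → ℂ)
    (V₁loc : (X : Finset L) → (X → Spin N) → (Pairs X → ℝ) → (X → Spin N) → ℂ)
    (V₂loc : (X : Finset L) → X → (X → Spin N) → (Pairs X → ℝ) → (X → Spin N) → ℂ)
    (J : L → Spin N)
    (hV₁ : ∀ φ : L → Spin N, (∀ x, ((‖φ x‖ : ℝ) : EReal) ≤ R) →
      ∀ s ∈ Set.Icc (0 : Pairs L → ℝ) 1, V₁ φ s J = ∑ X ∈ couplingParts s,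
        V₁loc X (restrictField X φ) (restrictCoupling X s) (restrictField X J))
    (hV₂ : ∀ φ : L → Spin N, (∀ x, ((‖φ x‖ : ℝ) : EReal) ≤ R) →
      ∀ s ∈ Set.Icc (0 : Pairs L → ℝ) 1, V₂ φ s J = ∑ X ∈ couplingParts s, ∑ x : X,
        V₂loc X x (restrictField X φ) (restrictCoupling X s) (restrictField X J))
    -- smoothness of the interactions
    (hsmooth₁ : ContDiffOn ℝ ∞ (fun p : (L → Spin N) × (Pairs L → ℝ) => V₁ p.1 p.2 J)
      ({φ | ∀ x, ((‖φ x‖ : ℝ) : EReal) ≤ R} ×ˢ Set.Icc 0 1))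
    (hsmooth₂ : ContDiffOn ℝ ∞ (fun p : (L → Spin N) × (Pairs L → ℝ) => V₂ p.1 p.2 J)
      ({φ | ∀ x, ((‖φ x‖ : ℝ) : EReal) ≤ R} ×ˢ Set.Icc 0 1))
    -- only if the fields are unbounded: stability along the forest interpolations
    (hgrowth : R = ⊤ → ∀ (k : ℕ) (ε : ℝ), 0 < ε → ∃ K : ℝ, ∀ φ : L → Spin N,
      ∀ F : Finset (Pairs L), (edgeGraph F).IsAcyclic → ∀ u ∈ Set.Icc (0 : F → ℝ) 1,
        ‖iteratedFDerivWithin ℝ k (fun s => Complex.exp (V₁ φ s J + V₂ φ s J))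
          (Set.Icc 0 1) (forestInterp F u)‖ ≤ K * Real.exp (ε * ‖φ‖ ^ 2)) :
    -- all integrals converge absolutely
    Integrable (fun φ : L → Spin N =>
      gaussDensity C φ * (chiR R φ * Complex.exp (V₁ φ 1 J + V₂ φ 1 J))) ∧
    (∀ X Q : Finset L, Q ⊆ X → ∀ T ∈ spanningTrees X, ∀ F ⊆ T,
      Integrable (fun p : (T → ℝ) × (X → Spin N) =>
        clusterIntegrand (restrictCov C X) r R {x : X | (x : L) ∈ Q}
          (boltzmann V₁loc V₂loc J X) T F p.1 p.2)
        ((volume.restrict (Set.Icc (0 : T → ℝ) 1)).prod volume)) ∧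
    -- the partition function is that of the polymer gas with activities `A_s` and `B`
    partitionFunction C R (fun φ => V₁ φ 1 J + V₂ φ 1 J) =
      polymerZ (smallActivity C r R V₁loc V₂loc J) (largeActivity C r R V₁loc V₂loc J) ∧
    -- its logarithm is given by the modified Mayer series: exactly if the series converge
    -- absolutely, and as an expansion in the activities in any case
    ((∀ x, smallActivity C r R V₁loc V₂loc J {x} ≠ 0) →
      (AbsConverges (smallActivity C r R V₁loc V₂loc J) (largeActivity C r R V₁loc V₂loc J) →
        Complex.exp (logSeries (smallActivity C r R V₁loc V₂loc J)
            (largeActivity C r R V₁loc V₂loc J)) =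
          partitionFunction C R (fun φ => V₁ φ 1 J + V₂ φ 1 J)) ∧
      (∀ᶠ t in 𝓝 (0 : ℂ),
        AbsConverges (scaleA t (smallActivity C r R V₁loc V₂loc J))
          (scaleB t (largeActivity C r R V₁loc V₂loc J)) ∧
        Complex.exp (logSeries (scaleA t (smallActivity C r R V₁loc V₂loc J))
            (scaleB t (largeActivity C r R V₁loc V₂loc J))) =
          polymerZ (scaleA t (smallActivity C r R V₁loc V₂loc J))
            (scaleB t (largeActivity C r R V₁loc V₂loc J)))) := by
  have hacc : Accretive C := accretive_of_inv hpos
  -- The analysis is applied to the exponential, on which the growth condition is imposed and which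
  -- factorizes because V₁ and V₂ are sums over the parts of s.
  let f : (L → Spin N) × (Pairs L → ℝ) → ℂ := fun p =>
    Complex.exp (V₁ p.1 p.2 J + V₂ p.1 p.2 J)
  have hf : ContDiffOn ℝ ∞ f (fieldBox L N R ×ˢ Set.Icc 0 1) := (hsmooth₁.add hsmooth₂).cexp
  have hb : ∀ π ∈ partitions (Finset.univ : Finset L), ∀ φ ∈ fieldBox L N R,
      ∀ s ∈ blockCouplings π, f (φ, s) = ∏ X ∈ π,
        boltzmann V₁loc V₂loc J X (restrictField X φ) (restrictCoupling X s) := by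
    intro π hπ φ hφ s hs
    change Complex.exp (V₁ φ s J + V₂ φ s J) = _
    rw [hV₁ φ hφ s (blockCouplings_subset hs), hV₂ φ hφ s (blockCouplings_subset hs),
      couplingParts_of_blockCouplings hπ hs, ← Finset.sum_add_distrib, Complex.exp_sum]
    rfl
  -- Boltzmann factors never vanish, which permits the division by the factors of the isolated
  -- points.
  have hint := fun (X : Finset L) (Q : Set X) (T : Finset (Pairs X)) (hT : T ∈ spanningTrees X)
    (F : Finset (Pairs X)) => integrable_clusterIntegrand hsymm hacc hr hrR hf hgrowth hb
      (fun X φ s => Complex.exp_ne_zero _) Q hT F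
  have hsum : ∀ φ : L → Spin N,
      gaussDensity C φ * (chiR R φ * Complex.exp (V₁ φ 1 J + V₂ φ 1 J)) =
        ∑ π ∈ partitions (Finset.univ : Finset L), ∏ X ∈ π, (chiR R (restrictField X φ) *
          treeSum C (boltzmann V₁loc V₂loc J) X (restrictField X φ)) :=
    integrand_eq_sum hsymm hacc hr hrR hf hb
  have hZ : partitionFunction C R (fun φ => V₁ φ 1 J + V₂ φ 1 J) =
      polymerZ (smallActivity C r R V₁loc V₂loc J) (largeActivity C r R V₁loc V₂loc J) := by
    rw [partitionFunction, integral_congr_ae (Filter.Eventually.of_forall hsum),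
      integral_finsetSum _ fun π hπ => integrable_prod_treeSum hint hrR hπ,
      polymerZ_eq_sum_partitions]
    refine Finset.sum_congr rfl fun π hπ => ?_
    rw [integral_prod_treeSum hint hrR hπ]
    exact Finset.prod_congr rfl fun X _ => blockActivity_boltzmann C r R V₁loc V₂loc J X
  refine ⟨?_, fun X Q _ T hT F _ => hint X _ T hT F, hZ, fun hA => ⟨fun h => ?_, ?_⟩⟩
  · simp_rw [hsum]
    exact integrable_finsetSum _ fun π hπ => integrable_prod_treeSum hint hrR hπ
  · rw [hZ]
    exact exp_logSeries hA h
  · exact eventually_exp_logSeries _ _ hA
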